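/- **Kreweras walks.** Let $\mathcal{K}$ be the set of words $w\in\{a,b,c\}^*$ (possibly empty) such that no prefix contains more $c$'s than $a$'s or more $c$'s than $b$'s; with $a=(1,0)$, $b=(0,1)$, $c=(-1,-1)$ these are the lattice walks from the origin that stay in $\mathbb{N}^2$. In $w=w_1\cdots w_n$, an $a$-step $w_i$ and a $c$-step $w_j$ are *matching* if $i<j$, the factor $w_i\cdots w_j$ has as many $a$'s as $c$'s, and $w_i\cdots w_k$ has more $a$'s than $c$'s for all $i\le k<j$; matching of $b$-steps with $c$-steps is defined in the same way. An $a$- or $b$-step without matching $c$-step is *unmatched*. A $c$-step with matching $a$-step $w_i$ and matching $b$-step $w_j$ is *of type $a$* if $i<j$ and *of type $b$* otherwise. **Maps.** Maps are connected planar maps on the sphere, up to orientation-preserving homeomorphism, rooted at an oriented edge; the root-face is the face at the right of the root-edge. Vertices and edges incident to the root-face are *outer*, the others, and the non-root faces, are *inner*. Let $\mathcal{T}$ be the set of rooted maps without self-loops in which every inner face has degree $3$ and the boundary of the root-face is simple, including the map $M_0$ with one edge and two vertices. A site-percolation configuration $\sigma$ on $M$ colors each vertex white or black. Let $\mathcal{T}_P$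 be the set of pairs $(M,\sigma)$, up to isomorphism, such that $M\in\mathcal{T}$; the root-edge goes from a white to a black vertex and no other outer edge goes from white to black when the boundary is followed with the root-face at its right; and the percolation path that starts at the root-edge (crossing each bicolor inner triangle it meets through its two bicolor edges, until it returns to the root-face) goes through all inner triangles incident to an outer edge. The last edge on this path is the *top-edge* (the root-edge itself for $M_0$); its white and black endpoints are the *top-left* vertex $v_\ell$ and the *top-right* vertex $v_r$. *Left* (resp. *right*) edges are the outer edges with two white (resp. black) endpoints, and *in-edges* are the edges that are neither left, right nor top edges. **The mapping $\Phi$.** Let $\Phi(w_1\cdots w_n)=\phi_{w_n}\circ\cdots\circ\phi_{w_1}(M_0,\sigma_0)$, where $\sigma_0$ makes the root-edge of $M_0$ go from white to black, and: - $\phi_a$ (resp. $\phi_b$) glues to the top-edge, in the root-face, a triangle whose third vertex is new and white (resp. black). The new top-edge is the other bicolor edge of this triangle. - $\phi_c$ applies if there are both a left edge and a right edge. Let $e$ be the top-edge, $e_\ell$ the left edge incident to $v_\ell$, $e_r$ the right edge incident to $v_r$, and $t_\ell,t_r$ the inner triangles incident to $e_\ell,e_r$. One of these, $t$, is the last triangle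 on the percolation path (from the root-edge to the top-edge) that is incident to a left or right edge. If $t=t_r$, recolor $v_r$ in white and glue $e$ and $e_\ell$ together, so that $v_\ell$ becomes an inner vertex. If $t=t_\ell$, recolor $v_\ell$ in black and glue $e$ and $e_r$ together, so that $v_r$ becomes an inner vertex. **The mappings $\eta$.** For $w=w_1\cdots w_n\in\mathcal{K}$ and $(M,\sigma)=\Phi(w)$, let $\eta_{\mathrm e}(i)$ be the edge of $M$ that arises from the top-edge before the $i$-th step, which becomes an in-edge at that step. Let $\eta_{\mathrm{vf}}(i)$ be the inner triangle of $M$ added by the $i$-th step if $w_i\in\{a,b\}$, and the vertex of $M$ that becomes inner at the $i$-th step if $w_i=c$. For an unmatched $a$-step (resp. $b$-step) $w_i$, let $\eta_{\mathrm{lr}}(i)$ be the left (resp. right) edge of $(M,\sigma)$ incident to the triangle $\eta_{\mathrm{vf}}(i)$. **Theorem.** For $w\in\mathcal{K}$ all the steps of the construction of $\Phi(w)$ are defined, and $\Phi$ is a bijection from $\mathcal{K}$ onto $\mathcal{T}_P$. Moreover, for every $w\in\mathcal{K}$, with $(M,\sigma)=\Phi(w)$: 1. $\eta_{\mathrm e}$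 is a bijection from the set of steps of $w$ onto the set of in-edges of $(M,\sigma)$. 2. $\eta_{\mathrm{vf}}$ restricts to a bijection from the $a$- and $b$-steps of $w$ onto the inner triangles of $M$, to a bijection from the $c$-steps of type $a$ onto the white inner vertices, and to a bijection from the $c$-steps of type $b$ onto the black inner vertices of $(M,\sigma)$. 3. For each unmatched $a$-step (resp. $b$-step) there is exactly one edge as in the definition of $\eta_{\mathrm{lr}}$, and $\eta_{\mathrm{lr}}$ is a bijection from the unmatched $a$-steps onto the left edges, and from the unmatched $b$-steps onto the right edges of $(M,\sigma)$. -/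

import Mathlib

/-!
Rooted site-percolated planar maps are encoded by the classical combinatorial description of maps on
oriented surfaces.  A dart is an edge together with one of its two orientations.
-/

namespace KrewerasMap

/-! ### Kreweras walks -/

/-- The letters: `a = (1,0)`, `b = (0,1)`, `c = (-1,-1)`. -/
inductive Letter
  | a
  | b
  | c
  deriving DecidableEq

/-- Words all of whose prefixes contain no more `c` than `a`, and no more `c` than `b`: the
Kreweras walks that stay in the first quadrant. -/
def quadrantWalks : Set (List Letter) :=
  {w | ∀ u, u <+: w → u.count Letter.c ≤ u.count Letter.a ∧ u.count Letter.c ≤ u.count Letter.b}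

/-- The factor of `w` from position `i` to position `k`, both included (positions start at `0`). -/
def factor (w : List Letter) (i k : ℕ) : List Letter :=
  (w.take (k + 1)).drop i

/-- The step `i`, which is an `s`-step, and the step `j`, which is a `c`-step, are matching. -/
def Matching (s : Letter) (w : List Letter) (i j : ℕ) : Prop :=
  w[i]? = some s ∧ w[j]? = some Letter.c ∧ i < j ∧
    (factor w i j).count s = (factor w i j).count Letter.c ∧
    ∀ k, i ≤ k → k < j → (factor w i k).count Letter.c < (factor w i k).count s

/-- The `s`-steps of `w` (for `s = a` or `s = b`) that have no matching `c`-step. -/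
def unmatchedSteps (s : Letter) (w : List Letter) : Set ℕ :=
  {i | w[i]? = some s ∧ ¬ ∃ j, Matching s w i j}

/-- The `c`-steps of type `a`: the matching `a`-step comes before the matching `b`-step. -/
def typeASteps (w : List Letter) : Set ℕ :=
  {k | ∃ i j, Matching Letter.a w i k ∧ Matching Letter.b w j k ∧ i < j}

/-- The `c`-steps of type `b`: the matching `a`-step does not come before the matching `b`-step. -/
def typeBSteps (w : List Letter) : Set ℕ :=
  {k | ∃ i j, Matching Letter.a w i k ∧ Matching Letter.b w j k ∧ ¬ i < j}

/-! ### Rooted site-percolated maps -/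

/-- The two colors of a site-percolation configuration. -/
inductive Color
  | white
  | black
  deriving DecidableEq

/-- A rooted map on an oriented closed surface (not yet connected or planar) with a coloring of its
vertices, given by its darts.  The dart `inv d` is the dart `d` reversed, and `next d` is the dart that
follows `d` along the boundary of the face at the right of `d`.  Hence the faces are the cycles of
`next`, a dart belonging to the face at its right; the edges are the cycles of `inv`; and
`next (inv d)` has the same origin as `d`, so that the vertices are the cycles of `next * inv`, a dart
belonging to its origin.  The coloring is recorded as the color of the origin of each dart. -/
structure PercMap where
  Dart : Type
  finite_dart : Finite Dart
  inv : Equiv.Perm Dart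
  inv_inv : ∀ d, inv (inv d) = d
  inv_ne : ∀ d, inv d ≠ d
  next : Equiv.Perm Dart
  root : Dart
  color : Dart → Color
  color_next_inv : ∀ d, color (next (inv d)) = color d

namespace PercMap

instance (M : PercMap) : Finite M.Dart := M.finite_dart

/-- Isomorphism of rooted site-percolated maps (orientation preserving, respecting root and colors). -/
structure Iso (M N : PercMap) where
  equiv : M.Dart ≃ N.Dart
  map_inv : ∀ d, equiv (M.inv d) = N.inv (equiv d)
  map_next : ∀ d, equiv (M.next d) = N.next (equiv d)
  map_root : equiv M.root = N.root
  map_color : ∀ d, N.color (equiv d) = M.color d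

/-- Being isomorphic. -/
instance isoSetoid : Setoid PercMap where
  r M N := Nonempty (Iso M N)
  iseqv :=
    { refl := fun M => ⟨⟨Equiv.refl _, fun _ => rfl, fun _ => rfl, rfl, fun _ => rfl⟩⟩
      symm := by
        rintro M N ⟨e⟩
        refine ⟨⟨e.equiv.symm, fun d => ?_, fun d => ?_, ?_, fun d => ?_⟩⟩
        · rw [Equiv.symm_apply_eq, e.map_inv, Equiv.apply_symm_apply]
        · rw [Equiv.symm_apply_eq, e.map_next, Equiv.apply_symm_apply]
        · rw [Equiv.symm_apply_eq, e.map_root]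
        · rw [← e.map_color, Equiv.apply_symm_apply]
      trans := by
        rintro M N P ⟨e⟩ ⟨f⟩
        exact ⟨⟨e.equiv.trans f.equiv, fun d => by simp [e.map_inv, f.map_inv],
          fun d => by simp [e.map_next, f.map_next], by simp [e.map_root, f.map_root],
          fun d => by simp [e.map_color, f.map_color]⟩⟩ }

variable (M : PercMap)

/-- Vertices. -/
abbrev Vertex : Type := Quotient (Equiv.Perm.SameCycle.setoid (M.next * M.inv))

/-- Edges. -/
abbrev Edge : Type := Quotient (Equiv.Perm.SameCycle.setoid M.inv)

/-- Faces. -/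
abbrev Face : Type := Quotient (Equiv.Perm.SameCycle.setoid M.next)

/-- The origin of a dart. -/
def origin (d : M.Dart) : M.Vertex := Quotient.mk _ d

/-- The edge underlying a dart. -/
def edge (d : M.Dart) : M.Edge := Quotient.mk _ d

/-- The face at the right of a dart. -/
def face (d : M.Dart) : M.Face := Quotient.mk _ d

/-- The root-face. -/
def rootFace : M.Face := M.face M.root

/-- The dart has the root-face at its right. -/
def Outer (d : M.Dart) : Prop := M.face d = M.rootFace

/-- The map is a connected map on the sphere: the darts are all linked by `inv` and `next`, and the
Euler characteristic is `2`. -/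
def Planar : Prop :=
  (∀ d d' : M.Dart, ∃ g ∈ Subgroup.closure {M.inv, M.next}, g d = d') ∧
    (Nat.card M.Vertex : ℤ) - Nat.card M.Edge + Nat.card M.Face = 2

/-- Every inner face has degree `3`. -/
def NearTriangulation : Prop :=
  ∀ f : M.Face, f ≠ M.rootFace → Nat.card {d // M.face d = f} = 3

/-- No edge is a self-loop. -/
def Loopless : Prop :=
  ∀ d, M.origin d ≠ M.origin (M.inv d)

/-- The boundary of the root-face passes at most once through each vertex. -/
def SimpleBoundary : Prop :=
  ∀ d d', M.Outer d → M.Outer d' → M.origin d = M.origin d' → d = d'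

/-- Rooted loopless triangulations with a simple boundary (the map with one edge and two vertices is
one of them). -/
def LooplessTriangulation : Prop :=
  M.Planar ∧ M.NearTriangulation ∧ M.Loopless ∧ M.SimpleBoundary

/-- The dart goes from a vertex of color `x` to a vertex of color `y`. -/
def Goes (x y : Color) (d : M.Dart) : Prop := M.color d = x ∧ M.color (M.inv d) = y

/-- The root-interface condition: the root-edge goes from white to black, and it is the only outer edge
that does so when the boundary is traversed with the root-face at the right. -/
def RootInterface : Prop :=
  M.Goes .white .black M.root ∧ ∀ d, M.Outer d → M.Goes .white .black d → d = M.root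

/-- One step of the percolation path that starts at the root-edge.  The bicolor edges that the path
crosses are oriented from white to black, like the root-edge.  After crossing the edge of `d` the path
is in the face at the left of `d`; if this is an inner face, then the path leaves it through the
edge of `d'`. -/
def PathStep (d d' : M.Dart) : Prop :=
  ¬ M.Outer (M.inv d) ∧ M.face d' = M.face (M.inv d) ∧ M.Goes .white .black d'

/-- The percolation path that starts at the root-edge crosses the edge of `d`
(from the right to the left of `d`). -/
def OnPath (d : M.Dart) : Prop := Relation.ReflTransGen M.PathStep M.root d

/-- Crossing the edge of `d`, the percolation path enters the inner face `f`. -/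
def PathEnters (d : M.Dart) (f : M.Face) : Prop :=
  M.OnPath d ∧ f ≠ M.rootFace ∧ M.face (M.inv d) = f

/-- The percolation path goes through every inner triangle incident to an outer edge. -/
def PathVisitsBoundary : Prop :=
  ∀ d, M.Outer d → ¬ M.Outer (M.inv d) → ∃ z, M.PathEnters z (M.face (M.inv d))

/-- Membership (of a representative) in the set `T_P`. -/
def IsTP : Prop :=
  M.LooplessTriangulation ∧ M.RootInterface ∧ M.PathVisitsBoundary

/-- The outer dart of a left edge (unicolor white outer edge). -/
def IsLeft (d : M.Dart) : Prop := M.Outer d ∧ M.Goes .white .white d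

/-- The outer dart of a right edge (unicolor black outer edge). -/
def IsRight (d : M.Dart) : Prop := M.Outer d ∧ M.Goes .black .black d

/-- The outer dart of the top-edge: the other bicolor outer edge. It goes from the top-right
vertex (black) to the top-left vertex (white).  For the map with one edge and two vertices this is
the root-edge reversed. -/
def IsTop (d : M.Dart) : Prop := M.Outer d ∧ M.Goes .black .white d

/-- The set of left edges. -/
def leftEdges : Set M.Edge := {e | ∃ d, M.IsLeft d ∧ M.edge d = e}

/-- The set of right edges. -/
def rightEdges : Set M.Edge := {e | ∃ d, M.IsRight d ∧ M.edge d = e}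

/-- The set whose only element, for a map in `T_P`, is the top-edge. -/
def topEdges : Set M.Edge := {e | ∃ d, M.IsTop d ∧ M.edge d = e}

/-- In-edges: the edges that are neither a left, right or top edge. -/
def inEdges : Set M.Edge := {e | e ∉ M.leftEdges ∧ e ∉ M.rightEdges ∧ e ∉ M.topEdges}

/-- Inner faces. -/
def innerFaces : Set M.Face := {f | f ≠ M.rootFace}

/-- Inner vertices (not incident to the root-face) of a given color. -/
def innerVertices (x : Color) : Set M.Vertex :=
  {v | (∀ d, M.Outer d → M.origin d ≠ v) ∧ ∀ d, M.origin d = v → M.color d = x}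

/-- The face `f` and the edge `e` are incident. -/
def Incident (f : M.Face) (e : M.Edge) : Prop := ∃ d, M.face d = f ∧ M.edge d = e

/-- `f` is the last face on the percolation path that is incident to a left or right edge: the path
enters `f`, and none of the faces that it enters afterwards is incident to such an edge. -/
def IsLastFace (f : M.Face) : Prop :=
  (∃ e, M.Incident f e ∧ (e ∈ M.leftEdges ∨ e ∈ M.rightEdges)) ∧
    ∃ z, M.PathEnters z f ∧
      ∀ z' f', Relation.TransGen M.PathStep z z' → M.PathEnters z' f' →
        ¬ ∃ e, M.Incident f' e ∧ (e ∈ M.leftEdges ∨ e ∈ M.rightEdges)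

/-! ### The percolated map with a single edge -/

/-- The single edge, whose root dart `false` goes from a white vertex to a black vertex. -/
def single : PercMap where
  Dart := Bool
  finite_dart := inferInstance
  inv := Equiv.boolNot
  inv_inv := by decide
  inv_ne := by decide
  next := Equiv.boolNot
  root := false
  color d := if d then .black else .white
  color_next_inv := by decide

/-! ### Gluing a triangle -/

/-- The four darts created when a triangle is glued to the edge of an outer dart `t` going from `p` to `q`
(in `T_P`: the top-right and the top-left vertex).  With `x` the new vertex of the triangle,
`outRight` goes from `p` to `x`, `outLeft` goes from `x` to `q`, and `inRight`, `inLeft` are these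
darts reversed. -/
inductive NewDart
  | outRight
  | outLeft
  | inRight
  | inLeft
  deriving DecidableEq

instance : Finite NewDart :=
  Finite.of_surjective
    (fun i : Fin 4 => ([.outRight, .outLeft, .inRight, .inLeft] : List NewDart).get i)
    (fun d => by cases d; exacts [⟨0, rfl⟩, ⟨1, rfl⟩, ⟨2, rfl⟩, ⟨3, rfl⟩])

variable {M}

theorem color_next (d : M.Dart) : M.color (M.next d) = M.color (M.inv d) := by
  have := M.color_next_inv (M.inv d)
  rwa [M.inv_inv] at this

theorem IsTop.next_ne {t : M.Dart} (h : M.IsTop t) : M.next t ≠ t := by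
  intro e
  have h1 := color_next t
  rw [e, h.2.1, h.2.2] at h1
  cases h1

variable (M)

/-- Reversal of darts after a triangle has been glued. -/
def attachInv : M.Dart ⊕ NewDart → M.Dart ⊕ NewDart
  | .inl d => .inl (M.inv d)
  | .inr .outRight => .inr .inRight
  | .inr .outLeft => .inr .inLeft
  | .inr .inRight => .inr .outRight
  | .inr .inLeft => .inr .outLeft

open Classical in
/-- The successor along faces after a triangle has been glued to the edge of `t`: the
new triangle is `t`, `inLeft`, `inRight`, and on the root-face `t` is replaced by `outRight`, `outLeft`. -/
noncomputable def attachNext (t : M.Dart) : M.Dart ⊕ NewDart → M.Dart ⊕ NewDart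
  | .inl d =>
      if d = t then .inr .inLeft else if M.next d = t then .inr .outRight else .inl (M.next d)
  | .inr .outRight => .inr .outLeft
  | .inr .outLeft => .inl (M.next t)
  | .inr .inLeft => .inr .inRight
  | .inr .inRight => .inl t

/-- The color of the origin of each dart after a triangle with a new vertex of color `x` has been
glued to the edge of `t`. -/
def attachColor (t : M.Dart) (x : Color) : M.Dart ⊕ NewDart → Color
  | .inl d => M.color d
  | .inr .outRight => M.color t
  | .inr .outLeft => x
  | .inr .inRight => x
  | .inr .inLeft => M.color (M.inv t)

theorem attachNext_injective (t : M.Dart) (ht : M.next t ≠ t) :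
    Function.Injective (M.attachNext t) := by
  have key : ∀ d d' : M.Dart, M.next d = M.next d' → d = d' := fun _ _ h => M.next.injective h
  rintro (d | d) (d' | d') h
  · simp only [attachNext] at h
    grind
  · cases d' <;> simp only [attachNext] at h <;> grind
  · cases d <;> simp only [attachNext] at h <;> grind
  · cases d <;> cases d' <;> simp only [attachNext] at h <;> grind

theorem attachInv_attachInv (y : M.Dart ⊕ NewDart) : M.attachInv (M.attachInv y) = y := by
  rcases y with d | d
  · exact congrArg Sum.inl (M.inv_inv d)
  · cases d <;> rfl

theorem attachInv_ne (y : M.Dart ⊕ NewDart) : M.attachInv y ≠ y := by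
  rcases y with d | d
  · exact fun h => M.inv_ne d (Sum.inl_injective h)
  · cases d <;> simp [attachInv]

theorem attachColor_attachNext (t : M.Dart) (x : Color) (y : M.Dart ⊕ NewDart) :
    M.attachColor t x (M.attachNext t (M.attachInv y)) = M.attachColor t x y := by
  rcases y with d | d
  · have h1 := M.color_next_inv d
    have h2 := M.inv_inv d
    simp only [attachInv, attachNext]
    split_ifs with h3 h4
    · simp only [attachColor]
      rw [← h3, h2]
    · simp only [attachColor]
      rw [← h4, h1]
    · simpa only [attachColor] using h1
  · cases d <;> simp [attachInv, attachNext, attachColor, color_next]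

/-- Glue a triangle, whose third vertex is new and has color `x`, to the edge of `t`, in the face at the
right of `t`. -/
noncomputable def attach (t : M.Dart) (ht : M.next t ≠ t) (x : Color) : PercMap where
  Dart := M.Dart ⊕ NewDart
  finite_dart := inferInstance
  inv := Function.Involutive.toPerm M.attachInv M.attachInv_attachInv
  inv_inv := M.attachInv_attachInv
  inv_ne := M.attachInv_ne
  next := Equiv.ofBijective (M.attachNext t)
    (Finite.injective_iff_bijective.1 (M.attachNext_injective t ht))
  root := .inl M.root
  color := M.attachColor t x
  color_next_inv := M.attachColor_attachNext t x

/-! ### Recoloring a vertex, and gluing two consecutive edges of the boundary -/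

open Classical in
/-- The coloring of `M` modified by giving the color `x` to the origin of `v`. -/
noncomputable def recolor (v : M.Dart) (x : Color) (d : M.Dart) : Color :=
  if M.origin d = M.origin v then x else M.color d

theorem origin_next_inv (d : M.Dart) : M.origin (M.next (M.inv d)) = M.origin d :=
  Quotient.sound (s := Equiv.Perm.SameCycle.setoid (M.next * M.inv))
    (show (M.next * M.inv).SameCycle ((M.next * M.inv) d) d from
      Equiv.Perm.sameCycle_apply_left.2 (Equiv.Perm.SameCycle.refl _ _))

theorem recolor_next_inv (v : M.Dart) (x : Color) (d : M.Dart) :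
    M.recolor v x (M.next (M.inv d)) = M.recolor v x d := by
  unfold recolor
  rw [M.origin_next_inv d, M.color_next_inv d]

/-- The edges of `d` and `next d` are distinct, the dart `d` is on a face of degree at least `3`, and the
root is neither `d` nor `next d`. -/
structure CanZip (d : M.Dart) : Prop where
  next_ne : M.next d ≠ d
  next_next_ne : M.next (M.next d) ≠ d
  inv_ne_next : M.inv d ≠ M.next d
  root_ne : M.root ≠ d
  root_ne_next : M.root ≠ M.next d

/-- The darts that remain when the edges of `d` and `next d` are glued together. -/
abbrev ZipDart (d : M.Dart) : Type := {y : M.Dart // y ≠ d ∧ y ≠ M.next d}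

open Classical in
/-- The dart `y` after gluing: `d` becomes `inv (next d)`, and `next d` becomes `inv d`. -/
noncomputable def zipDart (d : M.Dart) (h : M.CanZip d) (y : M.Dart) : M.ZipDart d :=
  if h1 : y = d then
    ⟨M.inv (M.next d), fun e => h.inv_ne_next ((congrArg M.inv e).symm.trans (M.inv_inv _)), M.inv_ne _⟩
  else if h2 : y = M.next d then ⟨M.inv d, M.inv_ne _, h.inv_ne_next⟩
  else ⟨y, h1, h2⟩

/-- Reversal of darts after gluing: the darts `inv d` and `inv (next d)` now form an edge. -/
noncomputable def zipInv (d : M.Dart) (h : M.CanZip d) (y : M.ZipDart d) : M.ZipDart d :=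
  M.zipDart d h (M.inv y)

open Classical in
/-- Successor along faces after gluing: `d` and `next d` are removed from their face. -/
noncomputable def zipNext (d : M.Dart) (h : M.CanZip d) (y : M.ZipDart d) : M.ZipDart d :=
  if h1 : M.next y = d then
    ⟨M.next (M.next d), h.next_next_ne, fun e => h.next_ne (M.next.injective e)⟩
  else ⟨M.next y, h1, fun e => y.2.1 (M.next.injective e)⟩

theorem zipInv_zipInv (d : M.Dart) (h : M.CanZip d) (y : M.ZipDart d) :
    M.zipInv d h (M.zipInv d h y) = y := by
  obtain ⟨y, h1, h2⟩ := y
  have e := M.inv_inv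
  have e1 := h.inv_ne_next
  have e2 := h.next_ne
  apply Subtype.ext
  simp only [zipInv, zipDart]
  grind

theorem zipInv_ne (d : M.Dart) (h : M.CanZip d) (y : M.ZipDart d) :
    M.zipInv d h y ≠ y := by
  obtain ⟨y, h1, h2⟩ := y
  have e := M.inv_inv
  have e0 := M.inv_ne
  have e2 := h.next_ne
  intro hy
  have hy2 := congrArg Subtype.val hy
  simp only [zipInv, zipDart] at hy2
  grind

theorem zipNext_injective (d : M.Dart) (h : M.CanZip d) :
    Function.Injective (M.zipNext d h) := by
  rintro ⟨y, h1, h2⟩ ⟨z, h3, h4⟩ hyz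
  have key : ∀ d d' : M.Dart, M.next d = M.next d' → d = d' := fun _ _ h => M.next.injective h
  have hyz2 := congrArg Subtype.val hyz
  apply Subtype.ext
  simp only [zipNext] at hyz2
  grind

theorem color_zipNext (d : M.Dart) (h : M.CanZip d) (col : M.Dart → Color)
    (hcol : ∀ y, col (M.next (M.inv y)) = col y) (hends : col d = col (M.inv (M.next d)))
    (y : M.ZipDart d) : col (M.zipNext d h (M.zipInv d h y)) = col y := by
  obtain ⟨y, h1, h2⟩ := y
  have e := M.inv_inv
  have e2 : ∀ d, col (M.next d) = col (M.inv d) := fun d => by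
    have := hcol (M.inv d)
    rwa [M.inv_inv] at this
  simp only [zipInv, zipDart, zipNext]
  grind

/-- Glue together the edges of `d` and `next d` (by the identification that folds them onto each other
at their common vertex, the end of `d`), on the side of the face at the right of `d`, and color the
vertices according to `col`, which gives the same color to the two vertices that are identified: the
origin of `d` and the end of `next d`. -/
noncomputable def zip (d : M.Dart) (h : M.CanZip d) (col : M.Dart → Color)
    (hcol : ∀ y, col (M.next (M.inv y)) = col y) (hends : col d = col (M.inv (M.next d))) :
    PercMap where
  Dart := M.ZipDart d
  finite_dart := inferInstance
  inv := Function.Involutive.toPerm (M.zipInv d h) (M.zipInv_zipInv d h)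
  inv_inv := M.zipInv_zipInv d h
  inv_ne := M.zipInv_ne d h
  next := Equiv.ofBijective (M.zipNext d h)
    (Finite.injective_iff_bijective.1 (M.zipNext_injective d h))
  root := ⟨M.root, h.root_ne, h.root_ne_next⟩
  color y := col y
  color_next_inv := M.color_zipNext d h col hcol hends

/-! ### The mappings `φ_a`, `φ_b`, `φ_c` -/

/-- The mapping `φ_c` is defined: with `t` the top-edge, the outer dart `next t`, whose origin is the
top-left vertex, is a left edge, and the outer dart `next⁻¹ t`, whose end is the top-right vertex, is a
right edge. (The root-edge always goes from white to black in `T_P`.) -/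
structure CanFold (t : M.Dart) : Prop where
  top : M.IsTop t
  left : M.IsLeft (M.next t)
  right : M.IsRight (M.next.symm t)
  root : M.Goes .white .black M.root

variable {M}

theorem CanFold.canZip_top {t : M.Dart} (h : M.CanFold t) : M.CanZip t := by
  obtain ⟨⟨h1, h2, h3⟩, ⟨h4, h5, h6⟩, ⟨h7, h8, h9⟩, ⟨h10, h11⟩⟩ := h
  refine ⟨?_, ?_, ?_, ?_, ?_⟩
  · intro e
    rw [e, h2] at h5
    cases h5
  · intro e
    have : M.next.symm t = M.next t := by rw [Equiv.symm_apply_eq, e]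
    rw [this, h5] at h8
    cases h8
  · intro e
    rw [← e, M.inv_inv, h2] at h6
    cases h6
  · intro e
    rw [e, h2] at h10
    cases h10
  · intro e
    rw [e, h6] at h11
    cases h11

theorem CanFold.canZip_right {t : M.Dart} (h : M.CanFold t) : M.CanZip (M.next.symm t) := by
  obtain ⟨⟨h1, h2, h3⟩, ⟨h4, h5, h6⟩, ⟨h7, h8, h9⟩, ⟨h10, h11⟩⟩ := h
  have hn : M.next (M.next.symm t) = t := Equiv.apply_symm_apply _ _
  refine ⟨?_, ?_, ?_, ?_, ?_⟩
  · intro e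
    rw [hn] at e
    rw [← e, h3] at h9
    cases h9
  · intro e
    rw [hn] at e
    rw [← e, h5] at h8
    cases h8
  · intro e
    rw [hn] at e
    rw [← e, M.inv_inv, h8] at h3
    cases h3
  · intro e
    rw [e, h8] at h10
    cases h10
  · intro e
    rw [hn] at e
    rw [e, h2] at h10
    cases h10

theorem CanFold.ends_white {t : M.Dart} (h : M.CanFold t) :
    M.recolor t .white t = M.recolor t .white (M.inv (M.next t)) := by
  simp [recolor, h.left.2.2]

theorem CanFold.ends_black {t : M.Dart} (h : M.CanFold t) :
    M.recolor (M.next t) .black (M.next.symm t) =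
      M.recolor (M.next t) .black (M.inv (M.next (M.next.symm t))) := by
  have ho := M.origin_next_inv (M.inv t)
  rw [M.inv_inv] at ho
  simp [recolor, h.right.2.1, ho]

end PercMap

/-! ### The step-by-step construction -/

/-- A percolated map with, for each of the `length` steps performed so far, a dart `edgeDart i` and a
dart `cellDart i` that record the edge, and the inner triangle or the inner vertex, that correspond to
step `i`: the edge of `edgeDart i`; the face of `cellDart i` if step `i` is an `a`-step or a `b`-step, and
the origin of `cellDart i` if it is a `c`-step. -/
structure State where
  map : PercMap
  length : ℕ
  edgeDart : ℕ → map.Dart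
  cellDart : ℕ → map.Dart

namespace State

/-- The single edge, before the first step. -/
def start : State where
  map := PercMap.single
  length := 0
  edgeDart _ := PercMap.single.root
  cellDart _ := PercMap.single.root

/-- The mapping `φ_a` (for `x` white) or `φ_b` (for `x` black) where `t` is the top-edge, which becomes the
edge of this step.  The face of `t` is now the new triangle. -/
noncomputable def glueTriangle (S : State) (t : S.map.Dart) (h : S.map.IsTop t) (x : Color) :
    State where
  map := S.map.attach t h.next_ne x
  length := S.length + 1
  edgeDart := Function.update (fun i => Sum.inl (S.edgeDart i)) S.length (Sum.inl t)
  cellDart := Function.update (fun i => Sum.inl (S.cellDart i)) S.length (Sum.inl t)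

/-- Glue the edges of `d` and `next d` together, with new coloring `col`.  The edge of this step is the one
that results from the gluing, and the vertex of this step is the common vertex of the two edges, that is,
the origin of `next d`. -/
noncomputable def glueEdges (S : State) (d : S.map.Dart) (h : S.map.CanZip d)
    (col : S.map.Dart → Color) (hcol : ∀ y, col (S.map.next (S.map.inv y)) = col y)
    (hends : col d = col (S.map.inv (S.map.next d))) : State where
  map := S.map.zip d h col hcol hends
  length := S.length + 1
  edgeDart := Function.update (fun i => S.map.zipDart d h (S.edgeDart i)) S.length
    (S.map.zipDart d h d)
  cellDart := Function.update (fun i => S.map.zipDart d h (S.cellDart i)) S.length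
    (S.map.zipDart d h (S.map.next d))

open Classical in
/-- The mapping `φ_c` where `t` is the top-edge.  If the triangle incident to the right edge
`next⁻¹ t` is the last triangle on the percolation path incident to a left or right edge, then the
top-right vertex (the origin of `t`) becomes white and the edges of `t` and `next t` are glued together;
otherwise the top-left vertex (the origin of `next t`) becomes black and the edges of `next⁻¹ t` and
`t` are glued together. -/
noncomputable def fold (S : State) (t : S.map.Dart) (h : S.map.CanFold t) : State :=
  if S.map.IsLastFace (S.map.face (S.map.inv (S.map.next.symm t))) then
    S.glueEdges t h.canZip_top (S.map.recolor t .white) (S.map.recolor_next_inv _ _) h.ends_white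
  else
    S.glueEdges (S.map.next.symm t) h.canZip_right (S.map.recolor (S.map.next t) .black)
      (S.map.recolor_next_inv _ _) h.ends_black

/-- The mapping of the given letter is defined at the given percolated map. -/
def Defined (S : State) : Letter → Prop
  | .a => ∃ t, S.map.IsTop t
  | .b => ∃ t, S.map.IsTop t
  | .c => ∃ t, S.map.CanFold t

open Classical in
/-- Apply `φ_a`, `φ_b` or `φ_c` (nothing is done where the mapping is not defined). -/
noncomputable def step (S : State) : Letter → State
  | .a => if h : ∃ t, S.map.IsTop t then S.glueTriangle h.choose h.choose_spec .white else S
  | .b => if h : ∃ t, S.map.IsTop t then S.glueTriangle h.choose h.choose_spec .black else S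
  | .c => if h : ∃ t, S.map.CanFold t then S.fold h.choose h.choose_spec else S

end State

/-- The construction applied to the letters of `w`, read from left to right. -/
noncomputable def build (w : List Letter) : State := w.foldl State.step State.start

/-- The site-percolated map obtained from the word `w`. -/
noncomputable def buildMap (w : List Letter) : PercMap := (build w).map

/-- Rooted site-percolated maps up to isomorphism. -/
abbrev PercMapClass : Type 1 := Quotient PercMap.isoSetoid

/-- The mapping `Φ`. -/
noncomputable def Phi (w : List Letter) : PercMapClass := Quotient.mk _ (buildMap w)

/-- The set `T_P`. -/
def TP : Set PercMapClass := {q | ∃ M : PercMap, M.IsTP ∧ Quotient.mk _ M = q}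

/-- The mapping from steps to edges. -/
noncomputable def etaE (w : List Letter) (i : ℕ) : (buildMap w).Edge :=
  (buildMap w).edge ((build w).edgeDart i)

/-- The mapping from steps to vertices and faces. -/
noncomputable def etaVF (w : List Letter) (i : ℕ) : (buildMap w).Vertex ⊕ (buildMap w).Face :=
  if w[i]? = some Letter.c then .inl ((buildMap w).origin ((build w).cellDart i))
  else .inr ((buildMap w).face ((build w).cellDart i))

/-- The edge `e` belongs to the set `A` and is incident to the triangle associated with step `i`. -/
def IncidentStep (w : List Letter) (A : Set (buildMap w).Edge) (i : ℕ) (e : (buildMap w).Edge) :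
    Prop :=
  e ∈ A ∧ ∃ f, etaVF w i = .inr f ∧ (buildMap w).Incident f e

open Classical in
/-- The mapping that sends an unmatched `a`-step (resp. `b`-step) to the left (resp. right) edge incident to
the triangle of this step; the value is irrelevant for other steps. -/
noncomputable def etaLR (w : List Letter) (i : ℕ) : (buildMap w).Edge :=
  haveI : Nonempty (buildMap w).Edge := ⟨(buildMap w).edge (buildMap w).root⟩
  if w[i]? = some Letter.a then
    Classical.epsilon (IncidentStep w (buildMap w).leftEdges i)
  else Classical.epsilon (IncidentStep w (buildMap w).rightEdges i)

end KrewerasMap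

/-!
A map is handled through its darts: a function that is constant along `next`, along `next * inv`, or along
both, is constant on faces, on vertices, or on the whole map (`apply_eq_of_face_eq`,
`apply_eq_of_origin_eq`, `connected_iff`).  The two operations on maps, gluing a triangle to an outer edge
and gluing two consecutive outer edges, are described up to isomorphism by the relations `IsAttach` and
`IsZip`, which transfer all the conditions that define `T_P` from one map to the other.  The mapping
`mirror`, which reverses the orientation and exchanges the colors, exchanges the roles of `a` and `b`, so
that only one of the two cases of each argument has to be treated.

**The construction is defined and stays in `T_P`.**  The invariant is `PercMap.Explored`: each step of the
percolation path, hence each triangle visited by the path, carries a time, which is the index of the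
`a`-step or `b`-step that created the triangle.  The times increase along the path, and the triangles of
the left (resp. right) edges have as times the `a`-steps (resp. `b`-steps) that are still open, the
top-edge being next to the last one.  So the letter `c` closes the last open `a`-step `i` and
the last open `b`-step `j`, the triangle of the left or of the right edge is the last one on the path according
to whether `j < i` or `i < j`, and the color of the vertex that becomes inner is given by the type of
the step.  The point that needs the sphere is that gluing creates no self-loop: by `IsTP.chord`, an edge
between two outer vertices is an outer edge or is crossed by the percolation path, since otherwise it would
close up with a part of the boundary to a closed walk, separating faces that the path connects.  The
separation property itself is `Planar.exists_faceBoundary`: modulo `2`, the cycle space and the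
space of boundaries of sets of faces have the same dimension by Euler's formula.

**The bijections between steps and cells.**  The invariant `PercMap.Cells` says that the in-edges, the inner
triangles and the inner vertices correspond to the steps performed so far.  Each step adds exactly one
in-edge, and one inner triangle or one inner vertex.  For the left and right edges the bijections are read off
the lists in `Explored`.

**Injectivity.**  From the triangle of the top-edge one sees whether the last step was an `a`-step, a
`b`-step or a `c`-step of either type (`lastStep_buildMap`).  The first two are undone by removing this
triangle.  To undo a `c`-step one has to know along which edge the map was glued:
`Explored.isCut` shows that it is the first edge, turning around the end of the top-edge that belongs to the
recolored vertex, whose triangle is visited by the percolation path.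

**Surjectivity.**  The same recipe is applied to any map of `T_P` with an inner triangle at the
top-edge (`IsTP.exists_pred`).  Either this triangle has a left or right edge at the top-edge and can be
removed, or there is a cut as above (`IsTP.exists_cut`), and the map that results from cutting is again in
`T_P` (`IsUnzip.isTP_canFold`), by the property of chords used once more.  The number of in-edges
decreases, so that one ends with the map with a single edge.
-/

namespace KrewerasMap

namespace PercMap

/-! ### Vertices, edges and faces as classes of darts -/

/-- A function that is invariant under a permutation is constant on its cycles. -/
theorem eq_of_sameCycle {A B : Type*} (σ : Equiv.Perm A) (f : A → B) (h : ∀ a, f (σ a) = f a) {x y : A}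
    (hxy : σ.SameCycle x y) : f x = f y := by
  obtain ⟨i, rfl⟩ := hxy
  have hinv : ∀ a, f (σ⁻¹ a) = f a := fun a => by
    rw [← h (σ⁻¹ a)]
    exact congrArg f (σ.apply_symm_apply a)
  induction i using Int.induction_on with
  | zero => simp
  | succ n ih =>
    rw [add_comm, zpow_add, zpow_one, Equiv.Perm.mul_apply, h]
    exact ih
  | pred n ih =>
    rw [sub_eq_add_neg, add_comm, zpow_add, zpow_neg_one, Equiv.Perm.mul_apply, hinv]
    exact ih

theorem card_quotient_eq {A B : Type*} (r : Setoid A) (s : Setoid B) (f : A → B)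
    (h : ∀ x y, s (f x) (f y) ↔ r x y) (hf : ∀ b, ∃ a, s (f a) b) :
    Nat.card (Quotient r) = Nat.card (Quotient s) := by
  refine Nat.card_congr (Equiv.ofBijective (Quotient.map f fun x y hxy => (h x y).2 hxy) ⟨?_, ?_⟩)
  · rintro ⟨x⟩ ⟨y⟩ hxy
    exact Quotient.sound ((h x y).1 (Quotient.exact hxy))
  · rintro ⟨b⟩
    obtain ⟨a, ha⟩ := hf b
    exact ⟨Quotient.mk _ a, Quotient.sound ha⟩

variable {M N : PercMap}

theorem origin_eq_iff {x y : M.Dart} :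
    M.origin x = M.origin y ↔ (M.next * M.inv).SameCycle x y :=
  ⟨fun h => Quotient.exact h, fun h => Quotient.sound h⟩

theorem edge_eq_iff_sameCycle {x y : M.Dart} : M.edge x = M.edge y ↔ M.inv.SameCycle x y :=
  ⟨fun h => Quotient.exact h, fun h => Quotient.sound h⟩

theorem face_eq_iff {x y : M.Dart} : M.face x = M.face y ↔ M.next.SameCycle x y :=
  ⟨fun h => Quotient.exact h, fun h => Quotient.sound h⟩

theorem apply_eq_of_origin_eq {B : Type*} (f : M.Dart → B) (h : ∀ y, f (M.next (M.inv y)) = f y)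
    {x y : M.Dart} (hxy : M.origin x = M.origin y) : f x = f y :=
  eq_of_sameCycle (M.next * M.inv) f h (origin_eq_iff.1 hxy)

theorem apply_eq_of_face_eq {B : Type*} (f : M.Dart → B) (h : ∀ y, f (M.next y) = f y)
    {x y : M.Dart} (hxy : M.face x = M.face y) : f x = f y :=
  eq_of_sameCycle M.next f h (face_eq_iff.1 hxy)

theorem color_eq_of_origin_eq {x y : M.Dart} (h : M.origin x = M.origin y) : M.color x = M.color y :=
  apply_eq_of_origin_eq M.color M.color_next_inv h

@[simp] theorem face_next (y : M.Dart) : M.face (M.next y) = M.face y :=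
  face_eq_iff.2 (Equiv.Perm.sameCycle_apply_left.2 (Equiv.Perm.SameCycle.refl _ _))

@[simp] theorem face_next_symm (y : M.Dart) : M.face (M.next.symm y) = M.face y := by
  rw [← face_next, Equiv.apply_symm_apply]

@[simp] theorem origin_next (y : M.Dart) : M.origin (M.next y) = M.origin (M.inv y) := by
  have := M.origin_next_inv (M.inv y)
  rwa [M.inv_inv] at this

@[simp] theorem origin_inv_next_symm (y : M.Dart) : M.origin (M.inv (M.next.symm y)) = M.origin y := by
  rw [← origin_next, Equiv.apply_symm_apply]

theorem color_inv_next_symm (y : M.Dart) : M.color (M.inv (M.next.symm y)) = M.color y := by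
  rw [← color_next, Equiv.apply_symm_apply]

theorem edge_inv (y : M.Dart) : M.edge (M.inv y) = M.edge y :=
  edge_eq_iff_sameCycle.2 (Equiv.Perm.sameCycle_apply_left.2 (Equiv.Perm.SameCycle.refl _ _))

theorem edge_eq_iff {x y : M.Dart} : M.edge x = M.edge y ↔ x = y ∨ x = M.inv y := by
  constructor
  · intro h
    have h2 : (x = y ∨ x = M.inv y) = (y = y ∨ y = M.inv y) := by
      refine eq_of_sameCycle M.inv (fun z => z = y ∨ z = M.inv y) (fun z => ?_)
        (edge_eq_iff_sameCycle.1 h)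
      have := M.inv_inv
      grind
    rw [h2]
    exact Or.inl rfl
  · rintro (rfl | rfl)
    · rfl
    · exact edge_inv y

theorem origin_surjective (v : M.Vertex) : ∃ y, M.origin y = v := Quotient.exists_rep v

theorem face_surjective (f : M.Face) : ∃ y, M.face y = f := Quotient.exists_rep f

theorem edge_surjective (e : M.Edge) : ∃ y, M.edge y = e := Quotient.exists_rep e

theorem inv_injective : Function.Injective M.inv := M.inv.injective

theorem inv_eq_iff {x y : M.Dart} : M.inv x = y ↔ x = M.inv y := by
  constructor
  · rintro rfl
    rw [M.inv_inv]
  · rintro rfl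
    rw [M.inv_inv]

@[simp] theorem outer_root : M.Outer M.root := rfl

@[simp] theorem outer_next {y : M.Dart} : M.Outer (M.next y) ↔ M.Outer y := by
  unfold Outer
  rw [face_next]

@[simp] theorem outer_next_symm {y : M.Dart} : M.Outer (M.next.symm y) ↔ M.Outer y := by
  unfold Outer
  rw [face_next_symm]

theorem outer_of_face_eq {x y : M.Dart} (h : M.face x = M.face y) (hx : M.Outer x) : M.Outer y :=
  h.symm.trans hx

theorem face_eq_of_outer {x y : M.Dart} (hx : M.Outer x) (hy : M.Outer y) : M.face x = M.face y :=
  hx.trans hy.symm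

/-- Every outer dart is reached from a given one by iterating `next`. -/
theorem Outer.exists_iterate {x y : M.Dart} (hx : M.Outer x) (hy : M.Outer y) :
    ∃ i : ℕ, M.next^[i] x = y := by
  obtain ⟨i, hi⟩ := (face_eq_iff.1 (face_eq_of_outer hx hy)).exists_nat_pow_eq
  exact ⟨i, by rw [← hi, Equiv.Perm.iterate_eq_pow]⟩

/-- To prove something of all outer darts, start anywhere on the root-face and follow it. -/
theorem Outer.induction {P : M.Dart → Prop} {x y : M.Dart} (hx : M.Outer x) (hy : M.Outer y)
    (h0 : P x) (hs : ∀ z, M.Outer z → P z → P (M.next z)) : P y := by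
  obtain ⟨i, rfl⟩ := hx.exists_iterate hy
  clear hy
  have : ∀ i, M.Outer (M.next^[i] x) ∧ P (M.next^[i] x) := by
    intro i
    induction i with
    | zero => exact ⟨hx, h0⟩
    | succ n ih =>
      rw [Function.iterate_succ_apply']
      exact ⟨outer_next.2 ih.1, hs _ ih.1 ih.2⟩
  exact (this i).2

/-- Connectedness in the form in which it is used: functions that are invariant under `inv` and `next`
are constant. -/
theorem connected_iff : (∀ d d' : M.Dart, ∃ g ∈ Subgroup.closure {M.inv, M.next}, g d = d') ↔
    ∀ f : M.Dart → Prop, (∀ y, f (M.inv y) = f y) → (∀ y, f (M.next y) = f y) →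
      ∀ x y, f x = f y := by
  constructor
  · intro h f h1 h2 x y
    obtain ⟨g, hg, rfl⟩ := h x y
    have : ∀ z, f (g z) = f z := by
      refine Subgroup.closure_induction (p := fun g _ => ∀ z, f (g z) = f z) ?_ ?_ ?_ ?_ hg
      · rintro g (rfl | rfl)
        · exact h1
        · exact h2
      · intro z
        rfl
      · intro g g' _ _ ih ih' z
        rw [Equiv.Perm.mul_apply, ih, ih']
      · intro g _ ih z
        rw [← ih (g⁻¹ z)]
        exact congrArg f (g.apply_symm_apply z)
    exact (this x).symm
  · intro h d d'
    have key : ∀ g ∈ Subgroup.closure {M.inv, M.next}, ∀ y,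
        (∃ k ∈ Subgroup.closure {M.inv, M.next}, k d = g y) =
          (∃ k ∈ Subgroup.closure {M.inv, M.next}, k d = y) := by
      intro g hg y
      apply propext
      constructor
      · rintro ⟨k, hk, e⟩
        exact ⟨g⁻¹ * k, mul_mem (inv_mem hg) hk, by
          rw [Equiv.Perm.mul_apply, e]
          exact g.symm_apply_apply y⟩
      · rintro ⟨k, hk, e⟩
        exact ⟨g * k, mul_mem hg hk, by rw [Equiv.Perm.mul_apply, e]⟩
    have := h (fun y => ∃ k ∈ Subgroup.closure {M.inv, M.next}, k d = y)
      (key M.inv (Subgroup.subset_closure (by simp))) (key M.next (Subgroup.subset_closure (by simp))) d d'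
    rw [← this]
    exact ⟨1, one_mem _, rfl⟩

/-! ### Inner triangles -/

/-- Inner faces of degree `3`, in terms of `next`: the third iterate is the identity there, and `next` has no
fixed point. -/
theorem nearTriangulation_iff : M.NearTriangulation ↔
    ∀ y, ¬ M.Outer y → M.next (M.next (M.next y)) = y ∧ M.next y ≠ y := by
  have hset : ∀ y : M.Dart, {z | M.face z = M.face y} =
      MulAction.orbit (Subgroup.zpowers M.next) y := by
    intro y
    ext z
    simp only [Set.mem_ofPred_eq, MulAction.mem_orbit_iff, Subtype.exists, Subgroup.mem_zpowers_iff]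
    rw [eq_comm, face_eq_iff]
    constructor
    · rintro ⟨i, hi⟩
      exact ⟨M.next ^ i, ⟨i, rfl⟩, hi⟩
    · rintro ⟨_, ⟨i, rfl⟩, hi⟩
      exact ⟨i, hi⟩
  have hcard : ∀ y : M.Dart, Nat.card {z // M.face z = M.face y} = Function.minimalPeriod M.next y := by
    intro y
    classical
    have : Fintype (MulAction.orbit (Subgroup.zpowers M.next) y) := Fintype.ofFinite _
    have h1 := MulAction.minimalPeriod_eq_card M.next y
    rw [← Nat.card_eq_fintype_card, ← hset y] at h1
    exact h1.symm
  constructor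
  · intro h y hy
    have h1 := h (M.face y) hy
    rw [hcard] at h1
    have h2 := Function.iterate_minimalPeriod (f := M.next) (x := y)
    rw [h1] at h2
    refine ⟨h2, fun h3 => ?_⟩
    have h4 : Function.minimalPeriod M.next y = 1 := Function.minimalPeriod_eq_one_iff_isFixedPt.2 h3
    omega
  · intro h f hf
    obtain ⟨y, rfl⟩ := face_surjective f
    obtain ⟨h1, h2⟩ := h y hf
    rw [hcard]
    have h3 : Function.minimalPeriod M.next y ∣ 3 :=
      Function.IsPeriodicPt.minimalPeriod_dvd (show M.next^[3] y = y from h1)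
    rcases (Nat.dvd_prime Nat.prime_three).1 h3 with h4 | h4
    · exact absurd (Function.minimalPeriod_eq_one_iff_isFixedPt.1 h4) h2
    · exact h4

theorem NearTriangulation.next3 (h : M.NearTriangulation) {y : M.Dart} (hy : ¬ M.Outer y) :
    M.next (M.next (M.next y)) = y := (nearTriangulation_iff.1 h y hy).1

theorem NearTriangulation.eq_of_face_eq (h : M.NearTriangulation) {y z : M.Dart} (hy : ¬ M.Outer y)
    (hz : M.face z = M.face y) : z = y ∨ z = M.next y ∨ z = M.next (M.next y) := by
  have h3 := h.next3 hy
  have key : ∀ a b : M.Dart, M.next a = M.next b → a = b := fun _ _ h => M.next.injective h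
  have h2 := apply_eq_of_face_eq (fun z => z = y ∨ z = M.next y ∨ z = M.next (M.next y))
    (fun z => by grind) hz
  rw [h2]
  exact Or.inl rfl

theorem NearTriangulation.next_symm (h : M.NearTriangulation) {y : M.Dart} (hy : ¬ M.Outer y) :
    M.next.symm y = M.next (M.next y) := by
  rw [Equiv.symm_apply_eq, h.next3 hy]

/-! ### The percolation path -/

theorem goes_inv {x y : Color} {d : M.Dart} : M.Goes x y (M.inv d) ↔ M.Goes y x d := by
  unfold Goes
  rw [M.inv_inv, and_comm]

theorem goes_iff_next {x y : Color} {d : M.Dart} : M.Goes x y d ↔ M.color d = x ∧ M.color (M.next d) = y := by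
  unfold Goes
  rw [color_next]

/-- An inner triangle has at most one dart from `x` to `y` if these colors differ. -/
theorem NearTriangulation.goes_unique (h : M.NearTriangulation) {x y : Color} (hxy : x ≠ y)
    {d d' : M.Dart} (hd : ¬ M.Outer d)
    (hf : M.face d' = M.face d) (h1 : M.Goes x y d) (h2 : M.Goes x y d') : d' = d := by
  have h3 := h.next3 hd
  rw [goes_iff_next] at h1 h2
  rcases h.eq_of_face_eq hd hf with rfl | rfl | rfl
  · rfl
  · exact absurd (h2.1.symm.trans h1.2) hxy
  · rw [h3] at h2
    exact absurd (h1.1.symm.trans h2.2) hxy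

theorem Color.cases (x : Color) : x = .white ∨ x = .black := by
  cases x <;> simp

theorem RootInterface.onPath_goes (h : M.RootInterface) {z : M.Dart} (hz : M.OnPath z) :
    M.Goes .white .black z := by
  rcases Relation.ReflTransGen.cases_tail hz with rfl | ⟨z', _, h2⟩
  · exact h.1
  · exact h2.2.2

theorem NearTriangulation.pathStep_unique (h : M.NearTriangulation) {d d1 d2 : M.Dart}
    (h1 : M.PathStep d d1) (h2 : M.PathStep d d2) : d1 = d2 :=
  h.goes_unique (by decide) (fun ho => h2.1 (outer_of_face_eq h2.2.1 ho))
    (h1.2.1.trans h2.2.1.symm) h2.2.2 h1.2.2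

theorem NearTriangulation.eq_of_face_inv_eq (h : M.NearTriangulation) {d1 d2 : M.Dart}
    (g1 : M.Goes .white .black d1) (g2 : M.Goes .white .black d2) (ho : ¬ M.Outer (M.inv d2))
    (hf : M.face (M.inv d1) = M.face (M.inv d2)) : d1 = d2 :=
  inv_injective (h.goes_unique (by decide) ho hf (goes_inv.2 g2) (goes_inv.2 g1))

theorem NearTriangulation.pathStep_injective (h : M.NearTriangulation) {d d1 d2 : M.Dart}
    (g1 : M.Goes .white .black d1) (g2 : M.Goes .white .black d2)
    (h1 : M.PathStep d1 d) (h2 : M.PathStep d2 d) : d1 = d2 :=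
  h.eq_of_face_inv_eq g1 g2 h2.1 (h1.2.1.symm.trans h2.2.1)

theorem NearTriangulation.exists_pathStep (h : M.NearTriangulation) {d : M.Dart}
    (g : M.Goes .white .black d) (ho : ¬ M.Outer (M.inv d)) : ∃ d', M.PathStep d d' := by
  have h3 := h.next3 ho
  have c0 : M.color (M.inv d) = .black := g.2
  have c1 : M.color (M.next (M.inv d)) = .white := by rw [color_next, M.inv_inv, g.1]
  rcases Color.cases (M.color (M.next (M.next (M.inv d)))) with c2 | c2
  · exact ⟨M.next (M.next (M.inv d)), ho, by simp, goes_iff_next.2 ⟨c2, by rw [h3, c0]⟩⟩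
  · exact ⟨M.next (M.inv d), ho, by simp, goes_iff_next.2 ⟨c1, c2⟩⟩

theorem not_pathStep_root {d : M.Dart} : ¬ M.PathStep d M.root := fun h => h.1 h.2.1.symm

/-- The outer face has exactly one dart from black to white, because it has exactly one dart from white
to black. -/
theorem RootInterface.exists_top (h : M.RootInterface) : ∃ t, ∀ y, M.IsTop y ↔ y = t := by
  have h1 : ({y | M.Outer y ∧ M.color y = .white} : Set M.Dart).ncard =
      {y | M.Outer y ∧ M.color (M.next y) = .white}.ncard := by
    have : {y | M.Outer y ∧ M.color (M.next y) = .white} =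
        M.next ⁻¹' {y | M.Outer y ∧ M.color y = .white} := by
      ext y
      simp
    rw [this, Set.ncard_preimage_of_injective_subset_range M.next.injective
      (fun y _ => M.next.surjective y)]
  rw [Set.ncard_eq_ncard_iff_ncard_sdiff_eq_ncard_sdiff] at h1
  have h2 : {y | M.Outer y ∧ M.color y = .white} \ {y | M.Outer y ∧ M.color (M.next y) = .white} =
      {M.root} := by
    ext y
    simp only [Set.mem_sdiff, Set.mem_ofPred_eq, Set.mem_singleton_iff]
    constructor
    · rintro ⟨⟨h3, h4⟩, h5⟩
      refine h.2 y h3 (goes_iff_next.2 ⟨h4, ?_⟩)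
      rcases Color.cases (M.color (M.next y)) with h6 | h6
      · exact absurd ⟨h3, h6⟩ h5
      · exact h6
    · rintro rfl
      have h3 := goes_iff_next.1 h.1
      refine ⟨⟨outer_root, h3.1⟩, fun h4 => ?_⟩
      rw [h3.2] at h4
      exact absurd h4.2 (by decide)
  rw [h2, Set.ncard_singleton, eq_comm, Set.ncard_eq_one] at h1
  obtain ⟨t, ht⟩ := h1
  refine ⟨t, fun y => ?_⟩
  have h3 := Set.ext_iff.1 ht y
  simp only [Set.mem_sdiff, Set.mem_ofPred_eq, Set.mem_singleton_iff] at h3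
  rw [← h3]
  unfold IsTop
  rw [goes_iff_next]
  constructor
  · rintro ⟨h4, h5, h6⟩
    exact ⟨⟨h4, h6⟩, fun h7 => by rw [h5] at h7; exact absurd h7.2 (by decide)⟩
  · rintro ⟨⟨h4, h5⟩, h6⟩
    refine ⟨h4, ?_, h5⟩
    rcases Color.cases (M.color y) with h7 | h7
    · exact absurd ⟨h4, h7⟩ h6
    · exact h7

theorem RootInterface.top_unique (h : M.RootInterface) {t t' : M.Dart} (ht : M.IsTop t)
    (ht' : M.IsTop t') : t = t' := by
  obtain ⟨s, hs⟩ := h.exists_top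
  rw [(hs t).1 ht, (hs t').1 ht']

/-- The percolation path returns to the root-face through the top-edge. -/
theorem onPath_top (hT : M.NearTriangulation) (hR : M.RootInterface) {t : M.Dart} (ht : M.IsTop t) :
    M.OnPath (M.inv t) := by
  by_contra hn
  have hin : ∀ z, M.OnPath z → ¬ M.Outer (M.inv z) := by
    intro z hz ho
    have : M.inv z = t := hR.top_unique ⟨ho, goes_inv.2 (hR.onPath_goes hz)⟩ ht
    exact hn (by rwa [← this, M.inv_inv])
  -- otherwise the path steps define an injective map of the finite set of path darts into itself, which
  -- misses the root
  have hex : ∀ z : {z // M.OnPath z}, ∃ z' : {z // M.OnPath z}, M.PathStep z.1 z'.1 := by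
    rintro ⟨z, hz⟩
    obtain ⟨z', h'⟩ := hT.exists_pathStep (hR.onPath_goes hz) (hin z hz)
    exact ⟨⟨z', hz.tail h'⟩, h'⟩
  choose f hf using hex
  have hinj : Function.Injective f := by
    intro x y hxy
    refine Subtype.ext (hT.pathStep_injective (hR.onPath_goes x.2) (hR.onPath_goes y.2) (hf x) ?_)
    rw [hxy]
    exact hf y
  obtain ⟨x, hx⟩ := Finite.injective_iff_surjective.1 hinj ⟨M.root, Relation.ReflTransGen.refl⟩
  have := hf x
  rw [hx] at this
  exact not_pathStep_root this

/-- The percolation path never comes back to an edge that it has crossed. -/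
theorem OnPath.not_transGen_self (hT : M.NearTriangulation) (hR : M.RootInterface) {z : M.Dart}
    (hz : M.OnPath z) : ¬ Relation.TransGen M.PathStep z z := by
  induction hz with
  | refl =>
    intro h
    obtain ⟨_, _, h2⟩ := Relation.TransGen.tail'_iff.1 h
    exact not_pathStep_root h2
  | tail h1 h2 ih =>
    rename_i z z'
    intro h
    obtain ⟨y, h3, h4⟩ := Relation.TransGen.tail'_iff.1 h
    have hy : M.OnPath y := (h1.tail h2).trans h3
    have : y = z := hT.pathStep_injective (hR.onPath_goes hy) (hR.onPath_goes h1) h4 h2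
    subst this
    exact ih (Relation.TransGen.head' h2 h3)

theorem OnPath.total (hT : M.NearTriangulation) {z z' : M.Dart} (hz : M.OnPath z) (hz' : M.OnPath z') :
    Relation.ReflTransGen M.PathStep z z' ∨ Relation.ReflTransGen M.PathStep z' z :=
  Relation.ReflTransGen.total_of_right_unique (fun _ _ _ h1 h2 => hT.pathStep_unique h1 h2) hz hz'

theorem PathEnters.unique (hT : M.NearTriangulation) (hR : M.RootInterface) {z z' : M.Dart} {f : M.Face}
    (h : M.PathEnters z f) (h' : M.PathEnters z' f) : z = z' :=
  hT.eq_of_face_inv_eq (hR.onPath_goes h.1) (hR.onPath_goes h'.1)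
    (fun ho => h'.2.1 (h'.2.2.symm.trans ho)) (h.2.2.trans h'.2.2.symm)

theorem IsLastFace.unique (hT : M.NearTriangulation) {f g : M.Face}
    (hf : M.IsLastFace f) (hg : M.IsLastFace g) : f = g := by
  obtain ⟨hf1, z, hz1, hz2⟩ := hf
  obtain ⟨hg1, y, hy1, hy2⟩ := hg
  rcases OnPath.total hT hz1.1 hy1.1 with h | h
  · rcases Relation.reflTransGen_iff_eq_or_transGen.1 h with h | h
    · subst h
      exact hz1.2.2.symm.trans hy1.2.2
    · exact absurd hg1 (hz2 y g h hy1)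
  · rcases Relation.reflTransGen_iff_eq_or_transGen.1 h with h | h
    · subst h
      exact hz1.2.2.symm.trans hy1.2.2
    · exact absurd hf1 (hy2 z f h hz1)

/-- A dart on the path whose right side is an inner triangle was preceded by a step into this
triangle. -/
theorem OnPath.exists_pathEnters {z : M.Dart} (hz : M.OnPath z) (ho : ¬ M.Outer z) :
    ∃ z', M.PathEnters z' (M.face z) ∧ M.PathStep z' z := by
  rcases Relation.ReflTransGen.cases_tail hz with rfl | ⟨z', h1, h2⟩
  · exact absurd outer_root ho
  · exact ⟨z', ⟨h1, ho, h2.2.1.symm⟩, h2⟩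

/-! ### Isomorphisms -/

/-- The inverse of an isomorphism. -/
def Iso.symm (e : Iso M N) : Iso N M where
  equiv := e.equiv.symm
  map_inv d := by rw [Equiv.symm_apply_eq, e.map_inv, Equiv.apply_symm_apply]
  map_next d := by rw [Equiv.symm_apply_eq, e.map_next, Equiv.apply_symm_apply]
  map_root := by rw [Equiv.symm_apply_eq, e.map_root]
  map_color d := by rw [← e.map_color, Equiv.apply_symm_apply]

theorem Iso.origin_eq (e : Iso M N) {x y : M.Dart} :
    N.origin (e.equiv x) = N.origin (e.equiv y) ↔ M.origin x = M.origin y := by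
  constructor
  · intro h
    have := apply_eq_of_origin_eq (fun y => M.origin (e.equiv.symm y))
      (fun y => by
        have h1 : e.equiv.symm (N.next (N.inv y)) = M.next (M.inv (e.equiv.symm y)) := by
          rw [Equiv.symm_apply_eq, e.map_next, e.map_inv, Equiv.apply_symm_apply]
        rw [h1, M.origin_next_inv]) h
    simpa using this
  · intro h
    exact apply_eq_of_origin_eq (fun y => N.origin (e.equiv y))
      (fun y => by rw [e.map_next, e.map_inv, N.origin_next_inv]) h

theorem Iso.face_eq (e : Iso M N) {x y : M.Dart} :
    N.face (e.equiv x) = N.face (e.equiv y) ↔ M.face x = M.face y := by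
  constructor
  · intro h
    have := apply_eq_of_face_eq (fun y => M.face (e.equiv.symm y))
      (fun y => by
        have h1 : e.equiv.symm (N.next y) = M.next (e.equiv.symm y) := by
          rw [Equiv.symm_apply_eq, e.map_next, Equiv.apply_symm_apply]
        rw [h1, face_next]) h
    simpa using this
  · intro h
    exact apply_eq_of_face_eq (fun y => N.face (e.equiv y))
      (fun y => by rw [e.map_next, face_next]) h

theorem Iso.outer (e : Iso M N) {x : M.Dart} : N.Outer (e.equiv x) ↔ M.Outer x := by
  unfold Outer rootFace
  rw [← e.map_root, e.face_eq]

theorem Iso.goes (e : Iso M N) {x y : Color} {d : M.Dart} : N.Goes x y (e.equiv d) ↔ M.Goes x y d := by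
  unfold Goes
  rw [← e.map_inv, e.map_color, e.map_color]

theorem Iso.isTop (e : Iso M N) {d : M.Dart} : N.IsTop (e.equiv d) ↔ M.IsTop d := by
  unfold IsTop
  rw [e.outer, e.goes]

theorem Iso.isLeft (e : Iso M N) {d : M.Dart} : N.IsLeft (e.equiv d) ↔ M.IsLeft d := by
  unfold IsLeft
  rw [e.outer, e.goes]

theorem Iso.isRight (e : Iso M N) {d : M.Dart} : N.IsRight (e.equiv d) ↔ M.IsRight d := by
  unfold IsRight
  rw [e.outer, e.goes]

theorem Iso.pathStep (e : Iso M N) {d d' : M.Dart} :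
    N.PathStep (e.equiv d) (e.equiv d') ↔ M.PathStep d d' := by
  unfold PathStep
  rw [← e.map_inv, e.outer, e.goes, e.face_eq]

theorem Iso.onPath_of (e : Iso M N) {d : M.Dart} (h : M.OnPath d) : N.OnPath (e.equiv d) := by
  have : N.OnPath (e.equiv M.root) := by
    rw [e.map_root]
    exact Relation.ReflTransGen.refl
  induction h with
  | refl => exact this
  | tail _ h2 ih => exact Relation.ReflTransGen.tail ih (e.pathStep.2 h2)

theorem Iso.onPath (e : Iso M N) {d : M.Dart} : N.OnPath (e.equiv d) ↔ M.OnPath d :=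
  ⟨fun h => by simpa [Iso.symm] using e.symm.onPath_of h, e.onPath_of⟩

/-- The path enters the face at the right of `y`. -/
def Visited (M : PercMap) (y : M.Dart) : Prop := ¬ M.Outer y ∧ ∃ z, M.OnPath z ∧ M.face (M.inv z) = M.face y

theorem visited_iff {y : M.Dart} : M.Visited y ↔ ∃ z, M.PathEnters z (M.face y) :=
  ⟨fun ⟨h, z, h1, h2⟩ => ⟨z, h1, h, h2⟩, fun ⟨z, h1, h, h2⟩ => ⟨h, z, h1, h2⟩⟩

theorem Iso.visited (e : Iso M N) {y : M.Dart} : N.Visited (e.equiv y) ↔ M.Visited y := by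
  unfold Visited
  rw [e.outer]
  refine and_congr_right fun _ => ⟨?_, ?_⟩
  · rintro ⟨z, h1, h2⟩
    obtain ⟨z, rfl⟩ := e.equiv.surjective z
    rw [← e.map_inv, e.face_eq] at h2
    exact ⟨z, e.onPath.1 h1, h2⟩
  · rintro ⟨z, h1, h2⟩
    exact ⟨e.equiv z, e.onPath.2 h1, by rwa [← e.map_inv, e.face_eq]⟩

theorem Iso.edge_eq (e : Iso M N) {x y : M.Dart} :
    N.edge (e.equiv x) = N.edge (e.equiv y) ↔ M.edge x = M.edge y := by
  rw [edge_eq_iff, edge_eq_iff, ← e.map_inv, e.equiv.apply_eq_iff_eq, e.equiv.apply_eq_iff_eq]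

end PercMap

/-! ### Reflection -/

/-- The other color. -/
def Color.swap : Color → Color
  | .white => .black
  | .black => .white

@[simp] theorem Color.swap_swap (x : Color) : x.swap.swap = x := by cases x <;> rfl

theorem Color.swap_eq_iff {x y : Color} : x.swap = y ↔ x = y.swap := by
  cases x <;> cases y <;> simp [Color.swap]

namespace PercMap

/-- The mirror image of a map, with the two colors exchanged.  A dart of the mirror image is the
reversed dart of the map, so that it still has the same face at its right; as the colors are
exchanged, the root-edge still goes from white to black. -/
@[reducible] def mirror (M : PercMap) : PercMap where
  Dart := M.Dart
  finite_dart := M.finite_dart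
  inv := M.inv
  inv_inv := M.inv_inv
  inv_ne := M.inv_ne
  next := M.next.symm
  root := M.root
  color d := (M.color (M.inv d)).swap
  color_next_inv d := by
    congr 1
    rw [color_inv_next_symm]

variable {M N : PercMap}

theorem mirror_mirror (M : PercMap) : M.mirror.mirror = M := by
  obtain ⟨D, hf, i, h1, h2, nx, r, col, h3⟩ := M
  simp only [mirror, Color.swap_swap, Equiv.symm_symm, h1]

theorem mirror_face {x y : M.Dart} : M.mirror.face x = M.mirror.face y ↔ M.face x = M.face y := by
  rw [face_eq_iff, face_eq_iff]
  exact Equiv.Perm.sameCycle_inv (f := M.next)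

theorem mirror_outer {x : M.Dart} : M.mirror.Outer x ↔ M.Outer x := mirror_face

theorem mirror_origin {x y : M.Dart} :
    M.mirror.origin x = M.mirror.origin y ↔ M.origin (M.inv x) = M.origin (M.inv y) := by
  constructor
  · intro h
    refine apply_eq_of_origin_eq (M := M.mirror) (fun z => M.origin (M.inv z)) (fun z => ?_) h
    exact origin_inv_next_symm _
  · intro h
    have h2 := apply_eq_of_origin_eq (M := M) (fun z => M.mirror.origin (M.inv z)) (fun z => ?_) h
    · simpa only [M.inv_inv] using h2
    · have := M.mirror.origin_next_inv (M.inv (M.next (M.inv z)))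
      rw [← this]
      simp only [mirror, M.inv_inv, Equiv.symm_apply_apply]

theorem mirror_origin_inv {x y : M.Dart} :
    M.mirror.origin (M.inv x) = M.mirror.origin (M.inv y) ↔ M.origin x = M.origin y := by
  rw [mirror_origin, M.inv_inv, M.inv_inv]

theorem mirror_goes {x y : Color} {d : M.Dart} : M.mirror.Goes x y d ↔ M.Goes y.swap x.swap d := by
  unfold Goes
  simp only [mirror, M.inv_inv, Color.swap_eq_iff]
  exact and_comm

theorem mirror_isTop {d : M.Dart} : M.mirror.IsTop d ↔ M.IsTop d := by
  unfold IsTop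
  rw [mirror_outer, mirror_goes]
  rfl

theorem mirror_isLeft {d : M.Dart} : M.mirror.IsLeft d ↔ M.IsRight d := by
  unfold IsLeft IsRight
  rw [mirror_outer, mirror_goes]
  rfl

theorem mirror_isRight {d : M.Dart} : M.mirror.IsRight d ↔ M.IsLeft d := by
  unfold IsLeft IsRight
  rw [mirror_outer, mirror_goes]
  rfl

theorem mirror_pathStep {d d' : M.Dart} : M.mirror.PathStep d d' ↔ M.PathStep d d' := by
  unfold PathStep
  rw [mirror_goes]
  exact and_congr (not_congr mirror_outer) (and_congr mirror_face Iff.rfl)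

theorem mirror_pathStep_eq : M.mirror.PathStep = M.PathStep := by
  funext d d'
  exact propext mirror_pathStep

theorem mirror_onPath {d : M.Dart} : M.mirror.OnPath d ↔ M.OnPath d := by
  unfold OnPath
  rw [mirror_pathStep_eq]

theorem mirror_pathEnters {z y : M.Dart} :
    M.mirror.PathEnters z (M.mirror.face y) ↔ M.PathEnters z (M.face y) := by
  unfold PathEnters
  exact and_congr mirror_onPath (and_congr (not_congr mirror_face) mirror_face)

theorem mirror_planar (h : M.Planar) : M.mirror.Planar := by
  obtain ⟨h1, h2⟩ := h
  constructor
  · rw [connected_iff] at h1 ⊢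
    intro f h3 h4
    refine h1 f h3 (fun y => ?_)
    have := h4 (M.next y)
    rw [← this]
    simp only [mirror, Equiv.symm_apply_apply]
  · rw [← h2]
    have e1 : Nat.card M.Vertex = Nat.card M.mirror.Vertex :=
      card_quotient_eq _ _ M.inv
        (fun x y => (origin_eq_iff (M := M.mirror)).symm.trans (mirror_origin_inv.trans origin_eq_iff))
        (fun b => ⟨M.inv b, by rw [M.inv_inv]⟩)
    have e2 : Nat.card M.Face = Nat.card M.mirror.Face :=
      card_quotient_eq _ _ id
        (fun x y => (face_eq_iff (M := M.mirror)).symm.trans (mirror_face.trans face_eq_iff))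
        (fun b => ⟨b, Equiv.Perm.SameCycle.refl _ _⟩)
    rw [e1, e2]

theorem mirror_nearTriangulation (h : M.NearTriangulation) : M.mirror.NearTriangulation := by
  rw [nearTriangulation_iff] at h ⊢
  intro y hy
  rw [mirror_outer] at hy
  obtain ⟨h1, h2⟩ := h y hy
  refine ⟨?_, fun h3 => h2 ?_⟩
  · simp only [mirror]
    rw [Equiv.symm_apply_eq, Equiv.symm_apply_eq, Equiv.symm_apply_eq, h1]
  · simp only [mirror] at h3
    rw [Equiv.symm_apply_eq] at h3
    exact h3.symm

theorem mirror_rootInterface (h : M.RootInterface) : M.mirror.RootInterface := by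
  refine ⟨mirror_goes.2 h.1, fun d h1 h2 => ?_⟩
  rw [mirror_outer] at h1
  rw [mirror_goes] at h2
  exact h.2 d h1 h2

theorem mirror_simpleBoundary (h : M.SimpleBoundary) : M.mirror.SimpleBoundary := by
  intro x y hx hy hxy
  rw [mirror_origin, ← origin_next, ← origin_next] at hxy
  exact M.next.injective (h _ _ (outer_next.2 (mirror_outer.1 hx)) (outer_next.2 (mirror_outer.1 hy)) hxy)

theorem mirror_loopless (h : M.Loopless) : M.mirror.Loopless := by
  intro d hd
  have hd' := mirror_origin.1 hd
  simp only [mirror, M.inv_inv] at hd'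
  exact h d hd'.symm

theorem mirror_visitsBoundary (h : M.PathVisitsBoundary) : M.mirror.PathVisitsBoundary := by
  intro d h1 h2
  obtain ⟨z, hz⟩ := h d (mirror_outer.1 h1) (fun h => h2 (mirror_outer.2 h))
  exact ⟨z, mirror_pathEnters.2 hz⟩

theorem mirror_isTP (h : M.IsTP) : M.mirror.IsTP := by
  obtain ⟨⟨h1, h2, h3, h4⟩, h5, h6⟩ := h
  exact ⟨⟨mirror_planar h1, mirror_nearTriangulation h2, mirror_loopless h3, mirror_simpleBoundary h4⟩,
    mirror_rootInterface h5, mirror_visitsBoundary h6⟩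

theorem mirror_leftEdges : M.mirror.leftEdges = M.rightEdges := by
  ext e
  exact exists_congr fun d => and_congr mirror_isLeft Iff.rfl

theorem mirror_rightEdges : M.mirror.rightEdges = M.leftEdges := by
  ext e
  exact exists_congr fun d => and_congr mirror_isRight Iff.rfl

theorem mirror_incident {d : M.Dart} {e : M.Edge} :
    M.mirror.Incident (M.mirror.face d) e ↔ M.Incident (M.face d) e :=
  exists_congr fun _ => and_congr mirror_face Iff.rfl

theorem mirror_isLastFace {d : M.Dart} (h : M.IsLastFace (M.face d)) :
    M.mirror.IsLastFace (M.mirror.face d) := by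
  obtain ⟨⟨e, he1, he2⟩, z, hz1, hz2⟩ := h
  refine ⟨⟨e, mirror_incident.2 he1, ?_⟩, z, mirror_pathEnters.2 hz1, ?_⟩
  · rw [mirror_leftEdges, mirror_rightEdges]
    exact he2.symm
  · intro z' f' h1 h2
    rw [mirror_pathStep_eq] at h1
    obtain ⟨d', rfl⟩ := face_surjective f'
    rintro ⟨e', h3, h4⟩
    rw [mirror_leftEdges, mirror_rightEdges] at h4
    exact hz2 z' (M.face d') h1 (mirror_pathEnters.1 h2) ⟨e', mirror_incident.1 h3, h4.symm⟩

/-! ### Closed walks bound in the sphere -/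

open Classical in
/-- The boundary, modulo `2`, of a set of edges. -/
noncomputable def edgeBoundary (M : PercMap) : (M.Edge → ZMod 2) →ₗ[ZMod 2] (M.Vertex → ZMod 2) :=
  letI := Fintype.ofFinite M.Dart
  { toFun := fun z v => ∑ y : M.Dart, if M.origin y = v then z (M.edge y) else 0
    map_add' := fun z z' => by
      funext v
      simp only [Pi.add_apply, ← Finset.sum_add_distrib]
      refine Finset.sum_congr rfl fun y _ => ?_
      split_ifs <;> simp
    map_smul' := fun k z => by
      funext v
      simp only [Pi.smul_apply, smul_eq_mul, RingHom.id_apply, Finset.mul_sum]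
      refine Finset.sum_congr rfl fun y _ => ?_
      split_ifs <;> simp }

/-- The boundary, modulo `2`, of a set of faces: the edges with exactly one side in the set. -/
noncomputable def faceBoundary (M : PercMap) : (M.Face → ZMod 2) →ₗ[ZMod 2] (M.Edge → ZMod 2) where
  toFun α := Quotient.lift (fun y => α (M.face y) + α (M.face (M.inv y))) fun x y h => by
    rcases edge_eq_iff.1 (edge_eq_iff_sameCycle.2 h) with rfl | rfl
    · rfl
    · rw [M.inv_inv, add_comm]
  map_add' α β := by
    funext e
    obtain ⟨y, rfl⟩ := edge_surjective e
    change (α _ + β _) + (α _ + β _) = (α _ + α _) + (β _ + β _)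
    ring
  map_smul' k α := by
    funext e
    obtain ⟨y, rfl⟩ := edge_surjective e
    change k * _ + k * _ = k * (_ + _)
    ring

theorem faceBoundary_edge (α : M.Face → ZMod 2) (y : M.Dart) :
    M.faceBoundary α (M.edge y) = α (M.face y) + α (M.face (M.inv y)) := rfl

theorem add_self_eq_zero_mod_two {ι : Type*} (f : ι → ZMod 2) : f + f = 0 :=
  funext fun i => CharTwo.add_self_eq_zero (f i)

theorem edgeBoundary_faceBoundary (α : M.Face → ZMod 2) : M.edgeBoundary (M.faceBoundary α) = 0 := by
  classical
  let _ := Fintype.ofFinite M.Dart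
  funext v
  change (∑ y : M.Dart, if M.origin y = v then M.faceBoundary α (M.edge y) else 0) = 0
  -- the two faces along a dart at `v` are seen from that dart and from the next dart at `v`
  have h : ∑ y : M.Dart, (if M.origin y = v then α (M.face (M.inv y)) else 0) =
      ∑ y : M.Dart, (if M.origin y = v then α (M.face y) else 0) := by
    refine Fintype.sum_equiv (M.inv.trans M.next) _ _ fun y => ?_
    simp only [Equiv.trans_apply, M.origin_next_inv, face_next]
  have h2 : ∀ y, (if M.origin y = v then M.faceBoundary α (M.edge y) else 0) =
      (if M.origin y = v then α (M.face y) else 0) +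
        (if M.origin y = v then α (M.face (M.inv y)) else 0) := by
    intro y
    rw [faceBoundary_edge]
    split_ifs <;> simp
  rw [Finset.sum_congr rfl fun y _ => h2 y, Finset.sum_add_distrib, h, CharTwo.add_self_eq_zero]

open Classical in
theorem edgeBoundary_single (c : M.Dart) :
    M.edgeBoundary (Pi.single (M.edge c) 1) =
      Pi.single (M.origin c) 1 + Pi.single (M.origin (M.inv c)) 1 := by
  let _ := Fintype.ofFinite M.Dart
  funext v
  change (∑ y : M.Dart, if M.origin y = v then (Pi.single (M.edge c) 1 : M.Edge → ZMod 2) (M.edge y)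
    else 0) = _
  rw [Fintype.sum_eq_add c (M.inv c) (M.inv_ne c).symm]
  · rw [edge_inv]
    simp only [Pi.single_eq_same, Pi.add_apply, Pi.single_apply, eq_comm]
  · rintro y ⟨h1, h2⟩
    have : M.edge y ≠ M.edge c := fun h => (edge_eq_iff.1 h).elim h1 h2
    simp [this]

theorem finrank_span_singleton_le_one {V : Type*} [AddCommGroup V] [Module (ZMod 2) V] (v : V) :
    Module.finrank (ZMod 2) (Submodule.span (ZMod 2) {v}) ≤ 1 := by
  have := finrank_span_le_card (R := ZMod 2) ({v} : Set V)
  simpa using this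

/-- In the sphere a closed walk separates the faces into two classes, such that exactly the edges that it
uses an odd number of times have sides in different classes.  Both the cycle space and the space of
boundaries of sets of faces have dimension `F - 1`, by connectedness and Euler's formula. -/
theorem Planar.exists_faceBoundary (h : M.Planar) {z : M.Edge → ZMod 2} (hz : M.edgeBoundary z = 0) :
    ∃ α, M.faceBoundary α = z := by
  classical
  let _ := Fintype.ofFinite M.Vertex
  let _ := Fintype.ofFinite M.Edge
  let _ := Fintype.ofFinite M.Face
  obtain ⟨hc, he⟩ := h
  rw [connected_iff] at hc
  have h1 := LinearMap.finrank_range_add_finrank_ker M.edgeBoundary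
  have h2 := LinearMap.finrank_range_add_finrank_ker M.faceBoundary
  rw [Module.finrank_fintype_fun_eq_card, ← Nat.card_eq_fintype_card] at h1 h2
  -- a set of faces without boundary is empty or contains all faces
  have h3 : Module.finrank (ZMod 2) (LinearMap.ker M.faceBoundary) ≤ 1 := by
    have : LinearMap.ker M.faceBoundary ≤ Submodule.span (ZMod 2) {fun _ => 1} := by
      intro α hα
      rw [Submodule.mem_span_singleton]
      refine ⟨α M.rootFace, ?_⟩
      funext f
      obtain ⟨y, rfl⟩ := face_surjective f
      have := hc (fun y => α (M.face y) = α M.rootFace) (fun y => ?_) (fun y => by rw [face_next])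
        y M.root
      · rw [Pi.smul_apply, smul_eq_mul, mul_one]
        have h4 : α (M.face y) = α M.rootFace := by
          rw [this]
          rfl
        exact h4.symm
      · have h4 := congrFun (LinearMap.mem_ker.1 hα) (M.edge y)
        rw [faceBoundary_edge, Pi.zero_apply, CharTwo.add_eq_zero] at h4
        rw [h4]
    exact (Submodule.finrank_mono this).trans ((finrank_span_singleton_le_one _))
  -- the vertices are all connected
  have h4 : Nat.card M.Vertex ≤ Module.finrank (ZMod 2) (LinearMap.range M.edgeBoundary) + 1 := by
    have htop : LinearMap.range M.edgeBoundary ⊔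
        Submodule.span (ZMod 2) {(Pi.single (M.origin M.root) 1 : M.Vertex → ZMod 2)} = ⊤ := by
      set W := LinearMap.range M.edgeBoundary ⊔
        Submodule.span (ZMod 2) {(Pi.single (M.origin M.root) 1 : M.Vertex → ZMod 2)} with hW
      have hmem : ∀ y, (Pi.single (M.origin y) 1 : M.Vertex → ZMod 2) ∈ W := by
        have hstep : ∀ y, ((Pi.single (M.origin (M.inv y)) 1 : M.Vertex → ZMod 2) ∈ W) =
            ((Pi.single (M.origin y) 1 : M.Vertex → ZMod 2) ∈ W) := by
          intro y
          have h5 : (Pi.single (M.origin y) 1 + Pi.single (M.origin (M.inv y)) 1 :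
              M.Vertex → ZMod 2) ∈ W := by
            rw [← edgeBoundary_single]
            exact Submodule.mem_sup_left ⟨_, rfl⟩
          exact propext ⟨fun h6 => (Submodule.add_mem_iff_left _ h6).1 h5,
            fun h6 => (Submodule.add_mem_iff_right _ h6).1 h5⟩
        intro y
        rw [hc (fun y => (Pi.single (M.origin y) 1 : M.Vertex → ZMod 2) ∈ W) hstep
          (fun y => by rw [origin_next, hstep]) y M.root]
        exact Submodule.mem_sup_right (Submodule.mem_span_singleton_self _)
      rw [eq_top_iff]
      intro β _
      have : β = ∑ v, β v • (Pi.single v 1 : M.Vertex → ZMod 2) := by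
        funext w
        simp [Finset.sum_apply, Pi.single_apply]
      rw [this]
      refine Submodule.sum_mem _ fun v _ => Submodule.smul_mem _ _ ?_
      obtain ⟨y, rfl⟩ := origin_surjective v
      exact hmem y
    have h5 := Submodule.finrank_add_le_finrank_add_finrank (LinearMap.range M.edgeBoundary)
      (Submodule.span (ZMod 2) {(Pi.single (M.origin M.root) 1 : M.Vertex → ZMod 2)})
    rw [htop, finrank_top, Module.finrank_fintype_fun_eq_card, ← Nat.card_eq_fintype_card] at h5
    exact h5.trans (Nat.add_le_add_left ((finrank_span_singleton_le_one _)) _)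
  have h5 : LinearMap.range M.faceBoundary ≤ LinearMap.ker M.edgeBoundary := by
    rintro _ ⟨α, rfl⟩
    exact edgeBoundary_faceBoundary α
  have h6 := Submodule.eq_of_le_of_finrank_le h5 (by omega)
  have h7 : z ∈ LinearMap.range M.faceBoundary := by
    rw [h6]
    exact hz
  exact h7

open Classical in
theorem edgeBoundary_segment (a : M.Dart) (m : ℕ) :
    M.edgeBoundary (∑ i ∈ Finset.range m, Pi.single (M.edge (M.next^[i] a)) 1) =
      Pi.single (M.origin a) 1 + Pi.single (M.origin (M.next^[m] a)) 1 := by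
  induction m with
  | zero =>
    simp only [Finset.range_zero, Finset.sum_empty, map_zero, Function.iterate_zero, id]
    exact (add_self_eq_zero_mod_two _).symm
  | succ m ih =>
    rw [Finset.sum_range_succ, map_add, ih, edgeBoundary_single, Function.iterate_succ_apply', origin_next,
      add_assoc, ← add_assoc (Pi.single (M.origin (M.next^[m] a)) 1), add_self_eq_zero_mod_two, zero_add]

/-! ### Chords -/

/-- An edge with the root-face on both sides is the root-edge: then the root-face has degree `2`. -/
theorem SimpleBoundary.eq_root (h : M.SimpleBoundary) {d : M.Dart} (h1 : M.Outer d)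
    (h2 : M.Outer (M.inv d)) : M.root = d ∨ M.root = M.inv d := by
  have e1 : M.next d = M.inv d := h _ _ (outer_next.2 h1) h2 (origin_next d)
  have e2 : M.next (M.inv d) = d := h _ _ (outer_next.2 h2) h1 (M.origin_next_inv d)
  have := apply_eq_of_face_eq (fun y => y = d ∨ y = M.inv d) (fun y => by
    have key : ∀ a b : M.Dart, M.next a = M.next b → a = b := fun _ _ h => M.next.injective h
    grind) h1
  have h3 : d = d ∨ d = M.inv d := Or.inl rfl
  rw [this] at h3
  exact h3

/-- An edge that joins two outer vertices is an outer edge or is crossed by the percolation path: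
otherwise this edge and the part of the outer boundary between its ends that avoids the root-edge form a
closed walk, which the path can cross only in the top-edge.  The path would then be unable to return to
the root-face, or to visit the triangle of a left or right edge of the walk. -/
theorem IsTP.chord (h : M.IsTP) {c d1 d2 : M.Dart} (ho1 : M.Outer d1) (ho2 : M.Outer d2)
    (h1 : M.origin d1 = M.origin c) (h2 : M.origin d2 = M.origin (M.inv c)) :
    M.Outer c ∨ M.Outer (M.inv c) ∨ M.OnPath c ∨ M.OnPath (M.inv c) := by
  classical
  obtain ⟨⟨hP, hT, hL, hS⟩, hR, hV⟩ := h
  -- the boundary is numbered from `b`, so that the root comes last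
  set b := M.next M.root with hb
  have hbo : M.Outer b := outer_next.2 outer_root
  set l := Function.minimalPeriod M.next b with hl
  have hper : b ∈ Function.periodicPts M.next := by
    obtain ⟨i, hi, hi2⟩ := M.next.injective.mem_periodicPts b
    exact ⟨i, hi, hi2⟩
  have hlpos : 0 < l := Function.minimalPeriod_pos_of_mem_periodicPts hper
  have hinj : ∀ i j, i < l → j < l → M.next^[i] b = M.next^[j] b → i = j := fun i j hi hj hij =>
    Function.iterate_injOn_Iio_minimalPeriod hi hj hij
  have hlast : M.next^[l - 1] b = M.root := by
    apply M.next.injective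
    rw [← Function.iterate_succ_apply' M.next, ← hb, Nat.succ_eq_add_one, Nat.sub_add_cancel hlpos]
    exact Function.iterate_minimalPeriod
  have hindex : ∀ y, M.Outer y → ∃ i < l, M.next^[i] b = y := by
    intro y hy
    obtain ⟨i, hi⟩ := hbo.exists_iterate hy
    exact ⟨i % l, Nat.mod_lt _ hlpos, by rw [Function.iterate_mod_minimalPeriod_eq, hi]⟩
  have hout : ∀ i, M.Outer (M.next^[i] b) := by
    intro i
    induction i with
    | zero => exact hbo
    | succ n ih =>
      rw [Function.iterate_succ_apply']
      exact outer_next.2 ih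
  -- the order of the two ends along the boundary does not matter
  suffices H : ∀ (c : M.Dart) (p q : ℕ), p < q → q < l → M.origin (M.next^[p] b) = M.origin c →
      M.origin (M.next^[q] b) = M.origin (M.inv c) →
      M.Outer c ∨ M.Outer (M.inv c) ∨ M.OnPath c ∨ M.OnPath (M.inv c) by
    obtain ⟨p, hp, rfl⟩ := hindex d1 ho1
    obtain ⟨q, hq, rfl⟩ := hindex d2 ho2
    rcases lt_trichotomy p q with hpq | hpq | hpq
    · exact H c p q hpq hq h1 h2
    · subst hpq
      exact absurd (h1.symm.trans h2) (hL c)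
    · have := H (M.inv c) q p hpq hp h2 (by rw [M.inv_inv, h1])
      rw [M.inv_inv] at this
      tauto
  clear h1 h2 ho1 ho2
  intro c p q hpq hq h1 h2
  by_contra! hcon
  obtain ⟨hc1, hc2, hc3, hc4⟩ := hcon
  obtain ⟨m, rfl⟩ := Nat.exists_eq_add_of_le hpq.le
  set a := M.next^[p] b with ha
  have hseg : ∀ i, M.next^[i] a = M.next^[p + i] b := fun i => by
    rw [ha, ← Function.iterate_add_apply, add_comm]
  have hso : ∀ i, M.Outer (M.next^[i] a) := fun i => by
    rw [hseg]
    exact hout _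
  have hsr : ∀ i < m, M.next^[i] a ≠ M.root := by
    intro i hi e
    rw [hseg, ← hlast] at e
    have := hinj _ _ (by omega) (by omega) e
    omega
  -- the closed walk: the edge of `c`, and the boundary from `p` to `q`, which avoids the root
  set z : M.Edge → ZMod 2 :=
    Pi.single (M.edge c) 1 + ∑ i ∈ Finset.range m, Pi.single (M.edge (M.next^[i] a)) 1 with hz
  have hzb : M.edgeBoundary z = 0 := by
    rw [hz, map_add, edgeBoundary_single, edgeBoundary_segment, h1, hseg m, h2]
    exact add_self_eq_zero_mod_two _
  obtain ⟨α, hα⟩ := hP.exists_faceBoundary hzb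
  have hzval : ∀ y, α (M.face y) + α (M.face (M.inv y)) = z (M.edge y) := fun y => by
    rw [← hα, faceBoundary_edge]
  have hz0 : ∀ y, y ≠ c → y ≠ M.inv c → (∀ i < m, M.next^[i] a ≠ y ∧ M.next^[i] a ≠ M.inv y) →
      z (M.edge y) = 0 := by
    intro y hy1 hy2 hy3
    have e1 : M.edge y ≠ M.edge c := fun e => (edge_eq_iff.1 e).elim hy1 hy2
    rw [hz, Pi.add_apply, Pi.single_apply, if_neg e1, zero_add, Finset.sum_apply]
    refine Finset.sum_eq_zero fun i hi => ?_
    have := hy3 i (Finset.mem_range.1 hi)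
    rw [Pi.single_apply, if_neg]
    intro e
    rw [eq_comm, edge_eq_iff] at e
    exact e.elim this.1 this.2
  have hz1 : ∀ k < m, (∀ i < m, M.next^[i] a ≠ M.inv (M.next^[k] a)) →
      z (M.edge (M.next^[k] a)) = 1 := by
    intro k hk hk2
    have e1 : M.edge (M.next^[k] a) ≠ M.edge c := by
      intro e
      rcases edge_eq_iff.1 e with e | e
      · exact hc1 (e ▸ hso k)
      · exact hc2 (e ▸ hso k)
    rw [hz, Pi.add_apply, Pi.single_apply, if_neg e1, zero_add, Finset.sum_apply,
      Finset.sum_eq_single_of_mem k (Finset.mem_range.2 hk)]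
    · rw [Pi.single_eq_same]
    · intro i hi hik
      have hi := Finset.mem_range.1 hi
      rw [Pi.single_apply, if_neg]
      intro e
      rw [eq_comm, edge_eq_iff] at e
      rcases e with e | e
      · rw [hseg, hseg] at e
        exact hik (by have := hinj _ _ (by omega) (by omega) e; omega)
      · exact hk2 i hi e
  -- the path does not cross the walk before it returns to the root-face
  have hcross : ∀ y, M.OnPath y → ¬ M.Outer (M.inv y) → z (M.edge y) = 0 := by
    intro y hy hyo
    refine hz0 y (fun e => hc3 (e ▸ hy)) (fun e => hc4 (e ▸ hy)) fun i hi => ⟨fun e => ?_, fun e => ?_⟩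
    · exact hsr i hi (e.trans (hR.2 y (e ▸ hso i) (hR.onPath_goes hy)))
    · exact hyo (e ▸ hso i)
  -- so the path stays on the same side of the walk as the root-face
  have hside : ∀ y, M.OnPath y → α (M.face y) = α M.rootFace := by
    intro y hy
    induction hy with
    | refl => rfl
    | @tail y' _ h3 h4 ih =>
      have h5 := hzval y'
      rw [hcross _ h3 h4.1, CharTwo.add_eq_zero, ih] at h5
      rw [h4.2.1, h5]
  have hside' : ∀ y, M.OnPath y → ¬ M.Outer (M.inv y) → α (M.face (M.inv y)) = α M.rootFace := by
    intro y hy hyo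
    have h5 := hzval y
    rw [hcross y hy hyo, CharTwo.add_eq_zero, hside y hy] at h5
    exact h5.symm
  obtain ⟨t, ht⟩ := hR.exists_top
  have htt := (ht t).2 rfl
  by_cases htop : ∃ k < m, M.next^[k] a = t
  · -- the last crossing, at the top-edge, would bring the path to the other side
    obtain ⟨k, hk, e⟩ := htop
    have h5 := hz1 k hk (fun i hi e2 => hsr i hi (hR.2 _ (hso i) (by
      rw [e2, e, goes_inv]
      exact htt.2)))
    rw [← hzval, e, hside _ (onPath_top hT hR htt), show M.face t = M.rootFace from htt.1,
      CharTwo.add_self_eq_zero] at h5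
    exact absurd h5 (by decide)
  · -- the first edge of the segment is a left or right edge: its triangle is on the other side
    push Not at htop
    have hm : 0 < m := by omega
    have hao : ¬ M.Outer (M.inv a) := by
      intro hao
      rcases hS.eq_root (hso 0) hao with e | e
      · exact hsr 0 hm e.symm
      · refine htop 0 hm ((ht _).1 ⟨hso 0, ?_⟩)
        rw [← goes_inv]
        exact e ▸ hR.1
    have h5 := hz1 0 hm (fun i hi e2 => hao (by
      have := hso i
      rwa [e2] at this))
    obtain ⟨y, hy1, hy2, hy3⟩ := hV a (hso 0) hao
    have h6 := hside' y hy1 (fun h => hao (outer_of_face_eq hy3 h))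
    have h7 := hzval a
    rw [← hy3, h6, show M.face a = M.rootFace from hso 0, CharTwo.add_self_eq_zero] at h7
    exact absurd (h7.trans h5) (by decide)

/-- The origin of the dart is incident to the root-face. -/
def OuterVertex (M : PercMap) (y : M.Dart) : Prop := ∃ d, M.Outer d ∧ M.origin d = M.origin y

theorem Outer.outerVertex {y : M.Dart} (h : M.Outer y) : M.OuterVertex y := ⟨y, h, rfl⟩

theorem OuterVertex.of_origin_eq {y z : M.Dart} (h : M.OuterVertex y) (e : M.origin y = M.origin z) :
    M.OuterVertex z := by
  obtain ⟨d, h1, h2⟩ := h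
  exact ⟨d, h1, h2.trans e⟩

theorem Outer.outerVertex_inv {y : M.Dart} (h : M.Outer y) : M.OuterVertex (M.inv y) :=
  ⟨M.next y, outer_next.2 h, origin_next y⟩

/-- A bicolor edge joining two outer vertices is on the percolation path. -/
theorem IsTP.onPath_of_outerVertex (h : M.IsTP) {c : M.Dart} (hc : M.Goes .white .black c)
    (h1 : M.OuterVertex c) (h2 : M.OuterVertex (M.inv c)) : M.OnPath c := by
  obtain ⟨d1, h3, h4⟩ := h1
  obtain ⟨d2, h5, h6⟩ := h2
  rcases h.chord h3 h5 h4 h6 with h7 | h7 | h7 | h7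
  · rw [h.2.1.2 c h7 hc]
    exact Relation.ReflTransGen.refl
  · have := onPath_top h.1.2.1 h.2.1 ⟨h7, goes_inv.2 hc⟩
    rwa [M.inv_inv] at this
  · exact h7
  · have := goes_inv.1 (h.2.1.onPath_goes h7)
    exact absurd (hc.1.symm.trans this.1) (by decide)

/-- A unicolor edge joining two outer vertices is an outer edge. -/
theorem IsTP.outer_of_outerVertex (h : M.IsTP) {c : M.Dart} (hc : M.color c = M.color (M.inv c))
    (h1 : M.OuterVertex c) (h2 : M.OuterVertex (M.inv c)) : M.Outer c ∨ M.Outer (M.inv c) := by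
  obtain ⟨d1, h3, h4⟩ := h1
  obtain ⟨d2, h5, h6⟩ := h2
  rcases h.chord h3 h5 h4 h6 with h7 | h7 | h7 | h7
  · exact Or.inl h7
  · exact Or.inr h7
  · have := h.2.1.onPath_goes h7
    rw [this.1, this.2] at hc
    exact absurd hc (by decide)
  · have := goes_inv.1 (h.2.1.onPath_goes h7)
    rw [this.1, this.2] at hc
    exact absurd hc (by decide)

/-! ### Gluing two consecutive edges -/

/-- The map `N` is obtained from `M` by gluing together the edges of `d` and `next d`; the function `ζ`
sends each dart of `M` to the dart of `N` that it becomes.  Colors are not considered. -/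
structure IsZip (M N : PercMap) (d : M.Dart) (ζ : M.Dart → N.Dart) : Prop where
  can : M.CanZip d
  surj : ∀ x, ∃ y, (y ≠ d ∧ y ≠ M.next d) ∧ ζ y = x
  inj : ∀ y z, (y ≠ d ∧ y ≠ M.next d) → (z ≠ d ∧ z ≠ M.next d) → ζ y = ζ z → y = z
  map_self : ζ d = ζ (M.inv (M.next d))
  map_next_self : ζ (M.next d) = ζ (M.inv d)
  map_inv : ∀ y, N.inv (ζ y) = ζ (M.inv y)
  next_of_ne : ∀ y, (y ≠ d ∧ y ≠ M.next d) → M.next y ≠ d → N.next (ζ y) = ζ (M.next y)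
  next_of_eq : ∀ y, M.next y = d → N.next (ζ y) = ζ (M.next (M.next d))
  map_root : N.root = ζ M.root

theorem isZip_zip (d : M.Dart) (h : M.CanZip d) (col : M.Dart → Color)
    (hcol : ∀ y, col (M.next (M.inv y)) = col y) (hends : col d = col (M.inv (M.next d))) :
    IsZip M (M.zip d h col hcol hends) d (M.zipDart d h) := by
  have hi := M.inv_inv
  have hi2 := M.inv_ne
  have h1 := h.next_ne
  have h2 := h.next_next_ne
  have h3 := h.inv_ne_next
  have key : ∀ a b : M.Dart, M.next a = M.next b → a = b := fun _ _ h => M.next.injective h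
  have hz : ∀ y : M.Dart, (y ≠ d ∧ y ≠ M.next d) → (M.zipDart d h y).1 = y := by
    rintro y ⟨h4, h5⟩
    simp [zipDart, h4, h5]
  refine ⟨h, ?_, ?_, ?_, ?_, ?_, ?_, ?_, ?_⟩
  · rintro ⟨y, hy⟩
    exact ⟨y, hy, Subtype.ext (hz y hy)⟩
  · intro y z hy hz' e
    rw [← hz y hy, ← hz z hz', e]
  · apply Subtype.ext
    simp only [zipDart]
    grind
  · apply Subtype.ext
    simp only [zipDart]
    grind
  · intro y
    change M.zipInv d h _ = _
    apply Subtype.ext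
    simp only [zipInv, zipDart]
    grind
  · rintro y hy h5
    change M.zipNext d h _ = _
    rw [show M.zipDart d h y = ⟨y, hy⟩ from Subtype.ext (hz y hy)]
    apply Subtype.ext
    simp only [zipNext, dif_neg h5]
    rw [hz _ ⟨h5, fun e => hy.1 (key _ _ e)⟩]
  · intro y hy
    change M.zipNext d h _ = _
    have hy2 : y ≠ d ∧ y ≠ M.next d := by grind
    rw [show M.zipDart d h y = ⟨y, hy2⟩ from Subtype.ext (hz y hy2)]
    apply Subtype.ext
    simp only [zipNext, dif_pos hy]
    rw [hz _ ⟨h2, fun e => h1 (key _ _ e)⟩]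
  · exact Subtype.ext (hz _ ⟨h.root_ne, h.root_ne_next⟩).symm

namespace IsZip

variable {d : M.Dart} {ζ : M.Dart → N.Dart}

theorem mirror (h : IsZip M N d ζ) : IsZip M.mirror N.mirror (M.next d) ζ := by
  have h1 := h.can.next_ne
  have h2 := h.can.next_next_ne
  have h3 := h.can.inv_ne_next
  have hs : M.next.symm (M.next d) = d := M.next.symm_apply_apply d
  refine ⟨⟨?_, ?_, ?_, h.can.root_ne_next, ?_⟩, ?_, ?_, ?_, ?_, h.map_inv, ?_, ?_, h.map_root⟩
  · simp only [PercMap.mirror, hs]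
    exact h1.symm
  · simp only [PercMap.mirror, hs]
    rw [ne_eq, Equiv.symm_apply_eq]
    exact h2.symm
  · simp only [PercMap.mirror, hs]
    exact fun e => h3 (inv_eq_iff.2 e.symm)
  · simp only [PercMap.mirror, hs]
    exact h.can.root_ne
  · simp only [PercMap.mirror, hs]
    intro x
    obtain ⟨y, hy, e⟩ := h.surj x
    exact ⟨y, hy.symm, e⟩
  · simp only [PercMap.mirror, hs]
    intro y z hy hz
    exact h.inj y z hy.symm hz.symm
  · simp only [PercMap.mirror, hs]
    exact h.map_next_self
  · simp only [PercMap.mirror, hs]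
    exact h.map_self
  · simp only [PercMap.mirror, hs]
    intro y hy h4
    rw [Equiv.symm_apply_eq]
    have h5 : M.next (M.next.symm y) = y := M.next.apply_symm_apply y
    rw [h.next_of_ne (M.next.symm y) ⟨fun e => ?_, h4⟩ (by rw [h5]; exact hy.2), h5]
    rw [e] at h5
    exact hy.1 h5.symm
  · simp only [PercMap.mirror, hs]
    intro y hy
    rw [Equiv.symm_apply_eq] at hy
    rw [Equiv.symm_apply_eq, h.next_of_eq _ (M.next.apply_symm_apply d), hy]

theorem ne_of_not_outer (_ : IsZip M N d ζ) (ho : M.Outer d) {y : M.Dart} (hy : ¬ M.Outer y) :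
    y ≠ d ∧ y ≠ M.next d :=
  ⟨fun e => hy (e ▸ ho), fun e => hy (e ▸ outer_next.2 ho)⟩

theorem next_of_not_outer (h : IsZip M N d ζ) (ho : M.Outer d) {y : M.Dart} (hy : ¬ M.Outer y) :
    N.next (ζ y) = ζ (M.next y) :=
  h.next_of_ne y (h.ne_of_not_outer ho hy) fun e => hy (by rw [← outer_next, e]; exact ho)

theorem face_eq (h : IsZip M N d ζ) {y z : M.Dart} (hy : y ≠ d ∧ y ≠ M.next d)
    (hz : z ≠ d ∧ z ≠ M.next d) : N.face (ζ y) = N.face (ζ z) ↔ M.face y = M.face z := by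
  classical
  constructor
  · intro e
    choose ι hι1 hι2 using h.surj
    have hι : ∀ y, (y ≠ d ∧ y ≠ M.next d) → ι (ζ y) = y := fun y hy => h.inj _ _ (hι1 _) hy (hι2 _)
    have := apply_eq_of_face_eq (fun x => M.face (ι x)) (fun x => by
      obtain ⟨y, hy, rfl⟩ := h.surj x
      by_cases h1 : M.next y = d
      · rw [h.next_of_eq y h1, hι y hy, hι _ ⟨h.can.next_next_ne, fun e => h.can.next_ne (M.next.injective e)⟩,
          face_next, face_next, ← h1, face_next]
      · rw [h.next_of_ne y hy h1, hι y hy, hι _ ⟨h1, fun e => hy.1 (M.next.injective e)⟩, face_next]) e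
    rwa [hι y hy, hι z hz] at this
  · intro e
    -- the removed darts are retracted to the next dart that remains
    have hn : M.next (M.next d) ≠ d ∧ M.next (M.next d) ≠ M.next d :=
      ⟨h.can.next_next_ne, fun e => h.can.next_ne (M.next.injective e)⟩
    have := apply_eq_of_face_eq
      (fun y => if y = d ∨ y = M.next d then N.face (ζ (M.next (M.next d))) else N.face (ζ y))
      (fun y => by
        have key : ∀ a b : M.Dart, M.next a = M.next b → a = b := fun _ _ h => M.next.injective h
        by_cases h1 : y = d
        · simp [h1]
        by_cases h2 : y = M.next d
        · simp [h2, hn]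
        by_cases h3 : M.next y = d
        · simp [h3, h1, h2, ← h.next_of_eq y h3]
        · have h4 : M.next y ≠ M.next d := fun e => h1 (key _ _ e)
          simp [h3, h4, h1, h2, ← h.next_of_ne y ⟨h1, h2⟩ h3]) e
    simpa [hy.1, hy.2, hz.1, hz.2] using this

theorem outer (h : IsZip M N d ζ) {y : M.Dart} (hy : y ≠ d ∧ y ≠ M.next d) :
    N.Outer (ζ y) ↔ M.Outer y := by
  unfold Outer rootFace
  rw [h.map_root, h.face_eq hy ⟨h.can.root_ne, h.can.root_ne_next⟩]

/-- Darts with the same origin keep this property.  The vertex at the origin of `d` needs the hypothesis that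
it is not the end of `next d`. -/
theorem origin_of_eq (h : IsZip M N d ζ) (hne : M.origin d ≠ M.origin (M.inv (M.next d))) {y z : M.Dart}
    (e : M.origin y = M.origin z) : N.origin (ζ y) = N.origin (ζ z) := by
  classical
  have hC : ∀ y, M.next (M.inv y) = d → N.origin (ζ y) = N.origin (ζ (M.next (M.next d))) := by
    intro y hy
    rw [← h.next_of_eq _ hy, origin_next, h.map_inv, M.inv_inv]
  have hD : ∀ y, M.inv y ≠ M.next d → M.next (M.inv y) ≠ d →
      N.origin (ζ (M.next (M.inv y))) = N.origin (ζ y) := by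
    intro y h1 h2
    by_cases h3 : M.inv y = d
    · rw [h3, h.map_next_self, ← h3, M.inv_inv]
    · rw [← h.next_of_ne _ ⟨h3, h1⟩ h2, origin_next, h.map_inv, M.inv_inv]
  -- turning around the origin of `d`, starting from `d`, one finally reaches the origin of
  -- `next (next d)`
  have key : N.origin (ζ d) = N.origin (ζ (M.next (M.next d))) := by
    set s := M.next * M.inv with hs
    set k := Function.minimalPeriod s d with hk
    have hper : d ∈ Function.periodicPts s := by
      obtain ⟨i, hi, hi2⟩ := s.injective.mem_periodicPts d
      exact ⟨i, hi, hi2⟩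
    have hkpos : 0 < k := Function.minimalPeriod_pos_of_mem_periodicPts hper
    have horig : ∀ i, M.origin (s^[i] d) = M.origin d := by
      intro i
      induction i with
      | zero => rfl
      | succ i ih =>
        rw [Function.iterate_succ_apply', ← ih]
        exact M.origin_next_inv _
    have hi : ∀ i, i < k → N.origin (ζ (s^[i] d)) = N.origin (ζ d) := by
      intro i
      induction i with
      | zero => exact fun _ => rfl
      | succ i ih =>
        intro hik
        rw [← ih (by omega), Function.iterate_succ_apply']
        refine hD _ (fun e => hne ?_) (fun e => ?_)
        · rw [← horig i, ← inv_eq_iff.1 e]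
        · have := Function.not_isPeriodicPt_of_pos_of_lt_minimalPeriod (f := s) (x := d) (n := i + 1)
            (by omega) hik
          refine this ?_
          unfold Function.IsPeriodicPt Function.IsFixedPt
          rw [Function.iterate_succ_apply']
          exact e
    rw [← hi (k - 1) (by omega)]
    refine hC _ ?_
    have h2 : s^[k - 1 + 1] d = d := by
      rw [Nat.sub_add_cancel hkpos]
      exact Function.iterate_minimalPeriod
    rwa [Function.iterate_succ_apply'] at h2
  refine apply_eq_of_origin_eq (fun y => N.origin (ζ y)) (fun y => ?_) e
  by_cases h1 : M.inv y = M.next d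
  · rw [h1, ← key, h.map_self, ← h1, M.inv_inv]
  · by_cases h2 : M.next (M.inv y) = d
    · rw [h2, hC y h2, key]
    · exact hD y h1 h2

/-- Gluing merges the origin of `d` and the end of `next d`, and no other vertices. -/
theorem origin_eq (h : IsZip M N d ζ) (hne : M.origin d ≠ M.origin (M.inv (M.next d))) {y z : M.Dart} :
    N.origin (ζ y) = N.origin (ζ z) ↔ M.origin y = M.origin z ∨
      (M.origin y = M.origin d ∨ M.origin y = M.origin (M.inv (M.next d))) ∧
      (M.origin z = M.origin d ∨ M.origin z = M.origin (M.inv (M.next d))) := by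
  classical
  have hself : N.origin (ζ d) = N.origin (ζ (M.inv (M.next d))) := by rw [h.map_self]
  constructor
  · intro e
    choose ι hι1 hι2 using h.surj
    have hι : ∀ y, (y ≠ d ∧ y ≠ M.next d) → ι (ζ y) = y := fun y hy => h.inj _ _ (hι1 _) hy (hι2 _)
    -- the vertex of `M`, with the two merged vertices identified
    set g : M.Dart → M.Vertex := fun y =>
      if M.origin y = M.origin d then M.origin (M.inv (M.next d)) else M.origin y with hg
    have hg0 : ∀ {y z}, M.origin y = M.origin z → g y = g z := fun {y z} e => by rw [hg]; simp only [e]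
    have hg1 : g d = g (M.inv (M.next d)) := by simp [hg]
    have hgι : ∀ y, g (ι (ζ y)) = g y := by
      intro y
      by_cases h1 : y = d
      · rw [h1, h.map_self, hι _ ⟨fun e => h.can.inv_ne_next (inv_eq_iff.2 e.symm), M.inv_ne _⟩, hg1]
      by_cases h2 : y = M.next d
      · rw [h2, h.map_next_self, hι _ ⟨M.inv_ne _, h.can.inv_ne_next⟩]
        exact hg0 (origin_next d).symm
      · rw [hι y ⟨h1, h2⟩]
    have hnext : ∀ y, (y ≠ d ∧ y ≠ M.next d) → g (ι (N.next (ζ y))) = g (M.inv y) := by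
      intro y hy
      by_cases h1 : M.next y = d
      · rw [h.next_of_eq y h1, hgι, hg0 (origin_next _), ← hg1]
        exact hg0 (by rw [← h1, origin_next])
      · rw [h.next_of_ne y hy h1, hgι]
        exact hg0 (origin_next y)
    have := apply_eq_of_origin_eq (fun x => g (ι x)) (fun x => by
      obtain ⟨y, hy, rfl⟩ := h.surj x
      rw [h.map_inv, hι y hy]
      by_cases h1 : M.inv y = d
      · rw [h1, h.map_self, hnext _ ⟨fun e => h.can.inv_ne_next (inv_eq_iff.2 e.symm), M.inv_ne _⟩,
          M.inv_inv, hg0 (origin_next d), ← h1, M.inv_inv]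
      by_cases h2 : M.inv y = M.next d
      · rw [h2, h.map_next_self, hnext _ ⟨M.inv_ne _, h.can.inv_ne_next⟩, M.inv_inv, hg1, ← h2,
          M.inv_inv]
      · rw [hnext _ ⟨h1, h2⟩, M.inv_inv]) e
    rw [hgι, hgι] at this
    simp only [hg] at this
    split_ifs at this with h1 h2 h2
    · exact Or.inl (h1.trans h2.symm)
    · exact Or.inr ⟨Or.inl h1, Or.inr this.symm⟩
    · exact Or.inr ⟨Or.inr this, Or.inl h2⟩
    · exact Or.inl this
  · rintro (e | ⟨e1 | e1, e2 | e2⟩)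
    · exact h.origin_of_eq hne e
    · exact h.origin_of_eq hne (e1.trans e2.symm)
    · rw [h.origin_of_eq hne e1, h.origin_of_eq hne e2, hself]
    · rw [h.origin_of_eq hne e1, h.origin_of_eq hne e2, hself]
    · exact h.origin_of_eq hne (e1.trans e2.symm)

end IsZip

/-! ### Counting -/

/-- A map that becomes a bijection when one element is removed from its domain. -/
theorem card_eq_succ {A B : Type*} [Finite A] (F : A → B) (a : A) (hs : ∀ b, ∃ x, x ≠ a ∧ F x = b)
    (hi : ∀ x y, x ≠ a → y ≠ a → F x = F y → x = y) : Nat.card A = Nat.card B + 1 := by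
  have h1 : Nat.card {x // x ≠ a} = Nat.card B :=
    Nat.card_congr (Equiv.ofBijective (fun x => F x.1)
      ⟨fun x y e => Subtype.ext (hi x y x.2 y.2 e), fun b => by
        obtain ⟨x, h1, h2⟩ := hs b
        exact ⟨⟨x, h1⟩, h2⟩⟩)
  have h2 := Set.ncard_add_ncard_compl ({a} : Set A)
  rw [Set.ncard_singleton] at h2
  have h3 : ({a}ᶜ : Set A).ncard = Nat.card {x // x ≠ a} := (Nat.card_coe_set_eq _).symm
  omega

theorem card_dart (M : PercMap) : Nat.card M.Dart = 2 * Nat.card M.Edge := by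
  classical
  let _ := Fintype.ofFinite M.Edge
  rw [Nat.card_congr (Equiv.sigmaFiberEquiv M.edge).symm, Nat.card_sigma]
  have : ∀ e : M.Edge, Nat.card {y // M.edge y = e} = 2 := by
    intro e
    obtain ⟨y, rfl⟩ := edge_surjective e
    have h1 : {z | M.edge z = M.edge y} = {y, M.inv y} := by
      ext z
      simp [edge_eq_iff]
    have h2 := Set.ncard_pair (M.inv_ne y).symm
    rw [← h1] at h2
    exact h2
  rw [Finset.sum_congr rfl fun e _ => this e, Finset.sum_const, Finset.card_univ, smul_eq_mul, mul_comm,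
    Nat.card_eq_fintype_card]

namespace IsZip

variable {d : M.Dart} {ζ : M.Dart → N.Dart}

theorem card_dart (h : IsZip M N d ζ) : Nat.card M.Dart = Nat.card N.Dart + 2 := by
  have h1 : Nat.card {y // y ≠ d ∧ y ≠ M.next d} = Nat.card N.Dart :=
    Nat.card_congr (Equiv.ofBijective (fun y => ζ y.1)
      ⟨fun x y e => Subtype.ext (h.inj x y x.2 y.2 e), fun b => by
        obtain ⟨x, h1, h2⟩ := h.surj b
        exact ⟨⟨x, h1⟩, h2⟩⟩)
  have h2 := Set.ncard_add_ncard_compl ({d, M.next d} : Set M.Dart)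
  rw [Set.ncard_pair h.can.next_ne.symm] at h2
  have h3 : ({d, M.next d}ᶜ : Set M.Dart) = {y | y ≠ d ∧ y ≠ M.next d} := by
    ext y
    simp
  rw [h3] at h2
  have h4 : ({y | y ≠ d ∧ y ≠ M.next d} : Set M.Dart).ncard = Nat.card {y // y ≠ d ∧ y ≠ M.next d} :=
    (Nat.card_coe_set_eq _).symm
  omega

theorem card_edge (h : IsZip M N d ζ) : Nat.card M.Edge = Nat.card N.Edge + 1 := by
  have h1 := h.card_dart
  rw [PercMap.card_dart, PercMap.card_dart] at h1
  omega

theorem card_vertex (h : IsZip M N d ζ) (hne : M.origin d ≠ M.origin (M.inv (M.next d))) :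
    Nat.card M.Vertex = Nat.card N.Vertex + 1 := by
  have hlift : ∀ y z, (M.next * M.inv).SameCycle y z → N.origin (ζ y) = N.origin (ζ z) :=
    fun y z e => h.origin_of_eq hne (origin_eq_iff.2 e)
  refine card_eq_succ (Quotient.lift (fun y => N.origin (ζ y)) hlift) (M.origin d) ?_ ?_
  · intro v
    obtain ⟨x, rfl⟩ := origin_surjective v
    obtain ⟨y, -, rfl⟩ := h.surj x
    by_cases h1 : M.origin y = M.origin d
    · exact ⟨M.origin (M.inv (M.next d)), hne.symm, (h.origin_eq hne).2 (Or.inr ⟨Or.inr rfl, Or.inl h1⟩)⟩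
    · exact ⟨M.origin y, h1, rfl⟩
  · intro v w hv hw e
    obtain ⟨y, rfl⟩ := origin_surjective v
    obtain ⟨z, rfl⟩ := origin_surjective w
    rcases (h.origin_eq hne).1 e with e1 | ⟨e1 | e1, e2 | e2⟩
    · exact e1
    · exact absurd e1 hv
    · exact absurd e1 hv
    · exact absurd e2 hw
    · exact e1.trans e2.symm

theorem card_face (h : IsZip M N d ζ) : Nat.card M.Face = Nat.card N.Face := by
  choose ι hι1 hι2 using h.surj
  refine (card_quotient_eq _ _ ι (fun x y => ?_) fun y => ?_).symm
  · refine face_eq_iff.symm.trans (Iff.trans ?_ face_eq_iff)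
    rw [← h.face_eq (hι1 _) (hι1 _), hι2, hι2]
  · have hn : M.next (M.next d) ≠ d ∧ M.next (M.next d) ≠ M.next d :=
      ⟨h.can.next_next_ne, fun e => h.can.next_ne (M.next.injective e)⟩
    have hsurj : ∀ z, (z ≠ d ∧ z ≠ M.next d) → ι (ζ z) = z := fun z hz => h.inj _ _ (hι1 _) hz (hι2 _)
    have h0 : ∃ a, M.face (ι a) = M.face y := by
      by_cases h1 : y = d
      · exact ⟨ζ (M.next (M.next d)), by rw [hsurj _ hn, h1, face_next, face_next]⟩
      by_cases h2 : y = M.next d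
      · exact ⟨ζ (M.next (M.next d)), by rw [hsurj _ hn, h2, face_next]⟩
      · exact ⟨ζ y, by rw [hsurj _ ⟨h1, h2⟩]⟩
    obtain ⟨a, ha⟩ := h0
    exact ⟨a, face_eq_iff.1 ha⟩

theorem connected (h : IsZip M N d ζ) (hne : M.origin d ≠ M.origin (M.inv (M.next d))) :
    (∀ f : M.Dart → Prop, (∀ y, f (M.inv y) = f y) → (∀ y, f (M.next y) = f y) → ∀ x y, f x = f y) ↔
    (∀ f : N.Dart → Prop, (∀ y, f (N.inv y) = f y) → (∀ y, f (N.next y) = f y) → ∀ x y, f x = f y) := by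
  constructor
  · intro hM f h1 h2 x y
    obtain ⟨x, -, rfl⟩ := h.surj x
    obtain ⟨y, -, rfl⟩ := h.surj y
    have h3 : ∀ y, f (ζ (M.inv y)) = f (ζ y) := fun y => by rw [← h.map_inv, h1]
    refine hM (fun y => f (ζ y)) h3 (fun y => ?_) x y
    rw [← h3 y]
    exact apply_eq_of_origin_eq f (fun x => by rw [h2, h1]) (h.origin_of_eq hne (origin_next y))
  · intro hN f h1 h2
    choose ι hι1 hι2 using h.surj
    have hι : ∀ y, (y ≠ d ∧ y ≠ M.next d) → ι (ζ y) = y := fun y hy => h.inj _ _ (hι1 _) hy (hι2 _)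
    have hf : ∀ y, f (ι (ζ y)) = f y := by
      intro y
      by_cases h3 : y = d
      · rw [h3, h.map_self, hι _ ⟨fun e => h.can.inv_ne_next (inv_eq_iff.2 e.symm), M.inv_ne _⟩, h1, h2]
      by_cases h4 : y = M.next d
      · rw [h4, h.map_next_self, hι _ ⟨M.inv_ne _, h.can.inv_ne_next⟩, h1, h2]
      · rw [hι y ⟨h3, h4⟩]
    intro x y
    rw [← hf x, ← hf y]
    refine hN (fun x => f (ι x)) (fun x => ?_) (fun x => ?_) _ _
    · obtain ⟨z, hz, rfl⟩ := h.surj x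
      rw [h.map_inv, hf, hf, h1]
    · obtain ⟨z, hz, rfl⟩ := h.surj x
      by_cases h3 : M.next z = d
      · rw [h.next_of_eq z h3, hf, hf, h2, h2, ← h3, h2]
      · rw [h.next_of_ne z hz h3, hf, hf, h2]

/-- Gluing removes one edge and one vertex, and no face. -/
theorem planar_iff (h : IsZip M N d ζ) (hne : M.origin d ≠ M.origin (M.inv (M.next d))) :
    M.Planar ↔ N.Planar := by
  unfold Planar
  rw [connected_iff, connected_iff, h.connected hne, h.card_edge, h.card_vertex hne, h.card_face]
  push_cast
  refine and_congr_right fun _ => ⟨fun e => ?_, fun e => ?_⟩ <;> linarith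

theorem nearTriangulation_iff (h : IsZip M N d ζ) (ho : M.Outer d) :
    M.NearTriangulation ↔ N.NearTriangulation := by
  rw [PercMap.nearTriangulation_iff, PercMap.nearTriangulation_iff]
  have key : ∀ y, ¬ M.Outer y →
      (N.next (N.next (N.next (ζ y))) = ζ y ∧ N.next (ζ y) ≠ ζ y ↔
        M.next (M.next (M.next y)) = y ∧ M.next y ≠ y) := by
    intro y hy
    have hy1 : ¬ M.Outer (M.next y) := by rwa [outer_next]
    have hy2 : ¬ M.Outer (M.next (M.next y)) := by rwa [outer_next]
    have hy3 : ¬ M.Outer (M.next (M.next (M.next y))) := by rwa [outer_next]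
    have hinj : ∀ y z, ¬ M.Outer y → ¬ M.Outer z → (ζ y = ζ z ↔ y = z) := fun y z h1 h2 =>
      ⟨h.inj y z (h.ne_of_not_outer ho h1) (h.ne_of_not_outer ho h2), fun e => by rw [e]⟩
    rw [h.next_of_not_outer ho hy, h.next_of_not_outer ho hy1, h.next_of_not_outer ho hy2,
      hinj _ _ hy3 hy, ne_eq, hinj _ _ hy1 hy]
  constructor
  · intro hM x hx
    obtain ⟨y, hy, rfl⟩ := h.surj x
    rw [h.outer hy] at hx
    exact (key y hx).2 (hM y hx)
  · intro hN y hy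
    exact (key y hy).1 (hN _ (by rwa [h.outer (h.ne_of_not_outer ho hy)]))

theorem loopless_of (h : IsZip M N d ζ) (hne : M.origin d ≠ M.origin (M.inv (M.next d)))
    (hN : N.Loopless) : M.Loopless := fun y e => hN (ζ y) (by rw [h.map_inv, h.origin_of_eq hne e])

end IsZip

/-! ### Gluing a triangle to an outer edge -/

/-- The map `N` is obtained from `M` by gluing to the edge of the outer dart `t` a triangle with a new
vertex of color `x`; the function `ι` embeds the darts of `M` into `N`, and `r`, `l` are the two new
outer darts, into and out of the new vertex. -/
structure IsAttach (M N : PercMap) (t : M.Dart) (x : Color) (ι : M.Dart → N.Dart) (r l : N.Dart) :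
    Prop where
  ne : M.next t ≠ t
  outer_top : M.Outer t
  root_ne : M.root ≠ t
  inj : Function.Injective ι
  cover : ∀ y, (∃ z, ι z = y) ∨ y = r ∨ y = l ∨ y = N.inv r ∨ y = N.inv l
  ne_right : ∀ z, ι z ≠ r
  ne_left : ∀ z, ι z ≠ l
  right_ne_left : r ≠ l
  right_ne_inv_left : r ≠ N.inv l
  map_inv : ∀ z, N.inv (ι z) = ι (M.inv z)
  next_top : N.next (ι t) = N.inv l
  next_inv_left : N.next (N.inv l) = N.inv r
  next_inv_right : N.next (N.inv r) = ι t
  next_right : N.next r = l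
  next_left : N.next l = ι (M.next t)
  next_prev : ∀ z, M.next z = t → N.next (ι z) = r
  next_of_ne : ∀ z, z ≠ t → M.next z ≠ t → N.next (ι z) = ι (M.next z)
  map_root : N.root = ι M.root
  color_map : ∀ z, N.color (ι z) = M.color z
  color_left : N.color l = x

theorem isAttach_attach (t : M.Dart) (ht : M.next t ≠ t) (ho : M.Outer t) (hr : M.root ≠ t) (x : Color) :
    IsAttach M (M.attach t ht x) t x Sum.inl (.inr .outRight) (.inr .outLeft) where
  ne := ht
  outer_top := ho
  root_ne := hr
  inj := Sum.inl_injective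
  cover := by
    rintro (z | d)
    · exact Or.inl ⟨z, rfl⟩
    · cases d
      · exact Or.inr (Or.inl rfl)
      · exact Or.inr (Or.inr (Or.inl rfl))
      · exact Or.inr (Or.inr (Or.inr (Or.inl rfl)))
      · exact Or.inr (Or.inr (Or.inr (Or.inr rfl)))
  ne_right z := Sum.inl_ne_inr
  ne_left z := Sum.inl_ne_inr
  right_ne_left e := by cases Sum.inr_injective e
  right_ne_inv_left e := by cases Sum.inr_injective (e : Sum.inr NewDart.outRight = Sum.inr NewDart.inLeft)
  map_inv _ := rfl
  next_top := by
    change M.attachNext t (.inl t) = .inr .inLeft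
    simp [attachNext]
  next_inv_left := rfl
  next_inv_right := rfl
  next_right := rfl
  next_left := rfl
  next_prev z hz := by
    change M.attachNext t (.inl z) = .inr .outRight
    have : z ≠ t := fun e => ht (e ▸ hz)
    simp [attachNext, this, hz]
  next_of_ne z h1 h2 := by
    change M.attachNext t (.inl z) = .inl (M.next z)
    simp [attachNext, h1, h2]
  map_root := rfl
  color_map _ := rfl
  color_left := rfl

namespace IsAttach

variable {t : M.Dart} {x : Color} {ι : M.Dart → N.Dart} {r l : N.Dart}

theorem ne_inv_right (h : IsAttach M N t x ι r l) (z : M.Dart) : ι z ≠ N.inv r := fun e =>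
  h.ne_right (M.inv z) (by rw [← h.map_inv, e, N.inv_inv])

theorem ne_inv_left (h : IsAttach M N t x ι r l) (z : M.Dart) : ι z ≠ N.inv l := fun e =>
  h.ne_left (M.inv z) (by rw [← h.map_inv, e, N.inv_inv])

theorem next_symm_top (h : IsAttach M N t x ι r l) : N.next.symm (ι t) = N.inv r := by
  rw [Equiv.symm_apply_eq, h.next_inv_right]

theorem color_right (h : IsAttach M N t x ι r l) : N.color r = M.color t := by
  rw [← h.next_prev (M.next.symm t) (M.next.apply_symm_apply t), color_next, h.map_inv, h.color_map,
    color_inv_next_symm]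

theorem color_inv_right (h : IsAttach M N t x ι r l) : N.color (N.inv r) = x := by
  rw [← color_next, h.next_right, h.color_left]

theorem color_inv_left (h : IsAttach M N t x ι r l) : N.color (N.inv l) = M.color (M.inv t) := by
  rw [← color_next, h.next_left, h.color_map, color_next]

theorem mirror (h : IsAttach M N t x ι r l) : IsAttach M.mirror N.mirror t x.swap ι l r where
  ne := by
    simp only [PercMap.mirror]
    rw [ne_eq, Equiv.symm_apply_eq]
    exact h.ne.symm
  outer_top := mirror_outer.2 h.outer_top
  root_ne := h.root_ne
  inj := h.inj
  cover y := by
    have := h.cover y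
    tauto
  ne_right := h.ne_left
  ne_left := h.ne_right
  right_ne_left := h.right_ne_left.symm
  right_ne_inv_left := fun e => h.right_ne_inv_left (inv_eq_iff.1 e.symm)
  map_inv := h.map_inv
  next_top := h.next_symm_top
  next_inv_left := by
    simp only [PercMap.mirror]
    rw [Equiv.symm_apply_eq, h.next_inv_left]
  next_inv_right := by
    simp only [PercMap.mirror]
    rw [Equiv.symm_apply_eq, h.next_top]
  next_right := by
    simp only [PercMap.mirror]
    rw [Equiv.symm_apply_eq, h.next_right]
  next_left := by
    simp only [PercMap.mirror]
    rw [Equiv.symm_apply_eq, h.next_prev _ (M.next.apply_symm_apply t)]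
  next_prev z hz := by
    simp only [PercMap.mirror] at hz ⊢
    rw [Equiv.symm_apply_eq] at hz ⊢
    rw [h.next_left, hz]
  next_of_ne z h1 h2 := by
    simp only [PercMap.mirror] at h2 ⊢
    have h3 : M.next (M.next.symm z) = z := M.next.apply_symm_apply z
    rw [Equiv.symm_apply_eq, h.next_of_ne _ h2 (by rwa [h3]), h3]
  map_root := h.map_root
  color_map z := by
    simp only
    rw [h.map_inv, h.color_map]
  color_left := by
    simp only
    rw [h.color_inv_right]

/-- Functions on the darts of `N` may be defined by cases. -/
theorem exists_extension (h : IsAttach M N t x ι r l) {B : Type*} (A : M.Dart → B) (b1 b2 b3 b4 : B) :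
    ∃ f : N.Dart → B, (∀ z, f (ι z) = A z) ∧ f r = b1 ∧ f l = b2 ∧ f (N.inv r) = b3 ∧
      f (N.inv l) = b4 := by
  classical
  refine ⟨fun y => if e : ∃ z, ι z = y then A e.choose else if y = r then b1 else if y = l then b2
    else if y = N.inv r then b3 else b4, fun z => ?_, ?_, ?_, ?_, ?_⟩
  · have e : ∃ z', ι z' = ι z := ⟨z, rfl⟩
    simp only [dif_pos e]
    rw [h.inj e.choose_spec]
  · simp [h.ne_right]
  · simp [h.ne_left, h.right_ne_left.symm]
  · have h1 : N.inv r ≠ l := fun e => h.right_ne_inv_left (inv_eq_iff.1 e)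
    simp [h.ne_inv_right, N.inv_ne r, h1]
  · have h1 : N.inv l ≠ N.inv r := fun e => h.right_ne_left (inv_injective e).symm
    simp [h.ne_inv_left, N.inv_ne l, h1, h.right_ne_inv_left.symm]

theorem origin_right (h : IsAttach M N t x ι r l) : N.origin r = N.origin (ι t) := by
  rw [← h.next_inv_right, N.origin_next_inv]

theorem origin_inv_right (h : IsAttach M N t x ι r l) : N.origin (N.inv r) = N.origin l := by
  rw [← origin_next, h.next_right]

theorem origin_inv_left (h : IsAttach M N t x ι r l) : N.origin (N.inv l) = N.origin (ι (M.inv t)) := by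
  rw [← h.next_top, origin_next, h.map_inv]

theorem exists_vertex_map (h : IsAttach M N t x ι r l) : ∃ F : N.Vertex → Option M.Vertex,
    (∀ z, F (N.origin (ι z)) = some (M.origin z)) ∧ F (N.origin l) = none := by
  obtain ⟨f, f1, f2, f3, f4, f5⟩ := h.exists_extension (fun z => some (M.origin z))
    (some (M.origin t)) none none (some (M.origin (M.inv t)))
  have hf : ∀ y, f (N.next (N.inv y)) = f y := by
    intro y
    rcases h.cover y with ⟨z, rfl⟩ | rfl | rfl | rfl | rfl
    · rw [h.map_inv, f1]
      by_cases h1 : M.inv z = t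
      · rw [h1, h.next_top, f5, ← h1, M.inv_inv]
      by_cases h2 : M.next (M.inv z) = t
      · rw [h.next_prev _ h2, f2, ← h2, M.origin_next_inv]
      · rw [h.next_of_ne _ h1 h2, f1, M.origin_next_inv]
    · rw [h.next_inv_right, f1, f2]
    · rw [h.next_inv_left, f3, f4]
    · rw [N.inv_inv, h.next_right, f3, f4]
    · rw [N.inv_inv, h.next_left, f1, f5, origin_next]
  exact ⟨Quotient.lift f fun y z e => eq_of_sameCycle _ f hf e, f1, f3⟩

theorem origin_of_eq (h : IsAttach M N t x ι r l) {y z : M.Dart} (e : M.origin y = M.origin z) :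
    N.origin (ι y) = N.origin (ι z) := by
  refine apply_eq_of_origin_eq (fun z => N.origin (ι z)) (fun z => ?_) e
  by_cases h1 : M.inv z = t
  · rw [h1, ← h.next_left, origin_next, h.origin_inv_left, ← h1, M.inv_inv]
  by_cases h2 : M.next (M.inv z) = t
  · rw [h2, ← h.origin_right, ← h.next_prev _ h2, origin_next, h.map_inv, M.inv_inv]
  · rw [← h.next_of_ne _ h1 h2, origin_next, h.map_inv, M.inv_inv]

theorem origin_eq (h : IsAttach M N t x ι r l) {y z : M.Dart} :
    N.origin (ι y) = N.origin (ι z) ↔ M.origin y = M.origin z := by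
  refine ⟨fun e => ?_, h.origin_of_eq⟩
  obtain ⟨F, F1, -⟩ := h.exists_vertex_map
  have := congrArg F e
  rwa [F1, F1, Option.some_inj] at this

theorem origin_ne (h : IsAttach M N t x ι r l) (z : M.Dart) : N.origin (ι z) ≠ N.origin l := by
  intro e
  obtain ⟨F, F1, F2⟩ := h.exists_vertex_map
  have := congrArg F e
  rw [F1, F2] at this
  cases this

/-- The vertices of the new map are the old ones and the new one. -/
theorem origin_cases (h : IsAttach M N t x ι r l) (y : N.Dart) :
    (∃ z, N.origin y = N.origin (ι z)) ∨ N.origin y = N.origin l := by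
  rcases h.cover y with ⟨z, rfl⟩ | rfl | rfl | rfl | rfl
  · exact Or.inl ⟨z, rfl⟩
  · exact Or.inl ⟨t, h.origin_right⟩
  · exact Or.inr rfl
  · exact Or.inr h.origin_inv_right
  · exact Or.inl ⟨_, h.origin_inv_left⟩

theorem card_vertex (h : IsAttach M N t x ι r l) : Nat.card N.Vertex = Nat.card M.Vertex + 1 := by
  obtain ⟨F, F1, F2⟩ := h.exists_vertex_map
  rw [← Finite.card_option]
  refine Nat.card_congr (Equiv.ofBijective F ⟨?_, ?_⟩)
  · intro v w e
    obtain ⟨y, rfl⟩ := origin_surjective v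
    obtain ⟨z, rfl⟩ := origin_surjective w
    rcases h.origin_cases y with ⟨y', hy⟩ | hy <;> rcases h.origin_cases z with ⟨z', hz⟩ | hz <;>
      rw [hy, hz] at e ⊢
    · rw [F1, F1, Option.some_inj] at e
      exact h.origin_of_eq e
    · rw [F1, F2] at e
      cases e
    · rw [F1, F2] at e
      cases e
  · rintro (_ | v)
    · exact ⟨_, F2⟩
    · obtain ⟨y, rfl⟩ := origin_surjective v
      exact ⟨_, F1 y⟩

theorem face_left (h : IsAttach M N t x ι r l) : N.face l = N.face (ι (M.next t)) := by
  rw [← h.next_left, face_next]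

theorem face_right (h : IsAttach M N t x ι r l) : N.face r = N.face (ι (M.next t)) := by
  rw [← h.face_left, ← h.next_right, face_next]

theorem face_inv_left (h : IsAttach M N t x ι r l) : N.face (N.inv l) = N.face (ι t) := by
  rw [← h.next_top, face_next]

theorem face_inv_right (h : IsAttach M N t x ι r l) : N.face (N.inv r) = N.face (ι t) := by
  rw [← h.next_inv_right, face_next]

theorem exists_face_map (h : IsAttach M N t x ι r l) : ∃ F : N.Face → Option M.Face,
    (∀ z, z ≠ t → F (N.face (ι z)) = some (M.face z)) ∧ F (N.face (ι t)) = none := by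
  classical
  obtain ⟨f, f1, f2, f3, f4, f5⟩ := h.exists_extension (fun z => if z = t then none else some (M.face z))
    (some (M.face t)) (some (M.face t)) none none
  have ft : f (ι t) = none := by simp [f1]
  have fz : ∀ z, z ≠ t → f (ι z) = some (M.face z) := fun z hz => by simp [f1, hz]
  have hf : ∀ y, f (N.next y) = f y := by
    intro y
    rcases h.cover y with ⟨z, rfl⟩ | rfl | rfl | rfl | rfl
    · by_cases h1 : z = t
      · rw [h1, h.next_top, f5, ft]
      by_cases h2 : M.next z = t
      · rw [h.next_prev _ h2, f2, fz z h1, ← h2, face_next]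
      · rw [h.next_of_ne _ h1 h2, fz z h1, fz _ h2, face_next]
    · rw [h.next_right, f3, f2]
    · rw [h.next_left, fz _ h.ne, f3, face_next]
    · rw [h.next_inv_right, ft, f4]
    · rw [h.next_inv_left, f4, f5]
  exact ⟨Quotient.lift f fun y z e => eq_of_sameCycle _ f hf e, fz, ft⟩

theorem face_of_eq (h : IsAttach M N t x ι r l) {y z : M.Dart} (hy : y ≠ t) (hz : z ≠ t)
    (e : M.face y = M.face z) : N.face (ι y) = N.face (ι z) := by
  classical
  have := apply_eq_of_face_eq (fun z => if z = t then N.face (ι (M.next t)) else N.face (ι z))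
    (fun z => by
      by_cases h1 : z = t
      · simp [h1, h.ne]
      by_cases h2 : M.next z = t
      · simp only [h2, if_true, h1, if_false]
        rw [← h.face_right, ← h.next_prev _ h2, face_next]
      · simp only [h2, if_false, h1]
        rw [← h.next_of_ne _ h1 h2, face_next]) e
  simpa [hy, hz] using this

theorem face_eq (h : IsAttach M N t x ι r l) {y z : M.Dart} (hy : y ≠ t) (hz : z ≠ t) :
    N.face (ι y) = N.face (ι z) ↔ M.face y = M.face z := by
  refine ⟨fun e => ?_, h.face_of_eq hy hz⟩
  obtain ⟨F, F1, -⟩ := h.exists_face_map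
  have := congrArg F e
  rwa [F1 y hy, F1 z hz, Option.some_inj] at this

theorem face_ne (h : IsAttach M N t x ι r l) {z : M.Dart} (hz : z ≠ t) :
    N.face (ι z) ≠ N.face (ι t) := by
  intro e
  obtain ⟨F, F1, F2⟩ := h.exists_face_map
  have := congrArg F e
  rw [F1 z hz, F2] at this
  cases this

theorem face_cases (h : IsAttach M N t x ι r l) (y : N.Dart) :
    (∃ z, z ≠ t ∧ N.face y = N.face (ι z)) ∨ N.face y = N.face (ι t) := by
  rcases h.cover y with ⟨z, rfl⟩ | rfl | rfl | rfl | rfl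
  · by_cases h1 : z = t
    · exact Or.inr (by rw [h1])
    · exact Or.inl ⟨z, h1, rfl⟩
  · exact Or.inl ⟨_, h.ne, h.face_right⟩
  · exact Or.inl ⟨_, h.ne, h.face_left⟩
  · exact Or.inr h.face_inv_right
  · exact Or.inr h.face_inv_left

theorem card_face (h : IsAttach M N t x ι r l) : Nat.card N.Face = Nat.card M.Face + 1 := by
  obtain ⟨F, F1, F2⟩ := h.exists_face_map
  rw [← Finite.card_option]
  refine Nat.card_congr (Equiv.ofBijective F ⟨?_, ?_⟩)
  · intro v w e
    obtain ⟨y, rfl⟩ := face_surjective v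
    obtain ⟨z, rfl⟩ := face_surjective w
    rcases h.face_cases y with ⟨y', hy', hy⟩ | hy <;> rcases h.face_cases z with ⟨z', hz', hz⟩ | hz <;>
      rw [hy, hz] at e ⊢
    · rw [F1 _ hy', F1 _ hz', Option.some_inj] at e
      exact h.face_of_eq hy' hz' e
    · rw [F1 _ hy', F2] at e
      cases e
    · rw [F1 _ hz', F2] at e
      cases e
  · rintro (_ | v)
    · exact ⟨_, F2⟩
    · obtain ⟨y, rfl⟩ := face_surjective v
      by_cases h1 : y = t
      · exact ⟨_, by rw [F1 _ h.ne, h1, face_next]⟩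
      · exact ⟨_, F1 y h1⟩

theorem card_dart (h : IsAttach M N t x ι r l) : Nat.card N.Dart = Nat.card M.Dart + 4 := by
  have h4 : Nat.card NewDart = 4 := by
    let _ : Fintype NewDart := ⟨{.outRight, .outLeft, .inRight, .inLeft}, by intro x; cases x <;> simp⟩
    rw [Nat.card_eq_fintype_card]
    rfl
  obtain ⟨f, f1, f2, f3, f4, f5⟩ := h.exists_extension (B := M.Dart ⊕ NewDart) Sum.inl
    (.inr .outRight) (.inr .outLeft) (.inr .inRight) (.inr .inLeft)
  rw [← h4, ← Nat.card_sum]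
  refine Nat.card_congr (Equiv.ofBijective f ⟨?_, ?_⟩)
  · intro y z e
    rcases h.cover y with ⟨y', rfl⟩ | rfl | rfl | rfl | rfl <;>
      rcases h.cover z with ⟨z', rfl⟩ | rfl | rfl | rfl | rfl <;>
      simp_all
  · rintro (z | z)
    · exact ⟨_, f1 z⟩
    · cases z
      exacts [⟨_, f2⟩, ⟨_, f3⟩, ⟨_, f4⟩, ⟨_, f5⟩]

theorem card_edge (h : IsAttach M N t x ι r l) : Nat.card N.Edge = Nat.card M.Edge + 2 := by
  have h1 := h.card_dart
  rw [PercMap.card_dart, PercMap.card_dart] at h1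
  omega

theorem connected (h : IsAttach M N t x ι r l) :
    (∀ f : M.Dart → Prop, (∀ y, f (M.inv y) = f y) → (∀ y, f (M.next y) = f y) → ∀ x y, f x = f y) ↔
    (∀ f : N.Dart → Prop, (∀ y, f (N.inv y) = f y) → (∀ y, f (N.next y) = f y) → ∀ x y, f x = f y) := by
  constructor
  · intro hM f h1 h2
    have e1 : f (ι t) = f r := by rw [← h.next_inv_right, h2, h1]
    have e2 : f r = f l := by rw [← h.next_right, h2]
    have h3 := hM (fun z => f (ι z)) (fun z => by rw [← h.map_inv, h1]) (fun z => by
      by_cases h3 : z = t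
      · rw [h3, ← h.next_left, h2, e1, e2]
      by_cases h4 : M.next z = t
      · rw [h4, e1, ← h.next_prev _ h4, h2]
      · rw [← h.next_of_ne _ h3 h4, h2])
    have h4 : ∀ y, f y = f (ι t) := by
      intro y
      rcases h.cover y with ⟨y', rfl⟩ | rfl | rfl | rfl | rfl
      · exact h3 _ _
      · exact e1.symm
      · rw [e1, e2]
      · rw [h1, e1]
      · rw [h1, e1, e2]
    intro y z
    rw [h4 y, h4 z]
  · intro hN f h1 h2 y z
    obtain ⟨g, g1, g2, g3, g4, g5⟩ := h.exists_extension f (f t) (f t) (f t) (f t)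
    rw [← g1 y, ← g1 z]
    refine hN g (fun y => ?_) (fun y => ?_) _ _
    · rcases h.cover y with ⟨y', rfl⟩ | rfl | rfl | rfl | rfl
      · rw [h.map_inv, g1, g1, h1]
      · rw [g2, g4]
      · rw [g3, g5]
      · rw [N.inv_inv, g2, g4]
      · rw [N.inv_inv, g3, g5]
    · rcases h.cover y with ⟨z, rfl⟩ | rfl | rfl | rfl | rfl
      · by_cases h3 : z = t
        · rw [h3, h.next_top, g5, g1]
        by_cases h4 : M.next z = t
        · rw [h.next_prev _ h4, g2, g1, ← h4, h2]
        · rw [h.next_of_ne _ h3 h4, g1, g1, h2]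
      · rw [h.next_right, g2, g3]
      · rw [h.next_left, g1, g3, h2]
      · rw [h.next_inv_right, g1, g4]
      · rw [h.next_inv_left, g4, g5]

/-- A new triangle comes with two edges, one vertex and one face. -/
theorem planar_iff (h : IsAttach M N t x ι r l) : M.Planar ↔ N.Planar := by
  unfold Planar
  rw [connected_iff, connected_iff, h.connected, h.card_edge, h.card_vertex, h.card_face]
  push_cast
  refine and_congr_right fun _ => ⟨fun e => ?_, fun e => ?_⟩ <;> linarith

theorem outer_map (h : IsAttach M N t x ι r l) {z : M.Dart} (hz : z ≠ t) : N.Outer (ι z) ↔ M.Outer z := by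
  unfold Outer rootFace
  rw [h.map_root, h.face_eq hz h.root_ne]

theorem not_outer_top (h : IsAttach M N t x ι r l) : ¬ N.Outer (ι t) := by
  unfold Outer rootFace
  rw [h.map_root]
  exact (h.face_ne h.root_ne).symm

theorem outer_left (h : IsAttach M N t x ι r l) : N.Outer l :=
  outer_of_face_eq h.face_left.symm ((h.outer_map h.ne).2 (outer_next.2 h.outer_top))

theorem outer_right (h : IsAttach M N t x ι r l) : N.Outer r :=
  outer_of_face_eq h.face_right.symm ((h.outer_map h.ne).2 (outer_next.2 h.outer_top))

theorem not_outer_inv_left (h : IsAttach M N t x ι r l) : ¬ N.Outer (N.inv l) := fun ho =>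
  h.not_outer_top (outer_of_face_eq h.face_inv_left ho)

theorem not_outer_inv_right (h : IsAttach M N t x ι r l) : ¬ N.Outer (N.inv r) := fun ho =>
  h.not_outer_top (outer_of_face_eq h.face_inv_right ho)

theorem outer_cases (h : IsAttach M N t x ι r l) {y : N.Dart} (hy : N.Outer y) :
    (∃ z, z ≠ t ∧ M.Outer z ∧ ι z = y) ∨ y = r ∨ y = l := by
  rcases h.cover y with ⟨z, rfl⟩ | rfl | rfl | rfl | rfl
  · have h1 : z ≠ t := fun e => h.not_outer_top (e ▸ hy)
    exact Or.inl ⟨z, h1, (h.outer_map h1).1 hy, rfl⟩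
  · simp
  · simp
  · exact absurd hy h.not_outer_inv_right
  · exact absurd hy h.not_outer_inv_left

theorem ne_top_of_not_outer (h : IsAttach M N t x ι r l) {z : M.Dart} (hz : ¬ M.Outer z) : z ≠ t :=
  fun e => hz (e ▸ h.outer_top)

theorem next_of_not_outer (h : IsAttach M N t x ι r l) {z : M.Dart} (hz : ¬ M.Outer z) :
    N.next (ι z) = ι (M.next z) :=
  h.next_of_ne z (h.ne_top_of_not_outer hz) (h.ne_top_of_not_outer (by rwa [outer_next]))

theorem nearTriangulation_iff (h : IsAttach M N t x ι r l) :
    M.NearTriangulation ↔ N.NearTriangulation := by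
  rw [PercMap.nearTriangulation_iff, PercMap.nearTriangulation_iff]
  have key : ∀ y, ¬ M.Outer y →
      (N.next (N.next (N.next (ι y))) = ι y ∧ N.next (ι y) ≠ ι y ↔
        M.next (M.next (M.next y)) = y ∧ M.next y ≠ y) := by
    intro y hy
    have hy1 : ¬ M.Outer (M.next y) := by rwa [outer_next]
    have hy2 : ¬ M.Outer (M.next (M.next y)) := by rwa [outer_next]
    rw [h.next_of_not_outer hy, h.next_of_not_outer hy1, h.next_of_not_outer hy2,
      h.inj.eq_iff, ne_eq, h.inj.eq_iff]
  have hlr : N.inv l ≠ N.inv r := fun e => h.right_ne_left (inv_injective e).symm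
  constructor
  · intro hM y hy
    rcases h.cover y with ⟨z, rfl⟩ | rfl | rfl | rfl | rfl
    · by_cases h1 : z = t
      · subst h1
        rw [h.next_top, h.next_inv_left, h.next_inv_right]
        exact ⟨rfl, (h.ne_inv_left _).symm⟩
      · rw [h.outer_map h1] at hy
        exact (key z hy).2 (hM z hy)
    · exact absurd h.outer_right hy
    · exact absurd h.outer_left hy
    · rw [h.next_inv_right, h.next_top, h.next_inv_left]
      exact ⟨rfl, h.ne_inv_right _⟩
    · rw [h.next_inv_left, h.next_inv_right, h.next_top]
      exact ⟨rfl, hlr.symm⟩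
  · intro hN y hy
    exact (key y hy).1 (hN _ (by rwa [h.outer_map (h.ne_top_of_not_outer hy)]))

theorem loopless_iff (h : IsAttach M N t x ι r l) : M.Loopless ↔ N.Loopless := by
  constructor
  · intro hM y
    rcases h.cover y with ⟨z, rfl⟩ | rfl | rfl | rfl | rfl
    · rw [h.map_inv, ne_eq, h.origin_eq]
      exact hM z
    · rw [h.origin_inv_right, h.origin_right]
      exact h.origin_ne _
    · rw [h.origin_inv_left]
      exact (h.origin_ne _).symm
    · rw [N.inv_inv, h.origin_inv_right, h.origin_right]
      exact (h.origin_ne _).symm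
    · rw [N.inv_inv, h.origin_inv_left]
      exact h.origin_ne _
  · intro hN z e
    exact hN (ι z) (by rw [h.map_inv, h.origin_of_eq e])

theorem simpleBoundary_iff (h : IsAttach M N t x ι r l) : M.SimpleBoundary ↔ N.SimpleBoundary := by
  constructor
  · intro hM y z hy hz e
    rcases h.outer_cases hy with ⟨y, hy1, hy2, rfl⟩ | rfl | rfl <;>
      rcases h.outer_cases hz with ⟨z, hz1, hz2, rfl⟩ | rfl | rfl
    · rw [hM y z hy2 hz2 (h.origin_eq.1 e)]
    · rw [h.origin_right] at e
      exact absurd (hM y t hy2 h.outer_top (h.origin_eq.1 e)) hy1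
    · exact absurd e (h.origin_ne _)
    · rw [h.origin_right] at e
      exact absurd (hM z t hz2 h.outer_top (h.origin_eq.1 e.symm)) hz1
    · rfl
    · rw [h.origin_right] at e
      exact absurd e (h.origin_ne _)
    · exact absurd e.symm (h.origin_ne _)
    · rw [h.origin_right] at e
      exact absurd e.symm (h.origin_ne _)
    · rfl
  · intro hN y z hy hz e
    have e' := h.origin_of_eq e
    by_cases h1 : y = t <;> by_cases h2 : z = t
    · rw [h1, h2]
    · rw [h1, ← h.origin_right] at e'
      exact absurd (hN _ _ h.outer_right ((h.outer_map h2).2 hz) e').symm (h.ne_right _)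
    · rw [h2, ← h.origin_right] at e'
      exact absurd (hN _ _ ((h.outer_map h1).2 hy) h.outer_right e') (h.ne_right _)
    · exact h.inj (hN _ _ ((h.outer_map h1).2 hy) ((h.outer_map h2).2 hz) e')

theorem goes_map (h : IsAttach M N t x ι r l) {a b : Color} {z : M.Dart} :
    N.Goes a b (ι z) ↔ M.Goes a b z := by
  unfold Goes
  rw [h.map_inv, h.color_map, h.color_map]

theorem goes_right (h : IsAttach M N t x ι r l) (ht : M.IsTop t) : N.Goes .black x r :=
  ⟨h.color_right.trans ht.2.1, h.color_inv_right⟩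

theorem goes_left (h : IsAttach M N t x ι r l) (ht : M.IsTop t) : N.Goes x .white l :=
  ⟨h.color_left, h.color_inv_left.trans ht.2.2⟩

theorem rootInterface_iff (h : IsAttach M N t x ι r l) (ht : M.IsTop t) :
    M.RootInterface ↔ N.RootInterface := by
  unfold RootInterface
  rw [h.map_root, h.goes_map]
  refine and_congr_right fun _ => ⟨fun hM y hy hy2 => ?_, fun hN z hz hz2 => ?_⟩
  · rcases h.outer_cases hy with ⟨y, hy1, hy3, rfl⟩ | rfl | rfl
    · rw [hM y hy3 (h.goes_map.1 hy2)]
    · exact absurd ((h.goes_right ht).1.symm.trans hy2.1) (by decide)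
    · exact absurd ((h.goes_left ht).2.symm.trans hy2.2) (by decide)
  · have h1 : z ≠ t := by
      rintro rfl
      exact absurd (ht.2.1.symm.trans hz2.1) (by decide)
    exact h.inj (hN _ ((h.outer_map h1).2 hz) (h.goes_map.2 hz2))

end IsAttach

end PercMap

/-! ### The percolation path with time stamps -/

/-- Iterating `f` from `x`, one meets the elements of the list in their order, and then `r`. -/
def Links {A : Type*} (f : A → A) : A → List (ℕ × A) → A → Prop
  | x, [], r => f x = r
  | x, p :: l, r => f x = p.2 ∧ Links f p.2 l r

theorem Links.map {A B : Type*} {f : A → A} {f' : B → B} (g : A → B) {x : A} {x' : B}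
    {l : List (ℕ × A)} {r : A} (h : Links f x l r) (hx : f' x' = g (f x))
    (hl : ∀ i y, (i, y) ∈ l → f' (g y) = g (f y)) :
    Links f' x' (l.map (Prod.map id g)) (g r) := by
  induction l generalizing x x' with
  | nil => exact hx.trans (congrArg g h)
  | cons p l ih =>
    exact ⟨hx.trans (congrArg g h.1), ih h.2 (hl p.1 p.2 (by simp)) fun i y hy => hl i y (by simp [hy])⟩

theorem Links.apply_mem {A : Type*} {f : A → A} {x : A} {l : List (ℕ × A)} {r : A} (h : Links f x l r)
    {y : A} (hy : y = x ∨ ∃ i, (i, y) ∈ l) : f y = r ∨ ∃ i, (i, f y) ∈ l := by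
  induction l generalizing x with
  | nil =>
    rcases hy with rfl | ⟨i, hi⟩
    · exact Or.inl h
    · cases hi
  | cons p l ih =>
    rcases hy with rfl | ⟨i, hi⟩
    · exact Or.inr ⟨p.1, by rw [h.1]; simp⟩
    · rcases ih h.2 (by
        rcases List.mem_cons.1 hi with rfl | h3
        · exact Or.inl rfl
        · exact Or.inr ⟨i, h3⟩) with h4 | ⟨j, hj⟩
      · exact Or.inl h4
      · exact Or.inr ⟨j, by simp [hj]⟩

theorem Links.exists_apply_eq {A : Type*} {f : A → A} {x : A} {l : List (ℕ × A)} {r : A}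
    (h : Links f x l r) {y : A} (hy : y = r ∨ ∃ i, (i, y) ∈ l) :
    ∃ z, (z = x ∨ ∃ i, (i, z) ∈ l) ∧ f z = y := by
  induction l generalizing x with
  | nil =>
    rcases hy with rfl | ⟨i, hi⟩
    · exact ⟨x, Or.inl rfl, h⟩
    · cases hi
  | cons p l ih =>
    by_cases h1 : y = p.2
    · exact ⟨x, Or.inl rfl, h.1.trans h1.symm⟩
    · obtain ⟨z, hz, e⟩ := ih h.2 (by
        rcases hy with h2 | ⟨i, hi⟩
        · exact Or.inl h2
        · rcases List.mem_cons.1 hi with rfl | h3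
          · exact absurd rfl h1
          · exact Or.inr ⟨i, h3⟩)
      refine ⟨z, Or.inr ?_, e⟩
      rcases hz with rfl | ⟨i, hi⟩
      · exact ⟨p.1, by simp⟩
      · exact ⟨i, by simp [hi]⟩

namespace PercMap

variable {M N : PercMap}

/-- The list consists of the successive darts crossed by the percolation path, the last one first, with
increasing time stamps along the path. -/
inductive Trail (M : PercMap) : List (ℕ × M.Dart) → Prop
  | root (k : ℕ) : Trail M [(k, M.root)]
  | cons {n k : ℕ} {z y : M.Dart} {p : List (ℕ × M.Dart)} :
    Trail M ((k, y) :: p) → k < n → M.PathStep y z → Trail M ((n, z) :: (k, y) :: p)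

namespace Trail

variable {p : List (ℕ × M.Dart)}

theorem onPath (h : M.Trail p) {k : ℕ} {z : M.Dart} (hz : (k, z) ∈ p) : M.OnPath z := by
  induction h generalizing k z with
  | root k =>
    obtain ⟨rfl, rfl⟩ := Prod.mk.inj (List.mem_singleton.1 hz)
    exact Relation.ReflTransGen.refl
  | cons h1 h2 h3 ih =>
    rcases List.mem_cons.1 hz with h4 | h4
    · obtain ⟨rfl, rfl⟩ := Prod.mk.inj h4
      exact Relation.ReflTransGen.tail (ih (List.mem_cons_self ..)) h3
    · exact ih h4

theorem lt_head {n k : ℕ} {y z : M.Dart} (h : M.Trail ((n, y) :: p)) (hz : (k, z) ∈ p) :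
    k < n ∧ Relation.TransGen M.PathStep z y := by
  induction p generalizing n y with
  | nil => cases hz
  | cons q p ih =>
    cases h with
    | cons h1 h2 h3 =>
      rcases List.mem_cons.1 hz with h4 | h4
      · obtain ⟨rfl, rfl⟩ := Prod.mk.inj h4
        exact ⟨h2, Relation.TransGen.single h3⟩
      · have := ih h1 h4
        exact ⟨by omega, this.2.tail h3⟩

theorem suffix {s : List (ℕ × M.Dart)} {q : ℕ × M.Dart} (h : M.Trail (s ++ q :: p)) :
    M.Trail (q :: p) := by
  induction s with
  | nil => exact h
  | cons a s ih =>
    cases s with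
    | nil =>
      cases h with
      | cons h1 _ _ => exact h1
    | cons b s =>
      cases h with
      | cons h1 _ _ => exact ih h1

/-- Along the trail, the order of the times is the order of the path. -/
theorem transGen_of_lt (h : M.Trail p) {k k' : ℕ} {z z' : M.Dart} (hz : (k, z) ∈ p) (hz' : (k', z') ∈ p)
    (hk : k < k') : Relation.TransGen M.PathStep z z' := by
  obtain ⟨s, q, rfl⟩ := List.append_of_mem hz'
  rcases List.mem_append.1 hz with h1 | h1
  · obtain ⟨s1, s2, rfl⟩ := List.append_of_mem h1
    rw [List.append_assoc, List.cons_append] at h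
    have := (h.suffix.lt_head (k := k') (z := z') (by simp)).1
    omega
  · rcases List.mem_cons.1 h1 with h2 | h2
    · obtain ⟨rfl, rfl⟩ := Prod.mk.inj h2
      omega
    · exact (h.suffix.lt_head h2).2

theorem time_unique (hT : M.NearTriangulation) (hR : M.RootInterface) (h : M.Trail p) {k k' : ℕ} {z : M.Dart}
    (hz : (k, z) ∈ p) (hz' : (k', z) ∈ p) : k = k' := by
  rcases lt_trichotomy k k' with h1 | h1 | h1
  · exact absurd (h.transGen_of_lt hz hz' h1) (OnPath.not_transGen_self hT hR (h.onPath hz))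
  · exact h1
  · exact absurd (h.transGen_of_lt hz' hz h1) (OnPath.not_transGen_self hT hR (h.onPath hz))

theorem mem_of_onPath (hT : M.NearTriangulation) {n : ℕ} {y z : M.Dart} (h : M.Trail ((n, y) :: p))
    (hy : M.Outer (M.inv y)) (hz : M.OnPath z) : ∃ k, (k, z) ∈ (n, y) :: p := by
  have hroot : ∀ q, M.Trail q → ∃ k, (k, M.root) ∈ q := by
    intro q hq
    induction hq with
    | root k => exact ⟨k, by simp⟩
    | cons _ _ _ ih =>
      obtain ⟨k, hk⟩ := ih
      exact ⟨k, List.mem_cons_of_mem _ hk⟩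
  have hnext : ∀ q, M.Trail q → ∀ k z, (k, z) ∈ q.tail → ∃ k' z', (k', z') ∈ q ∧ M.PathStep z z' := by
    intro q hq
    induction hq with
    | root k =>
      intro k z hz
      cases hz
    | @cons n' _ z0 _ _ h1 h2 h3 ih =>
      intro k z hz
      rcases List.mem_cons.1 hz with h4 | h4
      · obtain ⟨rfl, rfl⟩ := Prod.mk.inj h4
        exact ⟨n', z0, by simp, h3⟩
      · obtain ⟨k', z', h5, h6⟩ := ih k z h4
        exact ⟨k', z', List.mem_cons_of_mem _ h5, h6⟩
  induction hz with
  | refl => exact hroot _ h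
  | @tail a b _ h2 ih =>
    obtain ⟨k, hk⟩ := ih
    rcases List.mem_cons.1 hk with h3 | h3
    · obtain ⟨rfl, rfl⟩ := Prod.mk.inj h3
      exact absurd hy h2.1
    · obtain ⟨k', z', h4, h5⟩ := hnext _ h k a h3
      rw [hT.pathStep_unique h2 h5]
      exact ⟨k', h4⟩

theorem map (g : M.Dart → N.Dart) (h : M.Trail p) (hroot : N.root = g M.root)
    (hstep : ∀ k k' z z', (k, z) ∈ p → (k', z') ∈ p → M.PathStep z z' → N.PathStep (g z) (g z')) :
    N.Trail (p.map (Prod.map id g)) := by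
  induction h with
  | root k =>
    rw [List.map_singleton, Prod.map, ← hroot]
    exact Trail.root k
  | @cons n k z y p h1 h2 h3 ih =>
    exact Trail.cons (ih fun k k' z z' hz hz' => hstep k k' z z' (List.mem_cons_of_mem _ hz)
      (List.mem_cons_of_mem _ hz')) h2 (hstep k n y z (by simp) (by simp) h3)

end Trail

/-- The state of a map in `T_P` during the construction.  `left` and `right` list the left and the right
edges, from the top-edge to the root-edge, with the times at which the percolation path enters their
triangles, and `path` is the path up to its last edge, the top-edge, whose time is the length `n` of the
word.  The path meets the triangles of the left and right edges in
the order of these times, and it touches a boundary vertex only between its visits to the triangles of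
the two boundary edges at this vertex. -/
structure Explored (M : PercMap) (n : ℕ) (t : M.Dart) (left right path : List (ℕ × M.Dart)) : Prop where
  tri : M.LooplessTriangulation
  iface : M.RootInterface
  top : M.IsTop t
  left_links : Links M.next t left M.root
  right_links : Links M.next.symm t right M.root
  left_goes : ∀ i d, (i, d) ∈ left → M.Goes .white .white d
  right_goes : ∀ i d, (i, d) ∈ right → M.Goes .black .black d
  trail : M.Trail ((n, M.inv t) :: path)
  left_visited : ∀ i d, (i, d) ∈ left → ∃ z, (i, z) ∈ path ∧ M.face (M.inv z) = M.face (M.inv d)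
  right_visited : ∀ i d, (i, d) ∈ right → ∃ z, (i, z) ∈ path ∧ M.face (M.inv z) = M.face (M.inv d)
  left_after : ∀ i d, (i, d) ∈ left → ∀ k z, (k, z) ∈ (n, M.inv t) :: path →
    M.origin z = M.origin d → i < k
  left_before : ∀ i d, (i, d) ∈ left → ∀ k z, (k, z) ∈ (n, M.inv t) :: path →
    M.origin z = M.origin (M.inv d) → k ≤ i
  right_after : ∀ i d, (i, d) ∈ right → ∀ k z, (k, z) ∈ (n, M.inv t) :: path →
    M.origin (M.inv z) = M.origin (M.inv d) → i < k
  right_before : ∀ i d, (i, d) ∈ right → ∀ k z, (k, z) ∈ (n, M.inv t) :: path →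
    M.origin (M.inv z) = M.origin d → k ≤ i
  left_sorted : left.Pairwise fun p q => q.1 < p.1
  right_sorted : right.Pairwise fun p q => q.1 < p.1

/-- Only the triangles of the left and right edges matter: those of the root-edge and of the top-edge are the
first and the last one on the path. -/
theorem visitsBoundary_of (hT : M.NearTriangulation) (hR : M.RootInterface)
    (h : ∀ d, M.IsLeft d ∨ M.IsRight d → ∃ z, M.OnPath z ∧ M.face (M.inv z) = M.face (M.inv d)) :
    M.PathVisitsBoundary := by
  intro d h1 h2
  rcases Color.cases (M.color d) with h3 | h3 <;> rcases Color.cases (M.color (M.inv d)) with h4 | h4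
  · obtain ⟨z, h5, h6⟩ := h d (Or.inl ⟨h1, h3, h4⟩)
    exact ⟨z, h5, h2, h6⟩
  · have := hR.2 d h1 ⟨h3, h4⟩
    exact ⟨d, this ▸ Relation.ReflTransGen.refl, h2, rfl⟩
  · obtain ⟨z, h5, -⟩ := (onPath_top hT hR ⟨h1, h3, h4⟩).exists_pathEnters h2
    exact ⟨z, h5⟩
  · obtain ⟨z, h5, h6⟩ := h d (Or.inr ⟨h1, h3, h4⟩)
    exact ⟨z, h5, h2, h6⟩

theorem SimpleBoundary.not_outer_inv (h : M.SimpleBoundary) (hR : M.RootInterface) {d : M.Dart} (hd : M.Outer d)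
    (hc : M.color d = M.color (M.inv d)) : ¬ M.Outer (M.inv d) := by
  intro ho
  have h1 := hR.1
  rcases h.eq_root hd ho with e | e
  · rw [e] at h1
    rw [h1.1, h1.2] at hc
    exact absurd hc (by decide)
  · rw [e, goes_inv] at h1
    rw [h1.1, h1.2] at hc
    exact absurd hc (by decide)

namespace Explored

variable {n : ℕ} {t : M.Dart} {left right path : List (ℕ × M.Dart)}

theorem mirror_iff : M.mirror.Explored n t right left path ↔ M.Explored n t left right path := by
  have htrail : ∀ p : List (ℕ × M.Dart), M.mirror.Trail p ↔ M.Trail p := by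
    intro p
    exact ⟨fun h => Trail.rec (M := M.mirror) (motive := fun p _ => M.Trail p) (fun k => Trail.root k)
        (fun _ h2 h3 ih => Trail.cons ih h2 (mirror_pathStep.1 h3)) h,
      fun h => Trail.rec (M := M) (motive := fun p _ => M.mirror.Trail p)
        (fun k => Trail.root (M := M.mirror) k)
        (fun _ h2 h3 ih => Trail.cons (M := M.mirror) ih h2 (mirror_pathStep.2 h3)) h⟩
  have hvis : ∀ z d : M.Dart, M.mirror.face (M.inv z) = M.mirror.face (M.inv d) ↔
    M.face (M.inv z) = M.face (M.inv d) := fun _ _ => mirror_face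
  have ho1 : ∀ z d : M.Dart, M.mirror.origin z = M.mirror.origin d ↔
    M.origin (M.inv z) = M.origin (M.inv d) := fun _ _ => mirror_origin
  have ho2 : ∀ z d : M.Dart, M.mirror.origin z = M.mirror.origin (M.inv d) ↔
    M.origin (M.inv z) = M.origin d := fun z d => by rw [ho1, M.inv_inv]
  have ho3 : ∀ z d : M.Dart, M.mirror.origin (M.inv z) = M.mirror.origin (M.inv d) ↔
    M.origin z = M.origin d := fun _ _ => mirror_origin_inv
  have ho4 : ∀ z d : M.Dart, M.mirror.origin (M.inv z) = M.mirror.origin d ↔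
    M.origin z = M.origin (M.inv d) := fun z d => by rw [ho1, M.inv_inv]
  constructor
  · intro h
    have htri : M.LooplessTriangulation := by
      obtain ⟨h1, h2, h3, h4⟩ := h.tri
      rw [← mirror_mirror M]
      exact ⟨mirror_planar h1, mirror_nearTriangulation h2, mirror_loopless h3, mirror_simpleBoundary h4⟩
    refine ⟨htri, ?_, mirror_isTop.1 h.top, h.right_links, h.left_links,
      fun i d hd => mirror_goes.1 (h.right_goes i d hd), fun i d hd => mirror_goes.1 (h.left_goes i d hd),
      (htrail _).1 h.trail, fun i d hd => ?_, fun i d hd => ?_, fun i d hd k z hz e => ?_,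
      fun i d hd k z hz e => ?_, fun i d hd k z hz e => ?_, fun i d hd k z hz e => ?_, h.right_sorted,
      h.left_sorted⟩
    · have := mirror_rootInterface h.iface
      rwa [mirror_mirror] at this
    · obtain ⟨z, h1, h2⟩ := h.right_visited i d hd
      exact ⟨z, h1, (hvis z d).1 h2⟩
    · obtain ⟨z, h1, h2⟩ := h.left_visited i d hd
      exact ⟨z, h1, (hvis z d).1 h2⟩
    · exact h.right_after i d hd k z hz ((ho3 z d).2 e)
    · exact h.right_before i d hd k z hz ((ho4 z d).2 e)
    · exact h.left_after i d hd k z hz ((ho1 z d).2 e)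
    · exact h.left_before i d hd k z hz ((ho2 z d).2 e)
  · intro h
    have htri : M.mirror.LooplessTriangulation := by
      obtain ⟨h1, h2, h3, h4⟩ := h.tri
      exact ⟨mirror_planar h1, mirror_nearTriangulation h2, mirror_loopless h3, mirror_simpleBoundary h4⟩
    refine ⟨htri, mirror_rootInterface h.iface, mirror_isTop.2 h.top, h.right_links, h.left_links,
      fun i d hd => mirror_goes.2 (h.right_goes i d hd), fun i d hd => mirror_goes.2 (h.left_goes i d hd),
      (htrail _).2 h.trail, fun i d hd => ?_, fun i d hd => ?_, fun i d hd k z hz e => ?_,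
      fun i d hd k z hz e => ?_, fun i d hd k z hz e => ?_, fun i d hd k z hz e => ?_, h.right_sorted,
      h.left_sorted⟩
    · obtain ⟨z, h1, h2⟩ := h.right_visited i d hd
      exact ⟨z, h1, (hvis z d).2 h2⟩
    · obtain ⟨z, h1, h2⟩ := h.left_visited i d hd
      exact ⟨z, h1, (hvis z d).2 h2⟩
    · exact h.right_after i d hd k z hz ((ho1 z d).1 e)
    · exact h.right_before i d hd k z hz ((ho2 z d).1 e)
    · exact h.left_after i d hd k z hz ((ho3 z d).1 e)
    · exact h.left_before i d hd k z hz ((ho4 z d).1 e)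

theorem outer_iff (h : M.Explored n t left right path) {y : M.Dart} :
    M.Outer y ↔ y = t ∨ y = M.root ∨ (∃ i, (i, y) ∈ left) ∨ ∃ i, (i, y) ∈ right := by
  constructor
  · intro hy
    refine h.top.1.induction hy (P := fun y => y = t ∨ y = M.root ∨ (∃ i, (i, y) ∈ left) ∨
      ∃ i, (i, y) ∈ right) (Or.inl rfl) ?_
    intro z _ hz
    have hl : (z = t ∨ ∃ i, (i, z) ∈ left) → M.next z = M.root ∨ ∃ i, (i, M.next z) ∈ left :=
      fun h1 => h.left_links.apply_mem h1
    have hr : (z = M.root ∨ ∃ i, (i, z) ∈ right) → M.next z = t ∨ ∃ i, (i, M.next z) ∈ right := by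
      intro h1
      obtain ⟨w, hw, e⟩ := h.right_links.exists_apply_eq h1
      rw [Equiv.symm_apply_eq] at e
      rwa [← e]
    tauto
  · have hl : ∀ (l : List (ℕ × M.Dart)) x, M.Outer x → Links M.next x l M.root →
        ∀ i y, (i, y) ∈ l → M.Outer y := by
      intro l
      induction l with
      | nil => simp
      | cons p l ih =>
        intro x hx hl i y hy
        have hp : M.Outer p.2 := by rw [← hl.1, outer_next]; exact hx
        rcases List.mem_cons.1 hy with rfl | h1
        · exact hp
        · exact ih _ hp hl.2 i y h1
    have hr : ∀ (l : List (ℕ × M.Dart)) x, M.Outer x → Links M.next.symm x l M.root →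
        ∀ i y, (i, y) ∈ l → M.Outer y := by
      intro l
      induction l with
      | nil => simp
      | cons p l ih =>
        intro x hx hl i y hy
        have hp : M.Outer p.2 := by rw [← hl.1, outer_next_symm]; exact hx
        rcases List.mem_cons.1 hy with rfl | h1
        · exact hp
        · exact ih _ hp hl.2 i y h1
    rintro (rfl | rfl | ⟨i, hi⟩ | ⟨i, hi⟩)
    · exact h.top.1
    · rfl
    · exact hl left t h.top.1 h.left_links i y hi
    · exact hr right t h.top.1 h.right_links i y hi

theorem isLeft_iff (h : M.Explored n t left right path) {y : M.Dart} :
    M.IsLeft y ↔ ∃ i, (i, y) ∈ left := by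
  constructor
  · rintro ⟨h1, h2⟩
    rcases h.outer_iff.1 h1 with rfl | rfl | h3 | ⟨i, h3⟩
    · exact absurd (h2.1.symm.trans h.top.2.1) (by decide)
    · exact absurd (h2.2.symm.trans h.iface.1.2) (by decide)
    · exact h3
    · exact absurd (h2.1.symm.trans (h.right_goes i y h3).1) (by decide)
  · rintro ⟨i, hi⟩
    exact ⟨h.outer_iff.2 (Or.inr (Or.inr (Or.inl ⟨i, hi⟩))), h.left_goes i y hi⟩

theorem isRight_iff (h : M.Explored n t left right path) {y : M.Dart} :
    M.IsRight y ↔ ∃ i, (i, y) ∈ right := by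
  have h1 := (mirror_iff.2 h).isLeft_iff (y := y)
  rwa [mirror_isLeft] at h1

theorem mem_onPath (h : M.Explored n t left right path) {k : ℕ} {z : M.Dart} (hz : (k, z) ∈ path) :
    M.OnPath z := h.trail.onPath (List.mem_cons_of_mem _ hz)

theorem isTP (h : M.Explored n t left right path) : M.IsTP := by
  refine ⟨h.tri, h.iface, visitsBoundary_of h.tri.2.1 h.iface ?_⟩
  rintro d (h1 | h1)
  · obtain ⟨i, hi⟩ := h.isLeft_iff.1 h1
    obtain ⟨z, h2, h3⟩ := h.left_visited i d hi
    exact ⟨z, h.mem_onPath h2, h3⟩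
  · obtain ⟨i, hi⟩ := h.isRight_iff.1 h1
    obtain ⟨z, h2, h3⟩ := h.right_visited i d hi
    exact ⟨z, h.mem_onPath h2, h3⟩

theorem left_outer (h : M.Explored n t left right path) {i : ℕ} {d : M.Dart} (hd : (i, d) ∈ left) :
    M.Outer d := (h.isLeft_iff.2 ⟨i, hd⟩).1

theorem right_outer (h : M.Explored n t left right path) {i : ℕ} {d : M.Dart} (hd : (i, d) ∈ right) :
    M.Outer d := (h.isRight_iff.2 ⟨i, hd⟩).1

theorem left_inner (h : M.Explored n t left right path) {i : ℕ} {d : M.Dart} (hd : (i, d) ∈ left) :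
    ¬ M.Outer (M.inv d) :=
  h.tri.2.2.2.not_outer_inv h.iface (h.left_outer hd)
    ((h.left_goes i d hd).1.trans (h.left_goes i d hd).2.symm)

theorem right_inner (h : M.Explored n t left right path) {i : ℕ} {d : M.Dart} (hd : (i, d) ∈ right) :
    ¬ M.Outer (M.inv d) :=
  h.tri.2.2.2.not_outer_inv h.iface (h.right_outer hd)
    ((h.right_goes i d hd).1.trans (h.right_goes i d hd).2.symm)

/-- The time of a triangle is unique. -/
theorem time_unique (h : M.Explored n t left right path) {k k' : ℕ} {z z' : M.Dart} (hz : (k, z) ∈ path)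
    (hz' : (k', z') ∈ path) (ho : ¬ M.Outer (M.inv z))
    (hf : M.face (M.inv z) = M.face (M.inv z')) : k = k' := by
  have h1 : z' = z := h.tri.2.1.eq_of_face_inv_eq (h.iface.onPath_goes (h.mem_onPath hz'))
    (h.iface.onPath_goes (h.mem_onPath hz)) ho hf.symm
  subst h1
  exact h.trail.time_unique h.tri.2.1 h.iface (List.mem_cons_of_mem _ hz) (List.mem_cons_of_mem _ hz')

theorem left_time_unique (h : M.Explored n t left right path) {i j : ℕ} {d d' : M.Dart}
    (hd : (i, d) ∈ left) (hd' : (j, d') ∈ left) (hf : M.face (M.inv d) = M.face (M.inv d')) : i = j := by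
  obtain ⟨z, h1, h2⟩ := h.left_visited i d hd
  obtain ⟨z', h3, h4⟩ := h.left_visited j d' hd'
  exact h.time_unique h1 h3 (fun ho => h.left_inner hd (outer_of_face_eq h2 ho)) (by rw [h2, h4, hf])

theorem right_time_unique (h : M.Explored n t left right path) {i j : ℕ} {d d' : M.Dart}
    (hd : (i, d) ∈ right) (hd' : (j, d') ∈ right) (hf : M.face (M.inv d) = M.face (M.inv d')) : i = j := by
  refine (mirror_iff.2 h).left_time_unique hd hd' ?_
  exact mirror_face.2 hf

theorem time_lt (h : M.Explored n t left right path) {k : ℕ} {z : M.Dart} (hz : (k, z) ∈ path) : k < n :=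
  (h.trail.lt_head hz).1

theorem left_time_lt (h : M.Explored n t left right path) {i : ℕ} {d : M.Dart} (hd : (i, d) ∈ left) :
    i < n := by
  obtain ⟨z, h1, -⟩ := h.left_visited i d hd
  exact h.time_lt h1

theorem right_time_lt (h : M.Explored n t left right path) {i : ℕ} {d : M.Dart} (hd : (i, d) ∈ right) :
    i < n := (mirror_iff.2 h).left_time_lt hd

theorem goes_of_mem (h : M.Explored n t left right path) {k : ℕ} {z : M.Dart}
    (hz : (k, z) ∈ (n, M.inv t) :: path) : M.Goes .white .black z :=
  h.iface.onPath_goes (h.trail.onPath hz)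

/-- Gluing a triangle with a white new vertex. -/
theorem attach (h : M.Explored n t left right path) {ι : M.Dart → N.Dart} {r l : N.Dart}
    (ha : IsAttach M N t .white ι r l) :
    N.Explored (n + 1) r ((n, l) :: left.map (Prod.map id ι)) (right.map (Prod.map id ι))
      (((n, M.inv t) :: path).map (Prod.map id ι)) := by
  obtain ⟨hP, hT, hL, hS⟩ := h.tri
  have hR := h.iface
  have hNT : N.NearTriangulation := ha.nearTriangulation_iff.1 hT
  have hNS : N.SimpleBoundary := ha.simpleBoundary_iff.1 hS
  have hNR : N.RootInterface := (ha.rootInterface_iff h.top).1 hR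
  have htop : N.IsTop r := ⟨ha.outer_right, ha.goes_right h.top⟩
  have hl_ne : ∀ i d, (i, d) ∈ left → d ≠ t := by
    rintro i d hd rfl
    exact absurd ((h.left_goes i d hd).1.symm.trans h.top.2.1) (by decide)
  have hr_ne : ∀ i d, (i, d) ∈ right → d ≠ t := by
    rintro i d hd rfl
    exact absurd ((h.right_goes i d hd).2.symm.trans h.top.2.2) (by decide)
  have hp_ne : ∀ k z, (k, z) ∈ (n, M.inv t) :: path → z ≠ t := by
    rintro k z hz rfl
    exact absurd ((h.goes_of_mem hz).1.symm.trans h.top.2.1) (by decide)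
  have hstep : ∀ k k' z z', (k, z) ∈ (n, M.inv t) :: path → (k', z') ∈ (n, M.inv t) :: path →
      M.PathStep z z' → N.PathStep (ι z) (ι z') := by
    rintro k k' z z' hz hz' ⟨h1, h2, h3⟩
    have h4 := ha.ne_top_of_not_outer h1
    refine ⟨?_, ?_, ha.goes_map.2 h3⟩
    · rwa [ha.map_inv, ha.outer_map h4]
    · rw [ha.map_inv]
      exact ha.face_of_eq (hp_ne k' z' hz') h4 h2
  have htrail0 := h.trail.map ι ha.map_root hstep
  have htrail : N.Trail ((n + 1, N.inv r) :: ((n, M.inv t) :: path).map (Prod.map id ι)) := by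
    rw [List.map_cons] at htrail0 ⊢
    refine Trail.cons htrail0 (Nat.lt_succ_self n) ⟨?_, ?_, goes_inv.2 htop.2⟩
    · rw [ha.map_inv, M.inv_inv]
      exact ha.not_outer_top
    · rw [ha.map_inv, M.inv_inv]
      exact ha.face_inv_right
  have hvis : ∀ i d, ¬ M.Outer (M.inv d) →
      (∃ z, (i, z) ∈ path ∧ M.face (M.inv z) = M.face (M.inv d)) →
      ∃ z, (i, z) ∈ ((n, M.inv t) :: path).map (Prod.map id ι) ∧
        N.face (N.inv z) = N.face (N.inv (ι d)) := by
    rintro i d hd ⟨z, h1, h2⟩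
    refine ⟨ι z, List.mem_map.2 ⟨(i, z), List.mem_cons_of_mem _ h1, rfl⟩, ?_⟩
    rw [ha.map_inv, ha.map_inv]
    exact ha.face_of_eq (ha.ne_top_of_not_outer fun ho => hd (outer_of_face_eq h2 ho))
      (ha.ne_top_of_not_outer hd) h2
  have hle : ∀ k z, (k, z) ∈ (n, M.inv t) :: path → k ≤ n := by
    intro k z hz
    rcases List.mem_cons.1 hz with h1 | h1
    · exact (Prod.mk.inj h1).1.le
    · exact (h.time_lt h1).le
  have hmem : ∀ k z, (k, z) ∈ (n + 1, N.inv r) :: ((n, M.inv t) :: path).map (Prod.map id ι) →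
      (k = n + 1 ∧ z = N.inv r) ∨ ∃ y, z = ι y ∧ (k, y) ∈ (n, M.inv t) :: path := by
    intro k z hz
    rcases List.mem_cons.1 hz with h1 | h1
    · exact Or.inl (Prod.mk.inj h1)
    · obtain ⟨⟨k', y⟩, h2, h3⟩ := List.mem_map.1 h1
      obtain ⟨rfl, rfl⟩ := Prod.mk.inj h3
      exact Or.inr ⟨y, rfl, h2⟩
  have hmap : ∀ (L : List (ℕ × M.Dart)) i d, (i, d) ∈ L.map (Prod.map id ι) →
      ∃ y, d = ι y ∧ (i, y) ∈ L := by
    intro L i d hd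
    obtain ⟨⟨k', y⟩, h2, h3⟩ := List.mem_map.1 hd
    obtain ⟨rfl, rfl⟩ := Prod.mk.inj h3
    exact ⟨y, rfl, h2⟩
  have hleft : ∀ i d, (i, d) ∈ (n, l) :: left.map (Prod.map id ι) →
      (i = n ∧ d = l) ∨ ∃ y, d = ι y ∧ (i, y) ∈ left := by
    intro i d hd
    rcases List.mem_cons.1 hd with h1 | h1
    · exact Or.inl (Prod.mk.inj h1)
    · exact Or.inr (hmap left i d h1)
  refine ⟨⟨ha.planar_iff.1 hP, hNT, ha.loopless_iff.1 hL, hNS⟩, hNR, htop, ?_, ?_, ?_, ?_, htrail,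
    ?_, ?_, ?_, ?_, ?_, ?_, ?_, ?_⟩
  · refine ⟨ha.next_right, ?_⟩
    rw [ha.map_root]
    refine h.left_links.map ι ha.next_left fun i y hy => ha.next_of_ne y (hl_ne i y hy) ?_
    rcases h.left_links.apply_mem (Or.inr ⟨i, hy⟩) with h1 | ⟨j, hj⟩
    · rw [h1]
      exact ha.root_ne
    · exact hl_ne j _ hj
  · rw [ha.map_root]
    refine h.right_links.map ι ?_ fun i y hy => ?_
    · rw [Equiv.symm_apply_eq, ha.next_prev _ (M.next.apply_symm_apply t)]
    · have h0 : M.next (M.next.symm y) = y := M.next.apply_symm_apply y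
      have h2 : M.next.symm y ≠ t := by
        rcases h.right_links.apply_mem (Or.inr ⟨i, hy⟩) with h1 | ⟨j, hj⟩
        · rw [h1]
          exact ha.root_ne
        · exact hr_ne j _ hj
      rw [Equiv.symm_apply_eq, ha.next_of_ne _ h2 (by rw [h0]; exact hr_ne i y hy), h0]
  · intro i d hd
    rcases hleft i d hd with ⟨rfl, rfl⟩ | ⟨y, rfl, hy⟩
    · exact ha.goes_left h.top
    · exact ha.goes_map.2 (h.left_goes i y hy)
  · intro i d hd
    obtain ⟨y, rfl, hy⟩ := hmap right i d hd
    exact ha.goes_map.2 (h.right_goes i y hy)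
  · intro i d hd
    rcases hleft i d hd with ⟨rfl, rfl⟩ | ⟨y, rfl, hy⟩
    · refine ⟨ι (M.inv t), by simp, ?_⟩
      rw [ha.map_inv, M.inv_inv, ha.face_inv_left]
    · exact hvis i y (h.left_inner hy) (h.left_visited i y hy)
  · intro i d hd
    obtain ⟨y, rfl, hy⟩ := hmap right i d hd
    exact hvis i y (h.right_inner hy) (h.right_visited i y hy)
  · intro i d hd k z hz e
    rcases hleft i d hd with ⟨rfl, rfl⟩ | ⟨y, rfl, hy⟩ <;>
      rcases hmem k z hz with ⟨rfl, rfl⟩ | ⟨w, rfl, hw⟩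
    · omega
    · exact absurd e (ha.origin_ne _)
    · rw [ha.origin_inv_right] at e
      exact absurd e.symm (ha.origin_ne _)
    · exact h.left_after i y hy k w hw (ha.origin_eq.1 e)
  · intro i d hd k z hz e
    rcases hleft i d hd with ⟨rfl, rfl⟩ | ⟨y, rfl, hy⟩ <;>
      rcases hmem k z hz with ⟨rfl, rfl⟩ | ⟨w, rfl, hw⟩
    · rw [ha.origin_inv_right, ha.origin_inv_left] at e
      exact absurd e.symm (ha.origin_ne _)
    · exact hle k w hw
    · rw [ha.origin_inv_right, ha.map_inv] at e
      exact absurd e.symm (ha.origin_ne _)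
    · rw [ha.map_inv] at e
      exact h.left_before i y hy k w hw (ha.origin_eq.1 e)
  · intro i d hd k z hz e
    obtain ⟨y, rfl, hy⟩ := hmap right i d hd
    rcases hmem k z hz with ⟨rfl, rfl⟩ | ⟨w, rfl, hw⟩
    · have := h.right_time_lt hy
      omega
    · rw [ha.map_inv, ha.map_inv] at e
      exact h.right_after i y hy k w hw (ha.origin_eq.1 e)
  · intro i d hd k z hz e
    obtain ⟨y, rfl, hy⟩ := hmap right i d hd
    rcases hmem k z hz with ⟨rfl, rfl⟩ | ⟨w, rfl, hw⟩
    · rw [N.inv_inv, ha.origin_right, ha.origin_eq] at e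
      exact absurd (hS _ _ h.top.1 (h.right_outer hy) e).symm (hr_ne i y hy)
    · rw [ha.map_inv] at e
      exact h.right_before i y hy k w hw (ha.origin_eq.1 e)
  · refine List.pairwise_cons.2 ⟨?_, List.pairwise_map.2 h.left_sorted⟩
    rintro ⟨i, d⟩ hd
    obtain ⟨y, rfl, hy⟩ := hmap left i d hd
    exact h.left_time_lt hy
  · exact List.pairwise_map.2 h.right_sorted

end Explored

namespace Explored

variable {n : ℕ} {t : M.Dart} {left right path : List (ℕ × M.Dart)}

/-- If the uppermost right edge has a later time than the uppermost left edge, then its triangle is the last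
one on the path. -/
theorem isLastFace_right {i j : ℕ} {dl dr : M.Dart}
    (h : M.Explored n t ((i, dl) :: left) ((j, dr) :: right) path) (hij : i < j) :
    M.IsLastFace (M.face (M.inv dr)) := by
  have hdr : (j, dr) ∈ (j, dr) :: right := List.mem_cons_self ..
  obtain ⟨z, hz1, hz2⟩ := h.right_visited j dr hdr
  refine ⟨⟨M.edge dr, ⟨M.inv dr, rfl, edge_inv dr⟩, Or.inr ⟨dr, h.isRight_iff.2 ⟨j, hdr⟩, rfl⟩⟩, z,
    ⟨h.mem_onPath hz1, h.right_inner hdr, hz2⟩, ?_⟩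
  rintro z' f' hzz ⟨h1, h2, rfl⟩ ⟨e, ⟨y, hy1, rfl⟩, he⟩
  -- a boundary triangle entered after `z` has a time that is not after that of `z`
  have key : ∀ k w d, (k, w) ∈ path → M.face (M.inv w) = M.face (M.inv d) → M.Outer d →
      M.edge d = M.edge y → (k < j ∨ d = dr) → False := by
    intro k w d hk hw hd hdy hkj
    have hyd : y = M.inv d := by
      rcases edge_eq_iff.1 hdy with rfl | rfl
      · exact absurd (hy1.symm.trans hd) h2
      · rw [M.inv_inv]
    have hwz : w = z' := h.tri.2.1.eq_of_face_inv_eq (h.iface.onPath_goes (h.mem_onPath hk))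
      (h.iface.onPath_goes h1) h2 (by rw [hw, ← hy1, hyd])
    have hcyc := OnPath.not_transGen_self h.tri.2.1 h.iface (h.mem_onPath hz1)
    rcases hkj with hkj | rfl
    · have := h.trail.transGen_of_lt (List.mem_cons_of_mem _ hk) (List.mem_cons_of_mem _ hz1) hkj
      rw [hwz] at this
      exact hcyc (hzz.trans this)
    · have : z' = z := h.tri.2.1.eq_of_face_inv_eq (h.iface.onPath_goes h1)
        (h.iface.onPath_goes (h.mem_onPath hz1)) (fun ho => h.right_inner hdr (outer_of_face_eq hz2 ho))
        (by rw [← hy1, hyd, hz2])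
      rw [this] at hzz
      exact hcyc hzz
  rcases he with ⟨d, hd, hdy⟩ | ⟨d, hd, hdy⟩
  · obtain ⟨k, hk⟩ := h.isLeft_iff.1 hd
    obtain ⟨w, hw1, hw2⟩ := h.left_visited k d hk
    refine key k w d hw1 hw2 hd.1 hdy (Or.inl ?_)
    rcases List.mem_cons.1 hk with h3 | h3
    · obtain ⟨rfl, rfl⟩ := Prod.mk.inj h3
      exact hij
    · have := (List.pairwise_cons.1 h.left_sorted).1 _ h3
      simp only at this
      omega
  · obtain ⟨k, hk⟩ := h.isRight_iff.1 hd
    obtain ⟨w, hw1, hw2⟩ := h.right_visited k d hk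
    refine key k w d hw1 hw2 hd.1 hdy ?_
    rcases List.mem_cons.1 hk with h3 | h3
    · obtain ⟨rfl, rfl⟩ := Prod.mk.inj h3
      exact Or.inr rfl
    · exact Or.inl ((List.pairwise_cons.1 h.right_sorted).1 _ h3)

theorem not_isLastFace_right {i j : ℕ} {dl dr : M.Dart}
    (h : M.Explored n t ((i, dl) :: left) ((j, dr) :: right) path) (hij : j < i) :
    ¬ M.IsLastFace (M.face (M.inv dr)) := by
  intro hlast
  have h1 := (mirror_iff.2 h).isLastFace_right hij
  have h2 := h1.unique (mirror_nearTriangulation h.tri.2.1) (mirror_isLastFace hlast)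
  have h3 := mirror_face.1 h2
  obtain ⟨z, hz1, hz2⟩ := h.right_visited j dr (List.mem_cons_self ..)
  obtain ⟨z', hz3, hz4⟩ := h.left_visited i dl (List.mem_cons_self ..)
  have := h.time_unique hz1 hz3
    (fun ho => h.right_inner (List.mem_cons_self ..) (outer_of_face_eq hz2 ho)) (by rw [hz2, hz4, h3])
  omega

/-- A path dart ending at the top-right vertex comes after the visit to the triangle of the uppermost
right edge. -/
theorem lt_time_of_origin_inv_eq_top {j : ℕ} {dr : M.Dart}
    (h : M.Explored n t left ((j, dr) :: right) path) {k : ℕ} {z : M.Dart}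
    (hz : (k, z) ∈ (n, M.inv t) :: path) (e : M.origin (M.inv z) = M.origin t) : j < k := by
  refine h.right_after j dr (List.mem_cons_self ..) k z hz ?_
  have h1 : M.next dr = t := (M.next.symm_apply_eq.1 h.right_links.1).symm
  rw [e, ← h1, origin_next]

/-- Gluing the top-edge to the uppermost left edge, when the triangle of the uppermost right edge is
visited after that of the uppermost left edge.  The path now leaves the map at this triangle. -/
theorem fold {i j : ℕ} {dl dr : M.Dart}
    (h : M.Explored n t ((i, dl) :: left) ((j, dr) :: right) path) (hij : i < j)
    {ζ : M.Dart → N.Dart} (hz : IsZip M N t ζ) (hcol : ∀ y, N.color (ζ y) = M.recolor t .white y) :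
    ∃ path', N.Explored (n + 1) (ζ dr) (left.map (Prod.map id ζ)) (right.map (Prod.map id ζ)) path' ∧
      ∀ k z, (k, z) ∈ path' ↔ ∃ y, (k, y) ∈ path ∧ k ≤ j ∧ z = ζ y := by
  obtain ⟨hP, hT, hL, hS⟩ := h.tri
  have hR := h.iface
  have hTP := h.isTP
  have hdl : (i, dl) ∈ (i, dl) :: left := List.mem_cons_self ..
  have hdr : (j, dr) ∈ (j, dr) :: right := List.mem_cons_self ..
  have hnt : M.next t = dl := h.left_links.1
  have hndr : M.next dr = t := (M.next.symm_apply_eq.1 h.right_links.1).symm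
  have hgl := h.left_goes i dl hdl
  have hgr := h.right_goes j dr hdr
  have hne : M.origin t ≠ M.origin (M.inv (M.next t)) := by
    intro e
    have := color_eq_of_origin_eq e
    rw [h.top.2.1, hnt, hgl.2] at this
    cases this
  have hne' := hne
  rw [hnt] at hne'
  -- the gluing creates no black vertex, and only the top-right vertex becomes white
  have hcw : ∀ y, M.color y = .white → N.color (ζ y) = .white := by
    intro y hy
    rw [hcol, recolor]
    split_ifs
    · rfl
    · exact hy
  have hcb : ∀ y, M.color y = .black → M.origin y ≠ M.origin t → N.color (ζ y) = .black := by
    intro y hy hy2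
    rw [hcol, recolor, if_neg hy2, hy]
  have hcb' : ∀ y, N.color (ζ y) = .black → M.color y = .black ∧ M.origin y ≠ M.origin t := by
    intro y hy
    rw [hcol, recolor] at hy
    split_ifs at hy with h1
    exact ⟨hy, h1⟩
  have hcw' : ∀ y, N.color (ζ y) = .white → M.origin y ≠ M.origin t → M.color y = .white := by
    intro y hy hy2
    rwa [hcol, recolor, if_neg hy2] at hy
  -- darts that are not removed: those of the path, of the right edges, and of the other left edges
  have hkeep : ∀ y, M.Goes .white .black y → y ≠ t ∧ y ≠ M.next t := by
    intro y hy
    constructor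
    · rintro rfl
      exact absurd (hy.1.symm.trans h.top.2.1) (by decide)
    · rintro rfl
      rw [hnt] at hy
      exact absurd (hy.2.symm.trans hgl.2) (by decide)
  have hkeepb : ∀ y, M.Goes .black .black y → y ≠ t ∧ y ≠ M.next t := by
    intro y hy
    constructor
    · rintro rfl
      exact absurd (hy.2.symm.trans h.top.2.2) (by decide)
    · rintro rfl
      rw [hnt] at hy
      exact absurd (hy.2.symm.trans hgl.2) (by decide)
  have hkeepl : ∀ k d, (k, d) ∈ left → d ≠ t ∧ d ≠ M.next t := by
    intro k d hd
    have hd' : (k, d) ∈ (i, dl) :: left := List.mem_cons_of_mem _ hd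
    constructor
    · rintro rfl
      exact absurd ((h.left_goes k d hd').1.symm.trans h.top.2.1) (by decide)
    · rw [hnt]
      rintro rfl
      have h1 := h.left_time_unique hdl hd' rfl
      have h2 := (List.pairwise_cons.1 h.left_sorted).1 _ hd
      simp only at h2
      omega
  have hdr_ne : ∀ k d, (k, d) ∈ right → d ≠ dr := by
    rintro k d hd rfl
    have h1 := h.right_time_unique hdr (List.mem_cons_of_mem _ hd) rfl
    have h2 := (List.pairwise_cons.1 h.right_sorted).1 _ hd
    simp only at h2
    omega
  have hkeepdr := hkeepb dr hgr
  have hinner : ∀ y, ¬ M.Outer y → y ≠ t ∧ y ≠ M.next t := fun y => hz.ne_of_not_outer h.top.1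
  -- no edge joins the two vertices that are merged: it would be on the path, at a time not after `i` because of
  -- its white end, and after `j` because of its black end
  have hnoedge : ∀ z, M.origin z = M.origin (M.inv dl) → M.origin (M.inv z) = M.origin t → False := by
    intro z e1 e2
    have hgz : M.Goes .white .black z :=
      ⟨(color_eq_of_origin_eq e1).trans hgl.2, (color_eq_of_origin_eq e2).trans h.top.2.1⟩
    have hon := hTP.onPath_of_outerVertex hgz
      ((h.left_outer hdl).outerVertex_inv.of_origin_eq e1.symm)
      (h.top.1.outerVertex.of_origin_eq e2.symm)
    obtain ⟨k, hk⟩ := h.trail.mem_of_onPath hT (by rw [M.inv_inv]; exact h.top.1) hon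
    have h1 := h.lt_time_of_origin_inv_eq_top hk e2
    have h2 := h.left_before i dl hdl k z hk e1
    omega
  -- except for the merged vertices, darts with the same origin had the same origin before
  have horig := fun y z => hz.origin_eq hne (y := y) (z := z)
  rw [hnt] at horig
  have horigw : ∀ y z, M.color y = .white → M.color z = .white →
      N.origin (ζ y) = N.origin (ζ z) → M.origin y = M.origin z := by
    intro y z hy hz e
    have hw : ∀ y, M.color y = .white → M.origin y ≠ M.origin t := by
      intro y hy e
      rw [color_eq_of_origin_eq e, h.top.2.1] at hy
      cases hy
    rcases (horig y z).1 e with e1 | ⟨e1 | e1, e2 | e2⟩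
    · exact e1
    · exact absurd e1 (hw y hy)
    · exact absurd e1 (hw y hy)
    · exact absurd e2 (hw z hz)
    · exact e1.trans e2.symm
  have horigb : ∀ y z, M.color y = .black → M.color z = .black → M.origin y ≠ M.origin t →
      N.origin (ζ y) = N.origin (ζ z) → M.origin y = M.origin z := by
    intro y z hy hz hyt e
    have hw : ∀ y, M.color y = .black → M.origin y ≠ M.origin (M.inv dl) := by
      intro y hy e
      rw [color_eq_of_origin_eq e, hgl.2] at hy
      cases hy
    rcases (horig y z).1 e with e1 | ⟨e1 | e1, _⟩
    · exact e1
    · exact absurd e1 hyt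
    · exact absurd e1 (hw y hy)
  have hNT := (hz.nearTriangulation_iff h.top.1).1 hT
  have hNL : N.Loopless := by
    intro x
    obtain ⟨y, hy, rfl⟩ := hz.surj x
    rw [hz.map_inv]
    intro e
    rcases (horig y _).1 e with e1 | ⟨e1 | e1, e2 | e2⟩
    · exact hL y e1
    · exact hL y (e1.trans e2.symm)
    · exact hnoedge (M.inv y) e2 (by rw [M.inv_inv]; exact e1)
    · exact hnoedge y e1 e2
    · exact hL y (e1.trans e2.symm)
  have hout_ne : ∀ y, M.Outer y → y ≠ t → M.origin y ≠ M.origin t := fun y hy hyt e =>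
    hyt (hS _ _ hy h.top.1 e)
  have hNS : N.SimpleBoundary := by
    intro x x' hx hx' e
    obtain ⟨y, hy, rfl⟩ := hz.surj x
    obtain ⟨y', hy', rfl⟩ := hz.surj x'
    rw [hz.outer hy] at hx
    rw [hz.outer hy'] at hx'
    rcases (horig y y').1 e with e1 | ⟨e1 | e1, e2 | e2⟩
    · rw [hS y y' hx hx' e1]
    · exact absurd e1 (hout_ne y hx hy.1)
    · exact absurd e1 (hout_ne y hx hy.1)
    · exact absurd e2 (hout_ne y' hx' hy'.1)
    · rw [hS y y' hx hx' (e1.trans e2.symm)]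
  have hroot_next : M.origin (M.inv M.root) ≠ M.origin t := by
    rw [← origin_next]
    refine hout_ne _ (outer_next.2 outer_root) fun e => ?_
    have : M.root = dr := M.next.injective (e.trans hndr.symm)
    have h1 := hR.1.1
    rw [this, hgr.1] at h1
    cases h1
  have hNR : N.RootInterface := by
    rw [RootInterface, hz.map_root]
    refine ⟨⟨hcw _ hR.1.1, ?_⟩, ?_⟩
    · rw [hz.map_inv]
      exact hcb _ hR.1.2 hroot_next
    · intro x hx hg
      obtain ⟨y, hy, rfl⟩ := hz.surj x
      rw [hz.outer hy] at hx
      have h1 := hg.2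
      rw [hz.map_inv] at h1
      rw [hR.2 y hx ⟨hcw' y hg.1 (hout_ne y hx hy.1), (hcb' _ h1).1⟩]
  have hdr_inv : M.origin (M.inv dr) = M.origin t := by rw [← hndr, origin_next]
  have hdr_not : M.origin dr ≠ M.origin t := hout_ne dr (h.right_outer hdr) hkeepdr.1
  have htop : N.IsTop (ζ dr) := by
    refine ⟨(hz.outer hkeepdr).2 (h.right_outer hdr), hcb dr hgr.1 hdr_not, ?_⟩
    rw [hz.map_inv, hcol, recolor, if_pos hdr_inv]
  have hinvkeep : ∀ k d, (k, d) ∈ right → M.origin (M.inv d) ≠ M.origin t := by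
    intro k d hd e
    rw [← origin_next] at e
    have h1 := hS _ _ (outer_next.2 (h.right_outer (List.mem_cons_of_mem _ hd))) h.top.1 e
    exact hdr_ne k d hd (M.next.injective (h1.trans hndr.symm))
  -- the path remains the same up to the triangle of `dr`, which it now leaves through the edge of `dr`
  obtain ⟨zj, hzj1, hzj2⟩ := h.right_visited j dr hdr
  have hzjo : ¬ M.Outer (M.inv zj) := fun ho => h.right_inner hdr (outer_of_face_eq hzj2 ho)
  obtain ⟨s, p, hsp⟩ := List.append_of_mem (List.mem_cons_of_mem (n, M.inv t) hzj1)
  have htr : M.Trail ((j, zj) :: p) := by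
    have := h.trail
    rw [hsp] at this
    exact this.suffix
  have hpmem : ∀ k z, (k, z) ∈ (j, zj) :: p → (k, z) ∈ (n, M.inv t) :: path := by
    intro k z hk
    rw [hsp]
    exact List.mem_append_right _ hk
  have hple : ∀ k z, (k, z) ∈ (j, zj) :: p → k ≤ j := by
    intro k z hk
    rcases List.mem_cons.1 hk with h1 | h1
    · exact (Prod.mk.inj h1).1.le
    · exact (htr.lt_head h1).1.le
  have hpmem' : ∀ k z, (k, z) ∈ path → k ≤ j → (k, z) ∈ (j, zj) :: p := by
    intro k z hk hkj
    have h1 := List.mem_cons_of_mem (n, M.inv t) hk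
    rw [hsp] at h1
    rcases List.mem_append.1 h1 with h2 | h2
    · obtain ⟨s1, s2, rfl⟩ := List.append_of_mem h2
      have h3 := h.trail
      rw [hsp, List.append_assoc, List.cons_append] at h3
      have := (h3.suffix.lt_head (k := j) (z := zj) (by simp)).1
      omega
    · exact h2
  have hpblack : ∀ k z, (k, z) ∈ (j, zj) :: p → M.origin (M.inv z) ≠ M.origin t := by
    intro k z hk e
    have h1 := h.lt_time_of_origin_inv_eq_top (hpmem k z hk) e
    have h2 := hple k z hk
    omega
  have htrail0 : N.Trail (((j, zj) :: p).map (Prod.map id ζ)) := by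
    refine htr.map ζ hz.map_root ?_
    rintro k k' z z' hk hk' ⟨h1, h2, h3⟩
    refine ⟨?_, ?_, hcw _ h3.1, ?_⟩
    · rwa [hz.map_inv, hz.outer (hinner _ h1)]
    · rwa [hz.map_inv, hz.face_eq (hkeep z' h3) (hinner _ h1)]
    · rw [hz.map_inv]
      exact hcb _ h3.2 (hpblack k' z' hk')
  have htrail : N.Trail ((n + 1, N.inv (ζ dr)) :: ((j, zj) :: p).map (Prod.map id ζ)) := by
    rw [List.map_cons] at htrail0 ⊢
    refine Trail.cons htrail0 ?_ ⟨?_, ?_, goes_inv.2 htop.2⟩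
    · have := h.right_time_lt hdr
      simp only [id]
      omega
    · rwa [hz.map_inv, hz.outer (hinner _ hzjo)]
    · rw [hz.map_inv, hz.map_inv, hz.face_eq (hinner _ (h.right_inner hdr)) (hinner _ hzjo), hzj2]
  have hmap : ∀ (L : List (ℕ × M.Dart)) k d, (k, d) ∈ L.map (Prod.map id ζ) →
      ∃ y, d = ζ y ∧ (k, y) ∈ L := by
    intro L i d hd
    obtain ⟨⟨k', y⟩, h2, h3⟩ := List.mem_map.1 hd
    obtain ⟨rfl, rfl⟩ := Prod.mk.inj h3
    exact ⟨y, rfl, h2⟩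
  have hmem : ∀ k z, (k, z) ∈ (n + 1, N.inv (ζ dr)) :: ((j, zj) :: p).map (Prod.map id ζ) →
      (k = n + 1 ∧ z = N.inv (ζ dr)) ∨ ∃ y, z = ζ y ∧ (k, y) ∈ (j, zj) :: p := by
    intro k z hk
    rcases List.mem_cons.1 hk with h1 | h1
    · exact Or.inl (Prod.mk.inj h1)
    · exact Or.inr (hmap _ k z h1)
  have hvis : ∀ k d, ¬ M.Outer (M.inv d) → k ≤ j →
      (∃ z, (k, z) ∈ path ∧ M.face (M.inv z) = M.face (M.inv d)) →
      ∃ z, (k, z) ∈ ((j, zj) :: p).map (Prod.map id ζ) ∧ N.face (N.inv z) = N.face (N.inv (ζ d)) := by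
    rintro k d hd hk ⟨z, h1, h2⟩
    refine ⟨ζ z, List.mem_map.2 ⟨(k, z), hpmem' k z h1 hk, rfl⟩, ?_⟩
    rw [hz.map_inv, hz.map_inv, hz.face_eq (hinner _ fun ho => hd (outer_of_face_eq h2 ho)) (hinner _ hd)]
    exact h2
  have hleft_lt : ∀ k d, (k, d) ∈ left → k < i := fun k d hd =>
    (List.pairwise_cons.1 h.left_sorted).1 _ hd
  have hright_lt : ∀ k d, (k, d) ∈ right → k < j := fun k d hd =>
    (List.pairwise_cons.1 h.right_sorted).1 _ hd
  have hgl' := fun k d (hd : (k, d) ∈ left) => h.left_goes k d (List.mem_cons_of_mem _ hd)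
  have hgr' := fun k d (hd : (k, d) ∈ right) => h.right_goes k d (List.mem_cons_of_mem _ hd)
  refine ⟨((j, zj) :: p).map (Prod.map id ζ), ⟨⟨(hz.planar_iff hne).1 hP, hNT, hNL, hNS⟩, hNR, htop,
    ?_, ?_, ?_, ?_, htrail, ?_, ?_, ?_, ?_, ?_, ?_, ?_, ?_⟩, fun k z => ⟨fun hk => ?_, ?_⟩⟩
  · rw [hz.map_root]
    refine h.left_links.2.map ζ ?_ fun k y hy => hz.next_of_ne y (hkeepl k y hy) fun e => ?_
    · rw [hz.next_of_eq dr hndr, hnt]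
    · have h1 := (hgl' k y hy).2
      rw [← color_next, e, h.top.2.1] at h1
      cases h1
  · rw [hz.map_root]
    have hsymm : ∀ y, M.Goes .black .black y → N.next.symm (ζ y) = ζ (M.next.symm y) := by
      intro y hy
      have h0 : M.next (M.next.symm y) = y := M.next.apply_symm_apply y
      have h1 : M.color (M.inv (M.next.symm y)) = .black := by rw [color_inv_next_symm, hy.1]
      rw [Equiv.symm_apply_eq, hz.next_of_ne _ ⟨fun e => ?_, fun e => ?_⟩ (by rw [h0]; exact (hkeepb y hy).1),
        h0]
      · rw [e, h.top.2.2] at h1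
        cases h1
      · rw [e, hnt, hgl.2] at h1
        cases h1
    exact h.right_links.2.map ζ (hsymm dr hgr) fun k y hy => hsymm y (hgr' k y hy)
  · intro k d hd
    obtain ⟨y, rfl, hy⟩ := hmap _ k d hd
    refine ⟨hcw _ (hgl' k y hy).1, ?_⟩
    rw [hz.map_inv]
    exact hcw _ (hgl' k y hy).2
  · intro k d hd
    obtain ⟨y, rfl, hy⟩ := hmap _ k d hd
    refine ⟨hcb _ (hgr' k y hy).1 (hout_ne y (h.right_outer (List.mem_cons_of_mem _ hy))
      (hkeepb y (hgr' k y hy)).1), ?_⟩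
    rw [hz.map_inv]
    exact hcb _ (hgr' k y hy).2 (hinvkeep k y hy)
  · intro k d hd
    obtain ⟨y, rfl, hy⟩ := hmap _ k d hd
    have := hleft_lt k y hy
    exact hvis k y (h.left_inner (List.mem_cons_of_mem _ hy)) (by omega)
      (h.left_visited k y (List.mem_cons_of_mem _ hy))
  · intro k d hd
    obtain ⟨y, rfl, hy⟩ := hmap _ k d hd
    exact hvis k y (h.right_inner (List.mem_cons_of_mem _ hy)) (hright_lt k y hy).le
      (h.right_visited k y (List.mem_cons_of_mem _ hy))
  · intro k d hd k' z hz' e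
    obtain ⟨y, rfl, hy⟩ := hmap _ k d hd
    have hkn := h.left_time_lt (List.mem_cons_of_mem _ hy)
    rcases hmem k' z hz' with ⟨rfl, rfl⟩ | ⟨w, rfl, hw⟩
    · omega
    · exact h.left_after k y (List.mem_cons_of_mem _ hy) k' w (hpmem k' w hw)
        (horigw w y (h.goes_of_mem (hpmem k' w hw)).1 (hgl' k y hy).1 e)
  · intro k d hd k' z hz' e
    obtain ⟨y, rfl, hy⟩ := hmap _ k d hd
    rw [hz.map_inv] at e
    rcases hmem k' z hz' with ⟨rfl, rfl⟩ | ⟨w, rfl, hw⟩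
    · -- the new path dart starts at the merged vertex, which is not the lower end of a left edge
      exfalso
      rw [hz.map_inv] at e
      have h1 : M.origin (M.inv y) = M.origin (M.inv dl) := by
        have hyt : M.origin (M.inv y) ≠ M.origin t := by
          intro e1
          have h1 := color_eq_of_origin_eq e1
          rw [(hgl' k y hy).2, h.top.2.1] at h1
          cases h1
        rcases (horig _ _).1 e with e1 | ⟨_, e1 | e1⟩
        · exact absurd (e1.symm.trans hdr_inv) hyt
        · exact absurd e1 hyt
        · exact e1
      rw [← origin_next, ← origin_next] at h1
      have h2 := hS _ _ (outer_next.2 (h.left_outer (List.mem_cons_of_mem _ hy)))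
        (outer_next.2 (h.left_outer hdl)) h1
      exact (hkeepl k y hy).2 ((M.next.injective h2).trans hnt.symm)
    · exact h.left_before k y (List.mem_cons_of_mem _ hy) k' w (hpmem k' w hw)
        (horigw w _ (h.goes_of_mem (hpmem k' w hw)).1 (hgl' k y hy).2 e)
  · intro k d hd k' z hz' e
    obtain ⟨y, rfl, hy⟩ := hmap _ k d hd
    have hkn := h.right_time_lt (List.mem_cons_of_mem _ hy)
    rcases hmem k' z hz' with ⟨rfl, rfl⟩ | ⟨w, rfl, hw⟩
    · omega
    · rw [hz.map_inv, hz.map_inv] at e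
      exact h.right_after k y (List.mem_cons_of_mem _ hy) k' w (hpmem k' w hw)
        (horigb _ _ (h.goes_of_mem (hpmem k' w hw)).2 (hgr' k y hy).2 (hpblack k' w hw) e)
  · intro k d hd k' z hz' e
    obtain ⟨y, rfl, hy⟩ := hmap _ k d hd
    rcases hmem k' z hz' with ⟨rfl, rfl⟩ | ⟨w, rfl, hw⟩
    · -- the new path dart ends at the new top-right vertex, where no other right edge starts
      exfalso
      rw [N.inv_inv] at e
      exact hdr_ne k y hy (hS _ _ (h.right_outer (List.mem_cons_of_mem _ hy)) (h.right_outer hdr)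
        (horigb _ _ hgr.1 (hgr' k y hy).1 hdr_not e).symm)
    · rw [hz.map_inv] at e
      exact h.right_before k y (List.mem_cons_of_mem _ hy) k' w (hpmem k' w hw)
        (horigb _ _ (h.goes_of_mem (hpmem k' w hw)).2 (hgr' k y hy).1 (hpblack k' w hw) e)
  · exact List.pairwise_map.2 (List.pairwise_cons.1 h.left_sorted).2
  · exact List.pairwise_map.2 (List.pairwise_cons.1 h.right_sorted).2
  · obtain ⟨y, rfl, hy⟩ := hmap _ k z hk
    have h1 := hple k y hy
    refine ⟨y, ?_, h1, rfl⟩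
    rcases List.mem_cons.1 (hpmem k y hy) with h2 | h2
    · have h3 := h.right_time_lt hdr
      have h4 := (Prod.mk.inj h2).1
      omega
    · exact h2
  · rintro ⟨y, h1, h2, rfl⟩
    exact List.mem_map.2 ⟨(k, y), hpmem' k y h1 h2, rfl⟩

/-- The mirror image of `attach`. -/
theorem attach_black (h : M.Explored n t left right path) {ι : M.Dart → N.Dart} {r l : N.Dart}
    (ha : IsAttach M N t .black ι r l) :
    N.Explored (n + 1) l (left.map (Prod.map id ι)) ((n, r) :: right.map (Prod.map id ι))
      (((n, M.inv t) :: path).map (Prod.map id ι)) :=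
  mirror_iff.1 ((mirror_iff.2 h).attach ha.mirror)

/-- The coloring of the mirror image, in the case where the top-left vertex is recolored. -/
theorem color_mirror_of_recolor {t : M.Dart} {ζ : M.Dart → N.Dart}
    (hinv : ∀ y, N.inv (ζ y) = ζ (M.inv y))
    (hcol : ∀ y, N.color (ζ y) = M.recolor (M.next t) .black y) (y : M.Dart) :
    N.mirror.color (ζ y) = M.mirror.recolor t .white y := by
  simp only [PercMap.mirror]
  rw [hinv, hcol, recolor, recolor]
  have h1 : M.mirror.origin y = M.mirror.origin t ↔ M.origin (M.inv y) = M.origin (M.next t) := by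
    rw [mirror_origin, origin_next]
  by_cases h2 : M.origin (M.inv y) = M.origin (M.next t)
  · rw [if_pos h2]
    exact (if_pos (h1.2 h2)).symm
  · rw [if_neg h2]
    exact (if_neg fun h3 => h2 (h1.1 h3)).symm

/-- The mirror image of `fold`. -/
theorem fold_black {i j : ℕ} {dl dr : M.Dart}
    (h : M.Explored n t ((i, dl) :: left) ((j, dr) :: right) path) (hij : j < i)
    {ζ : M.Dart → N.Dart} (hz : IsZip M N (M.next.symm t) ζ)
    (hcol : ∀ y, N.color (ζ y) = M.recolor (M.next t) .black y) :
    ∃ path', N.Explored (n + 1) (ζ dl) (left.map (Prod.map id ζ)) (right.map (Prod.map id ζ)) path' := by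
  have hz' := hz.mirror
  rw [Equiv.apply_symm_apply] at hz'
  obtain ⟨path', hp, -⟩ := (mirror_iff.2 h).fold hij hz' (color_mirror_of_recolor hz.map_inv hcol)
  exact ⟨path', mirror_iff.1 hp⟩

end Explored

end PercMap

/-! ### Matching steps of a word -/

theorem getElem?_concat {w : List Letter} {x y : Letter} {i : ℕ} :
    (w ++ [x])[i]? = some y ↔ w[i]? = some y ∨ (i = w.length ∧ x = y) := by
  rcases lt_trichotomy i w.length with h | h | h
  · rw [List.getElem?_append_left h]
    constructor
    · exact Or.inl
    · rintro (h1 | ⟨h1, -⟩)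
      · exact h1
      · omega
  · subst h
    simp
  · have h1 : (w ++ [x])[i]? = none := List.getElem?_eq_none (by simp; omega)
    have h2 : w[i]? = none := List.getElem?_eq_none (by omega)
    rw [h1, h2]
    simp
    omega

theorem lt_length_of_getElem? {w : List Letter} {y : Letter} {i : ℕ} (h : w[i]? = some y) :
    i < w.length := (List.getElem?_eq_some_iff.1 h).1

/-- The stack of the `s`-steps that have no matching `c`-step yet, the last one first. -/
def openSteps (s : Letter) (w : List Letter) : List ℕ :=
  w.zipIdx.foldl (fun st p => if p.1 = s then p.2 :: st else if p.1 = .c then st.tail else st) []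

theorem openSteps_concat (s : Letter) (w : List Letter) (x : Letter) :
    openSteps s (w ++ [x]) = if x = s then w.length :: openSteps s w
      else if x = .c then (openSteps s w).tail else openSteps s w := by
  unfold openSteps
  rw [List.zipIdx_append, List.foldl_append]
  simp

theorem factor_concat {w : List Letter} {x : Letter} {i k : ℕ} (hk : k < w.length) :
    factor (w ++ [x]) i k = factor w i k := by
  unfold factor
  rw [List.take_append_of_le_length (by omega)]

theorem factor_concat_length {w : List Letter} {x : Letter} {i : ℕ} (hi : i ≤ w.length) :
    factor (w ++ [x]) i w.length = w.drop i ++ [x] := by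
  unfold factor
  rw [List.take_of_length_le (by simp), List.drop_append_of_le_length hi]

theorem Matching.lt_length {s : Letter} {w : List Letter} {i j : ℕ} (h : Matching s w i j) :
    j < w.length := lt_length_of_getElem? h.2.1

theorem matching_concat {s : Letter} {w : List Letter} {x : Letter} {i j : ℕ} (hj : j < w.length) :
    Matching s (w ++ [x]) i j ↔ Matching s w i j := by
  unfold Matching
  rw [List.getElem?_append_left hj, factor_concat hj]
  constructor
  · rintro ⟨h1, h2, h3, h4, h5⟩
    refine ⟨?_, h2, h3, h4, fun k hk hk2 => ?_⟩
    · rwa [List.getElem?_append_left (by omega)] at h1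
    · have := h5 k hk hk2
      rwa [factor_concat (by omega)] at this
  · rintro ⟨h1, h2, h3, h4, h5⟩
    refine ⟨?_, h2, h3, h4, fun k hk hk2 => ?_⟩
    · rwa [List.getElem?_append_left (by omega)]
    · rw [factor_concat (by omega)]
      exact h5 k hk hk2

/-- The open step at depth `p` of the stack sees `p + 1` more `s` than `c` from itself to the end of the
word, and sees strictly more `s` than `c` all the way. -/
theorem openSteps_getElem? {s : Letter} (hs : s ≠ .c) (w : List Letter) {p i : ℕ}
    (h : (openSteps s w)[p]? = some i) :
    w[i]? = some s ∧ (w.drop i).count s = (w.drop i).count .c + (p + 1) ∧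
      ∀ k, i ≤ k → k < w.length → (factor w i k).count .c < (factor w i k).count s := by
  induction w using List.reverseRecOn generalizing p i with
  | nil => simp [openSteps] at h
  | append_singleton w x ih =>
    -- the strict inequality at the new last position follows from the count
    have hstep : ∀ q, w[i]? = some s →
        (∀ k, i ≤ k → k < w.length → (factor w i k).count .c < (factor w i k).count s) →
        ((w ++ [x]).drop i).count s = ((w ++ [x]).drop i).count .c + (q + 1) →
        ∀ k, i ≤ k → k < (w ++ [x]).length →
          (factor (w ++ [x]) i k).count .c < (factor (w ++ [x]) i k).count s := by
      intro q h1 h2 h3 k hk hk2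
      have hi := lt_length_of_getElem? h1
      rw [List.length_append, List.length_singleton] at hk2
      rcases Nat.lt_succ_iff_lt_or_eq.1 hk2 with h4 | rfl
      · rw [factor_concat h4]
        exact h2 k hk h4
      · rw [factor_concat_length hi.le]
        rw [List.drop_append_of_le_length hi.le] at h3
        omega
    rw [openSteps_concat] at h
    have hgoal : ∀ q q', (openSteps s w)[q]? = some i →
        [x].count s + (q + 1) = [x].count .c + (q' + 1) → q' = p →
        (w ++ [x])[i]? = some s ∧
        ((w ++ [x]).drop i).count s = ((w ++ [x]).drop i).count .c + (p + 1) ∧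
          ∀ k, i ≤ k → k < (w ++ [x]).length →
            (factor (w ++ [x]) i k).count .c < (factor (w ++ [x]) i k).count s := by
      rintro q q' h1 h2 rfl
      obtain ⟨h3, h4, h5⟩ := ih h1
      have hi := lt_length_of_getElem? h3
      have h6 : ((w ++ [x]).drop i).count s = ((w ++ [x]).drop i).count .c + (q' + 1) := by
        rw [List.drop_append_of_le_length hi.le, List.count_append, List.count_append]
        omega
      exact ⟨getElem?_concat.2 (Or.inl h3), h6, hstep q' h3 h5 h6⟩
    split_ifs at h with h1 h2
    · subst h1
      cases p with
      | zero =>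
        rw [List.getElem?_cons_zero, Option.some_inj] at h
        subst h
        have h6 : ((w ++ [x]).drop w.length) = [x] := by simp
        refine ⟨getElem?_concat.2 (Or.inr ⟨rfl, rfl⟩), ?_, ?_⟩
        · rw [h6]
          simp [hs]
        · intro k hk hk2
          rw [List.length_append, List.length_singleton] at hk2
          obtain rfl : k = w.length := by omega
          rw [factor_concat_length le_rfl]
          simp [hs]
      | succ p =>
        rw [List.getElem?_cons_succ] at h
        refine hgoal p (p + 1) h ?_ rfl
        simp [hs]
        omega
    · subst h2
      rw [List.getElem?_tail] at h
      refine hgoal (p + 1) p h ?_ rfl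
      simp [hs.symm]
      omega
    · refine hgoal p p h ?_ rfl
      simp [h1, h2]

theorem matching_of_head {s : Letter} (hs : s ≠ .c) {w : List Letter} {i : ℕ}
    (h : (openSteps s w)[0]? = some i) : Matching s (w ++ [.c]) i w.length := by
  obtain ⟨h1, h2, h3⟩ := openSteps_getElem? hs w h
  have hi := lt_length_of_getElem? h1
  refine ⟨getElem?_concat.2 (Or.inl h1), getElem?_concat.2 (Or.inr ⟨rfl, rfl⟩), hi, ?_, ?_⟩
  · rw [factor_concat_length hi.le, List.count_append, List.count_append, h2]
    simp [hs.symm]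
  · intro k hk hk2
    rw [factor_concat hk2]
    exact h3 k hk hk2

theorem exists_matching_of_notMem {s : Letter} (hs : s ≠ .c) {w : List Letter} {i : ℕ} (hi : w[i]? = some s)
    (h : i ∉ openSteps s w) : ∃ j, Matching s w i j := by
  induction w using List.reverseRecOn with
  | nil => simp at hi
  | append_singleton w x ih =>
    rw [openSteps_concat] at h
    rcases getElem?_concat.1 hi with h1 | ⟨rfl, rfl⟩
    · by_cases h2 : i ∈ openSteps s w
      · split_ifs at h with h3 h4
        · exact absurd (List.mem_cons_of_mem _ h2) h
        · subst h4
          refine ⟨w.length, matching_of_head hs ?_⟩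
          cases hst : openSteps s w with
          | nil => simp [hst] at h2
          | cons j st =>
            rw [hst] at h h2
            rcases List.mem_cons.1 h2 with rfl | h5
            · rfl
            · exact absurd h5 h
        · exact absurd h2 h
      · obtain ⟨j, hj⟩ := ih h1 h2
        exact ⟨j, (matching_concat hj.lt_length).2 hj⟩
    · simp at h

theorem unmatchedSteps_eq {s : Letter} (hs : s ≠ .c) (w : List Letter) :
    unmatchedSteps s w = {i | i ∈ openSteps s w} := by
  ext i
  constructor
  · rintro ⟨h1, h2⟩
    by_contra h3
    exact h2 (exists_matching_of_notMem hs h1 h3)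
  · intro h
    obtain ⟨p, hp⟩ := List.getElem?_of_mem h
    obtain ⟨h1, -, h3⟩ := openSteps_getElem? hs w hp
    refine ⟨h1, ?_⟩
    rintro ⟨j, hj⟩
    have h4 := hj.2.2.2.1
    have h5 := h3 j hj.2.2.1.le hj.lt_length
    omega

theorem matching_concat_c_iff {s : Letter} (hs : s ≠ .c) {w : List Letter} {i : ℕ} :
    Matching s (w ++ [.c]) i w.length ↔ (openSteps s w)[0]? = some i := by
  refine ⟨fun h => ?_, matching_of_head hs⟩
  obtain ⟨h1, h2, h3, h4, h5⟩ := h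
  have h6 : w[i]? = some s := by rwa [List.getElem?_append_left h3] at h1
  have h7 : i ∈ openSteps s w := by
    by_contra hn
    obtain ⟨j, hj⟩ := exists_matching_of_notMem hs h6 hn
    have h8 := h5 j hj.2.2.1.le hj.lt_length
    rw [factor_concat hj.lt_length, hj.2.2.2.1] at h8
    omega
  obtain ⟨p, hp⟩ := List.getElem?_of_mem h7
  obtain ⟨-, h8, -⟩ := openSteps_getElem? hs w hp
  rw [factor_concat_length h3.le, List.count_append, List.count_append, h8] at h4
  have h9 : [Letter.c].count s = 0 := by simp [hs.symm]
  have h10 : [Letter.c].count Letter.c = 1 := by simp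
  obtain rfl : p = 0 := by omega
  exact hp

theorem typeASteps_concat {w : List Letter} {x : Letter} {k : ℕ} (h : k ∈ typeASteps w) :
    k ∈ typeASteps (w ++ [x]) := by
  obtain ⟨i, j, h1, h2, h3⟩ := h
  exact ⟨i, j, (matching_concat h1.lt_length).2 h1, (matching_concat h2.lt_length).2 h2, h3⟩

theorem typeBSteps_concat {w : List Letter} {x : Letter} {k : ℕ} (h : k ∈ typeBSteps w) :
    k ∈ typeBSteps (w ++ [x]) := by
  obtain ⟨i, j, h1, h2, h3⟩ := h
  exact ⟨i, j, (matching_concat h1.lt_length).2 h1, (matching_concat h2.lt_length).2 h2, h3⟩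

theorem quadrantWalks_of_concat {w : List Letter} {x : Letter} (h : w ++ [x] ∈ quadrantWalks) :
    w ∈ quadrantWalks := fun u hu => h u (hu.trans (List.prefix_append w [x]))

theorem concat_mem_quadrantWalks {w : List Letter} {x : Letter} (hw : w ∈ quadrantWalks)
    (h : (w ++ [x]).count .c ≤ (w ++ [x]).count .a ∧ (w ++ [x]).count .c ≤ (w ++ [x]).count .b) :
    w ++ [x] ∈ quadrantWalks := by
  intro u hu
  rcases List.prefix_concat_iff.1 hu with rfl | h1
  · simpa using h
  · exact hw u h1

theorem length_openSteps {s : Letter} (hs : s ≠ .c) {w : List Letter}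
    (h : ∀ u, u <+: w → u.count .c ≤ u.count s) : (openSteps s w).length + w.count .c = w.count s := by
  induction w using List.reverseRecOn with
  | nil => simp [openSteps]
  | append_singleton w x ih =>
    have h1 := ih fun u hu => h u (hu.trans (List.prefix_append w [x]))
    have h2 := h _ (List.prefix_refl _)
    rw [openSteps_concat]
    rw [List.count_append, List.count_append] at h2 ⊢
    by_cases h3 : x = s
    · subst h3
      simp [hs]
      omega
    · by_cases h4 : x = .c
      · subst h4
        simp [hs.symm] at h2 ⊢
        omega
      · simp [h3, h4]
        omega

/-! ### Steps, edges, triangles and inner vertices -/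

theorem Matching.left_unique {s : Letter} (hs : s ≠ .c) {w : List Letter} {i i' k : ℕ}
    (h : Matching s w i k) (h' : Matching s w i' k) : i = i' := by
  induction w using List.reverseRecOn with
  | nil => simpa using h.lt_length
  | append_singleton w x ih =>
    have hk := h.lt_length
    rw [List.length_append, List.length_singleton] at hk
    rcases Nat.lt_succ_iff_lt_or_eq.1 hk with h1 | h1
    · exact ih ((matching_concat h1).1 h) ((matching_concat h1).1 h')
    · subst h1
      have hx : x = .c := by
        rcases getElem?_concat.1 h.2.1 with h2 | h2
        · exact absurd (lt_length_of_getElem? h2) (lt_irrefl _)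
        · exact h2.2
      subst hx
      have e := ((matching_concat_c_iff hs).1 h).symm.trans ((matching_concat_c_iff hs).1 h')
      exact Option.some_injective _ e

theorem disjoint_typeSteps {w : List Letter} {k : ℕ} (ha : k ∈ typeASteps w) (hb : k ∈ typeBSteps w) :
    False := by
  obtain ⟨i, j, h1, h2, h3⟩ := ha
  obtain ⟨i', j', h4, h5, h6⟩ := hb
  rw [h1.left_unique (by decide) h4, h2.left_unique (by decide) h5] at h3
  exact h6 h3

namespace PercMap

variable {M N : PercMap}

/-- The outer darts except the root: the outer darts of the left, right and top edges. -/
def Side (M : PercMap) (y : M.Dart) : Prop := M.Outer y ∧ y ≠ M.root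

theorem RootInterface.side_iff (h : M.RootInterface) {y : M.Dart} :
    M.Side y ↔ M.IsLeft y ∨ M.IsRight y ∨ M.IsTop y := by
  constructor
  · rintro ⟨h1, h2⟩
    rcases Color.cases (M.color y) with h3 | h3 <;> rcases Color.cases (M.color (M.inv y)) with h4 | h4
    · exact Or.inl ⟨h1, h3, h4⟩
    · exact absurd (h.2 y h1 ⟨h3, h4⟩) h2
    · exact Or.inr (Or.inr ⟨h1, h3, h4⟩)
    · exact Or.inr (Or.inl ⟨h1, h3, h4⟩)
  · have h1 := h.1
    rintro (h2 | h2 | h2) <;> refine ⟨h2.1, ?_⟩ <;> rintro rfl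
    · exact absurd (h1.2.symm.trans h2.2.2) (by decide)
    · exact absurd (h1.1.symm.trans h2.2.1) (by decide)
    · exact absurd (h1.1.symm.trans h2.2.1) (by decide)

theorem RootInterface.mem_inEdges (h : M.RootInterface) {y : M.Dart} :
    M.edge y ∈ M.inEdges ↔ ¬ M.Side y ∧ ¬ M.Side (M.inv y) := by
  rw [h.side_iff, h.side_iff]
  have key : ∀ P : M.Dart → Prop, (∃ d, P d ∧ M.edge d = M.edge y) ↔ P y ∨ P (M.inv y) := by
    intro P
    constructor
    · rintro ⟨d, h1, h2⟩
      rcases edge_eq_iff.1 h2 with rfl | rfl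
      · exact Or.inl h1
      · exact Or.inr h1
    · rintro (h1 | h1)
      · exact ⟨_, h1, rfl⟩
      · exact ⟨_, h1, edge_inv y⟩
  change ¬ (∃ d, M.IsLeft d ∧ M.edge d = M.edge y) ∧ ¬ (∃ d, M.IsRight d ∧ M.edge d = M.edge y) ∧
    ¬ (∃ d, M.IsTop d ∧ M.edge d = M.edge y) ↔ _
  rw [key, key, key]
  tauto

/-- After the steps of `w`, the edges of the darts `eD i` are the in-edges, the faces of the darts
`cD i`, for the `a`-steps and the `b`-steps, are the inner faces, and the origins of the darts `cD i`, for
the `c`-steps, are the inner vertices, with colors given by the types of the steps. -/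
structure Cells (M : PercMap) (w : List Letter) (eD cD : ℕ → M.Dart) : Prop where
  edge_inner : ∀ i, i < w.length → ¬ M.Side (eD i) ∧ ¬ M.Side (M.inv (eD i))
  edge_inj : ∀ i j, i < w.length → j < w.length → M.edge (eD i) = M.edge (eD j) → i = j
  edge_surj : ∀ y, ¬ M.Side y → ¬ M.Side (M.inv y) → ∃ i, i < w.length ∧ M.edge (eD i) = M.edge y
  face_inner : ∀ i, (w[i]? = some .a ∨ w[i]? = some .b) → ¬ M.Outer (cD i)
  face_inj : ∀ i j, (w[i]? = some .a ∨ w[i]? = some .b) → (w[j]? = some .a ∨ w[j]? = some .b) →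
    M.face (cD i) = M.face (cD j) → i = j
  face_surj : ∀ y, ¬ M.Outer y →
    ∃ i, (w[i]? = some .a ∨ w[i]? = some .b) ∧ M.face (cD i) = M.face y
  vertex_inner : ∀ i, w[i]? = some .c → ¬ M.OuterVertex (cD i)
  vertex_inj : ∀ i j, w[i]? = some .c → w[j]? = some .c → M.origin (cD i) = M.origin (cD j) → i = j
  vertex_surj : ∀ y, ¬ M.OuterVertex y → ∃ i, w[i]? = some .c ∧ M.origin (cD i) = M.origin y
  vertex_color : ∀ i, w[i]? = some .c →
    (M.color (cD i) = .white ∧ i ∈ typeASteps w) ∨ (M.color (cD i) = .black ∧ i ∈ typeBSteps w)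

namespace IsAttach

variable {t : M.Dart} {x : Color} {ι : M.Dart → N.Dart} {r l : N.Dart}

theorem side_map (h : IsAttach M N t x ι r l) {z : M.Dart} : N.Side (ι z) ↔ M.Side z ∧ z ≠ t := by
  unfold Side
  rw [h.map_root, h.inj.ne_iff]
  by_cases h1 : z = t
  · simp [h1, h.not_outer_top]
  · simp [h1, h.outer_map h1]

theorem edge_map (h : IsAttach M N t x ι r l) {y z : M.Dart} :
    N.edge (ι y) = N.edge (ι z) ↔ M.edge y = M.edge z := by
  rw [edge_eq_iff, edge_eq_iff, h.map_inv, h.inj.eq_iff, h.inj.eq_iff]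

theorem outerVertex_map (h : IsAttach M N t x ι r l) {y : M.Dart} :
    N.OuterVertex (ι y) ↔ M.OuterVertex y := by
  constructor
  · rintro ⟨d, h1, h2⟩
    rcases h.outer_cases h1 with ⟨z, h3, h4, rfl⟩ | rfl | rfl
    · exact ⟨z, by assumption, h.origin_eq.1 h2⟩
    · rw [h.origin_right] at h2
      exact ⟨t, h.outer_top, h.origin_eq.1 h2⟩
    · exact absurd h2.symm (h.origin_ne y)
  · rintro ⟨d, h1, h2⟩
    by_cases h3 : d = t
    · subst h3
      exact ⟨r, h.outer_right, h.origin_right.trans (h.origin_of_eq h2)⟩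
    · exact ⟨ι d, (h.outer_map h3).2 h1, h.origin_of_eq h2⟩

/-- The new triangle is the face of the step, and the former top-edge becomes its edge. -/
theorem cells (h : IsAttach M N t x ι r l) (hS : M.SimpleBoundary) {w : List Letter} {s : Letter}
    (hs : s = .a ∨ s = .b) {eD cD : ℕ → M.Dart} {eD' cD' : ℕ → N.Dart} (hc : M.Cells w eD cD)
    (he : ∀ i, i < w.length → eD' i = ι (eD i)) (he' : eD' w.length = ι t)
    (hd : ∀ i, i < w.length → cD' i = ι (cD i)) (hd' : cD' w.length = ι t) :
    N.Cells (w ++ [s]) eD' cD' := by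
  have hlen : ∀ {i : ℕ}, i < (w ++ [s]).length → i < w.length ∨ i = w.length := by
    intro i hi
    rw [List.length_append, List.length_singleton] at hi
    omega
  have htri : ∀ {i : ℕ}, ((w ++ [s])[i]? = some .a ∨ (w ++ [s])[i]? = some .b) ↔
      ((w[i]? = some .a ∨ w[i]? = some .b) ∨ i = w.length) := by
    intro i
    rw [getElem?_concat, getElem?_concat]
    tauto
  have hvert : ∀ {i : ℕ}, (w ++ [s])[i]? = some Letter.c → w[i]? = some Letter.c := by
    intro i hi
    rcases getElem?_concat.1 hi with h1 | ⟨-, h1⟩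
    · exact h1
    · rcases hs with h2 | h2 <;> rw [h2] at h1 <;> cases h1
  have htri' : ∀ {i : ℕ}, (w[i]? = some .a ∨ w[i]? = some .b) → i < w.length := by
    rintro i (h1 | h1) <;> exact lt_length_of_getElem? h1
  have hside : M.Side t := ⟨h.outer_top, h.root_ne.symm⟩
  refine ⟨?_, ?_, ?_, ?_, ?_, ?_, ?_, ?_, ?_, ?_⟩
  · intro i hi
    rcases hlen hi with h1 | rfl
    · rw [he i h1, h.map_inv, h.side_map, h.side_map]
      have := hc.edge_inner i h1
      tauto
    · rw [he', h.map_inv, h.side_map, h.side_map]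
      refine ⟨by tauto, ?_⟩
      rintro ⟨⟨h1, h2⟩, -⟩
      rcases hS.eq_root h.outer_top h1 with h3 | h3
      · exact h.root_ne h3
      · exact h2 h3.symm
  · have key : ∀ i, i < w.length → M.edge (eD i) ≠ M.edge t := by
      intro i h1 e
      have h2 := hc.edge_inner i h1
      rcases edge_eq_iff.1 e with h3 | h3
      · exact h2.1 (h3 ▸ hside)
      · rw [h3, M.inv_inv] at h2
        exact h2.2 hside
    intro i j hi hj e
    rcases hlen hi with h1 | rfl <;> rcases hlen hj with h2 | rfl
    · rw [he i h1, he j h2, h.edge_map] at e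
      exact hc.edge_inj i j h1 h2 e
    · rw [he i h1, he', h.edge_map] at e
      exact absurd e (key i h1)
    · rw [he j h2, he', h.edge_map] at e
      exact absurd e.symm (key j h2)
    · rfl
  · have hr : N.Side r := ⟨h.outer_right, fun e => h.ne_right M.root (by rw [e, h.map_root])⟩
    have hl : N.Side l := ⟨h.outer_left, fun e => h.ne_left M.root (by rw [e, h.map_root])⟩
    intro y h1 h2
    rcases h.cover y with ⟨z, rfl⟩ | rfl | rfl | rfl | rfl
    · rw [h.side_map] at h1
      rw [h.map_inv, h.side_map] at h2
      by_cases h3 : z = t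
      · exact ⟨w.length, by simp, by rw [he', h3]⟩
      by_cases h4 : M.inv z = t
      · exact ⟨w.length, by simp, by rw [he', ← h4, ← h.map_inv, edge_inv]⟩
      · obtain ⟨i, h5, h6⟩ := hc.edge_surj z (by tauto) (by tauto)
        refine ⟨i, ?_, by rw [he i h5, h.edge_map, h6]⟩
        rw [List.length_append]
        omega
    · exact absurd hr h1
    · exact absurd hl h1
    · rw [N.inv_inv] at h2
      exact absurd hr h2
    · rw [N.inv_inv] at h2
      exact absurd hl h2
  · intro i hi
    rcases htri.1 hi with h1 | rfl
    · have h2 := hc.face_inner i h1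
      rw [hd i (htri' h1), h.outer_map (h.ne_top_of_not_outer h2)]
      exact h2
    · rw [hd']
      exact h.not_outer_top
  · intro i j hi hj e
    rcases htri.1 hi with h1 | rfl <;> rcases htri.1 hj with h2 | rfl
    · rw [hd i (htri' h1), hd j (htri' h2), h.face_eq (h.ne_top_of_not_outer (hc.face_inner i h1))
        (h.ne_top_of_not_outer (hc.face_inner j h2))] at e
      exact hc.face_inj i j h1 h2 e
    · rw [hd i (htri' h1), hd'] at e
      exact absurd e (h.face_ne (h.ne_top_of_not_outer (hc.face_inner i h1)))
    · rw [hd j (htri' h2), hd'] at e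
      exact absurd e.symm (h.face_ne (h.ne_top_of_not_outer (hc.face_inner j h2)))
    · rfl
  · intro y hy
    rcases h.face_cases y with ⟨z, h1, h2⟩ | h1
    · have h3 : ¬ M.Outer z := fun h3 => hy (outer_of_face_eq h2.symm ((h.outer_map h1).2 h3))
      obtain ⟨i, h4, h5⟩ := hc.face_surj z h3
      refine ⟨i, htri.2 (Or.inl h4), ?_⟩
      rw [hd i (htri' h4), h2, h.face_eq (h.ne_top_of_not_outer (hc.face_inner i h4)) h1, h5]
    · exact ⟨w.length, htri.2 (Or.inr rfl), by rw [hd', h1]⟩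
  · intro i hi
    have h1 := hvert hi
    rw [hd i (lt_length_of_getElem? h1), h.outerVertex_map]
    exact hc.vertex_inner i h1
  · intro i j hi hj e
    have h1 := hvert hi
    have h2 := hvert hj
    rw [hd i (lt_length_of_getElem? h1), hd j (lt_length_of_getElem? h2), h.origin_eq] at e
    exact hc.vertex_inj i j h1 h2 e
  · intro y hy
    rcases h.origin_cases y with ⟨z, h1⟩ | h1
    · have h2 : ¬ M.OuterVertex z := fun h2 => hy ((h.outerVertex_map.2 h2).of_origin_eq h1.symm)
      obtain ⟨i, h3, h4⟩ := hc.vertex_surj z h2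
      refine ⟨i, getElem?_concat.2 (Or.inl h3), ?_⟩
      rw [hd i (lt_length_of_getElem? h3), h1, h.origin_of_eq h4]
    · exact absurd ⟨l, h.outer_left, h1.symm⟩ hy
  · intro i hi
    have h1 := hvert hi
    rw [hd i (lt_length_of_getElem? h1), h.color_map]
    rcases hc.vertex_color i h1 with ⟨h2, h3⟩ | ⟨h2, h3⟩
    · exact Or.inl ⟨h2, typeASteps_concat h3⟩
    · exact Or.inr ⟨h2, typeBSteps_concat h3⟩

end IsAttach

namespace IsZip

variable {d : M.Dart} {ζ : M.Dart → N.Dart}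

theorem side_map (h : IsZip M N d ζ) {y : M.Dart} (hy : y ≠ d ∧ y ≠ M.next d) :
    N.Side (ζ y) ↔ M.Side y := by
  unfold Side
  rw [h.outer hy, h.map_root]
  refine and_congr_right fun _ => not_congr ⟨h.inj _ _ hy ⟨h.can.root_ne, h.can.root_ne_next⟩, ?_⟩
  rintro rfl
  rfl

/-- The only vertex that leaves the boundary is the origin of `next d`. -/
theorem outerVertex_map (h : IsZip M N d ζ) (hS : M.SimpleBoundary) (ho : M.Outer d)
    (hne : M.origin d ≠ M.origin (M.inv (M.next d))) {y : M.Dart} :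
    N.OuterVertex (ζ y) ↔ M.OuterVertex y ∧ M.origin y ≠ M.origin (M.next d) := by
  have ho1 : M.Outer (M.next d) := outer_next.2 ho
  have ho2 : M.Outer (M.next (M.next d)) := outer_next.2 ho1
  have hn2 : M.next (M.next d) ≠ M.next d := fun e => h.can.next_ne (M.next.injective e)
  constructor
  · rintro ⟨x, h1, h2⟩
    obtain ⟨z, hz, rfl⟩ := h.surj x
    rw [h.outer hz] at h1
    rcases (h.origin_eq hne).1 h2 with h3 | ⟨-, h3⟩
    · exact ⟨⟨z, h1, h3⟩, fun e => hz.2 (hS _ _ h1 ho1 (h3.trans e))⟩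
    · rcases h3 with h3 | h3
      · exact ⟨⟨d, ho, h3.symm⟩, fun e => h.can.next_ne (hS _ _ ho1 ho (e.symm.trans h3))⟩
      · rw [← origin_next] at h3
        exact ⟨⟨_, ho2, h3.symm⟩, fun e => hn2 (hS _ _ ho2 ho1 (h3.symm.trans e))⟩
  · rintro ⟨⟨z, h1, h2⟩, h3⟩
    have h4 : z ≠ M.next d := fun e => h3 (by rw [← h2, e])
    by_cases h5 : z = d
    · refine ⟨ζ (M.next (M.next d)), (h.outer ⟨h.can.next_next_ne, hn2⟩).2 ho2, ?_⟩
      rw [h.origin_eq hne, origin_next, ← h2, h5]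
      simp
    · exact ⟨ζ z, (h.outer ⟨h5, h4⟩).2 h1, h.origin_of_eq hne h2⟩

/-- The glued edge is the edge of the step, and the vertex that leaves the boundary is its vertex. -/
theorem cells (h : IsZip M N d ζ) (hS : M.SimpleBoundary) (ho : M.Outer d)
    (hne : M.origin d ≠ M.origin (M.inv (M.next d))) (hi : ¬ M.Outer (M.inv d))
    (hi' : ¬ M.Outer (M.inv (M.next d))) {w : List Letter}
    {eD cD : ℕ → M.Dart} {eD' cD' : ℕ → N.Dart} (hc : M.Cells w eD cD)
    (he : ∀ i, i < w.length → eD' i = ζ (eD i)) (he' : eD' w.length = ζ d)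
    (hd : ∀ i, i < w.length → cD' i = ζ (cD i)) (hd' : cD' w.length = ζ (M.next d))
    (hcol : ∀ y, ¬ M.OuterVertex y → N.color (ζ y) = M.color y)
    (hcol' : (N.color (ζ (M.next d)) = .white ∧ w.length ∈ typeASteps (w ++ [.c])) ∨
      (N.color (ζ (M.next d)) = .black ∧ w.length ∈ typeBSteps (w ++ [.c]))) :
    N.Cells (w ++ [.c]) eD' cD' := by
  have hlen : ∀ {i : ℕ}, i < (w ++ [Letter.c]).length → i < w.length ∨ i = w.length := by
    intro i hi
    rw [List.length_append, List.length_singleton] at hi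
    omega
  have htri : ∀ {i : ℕ}, ((w ++ [Letter.c])[i]? = some .a ∨ (w ++ [Letter.c])[i]? = some .b) ↔
      (w[i]? = some .a ∨ w[i]? = some .b) := by
    intro i
    rw [getElem?_concat, getElem?_concat]
    simp
  have hvert : ∀ {i : ℕ}, (w ++ [Letter.c])[i]? = some Letter.c ↔ w[i]? = some Letter.c ∨ i = w.length := by
    intro i
    rw [getElem?_concat]
    simp
  have htri' : ∀ {i : ℕ}, (w[i]? = some .a ∨ w[i]? = some .b) → i < w.length := by
    rintro i (h1 | h1) <;> exact lt_length_of_getElem? h1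
  have ho1 : M.Outer (M.next d) := outer_next.2 ho
  have hside : M.Side d := ⟨ho, h.can.root_ne.symm⟩
  have hside' : M.Side (M.next d) := ⟨ho1, h.can.root_ne_next.symm⟩
  have hns : ∀ {y}, ¬ M.Side y → y ≠ d ∧ y ≠ M.next d := fun {y} hy =>
    ⟨fun e => hy (e ▸ hside), fun e => hy (e ▸ hside')⟩
  have hs1 : ¬ M.Side (M.inv d) := fun h1 => hi h1.1
  have hs2 : ¬ M.Side (M.inv (M.next d)) := fun h1 => hi' h1.1
  have hov : ∀ {y}, (M.origin y = M.origin d ∨ M.origin y = M.origin (M.inv (M.next d))) →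
      M.OuterVertex y := by
    rintro y (h1 | h1)
    · exact ⟨d, ho, h1.symm⟩
    · exact ho1.outerVertex_inv.of_origin_eq h1.symm
  have hinner : ∀ {y z}, ¬ M.OuterVertex y → (N.origin (ζ y) = N.origin (ζ z) ↔
      M.origin y = M.origin z) := by
    intro y z hy
    rw [h.origin_eq hne]
    constructor
    · rintro (h1 | ⟨h1, -⟩)
      · exact h1
      · exact absurd (hov h1) hy
    · exact Or.inl
  refine ⟨?_, ?_, ?_, ?_, ?_, ?_, ?_, ?_, ?_, ?_⟩
  · intro i hil
    rcases hlen hil with h1 | rfl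
    · have h2 := hc.edge_inner i h1
      rw [he i h1, h.map_inv, h.side_map (hns h2.1), h.side_map (hns h2.2)]
      exact h2
    · rw [he', h.map_inv, h.map_self, h.side_map (hns hs1), h.side_map (hns hs2)]
      exact ⟨hs2, hs1⟩
  · have hee : ∀ {y z}, ¬ M.Side y → ¬ M.Side z → ¬ M.Side (M.inv z) →
        N.edge (ζ y) = N.edge (ζ z) → M.edge y = M.edge z := by
      intro y z h1 h2 h3 e
      rcases edge_eq_iff.1 e with h4 | h4
      · exact congrArg _ (h.inj _ _ (hns h1) (hns h2) h4)
      · rw [h.map_inv] at h4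
        rw [h.inj _ _ (hns h1) (hns h3) h4, edge_inv]
    have key : ∀ i, i < w.length → N.edge (ζ (eD i)) ≠ N.edge (ζ d) := by
      intro i h1 e
      have h2 := hc.edge_inner i h1
      rcases edge_eq_iff.1 e with h3 | h3
      · rw [h.map_self] at h3
        rw [h.inj _ _ (hns h2.1) (hns hs2) h3, M.inv_inv] at h2
        exact h2.2 hside'
      · rw [h.map_inv] at h3
        rw [h.inj _ _ (hns h2.1) (hns hs1) h3, M.inv_inv] at h2
        exact h2.2 hside
    intro i j hil hjl e
    rcases hlen hil with h1 | rfl <;> rcases hlen hjl with h2 | rfl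
    · rw [he i h1, he j h2] at e
      have h3 := hc.edge_inner j h2
      exact hc.edge_inj i j h1 h2 (hee (hc.edge_inner i h1).1 h3.1 h3.2 e)
    · rw [he i h1, he'] at e
      exact absurd e (key i h1)
    · rw [he j h2, he'] at e
      exact absurd e.symm (key j h2)
    · rfl
  · intro x h1 h2
    obtain ⟨y, hy, rfl⟩ := h.surj x
    rw [h.side_map hy] at h1
    by_cases h3 : M.inv y = d
    · exact ⟨w.length, by simp, by rw [he', ← h3, ← h.map_inv, edge_inv]⟩
    by_cases h4 : M.inv y = M.next d
    · exact ⟨w.length, by simp, by rw [he', h.map_self, ← h4, M.inv_inv]⟩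
    · rw [h.map_inv, h.side_map ⟨h3, h4⟩] at h2
      obtain ⟨i, h5, h6⟩ := hc.edge_surj y h1 h2
      refine ⟨i, by rw [List.length_append]; omega, ?_⟩
      rw [he i h5]
      rcases edge_eq_iff.1 h6 with h7 | h7
      · rw [h7]
      · rw [h7, ← h.map_inv, edge_inv]
  · intro i hil
    rw [htri] at hil
    have h2 := hc.face_inner i hil
    rw [hd i (htri' hil), h.outer (h.ne_of_not_outer ho h2)]
    exact h2
  · intro i j h1 h2 e
    rw [htri] at h1 h2
    rw [hd i (htri' h1), hd j (htri' h2), h.face_eq (h.ne_of_not_outer ho (hc.face_inner i h1))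
      (h.ne_of_not_outer ho (hc.face_inner j h2))] at e
    exact hc.face_inj i j h1 h2 e
  · intro x hx
    obtain ⟨y, hy, rfl⟩ := h.surj x
    rw [h.outer hy] at hx
    obtain ⟨i, h4, h5⟩ := hc.face_surj y hx
    refine ⟨i, htri.2 h4, ?_⟩
    rw [hd i (htri' h4), h.face_eq (h.ne_of_not_outer ho (hc.face_inner i h4)) hy, h5]
  · intro i hil
    rcases hvert.1 hil with h1 | rfl
    · rw [hd i (lt_length_of_getElem? h1), h.outerVertex_map hS ho hne]
      exact fun h2 => hc.vertex_inner i h1 h2.1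
    · rw [hd', h.outerVertex_map hS ho hne]
      exact fun h2 => h2.2 rfl
  · intro i j hil hjl e
    rcases hvert.1 hil with h1 | rfl <;> rcases hvert.1 hjl with h2 | rfl
    · rw [hd i (lt_length_of_getElem? h1), hd j (lt_length_of_getElem? h2),
        hinner (hc.vertex_inner i h1)] at e
      exact hc.vertex_inj i j h1 h2 e
    · rw [hd i (lt_length_of_getElem? h1), hd', hinner (hc.vertex_inner i h1)] at e
      exact absurd ⟨_, ho1, e.symm⟩ (hc.vertex_inner i h1)
    · rw [hd j (lt_length_of_getElem? h2), hd'] at e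
      have e := (hinner (hc.vertex_inner j h2)).1 e.symm
      exact absurd ⟨_, ho1, e.symm⟩ (hc.vertex_inner j h2)
    · rfl
  · intro x hx
    obtain ⟨y, hy, rfl⟩ := h.surj x
    rw [h.outerVertex_map hS ho hne] at hx
    by_cases h1 : M.OuterVertex y
    · have h2 : M.origin y = M.origin (M.next d) := by tauto
      exact ⟨w.length, hvert.2 (Or.inr rfl), by rw [hd', h.origin_of_eq hne h2]⟩
    · obtain ⟨i, h3, h4⟩ := hc.vertex_surj y h1
      exact ⟨i, hvert.2 (Or.inl h3), by rw [hd i (lt_length_of_getElem? h3), h.origin_of_eq hne h4]⟩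
  · intro i hil
    rcases hvert.1 hil with h1 | rfl
    · rw [hd i (lt_length_of_getElem? h1), hcol _ (hc.vertex_inner i h1)]
      rcases hc.vertex_color i h1 with ⟨h2, h3⟩ | ⟨h2, h3⟩
      · exact Or.inl ⟨h2, typeASteps_concat h3⟩
      · exact Or.inr ⟨h2, typeBSteps_concat h3⟩
    · rw [hd']
      exact hcol'

end IsZip

theorem color_zip_zipDart (d : M.Dart) (h : M.CanZip d) (col : M.Dart → Color)
    (hcol : ∀ y, col (M.next (M.inv y)) = col y) (hends : col d = col (M.inv (M.next d))) (y : M.Dart) :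
    (M.zip d h col hcol hends).color (M.zipDart d h y) = col y := by
  change col (M.zipDart d h y).1 = col y
  unfold zipDart
  split_ifs with h1 h2
  · rw [h1, hends]
  · rw [h2, ← hcol (M.inv d), M.inv_inv]
  · rfl

end PercMap

open PercMap

/-! ### The construction step by step -/

/-- The state `S` is reached after the steps of `w`: its map is explored as described by `Explored`, the
times of the left and of the right edges are the open `a`-steps and the open `b`-steps, and the cells of the
map correspond to the steps. -/
structure State.Tracks (S : State) (w : List Letter) (t : S.map.Dart)
    (left right path : List (ℕ × S.map.Dart)) : Prop where
  length_eq : S.length = w.length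
  explored : S.map.Explored w.length t left right path
  left_steps : left.map Prod.fst = openSteps .a w
  right_steps : right.map Prod.fst = openSteps .b w
  cells : S.map.Cells w S.edgeDart S.cellDart
  left_face : ∀ i d, (i, d) ∈ left → S.map.face (S.map.inv d) = S.map.face (S.cellDart i)
  right_face : ∀ i d, (i, d) ∈ right → S.map.face (S.map.inv d) = S.map.face (S.cellDart i)

theorem map_fst_map {A B : Type*} (f : A → B) (l : List (ℕ × A)) :
    (l.map (Prod.map id f)).map Prod.fst = l.map Prod.fst := by
  rw [List.map_map]
  exact List.map_congr_left fun _ _ => rfl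

theorem mem_map_snd {A B : Type*} {f : A → B} {l : List (ℕ × A)} {i : ℕ} {y : B}
    (h : (i, y) ∈ l.map (Prod.map id f)) : ∃ d, (i, d) ∈ l ∧ y = f d := by
  obtain ⟨⟨j, d⟩, h1, h2⟩ := List.mem_map.1 h
  obtain ⟨rfl, rfl⟩ := Prod.mk.inj h2
  exact ⟨d, h1, rfl⟩

namespace State

section

variable (S : State) {i : ℕ}

theorem edgeDart_glueTriangle_of_ne {t : S.map.Dart} (h : S.map.IsTop t) (x : Color) (hi : i ≠ S.length) :
    (S.glueTriangle t h x).edgeDart i = (Sum.inl (S.edgeDart i) : S.map.Dart ⊕ NewDart) := by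
  have h1 := Function.update_of_ne hi (Sum.inl t) (fun j => (Sum.inl (S.edgeDart j) : S.map.Dart ⊕ NewDart))
  exact h1

theorem edgeDart_glueTriangle {t : S.map.Dart} (h : S.map.IsTop t) (x : Color) (hi : i = S.length) :
    (S.glueTriangle t h x).edgeDart i = (Sum.inl t : S.map.Dart ⊕ NewDart) := by
  subst hi
  have h1 := Function.update_self S.length (Sum.inl t) (fun j => (Sum.inl (S.edgeDart j) : S.map.Dart ⊕ NewDart))
  exact h1

theorem cellDart_glueTriangle_of_ne {t : S.map.Dart} (h : S.map.IsTop t) (x : Color) (hi : i ≠ S.length) :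
    (S.glueTriangle t h x).cellDart i = (Sum.inl (S.cellDart i) : S.map.Dart ⊕ NewDart) := by
  have h1 := Function.update_of_ne hi (Sum.inl t) (fun j => (Sum.inl (S.cellDart j) : S.map.Dart ⊕ NewDart))
  exact h1

theorem cellDart_glueTriangle {t : S.map.Dart} (h : S.map.IsTop t) (x : Color) (hi : i = S.length) :
    (S.glueTriangle t h x).cellDart i = (Sum.inl t : S.map.Dart ⊕ NewDart) := by
  subst hi
  have h1 := Function.update_self S.length (Sum.inl t) (fun j => (Sum.inl (S.cellDart j) : S.map.Dart ⊕ NewDart))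
  exact h1

variable {d : S.map.Dart} (hd : S.map.CanZip d) {col : S.map.Dart → Color}
  (hcol : ∀ y, col (S.map.next (S.map.inv y)) = col y) (hends : col d = col (S.map.inv (S.map.next d)))

theorem edgeDart_glueEdges_of_ne (hi : i ≠ S.length) :
    (S.glueEdges d hd col hcol hends).edgeDart i = S.map.zipDart d hd (S.edgeDart i) := by
  have h1 := Function.update_of_ne hi (S.map.zipDart d hd d) (fun j => (S.map.zipDart d hd (S.edgeDart j) : S.map.ZipDart d))
  exact h1

theorem edgeDart_glueEdges (hi : i = S.length) :
    (S.glueEdges d hd col hcol hends).edgeDart i = S.map.zipDart d hd d := by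
  subst hi
  have h1 := Function.update_self S.length (S.map.zipDart d hd d) (fun j => (S.map.zipDart d hd (S.edgeDart j) : S.map.ZipDart d))
  exact h1

theorem cellDart_glueEdges_of_ne (hi : i ≠ S.length) :
    (S.glueEdges d hd col hcol hends).cellDart i = S.map.zipDart d hd (S.cellDart i) := by
  have h1 := Function.update_of_ne hi (S.map.zipDart d hd (S.map.next d)) (fun j => (S.map.zipDart d hd (S.cellDart j) : S.map.ZipDart d))
  exact h1

theorem cellDart_glueEdges (hi : i = S.length) :
    (S.glueEdges d hd col hcol hends).cellDart i = S.map.zipDart d hd (S.map.next d) := by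
  subst hi
  have h1 := Function.update_self S.length (S.map.zipDart d hd (S.map.next d)) (fun j => (S.map.zipDart d hd (S.cellDart j) : S.map.ZipDart d))
  exact h1

end

end State

namespace State.Tracks

variable {S : State} {w : List Letter} {t : S.map.Dart} {left right path : List (ℕ × S.map.Dart)}

/-- The triangles of the former boundary edges are unchanged. -/
theorem face_attach (_ : S.Tracks w t left right path) {S' : State} {x : Color}
    {ι : S.map.Dart → S'.map.Dart} {r l : S'.map.Dart} (ha : IsAttach S.map S'.map t x ι r l)
    (hd : ∀ i, i < w.length → S'.cellDart i = ι (S.cellDart i)) {i : ℕ} {d : S.map.Dart}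
    (hi : i < w.length) (ho : ¬ S.map.Outer (S.map.inv d))
    (hf : S.map.face (S.map.inv d) = S.map.face (S.cellDart i)) :
    S'.map.face (ι (S.map.inv d)) = S'.map.face (S'.cellDart i) := by
  rw [hd i hi, ha.face_eq (ha.ne_top_of_not_outer ho)
    (ha.ne_top_of_not_outer fun h1 => ho (outer_of_face_eq hf.symm h1)), hf]

/-- A state that results from gluing a triangle with a white new vertex to the top-edge. -/
theorem attach_white (h : S.Tracks w t left right path) {S' : State} {ι : S.map.Dart → S'.map.Dart}
    {r l : S'.map.Dart} (ha : IsAttach S.map S'.map t .white ι r l) (hlen : S'.length = w.length + 1)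
    (he : ∀ i, i < w.length → S'.edgeDart i = ι (S.edgeDart i)) (he' : S'.edgeDart w.length = ι t)
    (hd : ∀ i, i < w.length → S'.cellDart i = ι (S.cellDart i)) (hd' : S'.cellDart w.length = ι t) :
    ∃ t' left' right' path', S'.Tracks (w ++ [.a]) t' left' right' path' := by
  have hw : (w ++ [Letter.a]).length = w.length + 1 := List.length_append
  have hex := h.explored.attach ha
  rw [← hw] at hex
  refine ⟨_, _, _, _, ⟨hlen.trans hw.symm, hex, ?_, ?_,
    ha.cells h.explored.tri.2.2.2 (Or.inl rfl) h.cells he he' hd hd', fun i d hm => ?_,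
    fun i d hm => ?_⟩⟩
  · rw [openSteps_concat, if_pos rfl, List.map_cons, map_fst_map, h.left_steps]
  · rw [openSteps_concat, map_fst_map, h.right_steps]
    simp
  · rcases List.mem_cons.1 hm with h1 | h1
    · obtain ⟨rfl, rfl⟩ := Prod.mk.inj h1
      rw [hd', ha.face_inv_left]
    · obtain ⟨d, h2, rfl⟩ := mem_map_snd h1
      rw [ha.map_inv, h.face_attach ha hd (h.explored.left_time_lt h2) (h.explored.left_inner h2)
        (h.left_face i d h2)]
  · obtain ⟨d, h2, rfl⟩ := mem_map_snd hm
    rw [ha.map_inv, h.face_attach ha hd (h.explored.right_time_lt h2) (h.explored.right_inner h2)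
      (h.right_face i d h2)]

/-- A state that results from gluing a triangle with a black new vertex to the top-edge. -/
theorem attach_black (h : S.Tracks w t left right path) {S' : State} {ι : S.map.Dart → S'.map.Dart}
    {r l : S'.map.Dart} (ha : IsAttach S.map S'.map t .black ι r l) (hlen : S'.length = w.length + 1)
    (he : ∀ i, i < w.length → S'.edgeDart i = ι (S.edgeDart i)) (he' : S'.edgeDart w.length = ι t)
    (hd : ∀ i, i < w.length → S'.cellDart i = ι (S.cellDart i)) (hd' : S'.cellDart w.length = ι t) :
    ∃ t' left' right' path', S'.Tracks (w ++ [.b]) t' left' right' path' := by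
  have hw : (w ++ [Letter.b]).length = w.length + 1 := List.length_append
  have hex := h.explored.attach_black ha
  rw [← hw] at hex
  refine ⟨_, _, _, _, ⟨hlen.trans hw.symm, hex, ?_, ?_,
    ha.cells h.explored.tri.2.2.2 (Or.inr rfl) h.cells he he' hd hd', fun i d hm => ?_,
    fun i d hm => ?_⟩⟩
  · rw [openSteps_concat, map_fst_map, h.left_steps]
    simp
  · rw [openSteps_concat, if_pos rfl, List.map_cons, map_fst_map, h.right_steps]
  · obtain ⟨d, h2, rfl⟩ := mem_map_snd hm
    rw [ha.map_inv, h.face_attach ha hd (h.explored.left_time_lt h2) (h.explored.left_inner h2)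
      (h.left_face i d h2)]
  · rcases List.mem_cons.1 hm with h1 | h1
    · obtain ⟨rfl, rfl⟩ := Prod.mk.inj h1
      rw [hd', ha.face_inv_right]
    · obtain ⟨d, h2, rfl⟩ := mem_map_snd h1
      rw [ha.map_inv, h.face_attach ha hd (h.explored.right_time_lt h2) (h.explored.right_inner h2)
        (h.right_face i d h2)]

theorem glueTriangle (h : S.Tracks w t left right path) {x : Color} {s : Letter}
    (hs : (x = .white ∧ s = .a) ∨ (x = .black ∧ s = .b)) :
    ∃ t' left' right' path',
      (S.glueTriangle t h.explored.top x).Tracks (w ++ [s]) t' left' right' path' := by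
  have hr : S.map.root ≠ t := by
    intro e
    have h1 := h.explored.iface.1.1
    rw [e, h.explored.top.2.1] at h1
    cases h1
  have ha := isAttach_attach t h.explored.top.next_ne h.explored.top.1 hr x
  have hl := h.length_eq
  have he := fun i (hi : i < w.length) =>
    S.edgeDart_glueTriangle_of_ne h.explored.top x (by rw [hl]; exact hi.ne)
  have hd := fun i (hi : i < w.length) =>
    S.cellDart_glueTriangle_of_ne h.explored.top x (by rw [hl]; exact hi.ne)
  have he' := S.edgeDart_glueTriangle h.explored.top x hl.symm
  have hd' := S.cellDart_glueTriangle h.explored.top x hl.symm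
  have hl' : (S.glueTriangle t h.explored.top x).length = S.length + 1 := rfl
  rcases hs with ⟨rfl, rfl⟩ | ⟨rfl, rfl⟩
  · exact h.attach_white ha (hl'.trans (congrArg (· + 1) hl)) he he' hd hd'
  · exact h.attach_black ha (hl'.trans (congrArg (· + 1) hl)) he he' hd hd'

/-- A state that results from gluing two consecutive edges of the boundary. -/
theorem zip (h : S.Tracks w t left right path) {S' : State} {d : S.map.Dart}
    {ζ : S.map.Dart → S'.map.Dart} (hz : IsZip S.map S'.map d ζ) (hlen : S'.length = w.length + 1)
    (he : ∀ i, i < w.length → S'.edgeDart i = ζ (S.edgeDart i)) (he' : S'.edgeDart w.length = ζ d)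
    (hd : ∀ i, i < w.length → S'.cellDart i = ζ (S.cellDart i))
    (hd' : S'.cellDart w.length = ζ (S.map.next d))
    {p q : ℕ × S.map.Dart} {left0 right0 : List (ℕ × S.map.Dart)} (hl : left = p :: left0)
    (hr : right = q :: right0) (ho : S.map.Outer d)
    (hne : S.map.color d ≠ S.map.color (S.map.inv (S.map.next d)))
    (hi : ¬ S.map.Outer (S.map.inv d)) (hi' : ¬ S.map.Outer (S.map.inv (S.map.next d)))
    (hinner : ∀ y, ¬ S.map.OuterVertex y → S'.map.color (ζ y) = S.map.color y)
    (hnew : (S'.map.color (ζ (S.map.next d)) = .white ∧ w.length ∈ typeASteps (w ++ [.c])) ∨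
      (S'.map.color (ζ (S.map.next d)) = .black ∧ w.length ∈ typeBSteps (w ++ [.c])))
    {t' : S'.map.Dart} (hex : ∃ path', S'.map.Explored (w.length + 1) t'
      (left0.map (Prod.map id ζ)) (right0.map (Prod.map id ζ)) path') :
    ∃ t' left' right' path', S'.Tracks (w ++ [.c]) t' left' right' path' := by
  obtain ⟨path', hex⟩ := hex
  have hw : (w ++ [Letter.c]).length = w.length + 1 := List.length_append
  rw [← hw] at hex
  have hne' : S.map.origin d ≠ S.map.origin (S.map.inv (S.map.next d)) :=
    fun e => hne (color_eq_of_origin_eq e)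
  have hface : ∀ i y, i < w.length → ¬ S.map.Outer (S.map.inv y) →
      S.map.face (S.map.inv y) = S.map.face (S.cellDart i) →
      S'.map.face (S'.map.inv (ζ y)) = S'.map.face (S'.cellDart i) := by
    intro i y h1 h2 h3
    rw [hd i h1, hz.map_inv, hz.face_eq (hz.ne_of_not_outer ho h2)
      (hz.ne_of_not_outer ho fun h4 => h2 (outer_of_face_eq h3.symm h4)), h3]
  refine ⟨_, _, _, _, ⟨hlen.trans hw.symm, hex, ?_, ?_,
    hz.cells h.explored.tri.2.2.2 ho hne' hi hi' h.cells he he' hd hd' hinner hnew,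
    fun i y hy => ?_, fun i y hy => ?_⟩⟩
  · rw [openSteps_concat, map_fst_map, ← h.left_steps, hl]
    simp
  · rw [openSteps_concat, map_fst_map, ← h.right_steps, hr]
    simp
  · obtain ⟨y, h2, rfl⟩ := mem_map_snd hy
    have h3 : (i, y) ∈ left := hl ▸ List.mem_cons_of_mem _ h2
    exact hface i y (h.explored.left_time_lt h3) (h.explored.left_inner h3) (h.left_face i y h3)
  · obtain ⟨y, h2, rfl⟩ := mem_map_snd hy
    have h3 : (i, y) ∈ right := hr ▸ List.mem_cons_of_mem _ h2
    exact hface i y (h.explored.right_time_lt h3) (h.explored.right_inner h3) (h.right_face i y h3)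

/-- The state after gluing two consecutive edges of the boundary with the coloring `col`. -/
theorem glueEdges (h : S.Tracks w t left right path) {d : S.map.Dart} (hd : S.map.CanZip d)
    {col : S.map.Dart → Color} (hcol : ∀ y, col (S.map.next (S.map.inv y)) = col y)
    (hends : col d = col (S.map.inv (S.map.next d))) {p q : ℕ × S.map.Dart}
    {left0 right0 : List (ℕ × S.map.Dart)} (hl : left = p :: left0) (hr : right = q :: right0)
    (ho : S.map.Outer d) (hne : S.map.color d ≠ S.map.color (S.map.inv (S.map.next d)))
    (hi : ¬ S.map.Outer (S.map.inv d)) (hi' : ¬ S.map.Outer (S.map.inv (S.map.next d)))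
    (hinner : ∀ y, ¬ S.map.OuterVertex y → col y = S.map.color y)
    (hnew : (col (S.map.next d) = .white ∧ w.length ∈ typeASteps (w ++ [.c])) ∨
      (col (S.map.next d) = .black ∧ w.length ∈ typeBSteps (w ++ [.c])))
    {t' : S.map.Dart} (hex : ∃ path', (S.map.zip d hd col hcol hends).Explored (w.length + 1)
      (S.map.zipDart d hd t') (left0.map (Prod.map id (S.map.zipDart d hd)))
      (right0.map (Prod.map id (S.map.zipDart d hd))) path') :
    ∃ t' left' right' path',
      (S.glueEdges d hd col hcol hends).Tracks (w ++ [.c]) t' left' right' path' := by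
  have hlen := h.length_eq
  have hc := color_zip_zipDart d hd col hcol hends
  refine h.zip (S' := S.glueEdges d hd col hcol hends) (isZip_zip d hd col hcol hends) ?_
    (fun i hi => S.edgeDart_glueEdges_of_ne hd hcol hends (by rw [hlen]; exact hi.ne))
    (S.edgeDart_glueEdges hd hcol hends hlen.symm)
    (fun i hi => S.cellDart_glueEdges_of_ne hd hcol hends (by rw [hlen]; exact hi.ne))
    (S.cellDart_glueEdges hd hcol hends hlen.symm) hl hr ho hne hi hi'
    (fun y hy => (hc y).trans (hinner y hy)) ?_ hex
  · exact congrArg (· + 1) hlen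
  · rcases hnew with ⟨h1, h2⟩ | ⟨h1, h2⟩
    · exact Or.inl ⟨(hc _).trans h1, h2⟩
    · exact Or.inr ⟨(hc _).trans h1, h2⟩

theorem canFold {i j : ℕ} {dl dr : S.map.Dart}
    (h : S.Tracks w t ((i, dl) :: left) ((j, dr) :: right) path) : S.map.CanFold t := by
  have h1 := h.explored.left_links.1
  have h2 := h.explored.right_links.1
  refine ⟨h.explored.top, ?_, ?_, h.explored.iface.1⟩
  · rw [h1, h.explored.isLeft_iff]
    exact ⟨i, List.mem_cons_self ..⟩
  · rw [h2, h.explored.isRight_iff]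
    exact ⟨j, List.mem_cons_self ..⟩

theorem fold {i j : ℕ} {dl dr : S.map.Dart}
    (h : S.Tracks w t ((i, dl) :: left) ((j, dr) :: right) path) :
    ∃ t' left' right' path', (S.fold t h.canFold).Tracks (w ++ [.c]) t' left' right' path' := by
  have hE := h.explored
  have hnt : S.map.next t = dl := hE.left_links.1
  have hsy : S.map.next.symm t = dr := hE.right_links.1
  have hndr : S.map.next dr = t := (S.map.next.symm_apply_eq.1 hsy).symm
  have hdl := hE.left_goes i dl (List.mem_cons_self ..)
  have hdr := hE.right_goes j dr (List.mem_cons_self ..)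
  have hol := hE.left_inner (List.mem_cons_self ..)
  have hor := hE.right_inner (List.mem_cons_self ..)
  have hot : ¬ S.map.Outer (S.map.inv t) := by
    intro ho
    have h1 : S.map.next t = S.map.inv t :=
      hE.tri.2.2.2 _ _ (outer_next.2 hE.top.1) ho (origin_next t)
    rw [← hnt, h1, goes_inv] at hdl
    exact absurd (hdl.1.symm.trans hE.top.2.1) (by decide)
  have hi : (openSteps .a w)[0]? = some i := by
    rw [← h.left_steps]
    rfl
  have hj : (openSteps .b w)[0]? = some j := by
    rw [← h.right_steps]
    rfl
  have hij : i ≠ j := by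
    rintro rfl
    have h1 := (openSteps_getElem? (by decide) w hi).1
    rw [(openSteps_getElem? (by decide) w hj).1] at h1
    cases h1
  have hmi := matching_of_head (by decide) hi
  have hmj := matching_of_head (by decide) hj
  rcases lt_or_gt_of_ne hij with hlt | hgt
  · have hlast : S.map.IsLastFace (S.map.face (S.map.inv (S.map.next.symm t))) := by
      rw [hsy]
      exact hE.isLastFace_right hlt
    rw [State.fold, if_pos hlast]
    refine h.glueEdges _ _ _ rfl rfl hE.top.1 ?_ hot (by rwa [hnt]) (fun y hy => ?_)
      (Or.inl ⟨?_, ⟨i, j, hmi, hmj, hlt⟩⟩)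
      ((hE.fold hlt (isZip_zip _ _ _ _ _) fun y => color_zip_zipDart _ _ _ _ _ y).imp fun _ h => h.1)
    · rw [hnt, hE.top.2.1, hdl.2]
      decide
    · exact if_neg fun e => hy ⟨t, hE.top.1, e.symm⟩
    · rw [hnt, recolor, hdl.1]
      simp
  · have hlast : ¬ S.map.IsLastFace (S.map.face (S.map.inv (S.map.next.symm t))) := by
      rw [hsy]
      exact hE.not_isLastFace_right hgt
    rw [State.fold, if_neg hlast]
    refine h.glueEdges _ _ _ rfl rfl (outer_next_symm.2 hE.top.1) ?_ (by rwa [hsy]) ?_ (fun y hy => ?_)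
      (Or.inr ⟨?_, ⟨i, j, hmi, hmj, hgt.le.not_gt⟩⟩)
      (hE.fold_black hgt (isZip_zip _ _ _ _ _) fun y => color_zip_zipDart _ _ _ _ _ y)
    · rw [hsy, hndr, hE.top.2.2, hdr.1]
      decide
    · rwa [hsy, hndr]
    · refine if_neg fun e => hy ⟨S.map.next t, outer_next.2 hE.top.1, e.symm⟩
    · rw [hsy, hndr, recolor, hE.top.2.1]
      simp

end State.Tracks

theorem build_concat (w : List Letter) (x : Letter) : build (w ++ [x]) = (build w).step x := by
  unfold build
  rw [List.foldl_append]
  rfl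

theorem single_outer (y : single.Dart) : single.Outer y := by
  cases y
  · exact rfl
  · exact face_next (M := single) single.root

theorem single_tri : single.LooplessTriangulation := by
  have hv : ∀ y z : single.Dart, single.origin y = single.origin z → y = z := by
    intro y z e
    exact apply_eq_of_origin_eq (M := single) (fun y => y) (fun y => by cases y <;> rfl) e
  refine ⟨⟨connected_iff.2 fun f h1 _ x y => ?_, ?_⟩, nearTriangulation_iff.2 fun y hy =>
    absurd (single_outer y) hy, fun d e => single.inv_ne d (hv _ _ e).symm, fun d d' _ _ e => hv d d' e⟩
  · have h2 : f true = f false := h1 false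
    cases x <;> cases y <;> first | rfl | exact h2 | exact h2.symm
  · have h1 : Nat.card single.Dart = 2 := Nat.card_eq_fintype_card (α := Bool)
    have h2 : Nat.card single.Vertex = 2 := by
      rw [← h1]
      exact (Nat.card_congr (Equiv.ofBijective single.origin
        ⟨fun y z e => hv y z e, origin_surjective⟩)).symm
    have h3 : Nat.card single.Face = 1 := by
      rw [Nat.card_eq_one_iff_unique]
      refine ⟨⟨fun f g => ?_⟩, ⟨single.rootFace⟩⟩
      obtain ⟨y, rfl⟩ := face_surjective f
      obtain ⟨z, rfl⟩ := face_surjective g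
      exact face_eq_of_outer (single_outer y) (single_outer z)
    have h4 := card_dart single
    rw [h1] at h4
    rw [h2, h3]
    omega

theorem single_explored : single.Explored 0 true [] [] [] := by
  refine ⟨single_tri, ⟨⟨rfl, rfl⟩, fun d _ h => ?_⟩, ⟨single_outer _, rfl, rfl⟩, rfl, rfl, ?_, ?_,
    Trail.root (M := single) 0, ?_, ?_, ?_, ?_, ?_, ?_, List.Pairwise.nil, List.Pairwise.nil⟩
  · cases d
    · rfl
    · exact absurd h.1 (by decide)
  all_goals intro i d hd; cases hd

theorem start_tracks : State.start.Tracks [] (true : Bool) [] [] [] := by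
  refine ⟨rfl, single_explored, rfl, rfl, ?_, fun i d hd => (by cases hd),
    fun i d hd => (by cases hd)⟩
  refine ⟨?_, ?_, ?_, ?_, ?_, ?_, ?_, ?_, ?_, ?_⟩
  · intro i hi
    cases hi
  · intro i j hi
    cases hi
  · intro y h1 h2
    cases y
    · exact absurd ⟨single_outer _, fun e : (true : Bool) = false => by cases e⟩ h2
    · exact absurd ⟨single_outer _, fun e : (true : Bool) = false => by cases e⟩ h1
  · simp
  · simp
  · intro y hy
    exact absurd (single_outer y) hy
  · simp
  · simp
  · intro y hy
    exact absurd (single_outer y).outerVertex hy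
  · simp

/-- If a `c`-step may follow, then there are open steps of either kind. -/
theorem openSteps_ne_nil {s : Letter} (hs : s = .a ∨ s = .b) {w : List Letter}
    (h : w ++ [.c] ∈ quadrantWalks) : openSteps s w ≠ [] := by
  intro e
  have h1 := quadrantWalks_of_concat h
  have h2 := h _ (List.prefix_refl _)
  rw [List.count_append, List.count_append, List.count_append] at h2
  have h3 : ∀ u, u <+: w → u.count .c ≤ u.count s := by
    intro u hu
    rcases hs with rfl | rfl
    · exact (h1 u hu).1
    · exact (h1 u hu).2
  have h4 := length_openSteps (by rcases hs with rfl | rfl <;> decide) h3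
  rw [e] at h4
  rcases hs with rfl | rfl <;> simp at h2 h4 <;> omega

theorem exists_tracks {w : List Letter} (hw : w ∈ quadrantWalks) :
    ∃ t left right path, (build w).Tracks w t left right path := by
  induction w using List.reverseRecOn with
  | nil => exact ⟨_, _, _, _, start_tracks⟩
  | append_singleton w x ih =>
    obtain ⟨t, left, right, path, h⟩ := ih (quadrantWalks_of_concat hw)
    rw [build_concat]
    have ht : ∃ t, (build w).map.IsTop t := ⟨t, h.explored.top⟩
    cases x with
    | a =>
      have e : ht.choose = t := h.explored.iface.top_unique ht.choose_spec h.explored.top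
      rw [State.step, dif_pos ht]
      have := h.glueTriangle (x := .white) (s := .a) (Or.inl ⟨rfl, rfl⟩)
      convert this using 10
    | b =>
      have e : ht.choose = t := h.explored.iface.top_unique ht.choose_spec h.explored.top
      rw [State.step, dif_pos ht]
      have := h.glueTriangle (x := .black) (s := .b) (Or.inr ⟨rfl, rfl⟩)
      convert this using 10
    | c =>
      obtain ⟨⟨i, dl⟩, left, rfl⟩ := List.exists_cons_of_ne_nil (l := left) fun e =>
        openSteps_ne_nil (Or.inl rfl) hw (by rw [← h.left_steps, e]; rfl)
      obtain ⟨⟨j, dr⟩, right, rfl⟩ := List.exists_cons_of_ne_nil (l := right) fun e =>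
        openSteps_ne_nil (Or.inr rfl) hw (by rw [← h.right_steps, e]; rfl)
      have hf : ∃ t, (build w).map.CanFold t := ⟨t, h.canFold⟩
      have key : ∀ s (hs : (build w).map.CanFold s), ∃ t' left' right' path',
          ((build w).fold s hs).Tracks (w ++ [.c]) t' left' right' path' := by
        intro s hs
        obtain rfl : t = s := h.explored.iface.top_unique h.explored.top hs.top
        exact h.fold
      rw [State.step, dif_pos hf]
      exact key _ _

theorem defined_of_concat {w : List Letter} {s : Letter} (hw : w ++ [s] ∈ quadrantWalks) :
    (build w).Defined s := by
  obtain ⟨t, left, right, path, h⟩ := exists_tracks (quadrantWalks_of_concat hw)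
  cases s with
  | a => exact ⟨t, h.explored.top⟩
  | b => exact ⟨t, h.explored.top⟩
  | c =>
    obtain ⟨⟨i, dl⟩, left, rfl⟩ := List.exists_cons_of_ne_nil (l := left) fun e =>
      openSteps_ne_nil (Or.inl rfl) hw (by rw [← h.left_steps, e]; rfl)
    obtain ⟨⟨j, dr⟩, right, rfl⟩ := List.exists_cons_of_ne_nil (l := right) fun e =>
      openSteps_ne_nil (Or.inr rfl) hw (by rw [← h.right_steps, e]; rfl)
    exact ⟨t, h.canFold⟩

open PercMap

/-! ### The bijections between steps and cells -/

theorem bijOn_etaE {w : List Letter} (hw : w ∈ quadrantWalks) :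
    Set.BijOn (etaE w) {i | i < w.length} (buildMap w).inEdges := by
  obtain ⟨t, left, right, path, h⟩ := exists_tracks hw
  have hR : (buildMap w).RootInterface := h.explored.iface
  have hc : (buildMap w).Cells w (build w).edgeDart (build w).cellDart := h.cells
  refine ⟨fun i hi => hR.mem_inEdges.2 (hc.edge_inner i hi),
    fun i hi j hj e => hc.edge_inj i j hi hj e, fun e he => ?_⟩
  obtain ⟨y, rfl⟩ := edge_surjective e
  obtain ⟨h1, h2⟩ := hR.mem_inEdges.1 he
  exact hc.edge_surj y h1 h2

theorem etaVF_of_ab {w : List Letter} {i : ℕ} (hi : w[i]? = some .a ∨ w[i]? = some .b) :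
    etaVF w i = .inr ((buildMap w).face ((build w).cellDart i)) := by
  unfold etaVF
  rw [if_neg]
  rcases hi with hi | hi <;> rw [hi] <;> simp

theorem etaVF_of_c {w : List Letter} {i : ℕ} (hi : w[i]? = some .c) :
    etaVF w i = .inl ((buildMap w).origin ((build w).cellDart i)) := if_pos hi

theorem bijOn_etaVF_innerFaces {w : List Letter} (hw : w ∈ quadrantWalks) :
    Set.BijOn (etaVF w) {i | w[i]? = some .a ∨ w[i]? = some .b} (Sum.inr '' (buildMap w).innerFaces) := by
  obtain ⟨t, left, right, path, h⟩ := exists_tracks hw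
  have hc : (buildMap w).Cells w (build w).edgeDart (build w).cellDart := h.cells
  refine ⟨fun i hi => ?_, fun i hi j hj e => ?_, ?_⟩
  · rw [etaVF_of_ab hi]
    exact ⟨_, hc.face_inner i hi, rfl⟩
  · rw [etaVF_of_ab hi, etaVF_of_ab hj] at e
    exact hc.face_inj i j hi hj (Sum.inr_injective e)
  · rintro _ ⟨f, hf, rfl⟩
    obtain ⟨y, rfl⟩ := face_surjective f
    obtain ⟨i, h1, h2⟩ := hc.face_surj y hf
    exact ⟨i, h1, by rw [etaVF_of_ab h1, h2]⟩

theorem getElem?_of_mem_typeASteps {w : List Letter} {i : ℕ} (h : i ∈ typeASteps w) :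
    w[i]? = some .c := by
  obtain ⟨j, k, h1, -⟩ := h
  exact h1.2.1

theorem getElem?_of_mem_typeBSteps {w : List Letter} {i : ℕ} (h : i ∈ typeBSteps w) :
    w[i]? = some .c := by
  obtain ⟨j, k, h1, -⟩ := h
  exact h1.2.1

theorem bijOn_etaVF_innerVertices {w : List Letter} (hw : w ∈ quadrantWalks) {x : Color} {A : Set ℕ}
    (hA : ∀ i, i ∈ A ↔ w[i]? = some .c ∧ (buildMap w).color ((build w).cellDart i) = x) :
    Set.BijOn (etaVF w) A (Sum.inl '' (buildMap w).innerVertices x) := by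
  obtain ⟨t, left, right, path, h⟩ := exists_tracks hw
  have hc : (buildMap w).Cells w (build w).edgeDart (build w).cellDart := h.cells
  refine ⟨fun i hi => ?_, fun i hi j hj e => ?_, ?_⟩
  · obtain ⟨h1, h2⟩ := (hA i).1 hi
    rw [etaVF_of_c h1]
    refine ⟨_, ⟨fun d hd e => hc.vertex_inner i h1 ⟨d, hd, e⟩, fun d e => ?_⟩, rfl⟩
    rw [color_eq_of_origin_eq e, h2]
  · have h1 := ((hA i).1 hi).1
    have h2 := ((hA j).1 hj).1
    rw [etaVF_of_c h1, etaVF_of_c h2] at e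
    exact hc.vertex_inj i j h1 h2 (Sum.inl_injective e)
  · rintro _ ⟨v, ⟨h1, h2⟩, rfl⟩
    obtain ⟨y, rfl⟩ := origin_surjective v
    obtain ⟨i, h3, h4⟩ := hc.vertex_surj y fun ⟨d, h5, h6⟩ => h1 d h5 h6
    exact ⟨i, (hA i).2 ⟨h3, h2 _ h4⟩, by rw [etaVF_of_c h3, h4]⟩

theorem bijOn_etaVF_white {w : List Letter} (hw : w ∈ quadrantWalks) :
    Set.BijOn (etaVF w) (typeASteps w) (Sum.inl '' (buildMap w).innerVertices .white) := by
  refine bijOn_etaVF_innerVertices hw fun i => ?_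
  obtain ⟨t, left, right, path, h⟩ := exists_tracks hw
  constructor
  · intro hi
    have h1 := getElem?_of_mem_typeASteps hi
    refine ⟨h1, ?_⟩
    rcases h.cells.vertex_color i h1 with ⟨h2, -⟩ | ⟨-, h2⟩
    · exact h2
    · exact (disjoint_typeSteps hi h2).elim
  · rintro ⟨h1, h2⟩
    rcases h.cells.vertex_color i h1 with ⟨-, h3⟩ | ⟨h3, -⟩
    · exact h3
    · cases h2.symm.trans h3

theorem bijOn_etaVF_black {w : List Letter} (hw : w ∈ quadrantWalks) :
    Set.BijOn (etaVF w) (typeBSteps w) (Sum.inl '' (buildMap w).innerVertices .black) := by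
  refine bijOn_etaVF_innerVertices hw fun i => ?_
  obtain ⟨t, left, right, path, h⟩ := exists_tracks hw
  constructor
  · intro hi
    have h1 := getElem?_of_mem_typeBSteps hi
    refine ⟨h1, ?_⟩
    rcases h.cells.vertex_color i h1 with ⟨-, h2⟩ | ⟨h2, -⟩
    · exact (disjoint_typeSteps h2 hi).elim
    · exact h2
  · rintro ⟨h1, h2⟩
    rcases h.cells.vertex_color i h1 with ⟨h3, -⟩ | ⟨-, h3⟩
    · cases h2.symm.trans h3
    · exact h3

/-- The edges of a side of the boundary correspond to the unmatched steps of one letter, if the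
triangles of these steps are those incident to the edges. -/
theorem existsUnique_incidentStep {w : List Letter} {s : Letter} (hs : s = .a ∨ s = .b)
    {side : List (ℕ × (buildMap w).Dart)} {P : (buildMap w).Dart → Prop}
    {A : Set (buildMap w).Edge} (hA : ∀ e, e ∈ A ↔ ∃ d, P d ∧ (buildMap w).edge d = e)
    (hP : ∀ d, P d ↔ ∃ i, (i, d) ∈ side) (ho : ∀ d, P d → (buildMap w).Outer d)
    (hi : ∀ i d, (i, d) ∈ side → ¬ (buildMap w).Outer ((buildMap w).inv d))
    (hf : ∀ i d, (i, d) ∈ side → (buildMap w).face ((buildMap w).inv d) =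
      (buildMap w).face ((build w).cellDart i))
    (ht : ∀ i j d d', (i, d) ∈ side → (j, d') ∈ side → (buildMap w).face ((buildMap w).inv d) =
      (buildMap w).face ((buildMap w).inv d') → i = j)
    (hsort : side.Pairwise fun p q => q.1 < p.1) (hside : side.map Prod.fst = openSteps s w) :
    (∀ i ∈ unmatchedSteps s w, ∃! e, IncidentStep w A i e) ∧
      ∀ η : ℕ → (buildMap w).Edge, (∀ i ∈ unmatchedSteps s w, IncidentStep w A i (η i)) →
        Set.BijOn η (unmatchedSteps s w) A := by
  have hsc : s ≠ .c := by rcases hs with rfl | rfl <;> decide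
  have hmem : ∀ i, i ∈ unmatchedSteps s w ↔ ∃ d, (i, d) ∈ side := by
    intro i
    rw [unmatchedSteps_eq hsc]
    change i ∈ openSteps s w ↔ _
    rw [← hside, List.mem_map]
    constructor
    · rintro ⟨⟨j, d⟩, h1, rfl⟩
      exact ⟨d, h1⟩
    · rintro ⟨d, h1⟩
      exact ⟨(i, d), h1, rfl⟩
  have huniq : ∀ i d d', (i, d) ∈ side → (i, d') ∈ side → d = d' := by
    intro i d d' h1 h2
    have hnd : (side.map Prod.fst).Nodup := by
      rw [List.Nodup, List.pairwise_map]
      exact hsort.imp fun hlt => hlt.ne'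
    exact congrArg Prod.snd (List.inj_on_of_nodup_map hnd h1 h2 rfl)
  have hab : ∀ i d, (i, d) ∈ side → w[i]? = some .a ∨ w[i]? = some .b := by
    intro i d h1
    have h2 : w[i]? = some s := ((hmem i).2 ⟨d, h1⟩).1
    rcases hs with rfl | rfl
    · exact Or.inl h2
    · exact Or.inr h2
  have hinc : ∀ i d, (i, d) ∈ side → IncidentStep w A i ((buildMap w).edge d) := fun i d h1 =>
    ⟨(hA _).2 ⟨d, (hP d).2 ⟨i, h1⟩, rfl⟩, _, etaVF_of_ab (hab i d h1),
      (buildMap w).inv d, hf i d h1, edge_inv d⟩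
  have hinc' : ∀ i d e, (i, d) ∈ side → IncidentStep w A i e → e = (buildMap w).edge d := by
    rintro i d e h1 ⟨h2, f, h3, y, h4, h5⟩
    obtain ⟨d', h6, rfl⟩ := (hA e).1 h2
    obtain ⟨j, h7⟩ := (hP d').1 h6
    rw [etaVF_of_ab (hab i d h1)] at h3
    rw [← Sum.inr_injective h3, ← hf i d h1] at h4
    rcases edge_eq_iff.1 h5 with rfl | rfl
    · exact absurd (outer_of_face_eq h4 (ho _ h6)) (hi i d h1)
    · obtain rfl := ht i j d d' h1 h7 h4.symm
      rw [huniq _ _ _ h1 h7]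
  refine ⟨fun i h1 => ?_, fun η hη => ⟨fun i h1 => (hη i h1).1, fun i h1 j h2 e => ?_, fun e he => ?_⟩⟩
  · obtain ⟨d, h2⟩ := (hmem i).1 h1
    exact ⟨_, hinc i d h2, fun e he => hinc' i d e h2 he⟩
  · obtain ⟨d, h3⟩ := (hmem i).1 h1
    obtain ⟨d', h4⟩ := (hmem j).1 h2
    rw [hinc' i d _ h3 (hη i h1), hinc' j d' _ h4 (hη j h2)] at e
    rcases edge_eq_iff.1 e with rfl | rfl
    · exact ht i j _ _ h3 h4 rfl
    · exact absurd (ho _ ((hP _).2 ⟨i, h3⟩)) (hi j d' h4)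
  · obtain ⟨d, h3, rfl⟩ := (hA e).1 he
    obtain ⟨i, h4⟩ := (hP d).1 h3
    have h5 := (hmem i).2 ⟨d, h4⟩
    exact ⟨i, h5, hinc' i d _ h4 (hη i h5)⟩

theorem left_incidentStep {w : List Letter} (hw : w ∈ quadrantWalks) :
    (∀ i ∈ unmatchedSteps .a w, ∃! e, IncidentStep w (buildMap w).leftEdges i e) ∧
      Set.BijOn (etaLR w) (unmatchedSteps .a w) (buildMap w).leftEdges := by
  obtain ⟨t, left, right, path, h⟩ := exists_tracks hw
  obtain ⟨h1, h2⟩ := existsUnique_incidentStep (Or.inl rfl) (P := (buildMap w).IsLeft)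
    (A := (buildMap w).leftEdges) (fun e => Iff.rfl) (fun d => h.explored.isLeft_iff) (fun d hd => hd.1)
    (fun i d hd => h.explored.left_inner hd) h.left_face
    (fun i j d d' hd hd' e => h.explored.left_time_unique hd hd' e) h.explored.left_sorted h.left_steps
  refine ⟨h1, h2 _ fun i hi => ?_⟩
  rw [etaLR, if_pos hi.1]
  exact Classical.epsilon_spec (h1 i hi).exists

theorem right_incidentStep {w : List Letter} (hw : w ∈ quadrantWalks) :
    (∀ i ∈ unmatchedSteps .b w, ∃! e, IncidentStep w (buildMap w).rightEdges i e) ∧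
      Set.BijOn (etaLR w) (unmatchedSteps .b w) (buildMap w).rightEdges := by
  obtain ⟨t, left, right, path, h⟩ := exists_tracks hw
  obtain ⟨h1, h2⟩ := existsUnique_incidentStep (Or.inr rfl) (P := (buildMap w).IsRight)
    (A := (buildMap w).rightEdges) (fun e => Iff.rfl) (fun d => h.explored.isRight_iff) (fun d hd => hd.1)
    (fun i d hd => h.explored.right_inner hd) h.right_face
    (fun i j d d' hd hd' e => h.explored.right_time_unique hd hd' e) h.explored.right_sorted h.right_steps
  refine ⟨h1, h2 _ fun i hi => ?_⟩
  rw [etaLR, if_neg (by rw [hi.1]; simp)]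
  exact Classical.epsilon_spec (h1 i hi).exists

namespace PercMap

variable {M N M' N' : PercMap}

/-! ### Isomorphisms before and after a step -/

/-- A surjective morphism between maps with the same number of darts is an isomorphism. -/
theorem exists_iso_of_surjective (f : M.Dart → N.Dart) (hc : Nat.card M.Dart = Nat.card N.Dart)
    (hf : Function.Surjective f) (h1 : ∀ y, f (M.inv y) = N.inv (f y))
    (h2 : ∀ y, f (M.next y) = N.next (f y)) (h3 : f M.root = N.root)
    (h4 : ∀ y, N.color (f y) = M.color y) : ∃ e : Iso M N, ∀ y, e.equiv y = f y :=
  ⟨⟨Equiv.ofBijective f ((Nat.bijective_iff_surjective_and_card f).2 ⟨hf, hc⟩), h1, h2, h3, h4⟩,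
    fun _ => rfl⟩

theorem Iso.card_dart (e : Iso M N) : Nat.card M.Dart = Nat.card N.Dart := Nat.card_congr e.equiv

/-- The mirror images of isomorphic maps are isomorphic. -/
def Iso.mirror (e : Iso M N) : Iso M.mirror N.mirror where
  equiv := e.equiv
  map_inv := e.map_inv
  map_next y := by
    rw [Equiv.eq_symm_apply, ← e.map_next, Equiv.apply_symm_apply]
  map_root := e.map_root
  map_color y := by
    simp only
    rw [← e.map_inv, e.map_color]

theorem Iso.map_next_symm (e : Iso M N) (y : M.Dart) :
    e.equiv (M.next.symm y) = N.next.symm (e.equiv y) := e.mirror.map_next y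

theorem Iso.isLastFace (e : Iso M N) {y : M.Dart} (h : M.IsLastFace (M.face y)) :
    N.IsLastFace (N.face (e.equiv y)) := by
  have hent : ∀ {z y : M.Dart}, N.PathEnters (e.equiv z) (N.face (e.equiv y)) ↔ M.PathEnters z (M.face y) := by
    intro z y
    unfold PathEnters rootFace
    rw [e.onPath, ← e.map_inv, ← e.map_root, ne_eq, e.face_eq, e.face_eq]
  have hinc : ∀ y : M.Dart, (∃ u, N.Incident (N.face (e.equiv y)) u ∧ (u ∈ N.leftEdges ∨ u ∈ N.rightEdges)) ↔
      ∃ u, M.Incident (M.face y) u ∧ (u ∈ M.leftEdges ∨ u ∈ M.rightEdges) := by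
    intro y
    have hl : ∀ d, N.edge (e.equiv d) ∈ N.leftEdges ↔ M.edge d ∈ M.leftEdges := by
      intro d
      constructor
      · rintro ⟨x, h1, h2⟩
        obtain ⟨x, rfl⟩ := e.equiv.surjective x
        exact ⟨x, e.isLeft.1 h1, e.edge_eq.1 h2⟩
      · rintro ⟨x, h1, h2⟩
        exact ⟨_, e.isLeft.2 h1, e.edge_eq.2 h2⟩
    have hr : ∀ d, N.edge (e.equiv d) ∈ N.rightEdges ↔ M.edge d ∈ M.rightEdges := by
      intro d
      constructor
      · rintro ⟨x, h1, h2⟩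
        obtain ⟨x, rfl⟩ := e.equiv.surjective x
        exact ⟨x, e.isRight.1 h1, e.edge_eq.1 h2⟩
      · rintro ⟨x, h1, h2⟩
        exact ⟨_, e.isRight.2 h1, e.edge_eq.2 h2⟩
    constructor
    · rintro ⟨_, ⟨d, h1, rfl⟩, h2⟩
      obtain ⟨d, rfl⟩ := e.equiv.surjective d
      rw [hl, hr] at h2
      exact ⟨_, ⟨d, e.face_eq.1 h1, rfl⟩, h2⟩
    · rintro ⟨_, ⟨d, h1, rfl⟩, h2⟩
      rw [← hl, ← hr] at h2
      exact ⟨_, ⟨_, e.face_eq.2 h1, rfl⟩, h2⟩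
  obtain ⟨h1, z, h2, h3⟩ := h
  refine ⟨(hinc y).2 h1, e.equiv z, hent.2 h2, fun z' f' h4 h5 h6 => ?_⟩
  obtain ⟨z', rfl⟩ := e.equiv.surjective z'
  obtain ⟨x, rfl⟩ := face_surjective f'
  obtain ⟨x, rfl⟩ := e.equiv.surjective x
  refine h3 z' (M.face x) ?_ (hent.1 h5) ((hinc x).1 h6)
  have hstep : ∀ a b, N.PathStep a b → M.PathStep (e.equiv.symm a) (e.equiv.symm b) := by
    intro a b hab
    rw [← e.pathStep]
    simpa using hab
  have key : ∀ a b, Relation.TransGen N.PathStep a b →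
      Relation.TransGen M.PathStep (e.equiv.symm a) (e.equiv.symm b) := by
    intro a b hab
    induction hab with
    | single h => exact Relation.TransGen.single (hstep _ _ h)
    | tail _ h ih => exact ih.tail (hstep _ _ h)
  simpa using key _ _ h4

theorem Iso.canFold (e : Iso M N) {t : M.Dart} (h : M.CanFold t) : N.CanFold (e.equiv t) := by
  refine ⟨e.isTop.2 h.top, ?_, ?_, ?_⟩
  · rw [← e.map_next]
    exact e.isLeft.2 h.left
  · rw [← e.map_next_symm]
    exact e.isRight.2 h.right
  · rw [← e.map_root]
    exact e.goes.2 h.root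

namespace IsAttach

variable {t : M.Dart} {x : Color} {ι : M.Dart → N.Dart} {r l : N.Dart} {t' : M'.Dart}
  {ι' : M'.Dart → N'.Dart} {r' l' : N'.Dart}

theorem iso (h : IsAttach M N t x ι r l) (h' : IsAttach M' N' t' x ι' r' l') (e : Iso M M')
    (ht : e.equiv t = t') : Nonempty (Iso N N') := by
  obtain ⟨f, f1, f2, f3, f4, f5⟩ := h.exists_extension (fun z => ι' (e.equiv z)) r' l' (N'.inv r') (N'.inv l')
  refine ⟨(exists_iso_of_surjective f ?_ ?_ ?_ ?_ ?_ ?_).choose⟩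
  · rw [h.card_dart, h'.card_dart, e.card_dart]
  · intro y
    rcases h'.cover y with ⟨z, rfl⟩ | rfl | rfl | rfl | rfl
    · exact ⟨ι (e.equiv.symm z), by rw [f1, Equiv.apply_symm_apply]⟩
    · exact ⟨_, f2⟩
    · exact ⟨_, f3⟩
    · exact ⟨_, f4⟩
    · exact ⟨_, f5⟩
  · intro y
    rcases h.cover y with ⟨z, rfl⟩ | rfl | rfl | rfl | rfl
    · rw [h.map_inv, f1, f1, h'.map_inv, e.map_inv]
    · rw [f4, f2]
    · rw [f5, f3]
    · rw [N.inv_inv, f4, f2, N'.inv_inv]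
    · rw [N.inv_inv, f5, f3, N'.inv_inv]
  · intro y
    rcases h.cover y with ⟨z, rfl⟩ | rfl | rfl | rfl | rfl
    · by_cases h1 : z = t
      · rw [h1, h.next_top, f5, f1, ht, h'.next_top]
      by_cases h2 : M.next z = t
      · rw [h.next_prev z h2, f2, f1, h'.next_prev]
        rw [← e.map_next, h2, ht]
      · rw [h.next_of_ne z h1 h2, f1, f1, e.map_next, h'.next_of_ne]
        · rw [← ht, e.equiv.apply_eq_iff_eq.ne]
          exact h1
        · rw [← e.map_next, ← ht, e.equiv.apply_eq_iff_eq.ne]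
          exact h2
    · rw [h.next_right, f2, f3, h'.next_right]
    · rw [h.next_left, f1, f3, h'.next_left, e.map_next, ht]
    · rw [h.next_inv_right, f1, f4, h'.next_inv_right, ht]
    · rw [h.next_inv_left, f4, f5, h'.next_inv_left]
  · rw [h.map_root, f1, h'.map_root, e.map_root]
  · intro y
    rcases h.cover y with ⟨z, rfl⟩ | rfl | rfl | rfl | rfl
    · rw [f1, h'.color_map, h.color_map, e.map_color]
    · rw [f2, h'.color_right, h.color_right, ← ht, e.map_color]
    · rw [f3, h'.color_left, h.color_left]
    · rw [f4, h'.color_inv_right, h.color_inv_right]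
    · rw [f5, h'.color_inv_left, h.color_inv_left, ← ht, ← e.map_inv, e.map_color]

theorem iso_of (h : IsAttach M N t x ι r l) (h' : IsAttach M' N' t' x ι' r' l') (e : Iso N N')
    (hr : e.equiv r = r') : Nonempty (Iso M M') := by
  have hl : e.equiv l = l' := by rw [← h.next_right, e.map_next, hr, h'.next_right]
  have hg : ∀ z, ∃ z', ι' z' = e.equiv (ι z) := by
    intro z
    rcases h'.cover (e.equiv (ι z)) with h1 | h1 | h1 | h1 | h1
    · exact h1
    · exact absurd (e.equiv.injective (h1.trans hr.symm)) (h.ne_right z)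
    · exact absurd (e.equiv.injective (h1.trans hl.symm)) (h.ne_left z)
    · rw [← hr, ← e.map_inv] at h1
      exact absurd (e.equiv.injective h1) (h.ne_inv_right z)
    · rw [← hl, ← e.map_inv] at h1
      exact absurd (e.equiv.injective h1) (h.ne_inv_left z)
  choose g hg using hg
  have hgt : g t = t' := by
    apply h'.inj
    rw [hg, ← h.next_inv_right, e.map_next, e.map_inv, hr, h'.next_inv_right]
  refine ⟨(exists_iso_of_surjective g ?_ ?_ ?_ ?_ ?_ ?_).choose⟩
  · have h1 := h.card_dart
    have h2 := h'.card_dart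
    have h3 := e.card_dart
    omega
  · intro z'
    obtain ⟨y, hy⟩ := e.equiv.surjective (ι' z')
    rcases h.cover y with ⟨z, rfl⟩ | rfl | rfl | rfl | rfl
    · exact ⟨z, h'.inj ((hg z).trans hy)⟩
    · exact absurd (hy.symm.trans hr) (h'.ne_right z')
    · exact absurd (hy.symm.trans hl) (h'.ne_left z')
    · rw [e.map_inv, hr] at hy
      exact absurd hy.symm (h'.ne_inv_right z')
    · rw [e.map_inv, hl] at hy
      exact absurd hy.symm (h'.ne_inv_left z')
  · intro z
    apply h'.inj
    rw [hg, ← h'.map_inv, hg, ← e.map_inv, h.map_inv]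
  · intro z
    have hgi : Function.Injective g := fun a b hab =>
      h.inj (e.equiv.injective (by rw [← hg, ← hg, hab]))
    apply h'.inj
    rw [hg]
    by_cases h1 : z = t
    · rw [h1, hgt, ← h.next_left, e.map_next, hl, h'.next_left]
    · have h2 : g z ≠ t' := fun h2 => h1 (hgi (h2.trans hgt.symm))
      by_cases h3 : M.next z = t
      · by_cases h4 : M'.next (g z) = t'
        · rw [h3, h4, ← hgt, hg]
        · have h5 := h'.next_of_ne _ h2 h4
          rw [hg, ← e.map_next, h.next_prev z h3, hr] at h5
          exact absurd h5.symm (h'.ne_right _)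
      · by_cases h4 : M'.next (g z) = t'
        · have h5 := h'.next_prev _ h4
          rw [hg, ← e.map_next, h.next_of_ne z h1 h3, ← hr] at h5
          exact absurd (e.equiv.injective h5) (h.ne_right _)
        · rw [← h'.next_of_ne _ h2 h4, hg, ← e.map_next, h.next_of_ne z h1 h3]
  · apply h'.inj
    rw [hg, ← h.map_root, e.map_root, h'.map_root]
  · intro z
    rw [← h'.color_map, hg, e.map_color, h.color_map]

end IsAttach

namespace IsZip

variable {d : M.Dart} {ζ : M.Dart → N.Dart} {d' : M'.Dart} {ζ' : M'.Dart → N'.Dart}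

theorem iso (h : IsZip M N d ζ) (h' : IsZip M' N' d' ζ') (e : Iso M M') (hd : e.equiv d = d')
    (hcol : ∀ y, N'.color (ζ' (e.equiv y)) = N.color (ζ y)) : Nonempty (Iso N N') := by
  choose g hg1 hg2 using h.surj
  have hf' : ∀ y, (y ≠ d ∧ y ≠ M.next d) → ζ' (e.equiv (g (ζ y))) = ζ' (e.equiv y) := by
    intro y hy
    rw [h.inj _ _ (hg1 _) hy (hg2 _)]
  have hf : ∀ y, ζ' (e.equiv (g (ζ y))) = ζ' (e.equiv y) := by
    intro y
    by_cases h1 : y = d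
    · rw [h1, h.map_self, hf' _ ⟨fun e => h.can.inv_ne_next (inv_eq_iff.2 e.symm), M.inv_ne _⟩, hd,
        h'.map_self, e.map_inv, e.map_next, hd]
    by_cases h2 : y = M.next d
    · rw [h2, h.map_next_self, hf' _ ⟨M.inv_ne _, h.can.inv_ne_next⟩, e.map_next, hd, h'.map_next_self,
        e.map_inv, hd]
    · exact hf' y ⟨h1, h2⟩
  have hne : ∀ y, (y ≠ d ∧ y ≠ M.next d) → e.equiv y ≠ d' ∧ e.equiv y ≠ M'.next d' := by
    rintro y ⟨h1, h2⟩
    rw [← hd, ← e.map_next, e.equiv.apply_eq_iff_eq.ne, e.equiv.apply_eq_iff_eq.ne]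
    exact ⟨h1, h2⟩
  refine ⟨(exists_iso_of_surjective (fun x => ζ' (e.equiv (g x))) ?_ ?_ ?_ ?_ ?_ ?_).choose⟩
  · have h1 := h.card_dart
    have h2 := h'.card_dart
    have h3 := e.card_dart
    omega
  · intro x
    obtain ⟨y, -, rfl⟩ := h'.surj x
    exact ⟨ζ (e.equiv.symm y), by simp only [hf, Equiv.apply_symm_apply]⟩
  · intro x
    obtain ⟨y, -, rfl⟩ := h.surj x
    rw [h.map_inv, hf, hf, h'.map_inv, e.map_inv]
  · intro x
    obtain ⟨y, hy, rfl⟩ := h.surj x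
    by_cases h1 : M.next y = d
    · rw [h.next_of_eq y h1, hf, hf, h'.next_of_eq, e.map_next, e.map_next, hd]
      rw [← e.map_next, h1, hd]
    · rw [h.next_of_ne y hy h1, hf, hf, h'.next_of_ne _ (hne y hy), e.map_next]
      rw [← e.map_next, ← hd, e.equiv.apply_eq_iff_eq.ne]
      exact h1
  · rw [h.map_root, hf, h'.map_root, e.map_root]
  · intro x
    obtain ⟨y, hy, rfl⟩ := h.surj x
    rw [hf, hcol]

/-- The glued darts are determined by the predecessor of `d` and by the dart that results from `d`. -/
theorem iso_of (h : IsZip M N d ζ) (h' : IsZip M' N' d' ζ') (e : Iso N N')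
    (hp : e.equiv (ζ (M.next.symm d)) = ζ' (M'.next.symm d')) (hc : e.equiv (ζ d) = ζ' d')
    (hcol : ∀ y, N.color (ζ y) = M.recolor d .white y)
    (hcol' : ∀ y, N'.color (ζ' y) = M'.recolor d' .white y)
    (hd : M.color d = .black) (hd' : M'.color d' = .black) : Nonempty (Iso M M') := by
  classical
  choose ι hι1 hι2 using h'.surj
  set g : M.Dart → M'.Dart := fun y =>
    if y = d then d' else if y = M.next d then M'.next d' else ι (e.equiv (ζ y)) with hg
  have hdn := h.can.next_ne
  have hgd : g d = d' := if_pos rfl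
  have hgn : g (M.next d) = M'.next d' := by
    simp only [hg, if_neg hdn, if_pos]
  have hgo : ∀ y, (y ≠ d ∧ y ≠ M.next d) → g y = ι (e.equiv (ζ y)) := fun y hy => by
    simp only [hg, if_neg hy.1, if_neg hy.2]
  have hgne : ∀ y, (y ≠ d ∧ y ≠ M.next d) → g y ≠ d' ∧ g y ≠ M'.next d' := fun y hy => by
    rw [hgo y hy]
    exact hι1 _
  have hcn : e.equiv (ζ (M.next d)) = ζ' (M'.next d') := by
    rw [h.map_next_self, ← h.map_inv, e.map_inv, hc, h'.map_inv, h'.map_next_self]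
  have hζ : ∀ y, ζ' (g y) = e.equiv (ζ y) := by
    intro y
    by_cases h1 : y = d
    · rw [h1, hgd, hc]
    by_cases h2 : y = M.next d
    · rw [h2, hgn, hcn]
    · rw [hgo y ⟨h1, h2⟩, hι2]
  have huniq : ∀ y z, (y ≠ d ∧ y ≠ M.next d) → (z ≠ d' ∧ z ≠ M'.next d') →
      e.equiv (ζ y) = ζ' z → g y = z := by
    intro y z hy hz hyz
    exact h'.inj _ _ (hgne y hy) hz ((hζ y).trans hyz)
  have hid : M.inv d ≠ d ∧ M.inv d ≠ M.next d := ⟨M.inv_ne _, h.can.inv_ne_next⟩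
  have hin : M.inv (M.next d) ≠ d ∧ M.inv (M.next d) ≠ M.next d :=
    ⟨fun e => h.can.inv_ne_next (inv_eq_iff.2 e.symm), M.inv_ne _⟩
  have hid' : M'.inv d' ≠ d' ∧ M'.inv d' ≠ M'.next d' := ⟨M'.inv_ne _, h'.can.inv_ne_next⟩
  have hin' : M'.inv (M'.next d') ≠ d' ∧ M'.inv (M'.next d') ≠ M'.next d' :=
    ⟨fun e => h'.can.inv_ne_next (inv_eq_iff.2 e.symm), M'.inv_ne _⟩
  have hgi : g (M.inv d) = M'.inv d' :=
    huniq _ _ hid hid' (by rw [← h.map_inv, e.map_inv, hc, h'.map_inv])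
  have hgin : g (M.inv (M.next d)) = M'.inv (M'.next d') :=
    huniq _ _ hin hin' (by rw [← h.map_inv, e.map_inv, hcn, h'.map_inv])
  have hinv : ∀ y, g (M.inv y) = M'.inv (g y) := by
    intro y
    by_cases h1 : y = d
    · rw [h1, hgi, hgd]
    by_cases h2 : y = M.next d
    · rw [h2, hgin, hgn]
    by_cases h3 : M.inv y = d
    · rw [h3, hgd, inv_eq_iff.1 h3, hgi, M'.inv_inv]
    by_cases h4 : M.inv y = M.next d
    · rw [h4, hgn, inv_eq_iff.1 h4, hgin, M'.inv_inv]
    · refine huniq _ _ ⟨h3, h4⟩ ⟨fun h5 => ?_, fun h5 => ?_⟩ ?_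
      · rw [inv_eq_iff, ← hgi] at h5
        have h6 := congrArg ζ' h5
        rw [hζ, hζ] at h6
        exact h3 (by rw [h.inj _ _ ⟨h1, h2⟩ hid (e.equiv.injective h6), M.inv_inv])
      · rw [inv_eq_iff, ← hgin] at h5
        have h6 := congrArg ζ' h5
        rw [hζ, hζ] at h6
        exact h4 (by rw [h.inj _ _ ⟨h1, h2⟩ hin (e.equiv.injective h6), M.inv_inv])
      · rw [← h.map_inv, e.map_inv, ← h'.map_inv, hζ]
  have hns : M.next (M.next.symm d) = d := M.next.apply_symm_apply d
  have hns' : M'.next (M'.next.symm d') = d' := M'.next.apply_symm_apply d'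
  have hpd : M.next.symm d ≠ d ∧ M.next.symm d ≠ M.next d := by
    constructor
    · rw [ne_eq, Equiv.symm_apply_eq]
      exact hdn.symm
    · rw [ne_eq, Equiv.symm_apply_eq]
      exact h.can.next_next_ne.symm
  have hpd' : M'.next.symm d' ≠ d' ∧ M'.next.symm d' ≠ M'.next d' := by
    constructor
    · rw [ne_eq, Equiv.symm_apply_eq]
      exact h'.can.next_ne.symm
    · rw [ne_eq, Equiv.symm_apply_eq]
      exact h'.can.next_next_ne.symm
  have hgp : g (M.next.symm d) = M'.next.symm d' := huniq _ _ hpd hpd' hp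
  have hnext : ∀ y, g (M.next y) = M'.next (g y) := by
    have key : ∀ a b : M.Dart, M.next a = M.next b → a = b := fun _ _ h => M.next.injective h
    have key' : ∀ a b : M'.Dart, M'.next a = M'.next b → a = b := fun _ _ h => M'.next.injective h
    intro y
    by_cases h1 : y = d
    · rw [h1, hgn, hgd]
    by_cases h2 : y = M.next d
    · rw [h2, hgn]
      refine huniq _ _ ⟨h.can.next_next_ne, fun e => hdn (key _ _ e)⟩
        ⟨h'.can.next_next_ne, fun e => h'.can.next_ne (key' _ _ e)⟩ ?_
      rw [← h.next_of_eq _ hns, e.map_next, hp, h'.next_of_eq _ hns']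
    by_cases h3 : M.next y = d
    · have h4 : y = M.next.symm d := by rw [Equiv.eq_symm_apply, h3]
      rw [h3, hgd, h4, hgp, hns']
    · have h5 : M'.next (g y) ≠ d' := by
        intro h5
        have h6 : g y = g (M.next.symm d) := by rw [hgp, Equiv.eq_symm_apply, h5]
        have h7 := congrArg ζ' h6
        rw [hζ, hζ] at h7
        exact h3 (by rw [h.inj _ _ ⟨h1, h2⟩ hpd (e.equiv.injective h7), hns])
      refine huniq _ _ ⟨h3, fun e => h1 (key _ _ e)⟩
        ⟨h5, fun e => (hgne y ⟨h1, h2⟩).1 (key' _ _ e)⟩ ?_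
      rw [← h.next_of_ne y ⟨h1, h2⟩ h3, e.map_next, ← h'.next_of_ne _ (hgne y ⟨h1, h2⟩) h5, hζ]
  have hsurj : Function.Surjective g := by
    intro z
    by_cases h1 : z = d'
    · exact ⟨d, hgd.trans h1.symm⟩
    by_cases h2 : z = M'.next d'
    · exact ⟨_, hgn.trans h2.symm⟩
    · obtain ⟨x, hx⟩ := e.equiv.surjective (ζ' z)
      obtain ⟨y, hy, rfl⟩ := h.surj x
      exact ⟨y, huniq y z hy ⟨h1, h2⟩ hx⟩
  have hcard : Nat.card M.Dart = Nat.card M'.Dart := by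
    have h1 := h.card_dart
    have h2 := h'.card_dart
    have h3 := e.card_dart
    omega
  have hinj : Function.Injective g := ((Nat.bijective_iff_surjective_and_card g).2 ⟨hsurj, hcard⟩).1
  have horig : ∀ y, M'.origin (g y) = M'.origin d' ↔ M.origin y = M.origin d := by
    intro y
    rw [← hgd]
    constructor
    · intro h1
      have hE : ∀ z, (Equiv.ofBijective g ⟨hinj, hsurj⟩).symm (g z) = z := fun z =>
        (Equiv.ofBijective g ⟨hinj, hsurj⟩).symm_apply_apply z
      have := apply_eq_of_origin_eq (fun z => M.origin ((Equiv.ofBijective g ⟨hinj, hsurj⟩).symm z))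
        (fun z => by
          obtain ⟨z, rfl⟩ := hsurj z
          rw [← hinv, ← hnext, hE, hE]
          exact M.origin_next_inv z) h1
      rwa [hE, hE] at this
    · exact apply_eq_of_origin_eq (fun z => M'.origin (g z)) fun z => by
        rw [hnext, hinv, M'.origin_next_inv]
  refine ⟨(exists_iso_of_surjective g hcard hsurj hinv hnext ?_ fun y => ?_).choose⟩
  · refine huniq _ _ ⟨h.can.root_ne, h.can.root_ne_next⟩ ⟨h'.can.root_ne, h'.can.root_ne_next⟩ ?_
    rw [← h.map_root, e.map_root, h'.map_root]
  · by_cases h1 : M.origin y = M.origin d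
    · rw [color_eq_of_origin_eq h1, color_eq_of_origin_eq ((horig y).2 h1), hd, hd']
    · have h2 := hcol y
      have h3 := hcol' (g y)
      rw [recolor, if_neg h1] at h2
      rw [recolor, if_neg fun h4 => h1 ((horig y).1 h4)] at h3
      rw [← h2, ← h3, hζ, e.map_color]

end IsZip

end PercMap

namespace PercMap

variable {M N M' N' : PercMap}

/-! ### Recovering the last step -/

theorem Trail.dart_unique {p : List (ℕ × M.Dart)} (h : M.Trail p) {k : ℕ} {z z' : M.Dart} (hz : (k, z) ∈ p)
    (hz' : (k, z') ∈ p) : z = z' := by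
  obtain ⟨s, q, rfl⟩ := List.append_of_mem hz'
  rcases List.mem_append.1 hz with h1 | h1
  · obtain ⟨s1, s2, rfl⟩ := List.append_of_mem h1
    rw [List.append_assoc, List.cons_append] at h
    exact absurd (h.suffix.lt_head (k := k) (z := z') (by simp)).1 (lt_irrefl _)
  · rcases List.mem_cons.1 h1 with h2 | h2
    · exact (Prod.mk.inj h2).2
    · exact absurd (h.suffix.lt_head h2).1 (lt_irrefl _)

/-- The next dart with the same origin, in the rotation inverse to `next * inv`. -/
def rotate (M : PercMap) (y : M.Dart) : M.Dart := M.inv (M.next.symm y)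

theorem origin_rotate (y : M.Dart) : M.origin (M.rotate y) = M.origin y := origin_inv_next_symm y

theorem origin_rotate_iterate (y : M.Dart) (k : ℕ) : M.origin (M.rotate^[k] y) = M.origin y := by
  induction k with
  | zero => rfl
  | succ k ih => rw [Function.iterate_succ_apply', origin_rotate, ih]

theorem next_inv_rotate (y : M.Dart) : M.next (M.inv (M.rotate y)) = y := by
  rw [rotate, M.inv_inv, Equiv.apply_symm_apply]

theorem exists_rotate_iterate_eq {x y : M.Dart} (h : M.origin x = M.origin y) :
    ∃ k, M.rotate^[k] x = y := by
  have h1 : ∀ y, (M.next * M.inv)⁻¹ y = M.rotate y := fun y => by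
    rw [Equiv.Perm.inv_eq_iff_eq, Equiv.Perm.mul_apply, next_inv_rotate]
  have h2 := Equiv.Perm.sameCycle_inv.2 (origin_eq_iff.1 h)
  obtain ⟨k, hk⟩ := h2.exists_nat_pow_eq
  refine ⟨k, ?_⟩
  rw [← hk, ← Equiv.Perm.iterate_eq_pow]
  congr 1
  funext z
  exact (h1 z).symm

/-- Turning around the origin of `y`, from `y`, the dart `c` is the first one whose triangle is visited by
the percolation path. -/
def IsCut (M : PercMap) (y c : M.Dart) : Prop :=
  ∃ m, 1 ≤ m ∧ M.rotate^[m] y = c ∧ M.Visited c ∧ ∀ k, 1 ≤ k → k < m → ¬ M.Visited (M.rotate^[k] y)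

theorem IsCut.unique {y c c' : M.Dart} (h : M.IsCut y c) (h' : M.IsCut y c') : c = c' := by
  obtain ⟨m, h1, rfl, h2, h3⟩ := h
  obtain ⟨m', h4, rfl, h5, h6⟩ := h'
  rcases lt_trichotomy m m' with h7 | rfl | h7
  · exact absurd h2 (h6 m h1 h7)
  · rfl
  · exact absurd h5 (h3 m' h4 h7)

theorem Iso.isCut (e : Iso M N) {y c : M.Dart} (h : M.IsCut y c) : N.IsCut (e.equiv y) (e.equiv c) := by
  have key : ∀ k, N.rotate^[k] (e.equiv y) = e.equiv (M.rotate^[k] y) := by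
    intro k
    induction k with
    | zero => rfl
    | succ k ih =>
      rw [Function.iterate_succ_apply', Function.iterate_succ_apply', ih, rotate, rotate, e.map_inv,
        e.map_next_symm]
  obtain ⟨m, h1, rfl, h2, h3⟩ := h
  refine ⟨m, h1, key m, e.visited.2 h2, fun k h4 h5 => ?_⟩
  rw [key, e.visited]
  exact h3 k h4 h5

namespace Explored

variable {n : ℕ} {t : M.Dart} {left right path : List (ℕ × M.Dart)}

/-- The triangles between the uppermost right edge and the top-edge, around the top-right vertex, are not
visited by the percolation path before it has visited the triangle of that right edge. -/
theorem not_entered_before {j : ℕ} {dr : M.Dart} (h : M.Explored n t left ((j, dr) :: right) path)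
    {δ : M.Dart} (ho : ¬ M.Outer δ) (hδ : M.origin δ = M.origin t) (hne : δ ≠ M.inv dr) {k : ℕ} {z : M.Dart}
    (hz : (k, z) ∈ path) (hk : k ≤ j) : M.face (M.inv z) ≠ M.face δ := by
  intro hf
  obtain ⟨hP, hT, hL, hS⟩ := h.tri
  have hz' := List.mem_cons_of_mem (n, M.inv t) hz
  have hgz := h.goes_of_mem hz'
  have hoz : ¬ M.Outer (M.inv z) := fun h1 => ho (outer_of_face_eq hf h1)
  have hend : M.origin (M.inv z) ≠ M.origin t := fun e => by
    have := h.lt_time_of_origin_inv_eq_top hz' e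
    omega
  obtain ⟨z1, hz1⟩ := hT.exists_pathStep hgz hoz
  obtain ⟨k1, hk1⟩ := h.trail.mem_of_onPath hT (by rw [M.inv_inv]; exact h.top.1)
    ((h.mem_onPath hz).tail hz1)
  have cδ : M.color δ = .black := by rw [color_eq_of_origin_eq hδ, h.top.2.1]
  have h3 := hT.next3 ho
  -- the path leaves the triangle towards `δ`
  have hz1e : M.next z1 = δ := by
    have g1 := goes_iff_next.1 hz1.2.2
    rcases hT.eq_of_face_eq ho (hz1.2.1.trans hf) with e | e | e
    · rw [e, cδ] at g1
      cases g1.1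
    · have g2 := goes_iff_next.1 (goes_inv.2 hgz)
      rw [e] at g1
      rcases hT.eq_of_face_eq ho hf with e2 | e2 | e2
      · exact absurd (e2 ▸ hδ) hend
      · rw [e2, g1.1] at g2
        cases g2.1
      · rw [e2, h3, cδ] at g2
        cases g2.2
    · rw [e, h3]
  have hk1j : j < k1 := h.lt_time_of_origin_inv_eq_top hk1 (by rw [← origin_next, hz1e, hδ])
  obtain ⟨zj, hzj1, hzj2⟩ := h.right_visited j dr (List.mem_cons_self ..)
  have hzj' := List.mem_cons_of_mem (n, M.inv t) hzj1
  have hpath : Relation.ReflTransGen M.PathStep zj z := by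
    obtain ⟨z', h4, h5⟩ := Relation.TransGen.tail'_iff.1 (h.trail.transGen_of_lt hzj' hk1 hk1j)
    have h6 := h.iface.onPath_goes (Relation.ReflTransGen.trans (h.mem_onPath hzj1) h4)
    rwa [hT.pathStep_injective h6 hgz h5 hz1] at h4
  rcases hk.lt_or_eq with h4 | rfl
  · exact OnPath.not_transGen_self hT h.iface (h.mem_onPath hz)
      (Relation.TransGen.trans_left (h.trail.transGen_of_lt hz' hzj' h4) hpath)
  · rw [h.trail.dart_unique hz' hzj', hzj2] at hf
    have hdr : M.origin (M.inv dr) = M.origin t := by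
      have h1 : M.next dr = t := (M.next.symm_apply_eq.1 h.right_links.1).symm
      rw [← origin_next, h1]
    have hor := h.right_inner (List.mem_cons_self ..)
    rcases hT.eq_of_face_eq hor hf.symm with e | e | e
    · exact hne e
    · rw [e, origin_next, M.inv_inv] at hδ
      exact hL dr (hδ.trans hdr.symm)
    · refine hL δ ?_
      rw [← origin_next, hδ, e, hT.next3 hor, hdr]

/-- The cut along which the glued edge has to be opened again. -/
theorem isCut {i j : ℕ} {dl dr : M.Dart}
    (h : M.Explored n t ((i, dl) :: left) ((j, dr) :: right) path) (hij : i < j)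
    {ζ : M.Dart → N.Dart} (hz : IsZip M N t ζ) (hcol : ∀ y, N.color (ζ y) = M.recolor t .white y) :
    N.IsCut (N.inv (ζ dr)) (ζ t) := by
  classical
  obtain ⟨hP, hT, hL, hS⟩ := h.tri
  obtain ⟨path', hE, hpath⟩ := h.fold hij hz hcol
  have hnt : M.next t = dl := h.left_links.1
  have hndr : M.next dr = t := (M.next.symm_apply_eq.1 h.right_links.1).symm
  have hor := h.right_inner (List.mem_cons_self ..)
  have hol := h.left_inner (List.mem_cons_self ..)
  have hdr : M.origin (M.inv dr) = M.origin t := by rw [← origin_next, hndr]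
  have hex := exists_rotate_iterate_eq hdr
  set m := Nat.find hex with hm
  have hm1 : M.rotate^[m] (M.inv dr) = t := Nat.find_spec hex
  have hm2 : ∀ k, k < m → M.rotate^[k] (M.inv dr) ≠ t := fun k hk => Nat.find_min hex hk
  have hm0 : 1 ≤ m := by
    rw [Nat.one_le_iff_ne_zero]
    intro e
    rw [e] at hm1
    have h1 : M.inv dr = t := hm1
    exact hor (by rw [h1]; exact h.top.1)
  have hinn : ∀ k, k < m → ¬ M.Outer (M.rotate^[k] (M.inv dr)) := fun k hk ho =>
    hm2 k hk (hS _ _ ho h.top.1 ((origin_rotate_iterate _ _).trans hdr))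
  -- between `inv dr` and `t` only inner darts are met, and the rotation commutes with the gluing
  have hζ : ∀ k, k ≤ m → N.rotate^[k] (N.inv (ζ dr)) = ζ (M.rotate^[k] (M.inv dr)) := by
    intro k
    induction k with
    | zero => exact fun _ => hz.map_inv dr
    | succ k ih =>
      intro hk
      have h1 := hinn k (by omega)
      rw [Function.iterate_succ_apply', Function.iterate_succ_apply', ih (by omega), rotate, rotate,
        ← hz.map_inv]
      congr 1
      rw [Equiv.symm_apply_eq, hz.next_of_not_outer h.top.1 (outer_next_symm.not.2 h1),
        Equiv.apply_symm_apply]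
  have hζt : N.face (ζ t) = N.face (ζ (M.inv dl)) := by rw [hz.map_self, hnt]
  refine ⟨m, hm0, by rw [hζ m le_rfl, hm1], ⟨fun ho => ?_, ?_⟩, fun k hk1 hk2 => ?_⟩
  · have ho := outer_of_face_eq hζt ho
    rw [hz.outer (hz.ne_of_not_outer h.top.1 hol)] at ho
    exact hol ho
  · obtain ⟨z, h1, h2⟩ := h.left_visited i dl (List.mem_cons_self ..)
    refine ⟨ζ z, hE.mem_onPath ((hpath i _).2 ⟨z, h1, hij.le, rfl⟩), ?_⟩
    rw [hζt, hz.map_inv, hz.face_eq (hz.ne_of_not_outer h.top.1 fun ho => hol (outer_of_face_eq h2 ho))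
      (hz.ne_of_not_outer h.top.1 hol), h2]
  · rw [hζ k hk2.le]
    have hδo := hinn k hk2
    rintro ⟨h1, x, h2, h3⟩
    obtain ⟨k0, hk0⟩ := hE.trail.mem_of_onPath hE.tri.2.1 (by rw [N.inv_inv]; exact hE.top.1) h2
    rcases List.mem_cons.1 hk0 with h4 | h4
    · rw [(Prod.mk.inj h4).2, N.inv_inv] at h3
      exact h1 (outer_of_face_eq h3 hE.top.1)
    · obtain ⟨z, h5, h6, rfl⟩ := (hpath k0 x).1 h4
      have h5' := List.mem_cons_of_mem (n, M.inv t) h5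
      have hg := h.goes_of_mem h5'
      have hzt : M.inv z ≠ t ∧ M.inv z ≠ M.next t := by
        constructor
        · intro e
          have := h.lt_time_of_origin_inv_eq_top h5' (by rw [e])
          omega
        · intro e
          rw [hnt] at e
          rw [inv_eq_iff.1 e, goes_inv] at hg
          exact absurd (hg.1.symm.trans (h.left_goes i dl (List.mem_cons_self ..)).1) (by decide)
      rw [hz.map_inv, hz.face_eq hzt (hz.ne_of_not_outer h.top.1 hδo)] at h3
      refine h.not_entered_before hδo ((origin_rotate_iterate _ _).trans hdr) (fun e => ?_) h5 h6 h3
      -- otherwise the rotation would reach the top-edge earlier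
      refine hm2 (m - k) (by omega) ?_
      rw [← hm1]
      conv_rhs => rw [show m = (m - k) + k by omega, Function.iterate_add_apply, e]

/-- The map before the gluing is determined by the map after it. -/
theorem iso_of_fold {i j : ℕ} {dl dr : M.Dart}
    (h : M.Explored n t ((i, dl) :: left) ((j, dr) :: right) path) (hij : i < j)
    {ζ : M.Dart → N.Dart} (hz : IsZip M N t ζ) (hcol : ∀ y, N.color (ζ y) = M.recolor t .white y)
    {n' : ℕ} {t' : M'.Dart} {left' right' path' : List (ℕ × M'.Dart)} {i' j' : ℕ} {dl' dr' : M'.Dart}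
    (h' : M'.Explored n' t' ((i', dl') :: left') ((j', dr') :: right') path') (hij' : i' < j')
    {ζ' : M'.Dart → N'.Dart} (hz' : IsZip M' N' t' ζ')
    (hcol' : ∀ y, N'.color (ζ' y) = M'.recolor t' .white y) (e : Iso N N') : Nonempty (Iso M M') := by
  obtain ⟨p, hE, -⟩ := h.fold hij hz hcol
  obtain ⟨p', hE', -⟩ := h'.fold hij' hz' hcol'
  have ht : e.equiv (ζ dr) = ζ' dr' := hE'.iface.top_unique (e.isTop.2 hE.top) hE'.top
  have hc := e.isCut (h.isCut hij hz hcol)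
  rw [e.map_inv, ht] at hc
  refine hz.iso_of hz' e ?_ (hc.unique (h'.isCut hij' hz' hcol')) hcol hcol' h.top.2.1 h'.top.2.1
  rw [h.right_links.1, h'.right_links.1, ht]

end Explored

open Classical in
/-- The last step, read off the triangle of the top-edge `t`: an `a`-step (`b`-step) leaves a triangle with a left
(right) edge next to the top-edge. -/
noncomputable def lastStep (M : PercMap) (t : M.Dart) : Option Letter :=
  if M.Outer (M.inv t) then none
  else if M.Side (M.inv (M.next.symm (M.inv t))) then some .a
  else if M.Side (M.inv (M.next (M.inv t))) then some .b
  else some .c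

theorem Iso.side (e : Iso M N) {y : M.Dart} : N.Side (e.equiv y) ↔ M.Side y := by
  unfold Side
  rw [e.outer, ← e.map_root, e.equiv.apply_eq_iff_eq.ne]

theorem Iso.lastStep (e : Iso M N) (t : M.Dart) : N.lastStep (e.equiv t) = M.lastStep t := by
  have h1 : N.Outer (N.inv (e.equiv t)) ↔ M.Outer (M.inv t) := by rw [← e.map_inv, e.outer]
  have h2 : N.Side (N.inv (N.next.symm (N.inv (e.equiv t)))) ↔ M.Side (M.inv (M.next.symm (M.inv t))) := by
    rw [← e.map_inv, ← e.map_next_symm, ← e.map_inv, e.side]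
  have h3 : N.Side (N.inv (N.next (N.inv (e.equiv t)))) ↔ M.Side (M.inv (M.next (M.inv t))) := by
    rw [← e.map_inv, ← e.map_next, ← e.map_inv, e.side]
  unfold PercMap.lastStep
  rw [propext h1, propext h2, propext h3]

theorem Iso.third_color (e : Iso M N) (hR : N.RootInterface) {d : M.Dart} {d' : N.Dart} (hd : M.IsTop d)
    (hd' : N.IsTop d') : N.color (N.inv (N.next (N.inv d'))) = M.color (M.inv (M.next (M.inv d))) := by
  rw [← hR.top_unique (e.isTop.2 hd) hd', ← e.map_inv, ← e.map_next, ← e.map_inv, e.map_color]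

theorem lastStep_eq_none {t : M.Dart} : M.lastStep t = none ↔ M.Outer (M.inv t) := by
  unfold lastStep
  split_ifs <;> simp_all

theorem lastStep_eq_c {t : M.Dart} : M.lastStep t = some .c ↔ ¬ M.Outer (M.inv t) ∧
    ¬ M.Side (M.inv (M.next.symm (M.inv t))) ∧ ¬ M.Side (M.inv (M.next (M.inv t))) := by
  unfold lastStep
  split_ifs <;> simp_all

theorem mirror_side {y : M.Dart} : M.mirror.Side y ↔ M.Side y := and_congr mirror_outer Iff.rfl

theorem mirror_lastStep_eq_c {t : M.Dart} : M.mirror.lastStep t = some .c ↔ M.lastStep t = some .c := by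
  rw [lastStep_eq_c, lastStep_eq_c, mirror_side, mirror_side, mirror_outer]
  exact ⟨fun ⟨h1, h2, h3⟩ => ⟨h1, h3, h2⟩, fun ⟨h1, h2, h3⟩ => ⟨h1, h3, h2⟩⟩

namespace IsAttach

variable {t : M.Dart} {x : Color} {ι : M.Dart → N.Dart} {r l : N.Dart}

theorem lastStep_right (h : IsAttach M N t x ι r l) : N.lastStep r = some .a := by
  unfold lastStep
  have h1 : N.next.symm (N.inv r) = N.inv l := by rw [Equiv.symm_apply_eq, h.next_inv_left]
  rw [if_neg h.not_outer_inv_right, h1, N.inv_inv, if_pos]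
  exact ⟨h.outer_left, fun e => h.ne_left M.root (by rw [e, h.map_root])⟩

theorem lastStep_left (h : IsAttach M N t x ι r l) (hS : M.SimpleBoundary) : N.lastStep l = some .b := by
  unfold lastStep
  have h1 : N.next.symm (N.inv l) = ι t := by rw [Equiv.symm_apply_eq, h.next_top]
  rw [if_neg h.not_outer_inv_left, h1, h.next_inv_left, N.inv_inv, if_neg, if_pos]
  · exact ⟨h.outer_right, fun e => h.ne_right M.root (by rw [e, h.map_root])⟩
  · rw [h.map_inv, h.side_map]
    rintro ⟨⟨h2, h3⟩, -⟩
    rcases hS.eq_root h.outer_top h2 with h4 | h4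
    · exact h.root_ne h4
    · exact h3 h4.symm

end IsAttach

namespace Explored

variable {n : ℕ} {t : M.Dart} {left right path : List (ℕ × M.Dart)}

/-- After the top-edge and a left edge have been glued, the triangle of the top-edge has a white third
vertex, and none of its edges is a left or a right edge. -/
theorem lastStep_fold {i j : ℕ} {dl dr : M.Dart}
    (h : M.Explored n t ((i, dl) :: left) ((j, dr) :: right) path)
    {ζ : M.Dart → N.Dart} (hz : IsZip M N t ζ) (hcol : ∀ y, N.color (ζ y) = M.recolor t .white y) :
    N.lastStep (ζ dr) = some .c ∧ N.color (N.inv (N.next (N.inv (ζ dr)))) = .white := by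
  obtain ⟨hP, hT, hL, hS⟩ := h.tri
  have hnt : M.next t = dl := h.left_links.1
  have hor := h.right_inner (List.mem_cons_self ..)
  have hol := h.left_inner (List.mem_cons_self ..)
  have hgr := h.right_goes j dr (List.mem_cons_self ..)
  have hgl := h.left_goes i dl (List.mem_cons_self ..)
  have ho1 : ¬ M.Outer (M.next (M.inv dr)) := outer_next.not.2 hor
  have ho2 : ¬ M.Outer (M.next (M.next (M.inv dr))) := outer_next.not.2 ho1
  have h3 := hT.next3 hor
  have c1 : M.color (M.next (M.inv dr)) = .black := by rw [color_next, M.inv_inv, hgr.1]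
  have c2 : M.color (M.next (M.next (M.inv dr))) = .white := by
    obtain ⟨z, hz1, hz2⟩ := h.right_visited j dr (List.mem_cons_self ..)
    have g := goes_iff_next.1 (goes_inv.2 (h.goes_of_mem (List.mem_cons_of_mem _ hz1)))
    rcases hT.eq_of_face_eq hor hz2 with e | e | e
    · rw [e, c1] at g
      cases g.2
    · rw [e] at g
      exact g.2
    · rw [e, h3, hgr.2] at g
      cases g.2
  have n0 : N.next (ζ (M.inv dr)) = ζ (M.next (M.inv dr)) := hz.next_of_not_outer h.top.1 hor
  have n1 := hz.next_of_not_outer h.top.1 ho1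
  have n2 : N.next.symm (ζ (M.inv dr)) = ζ (M.next (M.next (M.inv dr))) := by
    rw [Equiv.symm_apply_eq, hz.next_of_not_outer h.top.1 ho2, h3]
  refine ⟨lastStep_eq_c.2 ⟨?_, ?_, ?_⟩, ?_⟩
  · rwa [hz.map_inv, hz.outer (hz.ne_of_not_outer h.top.1 hor)]
  · rw [hz.map_inv, n2, hz.map_inv]
    have g : M.Goes .black .white (M.inv (M.next (M.next (M.inv dr)))) := by
      rw [goes_inv, goes_iff_next, h3]
      exact ⟨c2, hgr.2⟩
    by_cases e1 : M.inv (M.next (M.next (M.inv dr))) = t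
    · rw [e1, hz.map_self, hnt, hz.side_map (hz.ne_of_not_outer h.top.1 hol)]
      exact fun hs => hol hs.1
    · rw [hz.side_map ⟨e1, fun e2 => ?_⟩]
      · exact fun hs => e1 (h.iface.top_unique ⟨hs.1, g⟩ h.top)
      · rw [e2, hnt] at g
        exact absurd (g.1.symm.trans hgl.1) (by decide)
  · rw [hz.map_inv, n0, hz.map_inv]
    have g : M.Goes .white .black (M.inv (M.next (M.inv dr))) := by
      rw [goes_inv, goes_iff_next]
      exact ⟨c1, c2⟩
    rw [hz.side_map ⟨fun e => ?_, fun e => ?_⟩]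
    · exact fun hs => hs.2 (h.iface.2 _ hs.1 g)
    · rw [e] at g
      exact absurd (g.1.symm.trans h.top.2.1) (by decide)
    · rw [e, hnt] at g
      exact absurd (g.2.symm.trans hgl.2) (by decide)
  · rw [← color_next, hz.map_inv, n0, n1, hcol, recolor, c2]
    simp

/-- The mirror image of `lastStep_fold`. -/
theorem lastStep_fold_black {i j : ℕ} {dl dr : M.Dart}
    (h : M.Explored n t ((i, dl) :: left) ((j, dr) :: right) path) (hij : j < i)
    {ζ : M.Dart → N.Dart} (hz : IsZip M N (M.next.symm t) ζ)
    (hcol : ∀ y, N.color (ζ y) = M.recolor (M.next t) .black y) :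
    N.lastStep (ζ dl) = some .c ∧ N.color (N.inv (N.next (N.inv (ζ dl)))) = .black := by
  obtain ⟨p, hE⟩ := h.fold_black hij hz hcol
  have hz' := hz.mirror
  rw [Equiv.apply_symm_apply] at hz'
  obtain ⟨h1, h2⟩ := (mirror_iff.2 h).lastStep_fold hz' (color_mirror_of_recolor hz.map_inv hcol)
  rw [mirror_lastStep_eq_c] at h1
  refine ⟨h1, ?_⟩
  rw [← color_next, ← hE.tri.2.1.next_symm (lastStep_eq_c.1 h1).1]
  simp only [mirror, N.inv_inv, Color.swap_eq_iff] at h2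
  exact h2

end Explored

end PercMap

open PercMap

/-! ### Injectivity -/

theorem exists_isAttach_a {w : List Letter} (hw : w ++ [.a] ∈ quadrantWalks) :
    ∃ t ι r l, (buildMap w).IsTop t ∧ IsAttach (buildMap w) (buildMap (w ++ [.a])) t .white ι r l := by
  obtain ⟨t, left, right, path, h⟩ := exists_tracks (quadrantWalks_of_concat hw)
  have ht : ∃ t, (build w).map.IsTop t := ⟨t, h.explored.top⟩
  rw [buildMap, buildMap, build_concat, State.step, dif_pos ht]
  refine ⟨_, _, _, _, ht.choose_spec, isAttach_attach _ ht.choose_spec.next_ne ht.choose_spec.1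
    (fun e => ?_) _⟩
  have h1 := h.explored.iface.1.1
  rw [e, ht.choose_spec.2.1] at h1
  cases h1

theorem exists_isAttach_b {w : List Letter} (hw : w ++ [.b] ∈ quadrantWalks) :
    ∃ t ι r l, (buildMap w).IsTop t ∧ IsAttach (buildMap w) (buildMap (w ++ [.b])) t .black ι r l := by
  obtain ⟨t, left, right, path, h⟩ := exists_tracks (quadrantWalks_of_concat hw)
  have ht : ∃ t, (build w).map.IsTop t := ⟨t, h.explored.top⟩
  rw [buildMap, buildMap, build_concat, State.step, dif_pos ht]
  refine ⟨_, _, _, _, ht.choose_spec, isAttach_attach _ ht.choose_spec.next_ne ht.choose_spec.1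
    (fun e => ?_) _⟩
  have h1 := h.explored.iface.1.1
  rw [e, ht.choose_spec.2.1] at h1
  cases h1

theorem exists_isZip {w : List Letter} (hw : w ++ [.c] ∈ quadrantWalks) :
    ∃ t i dl left j dr right path ζ,
      (buildMap w).Explored w.length t ((i, dl) :: left) ((j, dr) :: right) path ∧
      ((i < j ∧ IsZip (buildMap w) (buildMap (w ++ [.c])) t ζ ∧
          ∀ y, (buildMap (w ++ [.c])).color (ζ y) = (buildMap w).recolor t .white y) ∨
        (j < i ∧ IsZip (buildMap w) (buildMap (w ++ [.c])) ((buildMap w).next.symm t) ζ ∧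
          ∀ y, (buildMap (w ++ [.c])).color (ζ y) =
            (buildMap w).recolor ((buildMap w).next t) .black y)) := by
  obtain ⟨t, left, right, path, h⟩ := exists_tracks (quadrantWalks_of_concat hw)
  obtain ⟨⟨i, dl⟩, left, rfl⟩ := List.exists_cons_of_ne_nil (l := left) fun e =>
    openSteps_ne_nil (Or.inl rfl) hw (by rw [← h.left_steps, e]; rfl)
  obtain ⟨⟨j, dr⟩, right, rfl⟩ := List.exists_cons_of_ne_nil (l := right) fun e =>
    openSteps_ne_nil (Or.inr rfl) hw (by rw [← h.right_steps, e]; rfl)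
  have hij : i ≠ j := by
    rintro rfl
    have hi : (openSteps .a w)[0]? = some i := by
      rw [← h.left_steps]
      rfl
    have hj : (openSteps .b w)[0]? = some i := by
      rw [← h.right_steps]
      rfl
    have h1 := (openSteps_getElem? (by decide) w hi).1
    rw [(openSteps_getElem? (by decide) w hj).1] at h1
    cases h1
  have hE := h.explored
  have hf : ∃ t, (build w).map.CanFold t := ⟨t, h.canFold⟩
  have e : hf.choose = t := hE.iface.top_unique hf.choose_spec.top hE.top
  have hsy : (build w).map.next.symm t = dr := hE.right_links.1
  have key : ∀ S : State, S = (build w).fold hf.choose hf.choose_spec → ∃ ζ : (build w).map.Dart → S.map.Dart,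
      ((i < j ∧ IsZip (build w).map S.map t ζ ∧
          ∀ y, S.map.color (ζ y) = (build w).map.recolor t .white y) ∨
        (j < i ∧ IsZip (build w).map S.map ((build w).map.next.symm t) ζ ∧
          ∀ y, S.map.color (ζ y) = (build w).map.recolor ((build w).map.next t) .black y)) := by
    generalize_proofs hs
    revert hs
    rw [e]
    rintro hs S rfl
    rcases lt_or_gt_of_ne hij with hlt | hgt
    · have hlast : (build w).map.IsLastFace
          ((build w).map.face ((build w).map.inv ((build w).map.next.symm t))) := by
        rw [hsy]
        exact hE.isLastFace_right hlt
      rw [State.fold, if_pos hlast]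
      exact ⟨_, Or.inl ⟨hlt, isZip_zip _ hs.canZip_top _ (recolor_next_inv _ _ _) hs.ends_white,
        fun y => color_zip_zipDart _ hs.canZip_top _ (recolor_next_inv _ _ _) hs.ends_white y⟩⟩
    · have hlast : ¬ (build w).map.IsLastFace
          ((build w).map.face ((build w).map.inv ((build w).map.next.symm t))) := by
        rw [hsy]
        exact hE.not_isLastFace_right hgt
      rw [State.fold, if_neg hlast]
      exact ⟨_, Or.inr ⟨hgt, isZip_zip _ hs.canZip_right _ (recolor_next_inv _ _ _) hs.ends_black,
        fun y => color_zip_zipDart _ hs.canZip_right _ (recolor_next_inv _ _ _) hs.ends_black y⟩⟩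
  obtain ⟨ζ, hζ⟩ := key (build (w ++ [.c])) (by rw [build_concat, State.step, dif_pos hf])
  exact ⟨t, i, dl, left, j, dr, right, path, ζ, hE, hζ⟩

theorem lastStep_buildMap {w : List Letter} (hw : w ∈ quadrantWalks) {t : (buildMap w).Dart}
    (ht : (buildMap w).IsTop t) : (buildMap w).lastStep t = w.getLast? := by
  obtain ⟨t0, left0, right0, path0, h0⟩ := exists_tracks hw
  have hR : (buildMap w).RootInterface := h0.explored.iface
  rcases List.eq_nil_or_concat' w with rfl | ⟨w, x, rfl⟩
  · rw [List.getLast?_nil, lastStep_eq_none]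
    exact single_outer _
  · rw [List.getLast?_concat]
    obtain ⟨t1, left1, right1, path1, h1⟩ := exists_tracks (quadrantWalks_of_concat hw)
    cases x with
    | a =>
      obtain ⟨t', ι, r, l, h2, h3⟩ := exists_isAttach_a hw
      rw [hR.top_unique ht ⟨h3.outer_right, h3.goes_right h2⟩]
      exact h3.lastStep_right
    | b =>
      obtain ⟨t', ι, r, l, h2, h3⟩ := exists_isAttach_b hw
      rw [hR.top_unique ht ⟨h3.outer_left, h3.goes_left h2⟩]
      exact h3.lastStep_left h1.explored.tri.2.2.2
    | c =>
      obtain ⟨t', i, dl, left, j, dr, right, path, ζ, h2, ⟨h3, h4, h5⟩ | ⟨h3, h4, h5⟩⟩ := exists_isZip hw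
      · obtain ⟨p, h6, -⟩ := h2.fold h3 h4 h5
        rw [hR.top_unique ht h6.top]
        exact (h2.lastStep_fold h4 h5).1
      · obtain ⟨p, h6⟩ := h2.fold_black h3 h4 h5
        rw [hR.top_unique ht h6.top]
        exact (h2.lastStep_fold_black h3 h4 h5).1

/-- An isomorphism between the maps after a step yields an isomorphism between the maps before it. -/
theorem iso_of_iso_concat {w w' : List Letter} {x : Letter} (hw : w ++ [x] ∈ quadrantWalks)
    (hw' : w' ++ [x] ∈ quadrantWalks) (e : Iso (buildMap (w ++ [x])) (buildMap (w' ++ [x]))) :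
    Nonempty (Iso (buildMap w) (buildMap w')) := by
  obtain ⟨t0, left0, right0, path0, h0⟩ := exists_tracks hw'
  have hR : (buildMap (w' ++ [x])).RootInterface := h0.explored.iface
  cases x with
  | a =>
    obtain ⟨t, ι, r, l, h1, h2⟩ := exists_isAttach_a hw
    obtain ⟨t', ι', r', l', h1', h2'⟩ := exists_isAttach_a hw'
    exact h2.iso_of h2' e (hR.top_unique (e.isTop.2 ⟨h2.outer_right, h2.goes_right h1⟩)
      ⟨h2'.outer_right, h2'.goes_right h1'⟩)
  | b =>
    obtain ⟨t, ι, r, l, h1, h2⟩ := exists_isAttach_b hw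
    obtain ⟨t', ι', r', l', h1', h2'⟩ := exists_isAttach_b hw'
    obtain ⟨f⟩ := h2.mirror.iso_of h2'.mirror e.mirror
      (hR.top_unique (e.isTop.2 ⟨h2.outer_left, h2.goes_left h1⟩) ⟨h2'.outer_left, h2'.goes_left h1'⟩)
    have := f.mirror
    rw [mirror_mirror, mirror_mirror] at this
    exact ⟨this⟩
  | c =>
    obtain ⟨t, i, dl, left, j, dr, right, path, ζ, h1, hz⟩ := exists_isZip hw
    obtain ⟨t', i', dl', left', j', dr', right', path', ζ', h1', hz'⟩ := exists_isZip hw'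
    rcases hz with ⟨h2, h3, h4⟩ | ⟨h2, h3, h4⟩ <;> rcases hz' with ⟨h2', h3', h4'⟩ | ⟨h2', h3', h4'⟩
    · exact h1.iso_of_fold h2 h3 h4 h1' h2' h3' h4' e
    · obtain ⟨p, h5, -⟩ := h1.fold h2 h3 h4
      obtain ⟨p', h5'⟩ := h1'.fold_black h2' h3' h4'
      have h6 := e.third_color hR h5.top h5'.top
      rw [(h1.lastStep_fold h3 h4).2, (h1'.lastStep_fold_black h2' h3' h4').2] at h6
      cases h6
    · obtain ⟨p, h5⟩ := h1.fold_black h2 h3 h4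
      obtain ⟨p', h5', -⟩ := h1'.fold h2' h3' h4'
      have h6 := e.third_color hR h5.top h5'.top
      rw [(h1.lastStep_fold_black h2 h3 h4).2, (h1'.lastStep_fold h3' h4').2] at h6
      cases h6
    · have hz := h3.mirror
      have hz' := h3'.mirror
      rw [Equiv.apply_symm_apply] at hz hz'
      obtain ⟨f⟩ := (Explored.mirror_iff.2 h1).iso_of_fold h2 hz
        (Explored.color_mirror_of_recolor h3.map_inv h4)
        (Explored.mirror_iff.2 h1') h2' hz' (Explored.color_mirror_of_recolor h3'.map_inv h4') e.mirror
      have := f.mirror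
      rw [mirror_mirror, mirror_mirror] at this
      exact ⟨this⟩

/-- The map determines the walk. -/
theorem eq_of_iso {w w' : List Letter} (hw : w ∈ quadrantWalks) (hw' : w' ∈ quadrantWalks)
    (e : Iso (buildMap w) (buildMap w')) : w = w' := by
  have hlast : ∀ {w w'}, w ∈ quadrantWalks → w' ∈ quadrantWalks → Iso (buildMap w) (buildMap w') →
      w.getLast? = w'.getLast? := by
    intro w w' hw hw' e
    obtain ⟨t, left, right, path, h⟩ := exists_tracks hw
    obtain ⟨t, ht⟩ : ∃ t, (buildMap w).IsTop t := ⟨t, h.explored.top⟩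
    rw [← lastStep_buildMap hw ht, ← lastStep_buildMap hw' (e.isTop.2 ht), e.lastStep]
  induction w using List.reverseRecOn generalizing w' with
  | nil =>
    have := hlast hw hw' e
    rw [List.getLast?_nil] at this
    exact (List.getLast?_eq_none_iff.1 this.symm).symm
  | append_singleton w x ih =>
    have h1 := hlast hw hw' e
    rcases List.eq_nil_or_concat' w' with rfl | ⟨w', x', rfl⟩
    · simp at h1
    · rw [List.getLast?_concat, List.getLast?_concat, Option.some_inj] at h1
      subst h1
      obtain ⟨f⟩ := iso_of_iso_concat hw hw' e
      rw [ih (quadrantWalks_of_concat hw) (quadrantWalks_of_concat hw') f]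

namespace PercMap

variable {M N : PercMap}

/-! ### Removing a triangle -/

namespace IsAttach

variable {t : M.Dart} {x : Color} {ι : M.Dart → N.Dart} {r l : N.Dart}

/-- Only the last edge of the percolation path is lost when the triangle is removed. -/
theorem onPath_of (h : IsAttach M N t x ι r l) (ht : M.IsTop t) {z : N.Dart} (hz : N.OnPath z) :
    z = N.inv r ∨ z = N.inv l ∨ ∃ y, ι y = z ∧ M.OnPath y := by
  induction hz with
  | refl => exact Or.inr (Or.inr ⟨M.root, h.map_root.symm, Relation.ReflTransGen.refl⟩)
  | @tail z z' hz1 hs ih =>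
    rcases ih with rfl | rfl | ⟨y, rfl, hy⟩
    · exact absurd (by rw [N.inv_inv]; exact h.outer_right) hs.1
    · exact absurd (by rw [N.inv_inv]; exact h.outer_left) hs.1
    · have hzo : ¬ N.Outer z' := fun ho => hs.1 (outer_of_face_eq hs.2.1 ho)
      rcases h.cover z' with ⟨y', rfl⟩ | rfl | rfl | rfl | rfl
      · right
        right
        refine ⟨y', rfl, hy.tail ?_⟩
        have hg := h.goes_map.1 hs.2.2
        have hy' : y' ≠ t := by
          rintro rfl
          exact absurd (hg.1.symm.trans ht.2.1) (by decide)
        have hyt : M.inv y ≠ t := by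
          intro e
          have := hs.2.1
          rw [h.map_inv, e] at this
          exact h.face_ne hy' this
        have h1 := hs.1
        have h2 := hs.2.1
        rw [h.map_inv] at h1 h2
        rw [h.outer_map hyt] at h1
        rw [h.face_eq hy' hyt] at h2
        exact ⟨h1, h2, hg⟩
      · exact absurd h.outer_right hzo
      · exact absurd h.outer_left hzo
      · exact Or.inl rfl
      · exact Or.inr (Or.inl rfl)

theorem isTP_of (h : IsAttach M N t x ι r l) (ht : M.IsTop t) (hN : N.IsTP) : M.IsTP := by
  obtain ⟨⟨hP, hT, hL, hS⟩, hR, hV⟩ := hN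
  have hT' := h.nearTriangulation_iff.2 hT
  have hR' := (h.rootInterface_iff ht).2 hR
  have hS' := h.simpleBoundary_iff.2 hS
  refine ⟨⟨h.planar_iff.2 hP, hT', h.loopless_iff.2 hL, hS'⟩, hR', visitsBoundary_of hT' hR' fun d hd => ?_⟩
  have hdo : M.Outer d := hd.elim (fun h1 => h1.1) (fun h1 => h1.1)
  have hdc : M.color d = M.color (M.inv d) :=
    hd.elim (fun h1 => h1.2.1.trans h1.2.2.symm) (fun h1 => h1.2.1.trans h1.2.2.symm)
  have htc : M.color t ≠ M.color (M.inv t) := by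
    rw [ht.2.1, ht.2.2]
    decide
  have hdt : d ≠ t := by
    rintro rfl
    exact htc hdc
  have hdi : M.inv d ≠ t := by
    rintro rfl
    rw [M.inv_inv] at htc
    exact htc hdc.symm
  have ho := hS'.not_outer_inv hR' hdo hdc
  obtain ⟨z, h1, h2, h3⟩ := hV (ι d) ((h.outer_map hdt).2 hdo) (by rwa [h.map_inv, h.outer_map hdi])
  have ho' : ¬ N.Outer (N.inv z) := fun h4 => h2 (h3.symm.trans h4)
  rcases h.onPath_of ht h1 with rfl | rfl | ⟨y, rfl, hy⟩
  · exact absurd (by rw [N.inv_inv]; exact h.outer_right) ho'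
  · exact absurd (by rw [N.inv_inv]; exact h.outer_left) ho'
  · rw [h.map_inv, h.map_inv] at h3
    refine ⟨y, hy, (h.face_eq (fun e => ?_) hdi).1 h3⟩
    rw [e] at h3
    exact h.face_ne hdi h3.symm

end IsAttach

/-- The darts that remain when the edges of `r` and `l` are removed. -/
abbrev RemainDart (N : PercMap) (r l : N.Dart) : Type :=
  {y : N.Dart // y ≠ r ∧ y ≠ l ∧ y ≠ N.inv r ∧ y ≠ N.inv l}

/-- A triangle two consecutive edges of which are outer edges can be removed.  The hypotheses that are
inequalities exclude degenerate faces. -/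
theorem exists_isAttach {r l : N.Dart} (ho : N.Outer r) (h1 : N.next r = l) (h2 : N.next (N.inv l) = N.inv r)
    (hr : ¬ N.Outer (N.inv r)) (h3 : N.next (N.next (N.inv r)) = N.inv l) (hn : N.next l ≠ r)
    (hne : r ≠ l) (hrr : N.root ≠ r) (hrl : N.root ≠ l) (h4 : N.next (N.inv r) ≠ N.inv r)
    (h5 : N.next (N.inv l) ≠ N.inv l) (h6 : N.inv l ≠ N.next (N.inv r)) :
    ∃ (M : PercMap) (t : M.Dart) (ι : M.Dart → N.Dart),
      ι t = N.next (N.inv r) ∧ IsAttach M N t (N.color l) ι r l := by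
  classical
  have hol : N.Outer l := by rwa [← h1, outer_next]
  have hi := N.inv_inv
  have hi2 := N.inv_ne
  have key : ∀ a b : N.Dart, N.next a = N.next b → a = b := fun _ _ h => N.next.injective h
  have ho1 : ¬ N.Outer (N.next (N.inv r)) := outer_next.not.2 hr
  have hil : ¬ N.Outer (N.inv l) := by
    rw [← h3, outer_next]
    exact ho1
  have n1 : N.next (N.inv r) ≠ r := fun e => ho1 (by rw [e]; exact ho)
  have n2 : N.next (N.inv r) ≠ l := fun e => ho1 (by rw [e]; exact hol)
  have n3 : r ≠ N.inv l := fun e => hil (e ▸ ho)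
  have n4 : r ≠ N.inv r := fun e => hr (e ▸ ho)
  have n5 : l ≠ N.inv r := fun e => hr (e ▸ hol)
  have n6 : l ≠ N.inv l := fun e => hil (e ▸ hol)
  obtain ⟨s, hs⟩ : ∃ s, s = N.next (N.inv r) := ⟨_, rfl⟩
  rw [← hs] at h3 h4 h6 ho1 n1 n2 ⊢
  have hroot : N.root ≠ N.inv r ∧ N.root ≠ N.inv l :=
    ⟨fun e => hr (e ▸ outer_root), fun e => hil (e ▸ outer_root)⟩
  have hs' : N.root ≠ s := fun e => ho1 (e ▸ outer_root)
  let D := RemainDart N r l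
  let nx : D → D := fun y =>
    if h : y.1 = s then ⟨N.next l, hn, by grind, by grind, by grind⟩
    else if h' : N.next y.1 = r then ⟨s, n1, n2, h4, fun e => h6 e.symm⟩
    else ⟨N.next y.1, h', by grind, by grind, by grind⟩
  have nx_val : ∀ y : D, (nx y).1 = if y.1 = s then N.next l else if N.next y.1 = r then s else N.next y.1 := by
    intro y
    simp only [nx]
    split_ifs <;> rfl
  clear_value nx
  have nx_inj : Function.Injective nx := by
    rintro ⟨y, hy⟩ ⟨z, hz⟩ e
    have e' := congrArg Subtype.val e
    rw [nx_val, nx_val] at e'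
    clear e
    apply Subtype.ext
    simp only at e' ⊢
    grind
  let iv : D → D := fun y => ⟨N.inv y.1, by have := y.2; grind, by have := y.2; grind, by have := y.2; grind,
    by have := y.2; grind⟩
  have iv_iv : ∀ y, iv (iv y) = y := fun y => Subtype.ext (N.inv_inv _)
  let M : PercMap :=
    { Dart := D
      finite_dart := inferInstance
      inv := Function.Involutive.toPerm iv iv_iv
      inv_inv := iv_iv
      inv_ne := fun y e => N.inv_ne y.1 (congrArg Subtype.val e)
      next := Equiv.ofBijective nx (Finite.injective_iff_bijective.1 nx_inj)
      root := ⟨N.root, hrr, hrl, hroot.1, hroot.2⟩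
      color := fun y => N.color y.1
      color_next_inv := by
        intro y
        change N.color (nx (iv y)).1 = N.color y.1
        rw [nx_val]
        change N.color (if N.inv y.1 = s then _ else _) = _
        split_ifs with h h'
        · exact (color_next l).trans ((congrArg N.color h3).symm.trans ((color_next s).trans
            (congrArg N.color (inv_eq_iff.1 h).symm)))
        · change N.next (N.inv y.1) = r at h'
          exact (congrArg N.color hs).trans ((N.color_next_inv r).trans
            ((congrArg N.color h').symm.trans (N.color_next_inv _)))
        · exact N.color_next_inv _ }
  have hnx : ∀ y : M.Dart, (M.next y).1 = if y.1 = s then N.next l else if N.next y.1 = r then s else N.next y.1 :=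
    nx_val
  have hnx1 : ∀ y : M.Dart, y.1 ≠ s → N.next y.1 ≠ r → (M.next y).1 = N.next y.1 := fun y h h' => by
    rw [hnx, if_neg h, if_neg h']
  have hsD : s ≠ r ∧ s ≠ l ∧ s ≠ N.inv r ∧ s ≠ N.inv l := ⟨n1, n2, h4, fun e => h6 e.symm⟩
  let t : M.Dart := (⟨s, hsD⟩ : D)
  have htn : (M.next t).1 = N.next l := by rw [hnx, if_pos rfl]
  refine ⟨M, t, fun y => y.1, rfl, ?_⟩
  -- the faces of `N`, the removed triangle being merged with the root-face
  have hout : M.Outer t := by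
    let f : N.Dart → M.Face := fun y =>
      if h : y ≠ r ∧ y ≠ l ∧ y ≠ N.inv r ∧ y ≠ N.inv l then M.face (⟨y, h⟩ : D) else M.face t
    have fD : ∀ y : M.Dart, f y.1 = M.face y := fun y => dif_pos y.2
    have fr : f r = M.face t := dif_neg (by simp)
    have fl : f l = M.face t := dif_neg (by simp)
    have fir : f (N.inv r) = M.face t := dif_neg (by simp)
    have fil : f (N.inv l) = M.face t := dif_neg (by simp)
    have hf : ∀ y, f (N.next y) = f y := by
      intro y
      by_cases hy : y ≠ r ∧ y ≠ l ∧ y ≠ N.inv r ∧ y ≠ N.inv l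
      · have e0 := fD (⟨y, hy⟩ : D)
        change f y = _ at e0
        by_cases e1 : y = s
        · rw [e1, h3, fil]
          exact (fD t).symm
        · by_cases e2 : N.next y = r
          · have : M.next (⟨y, hy⟩ : D) = t := Subtype.ext (by rw [hnx, if_neg e1, if_pos e2])
            rw [e2, fr, e0, ← this, face_next]
          · have := fD (M.next (⟨y, hy⟩ : D))
            rw [hnx1 _ e1 e2, face_next] at this
            rw [e0]
            exact this
      · have e1 : y = r ∨ y = l ∨ y = N.inv r ∨ y = N.inv l := by tauto
        rcases e1 with rfl | rfl | rfl | rfl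
        · rw [h1, fl, fr]
        · rw [fl, ← htn, fD, face_next]
        · rw [← hs, fir]
          exact fD t
        · rw [h2, fir, fil]
    have := apply_eq_of_face_eq f hf (show N.face r = N.face N.root from ho)
    rw [fr] at this
    exact this.trans (fD M.root)
  refine
    { ne := fun e => ?_
      outer_top := hout
      root_ne := fun e => hs' (congrArg Subtype.val e)
      inj := Subtype.val_injective
      cover := fun y => ?_
      ne_right := fun z => z.2.1
      ne_left := fun z => z.2.2.1
      right_ne_left := hne
      right_ne_inv_left := n3
      map_inv := fun _ => rfl
      next_top := h3
      next_inv_left := h2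
      next_inv_right := hs.symm
      next_right := h1
      next_left := htn.symm
      next_prev := fun z hz => ?_
      next_of_ne := fun z hz hz' => ?_
      map_root := rfl
      color_map := fun _ => rfl
      color_left := rfl }
  · have := congrArg Subtype.val e
    rw [htn] at this
    change N.next l = s at this
    rw [hs] at this
    exact n5 (key _ _ this)
  · by_cases hy : y ≠ r ∧ y ≠ l ∧ y ≠ N.inv r ∧ y ≠ N.inv l
    · exact Or.inl ⟨(⟨y, hy⟩ : D), rfl⟩
    · tauto
  · have h7 := congrArg Subtype.val hz
    rw [hnx] at h7
    change _ = s at h7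
    have h8 := z.2
    grind
  · have e1 : z.1 ≠ s := fun e => hz (Subtype.ext e)
    refine (hnx1 z e1 fun e2 => hz' (Subtype.ext ?_)).symm
    rw [hnx, if_neg e1, if_pos e2]

/-! ### Cutting along an edge -/

/-- The vertex at the white end of the top-edge `t` of `N` is going to be split in two, by cutting `N` along the
inner edge of the dart `c`, whose origin is this vertex: the set `B` consists of the darts with this
origin between the top-edge and `c`, that edge included and `c` excluded. -/
structure Cut (N : PercMap) (t c : N.Dart) (B : Set N.Dart) : Prop where
  top : N.IsTop t
  inner : ¬ N.Outer (N.inv t)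
  mem_top : N.inv t ∈ B
  not_mem : c ∉ B
  next_inv_mem : ∀ y, N.next (N.inv y) ∈ B ↔ (y ∈ B ∧ y ≠ N.inv t) ∨ y = c
  not_outer : ∀ y ∈ B, ¬ N.Outer y
  origin_mem : ∀ y ∈ B, N.origin y = N.origin (N.inv t)
  not_visited : ∀ y ∈ B, y ≠ N.inv t → ¬ N.Visited y
  visited : N.Visited c
  origin_cut : N.origin c = N.origin (N.inv t)
  inv_not_outer : ¬ N.Outer (N.inv c)
  color_inv : N.color (N.inv c) = .white
  inv_not_outerVertex : ¬ N.OuterVertex (N.inv c)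

/-- The map `M` is obtained by cutting `N` along the edge of `c`.  The darts of `N` are embedded into `M` by
`ι`, and the two new darts, on the root-face, are `D`, which runs along `c`, and `D'`, which runs
along `inv c`.  The part of the vertex that carries the darts of `B` becomes black. -/
structure IsUnzip (M N : PercMap) (t c : N.Dart) (B : Set N.Dart) (ι : N.Dart → M.Dart) (D D' : M.Dart) :
    Prop where
  inj : Function.Injective ι
  cover : ∀ y, (∃ z, ι z = y) ∨ y = D ∨ y = D'
  ne_fst : ∀ z, ι z ≠ D
  ne_snd : ∀ z, ι z ≠ D'
  fst_ne_snd : D ≠ D'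
  inv_fst : M.inv D = ι (N.inv c)
  inv_snd : M.inv D' = ι c
  map_inv : ∀ y, y ≠ c → y ≠ N.inv c → M.inv (ι y) = ι (N.inv y)
  next_top : M.next (ι t) = D
  next_fst : M.next D = D'
  next_snd : M.next D' = ι (N.next t)
  map_next : ∀ y, y ≠ t → M.next (ι y) = ι (N.next y)
  map_root : M.root = ι N.root
  color_fst : M.color D = .black
  color_snd : M.color D' = .white
  color_mem : ∀ y ∈ B, M.color (ι y) = .black
  color_not_mem : ∀ y, y ∉ B → M.color (ι y) = N.color y

namespace Cut

variable {t c : N.Dart} {B : Set N.Dart}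

theorem color_cut (h : Cut N t c B) : N.color c = .white :=
  (color_eq_of_origin_eq h.origin_cut).trans h.top.2.2

theorem ne_top (h : Cut N t c B) : c ≠ t := by
  rintro rfl
  exact h.visited.1 h.top.1

theorem inv_ne_top (h : Cut N t c B) : N.inv c ≠ t := fun e => h.inv_not_outer (by rw [e]; exact h.top.1)

theorem inv_not_mem (h : Cut N t c B) : N.inv c ∉ B := fun hc => by
  obtain ⟨d, h1, h2⟩ : N.OuterVertex (N.inv t) := h.top.1.outerVertex_inv
  exact h.inv_not_outerVertex ⟨d, h1, h2.trans (h.origin_mem _ hc).symm⟩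

theorem outer_eq (h : Cut N t c B) (hS : N.SimpleBoundary) {y : N.Dart} (hy : N.Outer y)
    (he : N.origin y = N.origin (N.inv t)) : y = N.next t :=
  hS _ _ hy (outer_next.2 h.top.1) (he.trans (origin_next t).symm)

/-- The cut can be carried out. -/
theorem exists_isUnzip (h : Cut N t c B) : ∃ (M : PercMap) (ι : N.Dart → M.Dart) (D D' : M.Dart),
    IsUnzip M N t c B ι D D' := by
  classical
  have hi := N.inv_inv
  have hi2 := N.inv_ne
  have key : ∀ a b : N.Dart, N.next a = N.next b → a = b := fun _ _ h => N.next.injective h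
  let iv : N.Dart ⊕ Bool → N.Dart ⊕ Bool := fun y => match y with
    | .inl y => if y = c then .inr true else if y = N.inv c then .inr false else .inl (N.inv y)
    | .inr false => .inl (N.inv c)
    | .inr true => .inl c
  let nx : N.Dart ⊕ Bool → N.Dart ⊕ Bool := fun y => match y with
    | .inl y => if y = t then .inr false else .inl (N.next y)
    | .inr false => .inr true
    | .inr true => .inl (N.next t)
  let col : N.Dart ⊕ Bool → Color := fun y => match y with
    | .inl y => if y ∈ B then .black else N.color y
    | .inr false => .black
    | .inr true => .white
  have iv0 : ∀ y, iv (.inl y) = if y = c then .inr true else if y = N.inv c then .inr false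
      else .inl (N.inv y) := fun _ => rfl
  have iv1 : iv (.inr false) = .inl (N.inv c) := rfl
  have iv2 : iv (.inr true) = .inl c := rfl
  have nx0 : ∀ y, nx (.inl y) = if y = t then .inr false else .inl (N.next y) := fun _ => rfl
  have nx1 : nx (.inr false) = .inr true := rfl
  have nx2 : nx (.inr true) = .inl (N.next t) := rfl
  have col0 : ∀ y, col (.inl y) = if y ∈ B then .black else N.color y := fun _ => rfl
  have col1 : col (.inr false) = .black := rfl
  have col2 : col (.inr true) = .white := rfl
  clear_value iv nx col
  have iv_iv : ∀ y, iv (iv y) = y := by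
    rintro (y | (_ | _))
    · rw [iv0]
      split_ifs with e1 e2
      · rw [iv2, e1]
      · rw [iv1, e2]
      · rw [iv0, if_neg fun e => e2 (inv_eq_iff.1 e), if_neg fun e => e1 (N.inv.injective e), hi]
    · rw [iv1, iv0, if_neg (hi2 c), if_pos rfl]
    · rw [iv2, iv0, if_pos rfl]
  have iv_ne : ∀ y, iv y ≠ y := by
    rintro (y | (_ | _))
    · rw [iv0]
      split_ifs with e1 e2
      · simp
      · simp
      · exact fun e => hi2 y (Sum.inl_injective e)
    · rw [iv1]
      simp
    · rw [iv2]
      simp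
  have nx_inj : Function.Injective nx := by
    rintro (y | (_ | _)) (z | (_ | _)) e
    · rw [nx0, nx0] at e
      split_ifs at e with e1 e2 e2
      · rw [e1, e2]
      · exact congrArg _ (key _ _ (Sum.inl_injective e))
    · rw [nx0, nx1] at e
      split_ifs at e
      simp at e
    · rw [nx0, nx2] at e
      split_ifs at e with e1
      exact absurd (key _ _ (Sum.inl_injective e)) e1
    · rw [nx0, nx1] at e
      split_ifs at e
      simp at e
    · rfl
    · rw [nx1, nx2] at e
      cases e
    · rw [nx0, nx2] at e
      split_ifs at e with e1
      exact absurd (key _ _ (Sum.inl_injective e)).symm e1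
    · rw [nx1, nx2] at e
      cases e
    · rfl
  have col_nx : ∀ y, col (nx (iv y)) = col y := by
    rintro (y | (_ | _))
    · rw [iv0]
      split_ifs with e1 e2
      · have h1 : N.next t ∉ B := by
          have h2 := h.next_inv_mem (N.inv t)
          rw [hi] at h2
          rw [h2]
          rintro (h3 | h3)
          · exact h3.2 rfl
          · exact h.not_mem (h3 ▸ h.mem_top)
        rw [nx2, col0, col0, if_neg h1, e1, if_neg h.not_mem, color_next, h.top.2.2, h.color_cut]
      · rw [nx1, col0, col2, e2, if_neg h.inv_not_mem, h.color_inv]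
      · rw [nx0, col0]
        split_ifs with e3 e4 e4
        · exact col1
        · exact absurd (by rw [inv_eq_iff.1 e3]; exact h.mem_top) e4
        · rw [col0, if_pos ((h.next_inv_mem y).2 (Or.inl ⟨e4, fun e => e3 (by rw [e, hi])⟩))]
        · rw [col0, if_neg, N.color_next_inv]
          rw [h.next_inv_mem]
          tauto
    · rw [iv1, nx0, if_neg h.inv_ne_top, col0, if_pos ((h.next_inv_mem c).2 (Or.inr rfl)), col1]
    · have h1 : N.next c ∉ B := by
        have h2 := h.next_inv_mem (N.inv c)
        rw [hi] at h2
        rw [h2]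
        rintro (h3 | h3)
        · exact h.inv_not_mem h3.1
        · exact hi2 c h3
      rw [iv2, nx0, if_neg h.ne_top, col0, if_neg h1, col2, color_next, h.color_inv]
  refine ⟨⟨N.Dart ⊕ Bool, inferInstance, Function.Involutive.toPerm iv iv_iv, iv_iv, iv_ne,
    Equiv.ofBijective nx (Finite.injective_iff_bijective.1 nx_inj), .inl N.root, col, col_nx⟩,
    Sum.inl, .inr false, .inr true, ?_⟩
  refine
    { inj := Sum.inl_injective
      cover := ?_
      ne_fst := fun _ => Sum.inl_ne_inr
      ne_snd := fun _ => Sum.inl_ne_inr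
      fst_ne_snd := by simp
      inv_fst := iv1
      inv_snd := iv2
      map_inv := fun y h1 h2 => (iv0 y).trans (by rw [if_neg h1, if_neg h2])
      next_top := (nx0 t).trans (if_pos rfl)
      next_fst := nx1
      next_snd := nx2
      map_next := fun y h1 => (nx0 y).trans (if_neg h1)
      map_root := rfl
      color_fst := col1
      color_snd := col2
      color_mem := fun y hy => (col0 y).trans (if_pos hy)
      color_not_mem := fun y hy => (col0 y).trans (if_neg hy) }
  rintro (y | (_ | _))
  · exact Or.inl ⟨y, rfl⟩
  · exact Or.inr (Or.inl rfl)
  · exact Or.inr (Or.inr rfl)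

end Cut

namespace IsUnzip

variable {t c : N.Dart} {B : Set N.Dart} {ι : N.Dart → M.Dart} {D D' : M.Dart}

/-- Gluing the edges of `D` and `D'` gives the map `N` back. -/
theorem exists_zip (h : IsUnzip M N t c B ι D D') (hc : Cut N t c B) :
    ∃ ζ : M.Dart → N.Dart, (∀ y, ζ (ι y) = y) ∧ ζ D = c ∧ ζ D' = N.inv c ∧ IsZip M N D ζ := by
  classical
  have hi := N.inv_inv
  let ζ : M.Dart → N.Dart := fun y => if y = D then c else if y = D' then N.inv c else
    if hy : ∃ z, ι z = y then hy.choose else c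
  have ζ1 : ζ D = c := if_pos rfl
  have ζ2 : ζ D' = N.inv c := (if_neg h.fst_ne_snd.symm).trans (if_pos rfl)
  have ζ0 : ∀ y, ζ (ι y) = y := by
    intro y
    have hy : ∃ z, ι z = ι y := ⟨y, rfl⟩
    simp only [ζ]
    rw [if_neg (h.ne_fst y), if_neg (h.ne_snd y), dif_pos hy]
    exact h.inj hy.choose_spec
  clear_value ζ
  have hcov : ∀ y, y ≠ D ∧ y ≠ D' → ∃ z, ι z = y := fun y hy => by
    rcases h.cover y with h1 | h1 | h1
    · exact h1
    · exact absurd h1 hy.1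
    · exact absurd h1 hy.2
  refine ⟨ζ, ζ0, ζ1, ζ2, ?_⟩
  refine
    { can :=
        { next_ne := by rw [h.next_fst]; exact h.fst_ne_snd.symm
          next_next_ne := by rw [h.next_fst, h.next_snd]; exact h.ne_fst _
          inv_ne_next := by rw [h.inv_fst, h.next_fst]; exact h.ne_snd _
          root_ne := by rw [h.map_root]; exact h.ne_fst _
          root_ne_next := by rw [h.map_root, h.next_fst]; exact h.ne_snd _ }
      surj := fun x => ⟨ι x, ⟨h.ne_fst x, by rw [h.next_fst]; exact h.ne_snd x⟩, ζ0 x⟩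
      inj := ?_
      map_self := by rw [h.next_fst, h.inv_snd, ζ0, ζ1]
      map_next_self := by rw [h.next_fst, h.inv_fst, ζ0, ζ2]
      map_inv := ?_
      next_of_ne := ?_
      next_of_eq := ?_
      map_root := by rw [h.map_root, ζ0] }
  · rw [h.next_fst]
    intro y z hy hz e
    obtain ⟨y, rfl⟩ := hcov y hy
    obtain ⟨z, rfl⟩ := hcov z hz
    rw [ζ0, ζ0] at e
    rw [e]
  · intro y
    rcases h.cover y with ⟨z, rfl⟩ | rfl | rfl
    · by_cases h1 : z = c
      · rw [ζ0, h1, ← h.inv_snd, M.inv_inv, ζ2]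
      · by_cases h2 : z = N.inv c
        · rw [ζ0, h2, ← h.inv_fst, M.inv_inv, ζ1, hi]
        · rw [h.map_inv z h1 h2, ζ0, ζ0]
    · rw [h.inv_fst, ζ0, ζ1]
    · rw [h.inv_snd, ζ0, ζ2, hi]
  · rw [h.next_fst]
    intro y hy hy'
    obtain ⟨z, rfl⟩ := hcov y hy
    have hz : z ≠ t := by
      rintro rfl
      exact hy' h.next_top
    rw [h.map_next z hz, ζ0, ζ0]
  · intro y hy
    rw [← h.next_top] at hy
    rw [M.next.injective hy, ζ0, h.next_fst, h.next_snd, ζ0]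

/-- The map that results from cutting belongs to `T_P`, the mapping `φ_c` is defined there, and the triangle
of the uppermost right edge is the last one on the percolation path that touches a left or right edge. -/
theorem isTP_canFold (h : IsUnzip M N t c B ι D D') (hc : Cut N t c B) (hN : N.IsTP) :
    M.IsTP ∧ M.CanFold D ∧ M.IsLastFace (M.face (M.inv (M.next.symm D))) ∧
      ∃ ζ, IsZip M N D ζ ∧ ∀ y, N.color (ζ y) = M.recolor D .white y := by
  obtain ⟨ζ, ζ0, ζ1, ζ2, hz⟩ := h.exists_zip hc
  obtain ⟨⟨hP, hT, hL, hS⟩, hR, hV⟩ := hN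
  have hne : M.origin D ≠ M.origin (M.inv (M.next D)) := by
    intro e
    have := color_eq_of_origin_eq e
    rw [h.next_fst, h.inv_snd, h.color_not_mem c hc.not_mem, h.color_fst, hc.color_cut] at this
    cases this
  have hι : ∀ y, ι y ≠ D ∧ ι y ≠ M.next D := fun y => ⟨h.ne_fst y, by rw [h.next_fst]; exact h.ne_snd y⟩
  have houter : ∀ {y}, M.Outer (ι y) ↔ N.Outer y := fun {y} => by
    rw [← hz.outer (hι y), ζ0]
  have hface : ∀ {y z}, M.face (ι y) = M.face (ι z) ↔ N.face y = N.face z := fun {y z} => by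
    rw [← hz.face_eq (hι y) (hι z), ζ0, ζ0]
  have hoD' : M.Outer D' := by
    rw [← outer_next, h.next_snd, houter, outer_next]
    exact hc.top.1
  have hoD : M.Outer D := by rwa [← outer_next, h.next_fst]
  have hT' := (hz.nearTriangulation_iff hoD).2 hT
  have hcov : ∀ {y}, M.Outer y → (∃ z, N.Outer z ∧ ι z = y) ∨ y = D ∨ y = D' := by
    intro y hy
    rcases h.cover y with ⟨z, rfl⟩ | h1
    · exact Or.inl ⟨z, houter.1 hy, rfl⟩
    · exact Or.inr h1
  have horig : ∀ {y z}, M.origin y = M.origin z → N.origin (ζ y) = N.origin (ζ z) := hz.origin_of_eq hne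
  have hnotB : ∀ {y}, N.Outer y → y ∉ B := fun hy hb => hc.not_outer _ hb hy
  have hoc : ∀ {y}, N.Outer y → y ≠ c ∧ y ≠ N.inv c := fun {y} hy =>
    ⟨fun e => hc.visited.1 (e ▸ hy), fun e => hc.inv_not_outer (e ▸ hy)⟩
  have hinv : ∀ {y}, N.Outer y → M.inv (ι y) = ι (N.inv y) := fun hy =>
    h.map_inv _ (hoc hy).1 (hoc hy).2
  have hcolO : ∀ {y}, N.Outer y → M.color (ι y) = N.color y := fun hy => h.color_not_mem _ (hnotB hy)
  have hblack : ∀ {y}, N.color y = .black → M.color (ι y) = .black := by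
    intro y hy
    by_cases h1 : y ∈ B
    · exact h.color_mem y h1
    · rw [h.color_not_mem y h1, hy]
  have hgoes : ∀ {y}, N.Goes .white .black y → y ≠ c ∧ y ≠ N.inv c := by
    intro y hy
    constructor
    · rintro rfl
      exact absurd (hy.2.symm.trans hc.color_inv) (by decide)
    · rintro rfl
      have := hy.2
      rw [N.inv_inv, hc.color_cut] at this
      cases this
  have hfst : ∀ {y}, N.Outer y → M.origin (ι y) ≠ M.origin D := by
    intro y hy e
    have h1 := horig e
    rw [ζ0, ζ1, hc.origin_cut] at h1
    have h2 := color_eq_of_origin_eq e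
    rw [hcolO hy, h.color_fst, color_eq_of_origin_eq h1, hc.top.2.2] at h2
    cases h2
  have hsnd : ∀ {y}, N.Outer y → M.origin (ι y) ≠ M.origin D' := by
    intro y hy e
    have h1 := horig e
    rw [ζ0, ζ2] at h1
    exact hc.inv_not_outerVertex ⟨y, hy, h1⟩
  have hDD : M.origin D ≠ M.origin D' := by
    intro e
    have := color_eq_of_origin_eq e
    rw [h.color_fst, h.color_snd] at this
    cases this
  have hS' : M.SimpleBoundary := by
    intro y z hy ho e
    rcases hcov hy with ⟨y, hy', rfl⟩ | rfl | rfl <;> rcases hcov ho with ⟨z, hz', rfl⟩ | rfl | rfl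
    · have h1 := horig e
      rw [ζ0, ζ0] at h1
      rw [hS y z hy' hz' h1]
    · exact absurd e (hfst hy')
    · exact absurd e (hsnd hy')
    · exact absurd e.symm (hfst hz')
    · rfl
    · exact absurd e hDD
    · exact absurd e.symm (hsnd hz')
    · exact absurd e.symm hDD
    · rfl
  have hroot : M.Goes .white .black M.root := by
    have ho : N.Outer N.root := outer_root
    rw [h.map_root]
    refine ⟨by rw [hcolO ho, hR.1.1], ?_⟩
    rw [hinv ho]
    exact hblack hR.1.2
  have hR' : M.RootInterface := by
    refine ⟨hroot, fun y hy hg => ?_⟩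
    rcases hcov hy with ⟨y, hy', rfl⟩ | rfl | rfl
    · have h1 := hg.1
      have h2 := hg.2
      rw [hcolO hy'] at h1
      rw [hinv hy'] at h2
      by_cases h3 : N.inv y ∈ B
      · have h4 := hc.origin_mem _ h3
        rw [← origin_next] at h4
        have h5 := N.next.injective (hc.outer_eq hS (outer_next.2 hy') h4)
        rw [h5, hc.top.2.1] at h1
        cases h1
      · rw [h.color_not_mem _ h3] at h2
        rw [hR.2 y hy' ⟨h1, h2⟩, h.map_root]
    · rw [Goes, h.color_fst] at hg
      cases hg.1
    · rw [Goes, h.inv_snd, h.color_not_mem c hc.not_mem, hc.color_cut] at hg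
      cases hg.2
  have hsymm : M.next.symm D = ι t := by rw [Equiv.symm_apply_eq, h.next_top]
  have hright : M.IsRight (ι t) := by
    refine ⟨houter.2 hc.top.1, by rw [hcolO hc.top.1, hc.top.2.1], ?_⟩
    rw [hinv hc.top.1]
    exact h.color_mem _ hc.mem_top
  have hcan : M.CanFold D := by
    refine ⟨⟨hoD, h.color_fst, ?_⟩, ?_, ?_, hroot⟩
    · rw [h.inv_fst, h.color_not_mem _ hc.inv_not_mem, hc.color_inv]
    · rw [h.next_fst]
      refine ⟨hoD', h.color_snd, ?_⟩
      rw [h.inv_snd, h.color_not_mem _ hc.not_mem, hc.color_cut]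
    · rwa [hsymm]
  -- the percolation path of `N`, except its last edge, is in `M`
  have hstep : ∀ {a b}, N.Goes .white .black a → b ≠ N.inv t → N.OnPath a → N.PathStep a b →
      M.PathStep (ι a) (ι b) := by
    intro a b ga hb ha hs
    have hb' : b ∉ B := fun h1 =>
      hc.not_visited b h1 hb ⟨fun h2 => hs.1 (outer_of_face_eq hs.2.1 h2), a, ha, hs.2.1.symm⟩
    have ea := hgoes ga
    have eb := hgoes hs.2.2
    refine ⟨?_, ?_, ?_, ?_⟩
    · rw [h.map_inv a ea.1 ea.2, houter]
      exact hs.1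
    · rw [h.map_inv a ea.1 ea.2, hface]
      exact hs.2.1
    · rw [h.color_not_mem b hb', hs.2.2.1]
    · rw [h.map_inv b eb.1 eb.2]
      exact hblack hs.2.2.2
  have hend : ∀ {b}, ¬ N.PathStep (N.inv t) b := fun hs => hs.1 (by rw [N.inv_inv]; exact hc.top.1)
  have hlift : ∀ {a b}, N.OnPath a → Relation.ReflTransGen N.PathStep a b → b ≠ N.inv t →
      Relation.ReflTransGen M.PathStep (ι a) (ι b) := by
    intro a b ha hab
    induction hab with
    | refl => exact fun _ => Relation.ReflTransGen.refl
    | @tail b b' h1 h2 ih =>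
      intro hb
      have hb1 : b ≠ N.inv t := by
        rintro rfl
        exact hend h2
      have hb2 : N.OnPath b := Relation.ReflTransGen.trans ha h1
      exact (ih hb1).tail (hstep (hR.onPath_goes hb2) hb hb2 h2)
  have hpath : ∀ {b}, N.OnPath b → b ≠ N.inv t → M.OnPath (ι b) := by
    intro b hb hbt
    have := hlift Relation.ReflTransGen.refl hb hbt
    rwa [← h.map_root] at this
  have hvis : ∀ {y}, N.Visited y → ∃ z, N.OnPath z ∧ z ≠ N.inv t ∧ N.face (N.inv z) = N.face y ∧
      M.face (M.inv (ι z)) = M.face (ι y) := by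
    rintro y ⟨h1, z, h2, h3⟩
    have e := hgoes (hR.onPath_goes h2)
    refine ⟨z, h2, ?_, h3, ?_⟩
    · rintro rfl
      rw [N.inv_inv] at h3
      exact h1 (outer_of_face_eq h3 hc.top.1)
    · rw [h.map_inv z e.1 e.2, hface, h3]
  -- the triangles along the boundary of `M` are visited by the percolation path of `N`
  have hside : ∀ {y}, M.IsLeft y ∨ M.IsRight y → ∃ x, M.inv y = ι x ∧ N.Visited x := by
    intro y hy
    have hyo : M.Outer y := hy.elim (fun h1 => h1.1) (fun h1 => h1.1)
    have hyc : M.color y = M.color (M.inv y) :=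
      hy.elim (fun h1 => h1.2.1.trans h1.2.2.symm) (fun h1 => h1.2.1.trans h1.2.2.symm)
    have ho := hS'.not_outer_inv hR' hyo hyc
    rcases hcov hyo with ⟨y, hy', rfl⟩ | rfl | rfl
    · rw [hinv hy', houter] at ho
      exact ⟨_, hinv hy', visited_iff.2 (hV y hy' ho)⟩
    · rw [hcan.top.2.1, hcan.top.2.2] at hyc
      cases hyc
    · exact ⟨c, h.inv_snd, hc.visited⟩
  refine ⟨⟨⟨(hz.planar_iff hne).2 hP, hT', hz.loopless_of hne hL, hS'⟩, hR',
    visitsBoundary_of hT' hR' fun y hy => ?_⟩, hcan, ?_, ζ, hz, fun y => ?_⟩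
  · obtain ⟨x, h1, h2⟩ := hside hy
    obtain ⟨z, h3, h4, -, h5⟩ := hvis h2
    exact ⟨ι z, hpath h3 h4, by rw [h1, h5]⟩
  · rw [hsymm]
    have h1 : N.Visited (N.inv t) := visited_iff.2 (hV t hc.top.1 hc.inner)
    obtain ⟨z0, h2, h3, h4, h5⟩ := hvis h1
    rw [← hinv hc.top.1] at h5
    have ho : ¬ M.Outer (M.inv (ι t)) := by rw [hinv hc.top.1, houter]; exact hc.inner
    have hs0 : N.PathStep z0 (N.inv t) :=
      ⟨fun ho => hc.inner (outer_of_face_eq h4 ho), h4.symm, hc.top.2.2, by rw [N.inv_inv]; exact hc.top.2.1⟩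
    refine ⟨⟨M.edge (ι t), ⟨M.inv (ι t), rfl, edge_inv _⟩, Or.inr ⟨ι t, hright, rfl⟩⟩, ι z0,
      ⟨hpath h2 h3, ho, h5⟩, ?_⟩
    rintro z' f' htr hent ⟨e, ⟨x, rfl, hxe⟩, he⟩
    have hx : ∃ y, (M.IsLeft y ∨ M.IsRight y) ∧ M.inv y = x := by
      have : ∃ y, (M.IsLeft y ∨ M.IsRight y) ∧ M.edge y = e :=
        he.elim (fun ⟨y, h6, h7⟩ => ⟨y, Or.inl h6, h7⟩) (fun ⟨y, h6, h7⟩ => ⟨y, Or.inr h6, h7⟩)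
      obtain ⟨y, h6, h7⟩ := this
      refine ⟨y, h6, ?_⟩
      rcases edge_eq_iff.1 (hxe.trans h7.symm) with h8 | h8
      · rw [h8] at hent
        exact absurd (h6.elim (fun h1 => h1.1) (fun h1 => h1.1)) hent.2.1
      · exact h8.symm
    obtain ⟨y, h6, rfl⟩ := hx
    obtain ⟨x, h7, h8⟩ := hside h6
    obtain ⟨z, h9, h10, h11, h12⟩ := hvis h8
    have hzz : ι z = z' := PathEnters.unique hT' hR' ⟨hpath h9 h10, hent.2.1, by rw [h12, h7]⟩ hent
    rw [← hzz] at htr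
    -- in `N` the path enters the triangle of the top-edge last
    rcases OnPath.total hT h9 h2 with h13 | h13
    · exact OnPath.not_transGen_self hT' hR' (hpath h2 h3)
        (Relation.TransGen.trans_left htr (hlift h9 h13 h3))
    · rcases Relation.ReflTransGen.cases_head h13 with h14 | ⟨s, h14, h15⟩
      · rw [h14] at htr
        exact OnPath.not_transGen_self hT' hR' (hpath h9 h10) htr
      · rw [hT.pathStep_unique h14 hs0] at h15
        rcases Relation.ReflTransGen.cases_head h15 with h16 | ⟨s', h16, -⟩
        · exact h10 h16.symm
        · exact hend h16
  · unfold recolor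
    split_ifs with h1
    · rw [color_eq_of_origin_eq (horig h1), ζ1, hc.color_cut]
    · rcases h.cover y with ⟨z, rfl⟩ | rfl | rfl
      · -- a dart of `B` lies in `N` at the merged vertex, and is black, so that it lies in `M` at the origin of `D`
        rw [ζ0, h.color_not_mem]
        intro hb
        refine h1 ?_
        have h2 : N.origin (ζ (ι z)) = N.origin (ζ D) := by
          rw [ζ0, ζ1, hc.origin_mem z hb, hc.origin_cut]
        rcases (hz.origin_eq hne).1 h2 with h3 | ⟨h3 | h3, -⟩
        · exact h3
        · exact h3
        · have h4 := color_eq_of_origin_eq h3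
          rw [h.color_mem z hb, h.next_fst, h.inv_snd, h.color_not_mem c hc.not_mem, hc.color_cut] at h4
          cases h4
      · exact absurd rfl h1
      · rw [ζ2, h.color_snd, hc.color_inv]

end IsUnzip

/-! ### Every map arises from a walk -/

/-- If the triangle of the top-edge has a white third vertex, but no left edge, then the map can be cut
open. The cut follows the first edge, around the top-left vertex and starting from the top-edge, whose
triangle is visited by the percolation path. -/
theorem IsTP.exists_cut (h : N.IsTP) {t : N.Dart} (ht : N.IsTop t) (ho : ¬ N.Outer (N.inv t))
    (hw : N.color (N.next (N.next (N.inv t))) = .white)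
    (hs : ¬ N.Outer (N.inv (N.next (N.next (N.inv t))))) : ∃ c B, N.Cut t c B := by
  classical
  obtain ⟨⟨hP, hT, hL, hS⟩, hR, hV⟩ := h
  -- the darts met around the top-left vertex, from the top-edge to the outer dart `next t`
  set d : ℕ → N.Dart := fun k => N.rotate^[k] (N.inv t) with hd
  have d0 : d 0 = N.inv t := rfl
  have dsucc : ∀ k, N.next (N.inv (d (k + 1))) = d k := fun k => by
    simp only [hd]
    rw [Function.iterate_succ_apply', next_inv_rotate]
  have dorig : ∀ k, N.origin (d k) = N.origin (N.inv t) := fun k => origin_rotate_iterate _ _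
  have key : ∀ a b : N.Dart, N.next a = N.next b → a = b := fun _ _ h => N.next.injective h
  have dinv : ∀ y k, N.next (N.inv y) = d k → y = d (k + 1) := fun y k e => by
    rw [← dsucc k] at e
    exact N.inv.injective (key _ _ e)
  have d1 : d 1 = N.inv (N.next (N.next (N.inv t))) := by
    change N.inv (N.next.symm (N.inv t)) = _
    rw [hT.next_symm ho]
  have hnt : N.Outer (N.next t) := outer_next.2 ht.1
  have hex : ∃ k, d k = N.next t := exists_rotate_iterate_eq (origin_next t).symm
  set K := Nat.find hex with hK
  have hK1 : d K = N.next t := Nat.find_spec hex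
  have hK2 : ∀ k, k < K → d k ≠ N.next t := fun k hk => Nat.find_min hex hk
  have dout : ∀ k, k < K → ¬ N.Outer (d k) := fun k hk hk' =>
    hK2 k hk (hS _ _ hk' hnt ((dorig k).trans (origin_next t).symm))
  have hK0 : 2 ≤ K := by
    by_contra hlt
    have : K = 0 ∨ K = 1 := by omega
    rcases this with e | e
    · rw [e, d0] at hK1
      exact ho (hK1 ▸ hnt)
    · rw [e, d1] at hK1
      exact hs (hK1 ▸ hnt)
  have dne : ∀ i k, i < k → k ≤ K → d i ≠ d k := by
    intro i k hik hk e
    refine hK2 (K - k + i) (by omega) ?_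
    rw [← hK1]
    simp only [hd] at e ⊢
    rw [Function.iterate_add_apply, e, ← Function.iterate_add_apply]
    congr 2
    omega
  -- the triangle of the edge of `next t` is visited
  have hlast : N.Visited (d (K - 1)) := by
    have e1 : N.next (N.inv (N.next t)) = d (K - 1) := by
      rw [← hK1, ← dsucc (K - 1)]
      congr 3
      omega
    have e2 : N.face (N.inv (N.next t)) = N.face (d (K - 1)) := by rw [← e1, face_next]
    have e3 : ¬ N.Outer (N.inv (N.next t)) := fun h1 => dout (K - 1) (by omega) (outer_of_face_eq e2 h1)
    have := visited_iff.2 (hV _ hnt e3)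
    rwa [Visited, e2, Outer, e2] at this
  have hex2 : ∃ j, 1 ≤ j ∧ N.Visited (d j) := ⟨K - 1, by omega, hlast⟩
  set j := Nat.find hex2 with hj
  obtain ⟨hj1, hj2⟩ : 1 ≤ j ∧ N.Visited (d j) := Nat.find_spec hex2
  have hj3 : ∀ k, 1 ≤ k → k < j → ¬ N.Visited (d k) := fun k h1 h2 h3 => Nat.find_min hex2 h2 ⟨h1, h3⟩
  have hjK : j ≤ K - 1 := Nat.find_min' hex2 ⟨by omega, hlast⟩
  have hcol : N.color (d j) = .white := (color_eq_of_origin_eq (dorig j)).trans ht.2.2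
  have e4 : N.next (N.inv (d j)) = d (j - 1) := by
    rw [← dsucc (j - 1)]
    congr 3
    omega
  have hio : ¬ N.Outer (N.inv (d j)) := by
    rw [← outer_next, e4]
    exact dout _ (by omega)
  -- a bicolor edge would be crossed by the path, which would enter the preceding triangle
  have hic : N.color (N.inv (d j)) = .white := by
    rcases Color.cases (N.color (N.inv (d j))) with h1 | h1
    · exact h1
    · exfalso
      obtain ⟨h2, z, h3, h4⟩ := hj2
      have h5 : N.OnPath (d j) := Relation.ReflTransGen.tail h3
        ⟨fun h6 => h2 (outer_of_face_eq h4 h6), h4.symm, hcol, h1⟩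
      have h6 : N.Visited (d (j - 1)) := by
        refine ⟨dout _ (by omega), d j, h5, ?_⟩
        rw [← e4, face_next]
      by_cases h7 : j = 1
      · rw [h7, d1, N.inv_inv, hw] at h1
        cases h1
      · exact hj3 (j - 1) (by omega) (by omega) h6
  have hiv : ¬ N.OuterVertex (N.inv (d j)) := by
    intro h1
    have h2 : N.OuterVertex (d j) := ht.1.outerVertex_inv.of_origin_eq (dorig j).symm
    rcases IsTP.outer_of_outerVertex ⟨⟨hP, hT, hL, hS⟩, hR, hV⟩ (hcol.trans hic.symm) h2 h1 with h3 | h3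
    · exact dout _ (by omega) h3
    · exact hio h3
  refine ⟨d j, {y | ∃ k, k < j ∧ d k = y}, ht, ho, ⟨0, by omega, rfl⟩, ?_, fun y => ⟨?_, ?_⟩, ?_, ?_, ?_, hj2,
    dorig j, hio, hic, hiv⟩
  · rintro ⟨k, h1, h2⟩
    exact dne k j h1 (by omega) h2
  · rintro ⟨k, h1, h2⟩
    have h3 := dinv y k h2.symm
    by_cases h4 : k + 1 < j
    · exact Or.inl ⟨⟨k + 1, h4, h3.symm⟩, fun h5 => dne 0 (k + 1) (by omega) (by omega) (by rw [d0, ← h5, h3])⟩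
    · right
      rw [h3]
      congr 1
      omega
  · rintro (⟨⟨k, h1, rfl⟩, h2⟩ | rfl)
    · obtain _ | k := k
      · exact absurd d0 h2
      · exact ⟨k, by omega, (dsucc k).symm⟩
    · exact ⟨j - 1, by omega, e4.symm⟩
  · rintro y ⟨k, h1, rfl⟩
    exact dout k (by omega)
  · rintro y ⟨k, h1, rfl⟩
    exact dorig k
  · rintro y ⟨k, h1, rfl⟩ h2
    obtain _ | k := k
    · exact absurd d0 h2
    · exact hj3 _ (by omega) h1

/-- The number of darts of in-edges, which increases with every step of the construction. -/
noncomputable def innerCount (M : PercMap) : ℕ := Set.ncard {y : M.Dart | ¬ M.Side y ∧ ¬ M.Side (M.inv y)}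

theorem innerCount_lt {f : M.Dart → N.Dart} {p : N.Dart}
    (hf : ∀ y, ¬ M.Side y → ¬ M.Side (M.inv y) → ¬ N.Side (f y) ∧ ¬ N.Side (N.inv (f y)) ∧ f y ≠ p)
    (hi : ∀ y z, ¬ M.Side y → ¬ M.Side z → f y = f z → y = z)
    (hp : ¬ N.Side p ∧ ¬ N.Side (N.inv p)) : M.innerCount < N.innerCount := by
  have hinj : Set.InjOn f {y : M.Dart | ¬ M.Side y ∧ ¬ M.Side (M.inv y)} := fun y hy z hz e =>
    hi y z hy.1 hz.1 e
  refine hinj.ncard_image.symm.le.trans_lt ?_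
  refine Set.ncard_lt_ncard (Set.ssubset_iff_subset_ne.2 ⟨?_, fun e => ?_⟩) (Set.toFinite _)
  · rintro _ ⟨y, hy, rfl⟩
    exact ⟨(hf y hy.1 hy.2).1, (hf y hy.1 hy.2).2.1⟩
  · have : p ∈ {y : N.Dart | ¬ N.Side y ∧ ¬ N.Side (N.inv y)} := hp
    rw [← e] at this
    obtain ⟨y, hy, h1⟩ := this
    exact (hf y hy.1 hy.2).2.2 h1

theorem IsAttach.innerCount_lt {t : M.Dart} {x : Color} {ι : M.Dart → N.Dart} {r l : N.Dart}
    (h : IsAttach M N t x ι r l) (hS : M.SimpleBoundary) : M.innerCount < N.innerCount := by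
  refine PercMap.innerCount_lt (f := ι) (p := ι t) (fun y h1 h2 => ?_) (fun y z _ _ e => h.inj e) ?_
  · rw [h.map_inv, h.side_map, h.side_map]
    refine ⟨fun h3 => h1 h3.1, fun h3 => h2 h3.1, fun h3 => ?_⟩
    rw [h.inj h3] at h1
    exact h1 ⟨h.outer_top, h.root_ne.symm⟩
  · rw [h.map_inv, h.side_map, h.side_map]
    refine ⟨fun h3 => h3.2 rfl, ?_⟩
    rintro ⟨⟨h1, h2⟩, -⟩
    rcases hS.eq_root h.outer_top h1 with h3 | h3
    · exact h.root_ne h3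
    · exact h2 h3.symm

theorem IsZip.innerCount_lt {d : M.Dart} {ζ : M.Dart → N.Dart} (h : IsZip M N d ζ) (hS : M.SimpleBoundary)
    (ho : M.Outer d) : M.innerCount < N.innerCount := by
  have ho' : M.Outer (M.next d) := outer_next.2 ho
  have hs : M.Side d := ⟨ho, h.can.root_ne.symm⟩
  have hs' : M.Side (M.next d) := ⟨ho', h.can.root_ne_next.symm⟩
  have hne : ∀ {y}, ¬ M.Side y → y ≠ d ∧ y ≠ M.next d := fun hy =>
    ⟨fun e => hy (e ▸ hs), fun e => hy (e ▸ hs')⟩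
  have h1 : ¬ M.Side (M.inv d) := by
    rintro ⟨h1, h2⟩
    rcases hS.eq_root ho h1 with h3 | h3
    · exact h.can.root_ne h3
    · exact h2 h3.symm
  have h2 : ¬ M.Side (M.inv (M.next d)) := by
    rintro ⟨h1, h2⟩
    rcases hS.eq_root ho' h1 with h3 | h3
    · exact h.can.root_ne_next h3
    · exact h2 h3.symm
  refine PercMap.innerCount_lt (f := ζ) (p := ζ d) (fun y h3 h4 => ?_)
    (fun y z h3 h4 e => h.inj y z (hne h3) (hne h4) e) ?_
  · rw [h.map_inv, h.side_map (hne h3), h.side_map (hne h4)]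
    refine ⟨h3, h4, fun e => ?_⟩
    rw [h.map_self] at e
    rw [h.inj _ _ (hne h3) (hne h2) e, M.inv_inv] at h4
    exact h4 hs'
  · rw [h.map_inv, h.side_map (hne h1), h.map_self, h.side_map (hne h2)]
    exact ⟨h2, h1⟩

/-- If the triangle of the top-edge has a white third vertex, then the map arises from a smaller one by
`φ_a`, or by `φ_c` in the case where the top-right vertex is recolored. -/
theorem IsTP.exists_pred (h : N.IsTP) {t : N.Dart} (ht : N.IsTop t) (ho : ¬ N.Outer (N.inv t))
    (hw : N.color (N.next (N.next (N.inv t))) = .white) :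
    ∃ M s, M.IsTP ∧ M.innerCount < N.innerCount ∧ M.IsTop s ∧
      ((∃ ι r l, IsAttach M N s .white ι r l) ∨
        M.CanFold s ∧ M.IsLastFace (M.face (M.inv (M.next.symm s))) ∧
          ∃ ζ, IsZip M N s ζ ∧ ∀ y, N.color (ζ y) = M.recolor s .white y) := by
  obtain ⟨⟨hP, hT, hL, hS⟩, hR, hV⟩ := h
  by_cases hs : N.Outer (N.inv (N.next (N.next (N.inv t))))
  · have h3 := hT.next3 ho
    have hnt : N.inv (N.next (N.next (N.inv t))) = N.next t := by
      refine hS _ _ hs (outer_next.2 ht.1) ?_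
      rw [← origin_next, h3, origin_next]
    have h1 : N.inv (N.next t) = N.next (N.next (N.inv t)) := by rw [← hnt, N.inv_inv]
    have c0 : N.color (N.inv t) = .white := ht.2.2
    have c1 : N.color (N.next (N.inv t)) = .black := by rw [color_next, N.inv_inv, ht.2.1]
    have cr := hR.1.1
    have cl : N.color (N.next t) = .white := by rw [color_next, c0]
    have hrt : N.root ≠ t := by
      intro e
      rw [e, ht.2.1] at cr
      cases cr
    have hrl : N.root ≠ N.next t := by
      intro e
      have := hR.1.2
      rw [e, h1, hw] at this
      cases this
    have a1 : N.next (N.next t) ≠ t := by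
      -- the root-face would consist of `t` and `next t`, neither of which is the root
      intro e
      have h4 := apply_eq_of_face_eq (fun y => y = t ∨ y = N.next t) (fun y => by
        have key : ∀ a b : N.Dart, N.next a = N.next b → a = b := fun _ _ h => N.next.injective h
        grind) ht.1
      have h5 : t = t ∨ t = N.next t := Or.inl rfl
      rw [h4] at h5
      exact h5.elim hrt hrl
    have a2 : t ≠ N.next t := by
      intro e
      have := ht.2.1
      rw [e, cl] at this
      cases this
    have a3 : N.next (N.inv t) ≠ N.inv t := by
      intro e
      rw [e, c0] at c1
      cases c1
    have a4 : N.next (N.inv (N.next t)) ≠ N.inv (N.next t) := by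
      intro e
      rw [h1, h3] at e
      rw [← e] at h3
      rw [h3, c0] at c1
      cases c1
    have a5 : N.inv (N.next t) ≠ N.next (N.inv t) := by
      intro e
      rw [← h1, e, c1] at hw
      cases hw
    obtain ⟨M, s, ι, hs1, hM⟩ := exists_isAttach (r := t) (l := N.next t) ht.1 rfl (by rw [h1, h3]) ho
      h1.symm a1 a2 hrt hrl a3 a4 a5
    have hst : M.IsTop s := by
      refine ⟨hM.outer_top, ?_, ?_⟩
      · rw [← hM.color_map, hs1, c1]
      · rw [← hM.color_map, ← hM.map_inv, hs1, ← color_next, hw]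
    have hMT := hM.isTP_of hst ⟨⟨hP, hT, hL, hS⟩, hR, hV⟩
    rw [cl] at hM
    exact ⟨M, s, hMT, hM.innerCount_lt hMT.1.2.2.2, hst, Or.inl ⟨ι, t, N.next t, hM⟩⟩
  · obtain ⟨c, B, hc⟩ := IsTP.exists_cut ⟨⟨hP, hT, hL, hS⟩, hR, hV⟩ ht ho hw hs
    obtain ⟨M, ι, D, D', hM⟩ := hc.exists_isUnzip
    obtain ⟨h1, h2, h3, ζ, h4, h5⟩ := hM.isTP_canFold hc ⟨⟨hP, hT, hL, hS⟩, hR, hV⟩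
    exact ⟨M, D, h1, h4.innerCount_lt h1.1.2.2.2 h2.top.1, h2.top, Or.inr ⟨h2, h3, ζ, h4, h5⟩⟩

/-- The only map of `T_P` without inner triangle at the top-edge. -/
theorem IsTP.iso_single (h : N.IsTP) {t : N.Dart} (ht : N.IsTop t) (ho : N.Outer (N.inv t)) :
    Nonempty (Iso single N) := by
  obtain ⟨⟨hP, hT, hL, hS⟩, hR, hV⟩ := h
  have hr : N.root = N.inv t := by
    rcases hS.eq_root ht.1 ho with e | e
    · have := hR.1.1
      rw [e, ht.2.1] at this
      cases this
    · exact e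
  have e1 : N.next t = N.inv t := hS _ _ (outer_next.2 ht.1) ho (origin_next t)
  have e2 : N.next (N.inv t) = t := hS _ _ (outer_next.2 ho) ht.1 (N.origin_next_inv t)
  have hi := N.inv_inv
  have hcov : ∀ y, y = t ∨ y = N.inv t := by
    intro y
    have h1 := connected_iff.1 hP.1 (fun y => y = t ∨ y = N.inv t) (fun y => by grind) (fun y => by
      have key : ∀ a b : N.Dart, N.next a = N.next b → a = b := fun _ _ h => N.next.injective h
      grind) y t
    rw [h1]
    exact Or.inl rfl
  let f : Bool → N.Dart := fun b => if b then t else N.inv t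
  have hf : Function.Bijective f := by
    constructor
    · rintro (_ | _) (_ | _) e
      · rfl
      · exact absurd e (N.inv_ne t)
      · exact absurd e.symm (N.inv_ne t)
      · rfl
    · intro y
      rcases hcov y with rfl | rfl
      · exact ⟨true, rfl⟩
      · exact ⟨false, rfl⟩
  refine ⟨⟨Equiv.ofBijective f hf, ?_, ?_, hr.symm, ?_⟩⟩
  · rintro (_ | _)
    · exact (hi t).symm
    · rfl
  · rintro (_ | _)
    · exact e2.symm
    · exact e1.symm
  · rintro (_ | _)
    · exact ht.2.2
    · exact ht.2.1

/-- Isomorphic maps remain isomorphic after a `c`-step in which the top-right vertex is recolored. -/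
theorem IsZip.iso_of_explored {A A' : PercMap} {n : ℕ} {t : A.Dart} {i j : ℕ} {dl dr : A.Dart}
    {left right path : List (ℕ × A.Dart)} (h : A.Explored n t ((i, dl) :: left) ((j, dr) :: right) path)
    {ζ : A.Dart → A'.Dart} (hij : i < j → IsZip A A' t ζ ∧ ∀ y, A'.color (ζ y) = A.recolor t .white y)
    (hne : i ≠ j) (e : Iso A M) (hR : M.RootInterface) {s : M.Dart} (hs : M.IsTop s)
    (hlast : M.IsLastFace (M.face (M.inv (M.next.symm s)))) {ζ' : M.Dart → N.Dart} (hz : IsZip M N s ζ')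
    (hcol : ∀ y, N.color (ζ' y) = M.recolor s .white y) : Nonempty (Iso A' N) := by
  have ht : e.equiv t = s := hR.top_unique (e.isTop.2 h.top) hs
  rcases lt_or_gt_of_ne hne with h1 | h1
  · obtain ⟨h2, h3⟩ := hij h1
    refine h2.iso hz e ht fun y => ?_
    rw [hcol, h3, recolor, recolor, ← ht, e.map_color]
    by_cases h4 : A.origin y = A.origin t
    · rw [if_pos h4, if_pos (e.origin_eq.2 h4)]
    · rw [if_neg h4, if_neg (e.origin_eq.not.2 h4)]
  · refine absurd ?_ (h.not_isLastFace_right h1)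
    have h2 := e.symm.isLastFace hlast
    rwa [e.symm.map_inv, e.symm.map_next_symm, ← ht,
      show e.symm.equiv (e.equiv t) = t from e.equiv.symm_apply_apply t, h.right_links.1] at h2

end PercMap

open PercMap

/-- Where `φ_c` is defined, the walk can be continued by a `c`-step. -/
theorem concat_c_mem {w : List Letter} (hw : w ∈ quadrantWalks) {t : (buildMap w).Dart}
    (ht : (buildMap w).CanFold t) : w ++ [.c] ∈ quadrantWalks := by
  obtain ⟨t', left, right, path, h⟩ := exists_tracks hw
  have h1 := length_openSteps (s := .a) (by decide) fun u hu => (hw u hu).1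
  have h2 := length_openSteps (s := .b) (by decide) fun u hu => (hw u hu).2
  obtain ⟨i, hi⟩ := h.explored.isLeft_iff.1 ht.left
  obtain ⟨j, hj⟩ := h.explored.isRight_iff.1 ht.right
  rw [← h.left_steps, List.length_map] at h1
  rw [← h.right_steps, List.length_map] at h2
  have h3 := List.length_pos_of_mem hi
  have h4 := List.length_pos_of_mem hj
  refine concat_mem_quadrantWalks hw ?_
  simp only [List.count_append, List.count_singleton]
  simp
  omega

theorem concat_a_mem {w : List Letter} (hw : w ∈ quadrantWalks) : w ++ [.a] ∈ quadrantWalks := by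
  refine concat_mem_quadrantWalks hw ?_
  have := hw w (List.prefix_refl w)
  simp only [List.count_append, List.count_singleton]
  simp
  omega

theorem concat_b_mem {w : List Letter} (hw : w ∈ quadrantWalks) : w ++ [.b] ∈ quadrantWalks := by
  refine concat_mem_quadrantWalks hw ?_
  have := hw w (List.prefix_refl w)
  simp only [List.count_append, List.count_singleton]
  simp
  omega

/-- Every element of `T_P` arises from a walk. -/
theorem exists_iso_buildMap (N : PercMap) (hN : N.IsTP) :
    ∃ w ∈ quadrantWalks, Nonempty (Iso (buildMap w) N) := by
  induction hn : N.innerCount using Nat.strong_induction_on generalizing N with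
  | _ n ih =>
  subst hn
  obtain ⟨t, ht⟩ := hN.2.1.exists_top
  replace ht : N.IsTop t := (ht t).2 rfl
  by_cases ho : N.Outer (N.inv t)
  · exact ⟨[], fun u hu => by rw [List.prefix_nil.1 hu]; simp, hN.iso_single ht ho⟩
  rcases Color.cases (N.color (N.next (N.next (N.inv t)))) with hw | hw
  · obtain ⟨M, s, hM, hlt, hs, ⟨ι, r, l, h1⟩ | ⟨h1, h2, ζ, h3, h4⟩⟩ := hN.exists_pred ht ho hw
    · obtain ⟨w, hw, ⟨e⟩⟩ := ih _ hlt M hM rfl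
      obtain ⟨t', ι', r', l', h2, h3⟩ := exists_isAttach_a (concat_a_mem hw)
      exact ⟨_, concat_a_mem hw, h3.iso h1 e (hM.2.1.top_unique (e.isTop.2 h2) hs)⟩
    · obtain ⟨w, hw, ⟨e⟩⟩ := ih _ hlt M hM rfl
      have hwc := concat_c_mem hw (e.symm.canFold h1)
      obtain ⟨t', i, dl, left, j, dr, right, path, ζ', h5, h6⟩ := exists_isZip hwc
      refine ⟨_, hwc, IsZip.iso_of_explored h5 (ζ := ζ') (fun h7 => ?_) ?_ e hM.2.1 hs h2 h3 h4⟩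
      · rcases h6 with h6 | h6
        · exact h6.2
        · omega
      · rcases h6 with h6 | h6 <;> omega
  · have h0 : N.mirror.color (N.mirror.next (N.mirror.next (N.mirror.inv t))) = .white := by
      have h3 := hN.1.2.1.next3 ho
      have h1 : N.next.symm (N.inv t) = N.next (N.next (N.inv t)) := hN.1.2.1.next_symm ho
      have h2 : N.next.symm (N.next (N.next (N.inv t))) = N.next (N.inv t) := N.next.symm_apply_apply _
      change (N.color (N.inv (N.next.symm (N.next.symm (N.inv t))))).swap = _
      rw [h1, h2, ← color_next, hw]
      rfl
    obtain ⟨M, s, hM, hlt, hs, h⟩ :=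
      (mirror_isTP hN).exists_pred (mirror_isTop.2 ht) (mirror_outer.not.2 ho) h0
    have hcount : ∀ A : PercMap, A.mirror.innerCount = A.innerCount := fun A => by
      unfold innerCount
      simp only [mirror_side]
    rw [hcount] at hlt
    obtain ⟨w, hw, ⟨e⟩⟩ := ih _ (by rw [hcount]; exact hlt) M.mirror (mirror_isTP hM) rfl
    have e' : Iso (buildMap w).mirror M := by
      have := e.mirror
      rwa [mirror_mirror] at this
    have hfin : ∀ {A : PercMap}, Nonempty (Iso A.mirror N.mirror) → Nonempty (Iso A N) := by
      rintro A ⟨f⟩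
      have := f.mirror
      rw [mirror_mirror, mirror_mirror] at this
      exact ⟨this⟩
    rcases h with ⟨ι, r, l, h1⟩ | ⟨h1, h2, ζ, h3, h4⟩
    · obtain ⟨t', ι', r', l', h2, h3⟩ := exists_isAttach_b (concat_b_mem hw)
      exact ⟨_, concat_b_mem hw, hfin (h3.mirror.iso h1 e'
        (hM.2.1.top_unique (e'.isTop.2 (mirror_isTop.2 h2)) hs))⟩
    · have hwc : w ++ [.c] ∈ quadrantWalks := by
        obtain ⟨h5, h6, h7, h8⟩ := e'.symm.canFold h1
        refine concat_c_mem hw (t := e'.symm.equiv s) ⟨mirror_isTop.1 h5, ?_, ?_, mirror_goes.1 h8⟩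
        · exact mirror_isRight.1 h7
        · exact mirror_isLeft.1 h6
      obtain ⟨t', i, dl, left, j, dr, right, path, ζ', h5, h6⟩ := exists_isZip hwc
      refine ⟨_, hwc, hfin (IsZip.iso_of_explored (Explored.mirror_iff.2 h5) (ζ := ζ') (fun h7 => ?_) ?_ e'
        hM.2.1 hs h2 h3 h4)⟩
      · rcases h6 with h6 | ⟨-, h6, h8⟩
        · omega
        · have h9 := h6.mirror
          rw [Equiv.apply_symm_apply] at h9
          exact ⟨h9, Explored.color_mirror_of_recolor h6.map_inv h8⟩
      · rcases h6 with h6 | h6 <;> omega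

end KrewerasMap

theorem mainTheorem3 :
    -- every mapping is applied only where it is defined
    (∀ (w : List KrewerasMap.Letter) (s : KrewerasMap.Letter),
      w ++ [s] ∈ KrewerasMap.quadrantWalks → (KrewerasMap.build w).Defined s) ∧
    Set.BijOn KrewerasMap.Phi KrewerasMap.quadrantWalks KrewerasMap.TP ∧
    ∀ w ∈ KrewerasMap.quadrantWalks,
      -- steps and in-edges
      Set.BijOn (KrewerasMap.etaE w) {i | i < w.length} (KrewerasMap.buildMap w).inEdges ∧
      -- `a`-steps, `b`-steps and inner triangles
      Set.BijOn (KrewerasMap.etaVF w)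
        {i | w[i]? = some KrewerasMap.Letter.a ∨ w[i]? = some KrewerasMap.Letter.b}
        (Sum.inr '' (KrewerasMap.buildMap w).innerFaces) ∧
      -- `c`-steps of either type and inner vertices of either color
      Set.BijOn (KrewerasMap.etaVF w) (KrewerasMap.typeASteps w)
        (Sum.inl '' (KrewerasMap.buildMap w).innerVertices KrewerasMap.Color.white) ∧
      Set.BijOn (KrewerasMap.etaVF w) (KrewerasMap.typeBSteps w)
        (Sum.inl '' (KrewerasMap.buildMap w).innerVertices KrewerasMap.Color.black) ∧
      -- unmatched `a`-steps and left edges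
      (∀ i ∈ KrewerasMap.unmatchedSteps KrewerasMap.Letter.a w,
        ∃! e, KrewerasMap.IncidentStep w (KrewerasMap.buildMap w).leftEdges i e) ∧
      Set.BijOn (KrewerasMap.etaLR w) (KrewerasMap.unmatchedSteps KrewerasMap.Letter.a w)
        (KrewerasMap.buildMap w).leftEdges ∧
      -- unmatched `b`-steps and right edges
      (∀ i ∈ KrewerasMap.unmatchedSteps KrewerasMap.Letter.b w,
        ∃! e, KrewerasMap.IncidentStep w (KrewerasMap.buildMap w).rightEdges i e) ∧
      Set.BijOn (KrewerasMap.etaLR w) (KrewerasMap.unmatchedSteps KrewerasMap.Letter.b w)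
        (KrewerasMap.buildMap w).rightEdges := by
  refine ⟨fun w s hw => KrewerasMap.defined_of_concat hw, ⟨fun w hw => ?_, fun w hw w' hw' e => ?_, ?_⟩,
    fun w hw => ?_⟩
  · obtain ⟨t, left, right, path, h⟩ := KrewerasMap.exists_tracks hw
    exact ⟨_, h.explored.isTP, rfl⟩
  · obtain ⟨e⟩ := Quotient.exact e
    exact KrewerasMap.eq_of_iso hw hw' e
  · rintro _ ⟨M, hM, rfl⟩
    obtain ⟨w, hw, e⟩ := KrewerasMap.exists_iso_buildMap M hM
    exact ⟨w, hw, Quotient.sound e⟩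
  · exact ⟨KrewerasMap.bijOn_etaE hw, KrewerasMap.bijOn_etaVF_innerFaces hw,
      KrewerasMap.bijOn_etaVF_white hw, KrewerasMap.bijOn_etaVF_black hw,
      (KrewerasMap.left_incidentStep hw).1, (KrewerasMap.left_incidentStep hw).2,
      (KrewerasMap.right_incidentStep hw).1, (KrewerasMap.right_incidentStep hw).2⟩
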